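/- Let $\Lambda=\mathbb Z[\lambda^{\pm1},z,\delta]/\langle\lambda^{-1}-\lambda-z(\delta-1)\rangle$ and let $n\ge 0$. The Birman–Wenzl algebra $BW_n$ is the unital associative $\Lambda$-algebra with generators $g_i^{\pm1},e_i$ ($1\le i\le n-1$) and relations: $g_ig_i^{-1}=g_i^{-1}g_i=1$; $g_i-g_i^{-1}=z(1-e_i)$; $e_i^2=\delta e_i$; $g_ig_{i\pm1}g_i=g_{i\pm1}g_ig_{i\pm1}$; $g_ig_j=g_jg_i$, $g_ie_j=e_jg_i$, $e_ie_j=e_je_i$ if $|i-j|>1$; $e_ie_{i\pm1}e_i=e_i$, $g_ig_{i\pm1}e_i=e_{i\pm1}e_i$, $e_ig_{i\pm1}g_i=e_ie_{i\pm1}$; $g_ie_i=e_ig_i=\lambda e_i$, $e_ig_{i\pm1}e_i=\lambda^{-1}e_i$. The Kauffman tangle algebra $MT_n$ is the quotient of the free $\Lambda$-module on regular isotopy classes of unoriented $(n,n)$-tangle diagrams in a rectangle (isotopy of the rectangle and Reidemeister moves II and III) by the local relations: $T^+-T^-=z(T^0-T^\infty)$; removal of a curl multiplies by $\lambda^{-1}$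 or $\lambda$, according to the sign of its crossing; removal of a circle without crossings multiplies by $\delta$. The product $ST$ places $S$ above $T$. Let $G_i^{\pm1}$ be the tangles in which strings $i,i+1$ cross once and the other strings are vertical, and let $E_i$ be the tangle in which the points $i,i+1$ are joined to each other at the top and at the bottom and the other strings are vertical; conventions are such that $G_i-G_i^{-1}=z(1-E_i)$ and $G_iE_i=\lambda E_i$. Let $\varphi:BW_n\to MT_n$ be the algebra homomorphism with $\varphi(g_i)=G_i$, $\varphi(e_i)=E_i$. For $n=r+2k$ with $r,k\ge0$ let $BW_n^{(r)}$ be the two-sided ideal of $BW_n$ generated by $e_1e_3\cdots e_{2k-1}$, and let $MT_n^{(r)}$ be the span of the tangles that are composites of an $(n,r)$-tangle and an $(r,n)$-tangle. For $m\le n$ elements of $BW_m$ are mapped to $BW_n$ by $g_i\mapsto g_i$, $e_i\mapsto e_i$. For $\pi\in S_n$ let $b_\pi\in BW_n$ be the positive permutation braid of $\pi$: the product of the $g_i$ (read from top to bottom) in a braid word whose strings join $i$ at the top to $\pi(i)$ at the bottom, and any two of whose strings cross at most once. Call $\pi$ a $(2k,r)$ Lorenz permutation if $\pi(i)<\pi(j)$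 whenever $1\le i<j\le 2k$ or $2k+1\le i<j\le n$. Put $f_0=1$ and $f_k=(g_1g_2\cdots g_{2k-2})\,f_{k-1}\,e_{2k-1}\,(g_{2k-2}\cdots g_2g_1)$. **Theorem.** For every $n\ge0$: 1. For all $r,k\ge0$ with $n=r+2k$, $\varphi$ maps $BW_n^{(r)}$ into $MT_n^{(r)}$ and is injective on $BW_n^{(r)}$. 2. $\varphi:BW_n\to MT_n$ is an isomorphism. 3. $BW_n$ is a free $\Lambda$-module of rank $(2n-1)!!$ (with $(-1)!!=1$). 4. For every $k\ge0$ and every $\Lambda$-basis $(t_c)_{c\in I}$ of $BW_k$, the elements $t_cf_kt_d$ ($c,d\in I$) form a $\Lambda$-basis of $BW_{2k}^{(0)}$. 5. For any choice of $\Lambda$-bases $(w_{k,x})_{x\in I_k}$ of $BW_{2k}^{(0)}$, $k\ge0$, the elements $$b_\pi\,w_{k,x}\,b_\tau\,b_\mu$$ form a $\Lambda$-basis of $BW_n$, where $0\le k\le n/2$, $r=n-2k$, $x\in I_k$, $\pi^{-1}$ and $\mu$ run over the $(2k,r)$ Lorenz permutations in $S_n$, and $\tau$ runs over the permutations in $S_n$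 that fix $1,\dots,2k$. -/

import Mathlib

namespace BMW

/-! ### The ring of coefficients -/

/-- The ring `ℤ[λ^{±1}, z, δ]` (with `z = C (X 0)`, `δ = C (X 1)`). -/
abbrev PreLam : Type := LaurentPolynomial (MvPolynomial (Fin 2) ℤ)

/-- `Λ = ℤ[λ^{±1}, z, δ] / ⟨λ⁻¹ - λ - z (δ - 1)⟩`. -/
def Lam : Type :=
  PreLam ⧸ (Ideal.span {LaurentPolynomial.T (-1) - LaurentPolynomial.T 1 -
    LaurentPolynomial.C (MvPolynomial.X 0) *
      (LaurentPolynomial.C (MvPolynomial.X 1) - 1)} : Ideal PreLam)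

noncomputable instance : CommRing Lam :=
  inferInstanceAs (CommRing (PreLam ⧸ (Ideal.span
    {LaurentPolynomial.T (-1) - LaurentPolynomial.T 1 -
      LaurentPolynomial.C (MvPolynomial.X 0) *
        (LaurentPolynomial.C (MvPolynomial.X 1) - 1)} : Ideal PreLam)))

/-- The quotient map `ℤ[λ^{±1}, z, δ] → Λ`. -/
noncomputable def Lam.mk : PreLam →+* Lam := Ideal.Quotient.mk _

/-- `λ ∈ Λ`. -/
noncomputable def lam : Lam := Lam.mk (LaurentPolynomial.T 1)

/-- `λ⁻¹ ∈ Λ`. -/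
noncomputable def lamInv : Lam := Lam.mk (LaurentPolynomial.T (-1))

/-- `z ∈ Λ`. -/
noncomputable def z : Lam := Lam.mk (LaurentPolynomial.C (MvPolynomial.X 0))

/-- `δ ∈ Λ`. -/
noncomputable def delta : Lam := Lam.mk (LaurentPolynomial.C (MvPolynomial.X 1))

/-! ### The Birman-Wenzl algebra

Indices of generators start at `0`: what is usually written `g_{i+1}`, `e_{i+1}` (`0 ≤ i ≤ n - 2`)
has index `i : Fin (n - 1)`. -/

/-- The generators `g_i`, `g_i⁻¹`, `e_i`. -/
inductive Gen (n : ℕ) : Type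
  | g (i : Fin (n - 1))
  | gInv (i : Fin (n - 1))
  | e (i : Fin (n - 1))

/-- `|i - j| = 1`. -/
def Adj {n : ℕ} (i j : Fin (n - 1)) : Prop := (i : ℕ) + 1 = j ∨ (j : ℕ) + 1 = i

/-- `|i - j| > 1`. -/
def Far {n : ℕ} (i j : Fin (n - 1)) : Prop := (i : ℕ) + 1 < j ∨ (j : ℕ) + 1 < i

/-- The generator `x` as an element of the free algebra. -/
noncomputable abbrev fr {n : ℕ} (x : Gen n) : FreeAlgebra Lam (Gen n) := FreeAlgebra.ι Lam x

open Gen in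
/-- The defining relations of the Birman-Wenzl algebra. -/
inductive BWRel (n : ℕ) : FreeAlgebra Lam (Gen n) → FreeAlgebra Lam (Gen n) → Prop
  | mul_inv (i : Fin (n - 1)) : BWRel n (fr (g i) * fr (gInv i)) 1
  | inv_mul (i : Fin (n - 1)) : BWRel n (fr (gInv i) * fr (g i)) 1
  | skein (i : Fin (n - 1)) : BWRel n (fr (g i) - fr (gInv i)) (z • (1 - fr (e i)))
  | idem (i : Fin (n - 1)) : BWRel n (fr (e i) * fr (e i)) (delta • fr (e i))
  | braid (i j : Fin (n - 1)) (h : Adj i j) :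
      BWRel n (fr (g i) * fr (g j) * fr (g i)) (fr (g j) * fr (g i) * fr (g j))
  | comm_gg (i j : Fin (n - 1)) (h : Far i j) :
      BWRel n (fr (g i) * fr (g j)) (fr (g j) * fr (g i))
  | comm_ge (i j : Fin (n - 1)) (h : Far i j) :
      BWRel n (fr (g i) * fr (e j)) (fr (e j) * fr (g i))
  | comm_ee (i j : Fin (n - 1)) (h : Far i j) :
      BWRel n (fr (e i) * fr (e j)) (fr (e j) * fr (e i))
  | tangle_eee (i j : Fin (n - 1)) (h : Adj i j) :
      BWRel n (fr (e i) * fr (e j) * fr (e i)) (fr (e i))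
  | tangle_gge (i j : Fin (n - 1)) (h : Adj i j) :
      BWRel n (fr (g i) * fr (g j) * fr (e i)) (fr (e j) * fr (e i))
  | tangle_egg (i j : Fin (n - 1)) (h : Adj i j) :
      BWRel n (fr (e i) * fr (g j) * fr (g i)) (fr (e i) * fr (e j))
  | deloop_ge (i : Fin (n - 1)) : BWRel n (fr (g i) * fr (e i)) (lam • fr (e i))
  | deloop_eg (i : Fin (n - 1)) : BWRel n (fr (e i) * fr (g i)) (lam • fr (e i))
  | deloop_ege (i j : Fin (n - 1)) (h : Adj i j) :
      BWRel n (fr (e i) * fr (g j) * fr (e i)) (lamInv • fr (e i))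

/-- The Birman-Wenzl algebra `BW_n` over `Λ`. -/
def BW (n : ℕ) : Type := RingQuot (BWRel n)

noncomputable instance (n : ℕ) : Ring (BW n) := inferInstanceAs (Ring (RingQuot (BWRel n)))

noncomputable instance (n : ℕ) : Algebra Lam (BW n) :=
  inferInstanceAs (Algebra Lam (RingQuot (BWRel n)))

/-- The quotient map from the free algebra. -/
noncomputable def BW.mk (n : ℕ) : FreeAlgebra Lam (Gen n) →ₐ[Lam] BW n :=
  RingQuot.mkAlgHom Lam (BWRel n)

/-- A `Λ`-algebra homomorphism out of `BW_n` from images of the generators. -/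
noncomputable def BW.lift {n : ℕ} {A : Type} [Ring A] [Algebra Lam A] (f : Gen n → A)
    (hf : ∀ ⦃x y⦄, BWRel n x y → FreeAlgebra.lift Lam f x = FreeAlgebra.lift Lam f y) :
    BW n →ₐ[Lam] A :=
  RingQuot.liftAlgHom Lam ⟨FreeAlgebra.lift Lam f, hf⟩

/-- `g_i ∈ BW_n`; the index is a natural number, and the value for an index out of range
(which is never used) is `1`. -/
noncomputable def BW.g (n i : ℕ) : BW n :=
  if h : i < n - 1 then BW.mk n (fr (Gen.g ⟨i, h⟩)) else 1

/-- `e_i ∈ BW_n`, with the same convention. -/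
noncomputable def BW.e (n i : ℕ) : BW n :=
  if h : i < n - 1 then BW.mk n (fr (Gen.e ⟨i, h⟩)) else 1

/-- The inclusion of the generators of `BW_m` into those of `BW_n`, `m ≤ n`. -/
def Gen.cast {m n : ℕ} (h : m ≤ n) : Gen m → Gen n
  | .g i => .g (Fin.castLE (Nat.sub_le_sub_right h 1) i)
  | .gInv i => .gInv (Fin.castLE (Nat.sub_le_sub_right h 1) i)
  | .e i => .e (Fin.castLE (Nat.sub_le_sub_right h 1) i)

/-- The homomorphism `BW_m → BW_n`, `m ≤ n`, with `g_i ↦ g_i`, `e_i ↦ e_i`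
(elements of `BW_m` placed on the first `m` strings). -/
noncomputable def BW.incl {m n : ℕ} (h : m ≤ n) : BW m →ₐ[Lam] BW n :=
  BW.lift (fun x => BW.mk n (fr (x.cast h))) (by
    have key : ∀ {x y}, BWRel n x y → BW.mk n x = BW.mk n y :=
      fun hxy => RingQuot.mkAlgHom_rel Lam hxy
    intro x y hxy
    cases hxy <;>
      simp only [map_mul, map_sub, map_one, map_smul, FreeAlgebra.lift_ι_apply, Gen.cast] <;>
      simp only [← map_mul, ← map_sub, ← map_one (BW.mk n), ← map_smul] <;>
      apply key <;> constructor <;> assumption)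

/-- The two-sided ideal `BW_n^{(n-2k)}` of `BW_n` generated by `e_1 e_3 ⋯ e_{2k-1}`
(in the present numbering: `e_0 e_2 ⋯ e_{2k-2}`), for `2k ≤ n`. -/
noncomputable def BW.ideal (n k : ℕ) : Submodule Lam (BW n) :=
  Submodule.span Lam {x | ∃ a b : BW n,
    x = a * ((List.range k).map fun j => BW.e n (2 * j)).prod * b}

/-! ### Braids in the Birman-Wenzl algebra -/

/-- The number of strings `i < j` that the string `j` has to cross. -/
def crossings {n : ℕ} (π : Equiv.Perm (Fin n)) (j : Fin n) : ℕ :=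
  (Finset.univ.filter fun i : Fin n => i < j ∧ π j < π i).card

/-- The positive permutation braid `b_π ∈ BW_n`: the strings join the point `i` at the top to
the point `π i` at the bottom, all crossings are positive and any two strings cross at most once.
In the word below, the `j`-th factor moves the string `j`, from position `j`, to the left across
those earlier strings that it has to cross, and `0, 1, 2, …` are treated in this order from top
to bottom. -/
noncomputable def BW.posBraid {n : ℕ} (π : Equiv.Perm (Fin n)) : BW n :=
  ((List.finRange n).map fun j =>
    ((List.range (crossings π j)).map fun t => BW.g n ((j : ℕ) - 1 - t)).prod).prod

/-- `π` is an `(l, n - l)` Lorenz permutation: it is increasing on the first `l` points, and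
increasing on the remaining points. -/
def IsLorenz {n : ℕ} (l : ℕ) (π : Equiv.Perm (Fin n)) : Prop :=
  ∀ i j : Fin n, i < j → ((j : ℕ) < l ∨ l ≤ (i : ℕ)) → π i < π j

/-- `τ` moves only points after the first `l`. -/
def FixesFirst {n : ℕ} (l : ℕ) (τ : Equiv.Perm (Fin n)) : Prop :=
  ∀ i : Fin n, (i : ℕ) < l → τ i = i

/-- The elements `f_k`: `f_0 = 1`, `f_{k+1} = (g_1 ⋯ g_{2k}) f_k e_{2k+1} (g_{2k} ⋯ g_1)` in the
usual numbering. -/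
noncomputable def BW.f (n : ℕ) : ℕ → BW n
  | 0 => 1
  | k + 1 => ((List.range (2 * k)).map (BW.g n)).prod * BW.f n k * BW.e n (2 * k) *
      ((List.range (2 * k)).reverse.map (BW.g n)).prod

/-! ### Tangle diagrams

A tangle diagram in the rectangle is taken in general position with respect to the height
function: from top to bottom it is a sequence of layers, each with exactly one crossing, local
maximum or local minimum, all other strings running vertically. -/

/-- Elementary `(m, n)`-diagrams (`m` end points at the top, `n` at the bottom). Strings are
numbered from the left, starting at `0`. -/
inductive Layer : ℕ → ℕ → Type
  /-- The strings `i` and `i + 1` cross. For `s = true` the string from top left to bottom right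
  is the upper one, for `s = false` it is the lower one. -/
  | cross {n : ℕ} (s : Bool) (i : ℕ) (h : i + 1 < n) : Layer n n
  /-- A local maximum: two new strings `i` and `i + 1` start, joined at their top. -/
  | cap {n : ℕ} (i : ℕ) (h : i ≤ n) : Layer n (n + 2)
  /-- A local minimum: the strings `i` and `i + 1` are joined and end. -/
  | cup {n : ℕ} (i : ℕ) (h : i ≤ n) : Layer (n + 2) n

/-- Diagrams of `(m, n)`-tangles: sequences of layers, from top to bottom. -/
inductive Diagram : ℕ → ℕ → Type
  | nil {n : ℕ} : Diagram n n
  | cons {m k n : ℕ} (a : Layer m k) (A : Diagram k n) : Diagram m n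

namespace Diagram

/-- One layer. -/
def one {m n : ℕ} (a : Layer m n) : Diagram m n := cons a nil

/-- Two layers. -/
def two {m k n : ℕ} (a : Layer m k) (b : Layer k n) : Diagram m n := cons a (one b)

/-- Three layers. -/
def three {m k l n : ℕ} (a : Layer m k) (b : Layer k l) (c : Layer l n) : Diagram m n :=
  cons a (two b c)

/-- `A.comp B` places `A` above `B`. -/
def comp : {m k n : ℕ} → Diagram m k → Diagram k n → Diagram m n
  | _, _, _, nil, B => B
  | _, _, _, cons a A, B => cons a (A.comp B)

theorem nil_comp {m n : ℕ} (A : Diagram m n) : nil.comp A = A := rfl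

theorem comp_nil {m n : ℕ} (A : Diagram m n) : A.comp nil = A := by
  induction A with
  | nil => rfl
  | cons a A ih => simp [comp, ih]

theorem comp_assoc {m k l n : ℕ} (A : Diagram m k) (B : Diagram k l) (C : Diagram l n) :
    (A.comp B).comp C = A.comp (B.comp C) := by
  induction A with
  | nil => rfl
  | cons a A ih => simp [comp, ih]

end Diagram

open Diagram Layer in
/-- The local moves that generate regular isotopy of diagrams in general position: isotopies of
the rectangle (exchange of the heights of two distant layers, cancellation of a neighbouring
maximum and minimum, and a string sliding across a maximum or minimum) and Reidemeister's
moves II and III. The other versions of the moves II and III follow from those given. -/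
inductive Move : {m n : ℕ} → Diagram m n → Diagram m n → Prop
  | cross_cross {n : ℕ} (s t : Bool) (i j : ℕ) (hij : i + 2 ≤ j) (hj : j + 1 < n) :
      Move (two (cross (n := n) s i (by omega)) (cross t j hj))
        (two (cross t j hj) (cross s i (by omega)))
  | cap_cross_right {n : ℕ} (s : Bool) (i j : ℕ) (hij : i ≤ j) (hj : j + 1 < n) :
      Move (two (cross (n := n) s j hj) (cap i (by omega)))
        (two (cap i (by omega)) (cross s (j + 2) (by omega)))
  | cap_cross_left {n : ℕ} (s : Bool) (i j : ℕ) (hij : j + 2 ≤ i) (hi : i ≤ n) :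
      Move (two (cross (n := n) s j (by omega)) (cap i hi))
        (two (cap i hi) (cross s j (by omega)))
  | cup_cross_right {n : ℕ} (s : Bool) (i j : ℕ) (hij : i ≤ j) (hj : j + 1 < n) :
      Move (two (cup i (by omega)) (cross (n := n) s j hj))
        (two (cross s (j + 2) (by omega)) (cup i (by omega)))
  | cup_cross_left {n : ℕ} (s : Bool) (i j : ℕ) (hij : j + 2 ≤ i) (hi : i ≤ n) :
      Move (two (cup i hi) (cross (n := n) s j (by omega)))
        (two (cross s j (by omega)) (cup i hi))
  | cap_cap {n : ℕ} (i j : ℕ) (hij : i ≤ j) (hj : j ≤ n) :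
      Move (two (cap (n := n) j hj) (cap i (by omega)))
        (two (cap i (by omega)) (cap (j + 2) (by omega)))
  | cup_cup {n : ℕ} (i j : ℕ) (hij : i ≤ j) (hj : j ≤ n) :
      Move (two (cup i (by omega)) (cup (n := n) j hj))
        (two (cup (j + 2) (by omega)) (cup i (by omega)))
  | cup_cap_left {n : ℕ} (i j : ℕ) (hij : i ≤ j) (hj : j ≤ n) :
      Move (two (cup (n := n) j hj) (cap i (by omega)))
        (two (cap i (by omega)) (cup (j + 2) (by omega)))
  | cup_cap_right {n : ℕ} (i j : ℕ) (hij : i ≤ j) (hj : j ≤ n) :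
      Move (two (cup (n := n) i (by omega)) (cap j hj))
        (two (cap (j + 2) (by omega)) (cup i (by omega)))
  | zigzag_left {n : ℕ} (i : ℕ) (hi : i + 1 ≤ n) :
      Move (two (cap (n := n) (i + 1) hi) (cup i (by omega))) nil
  | zigzag_right {n : ℕ} (i : ℕ) (hi : i + 1 ≤ n) :
      Move (two (cap (n := n) i (by omega)) (cup (i + 1) hi)) nil
  | slide_cap {n : ℕ} (s : Bool) (i : ℕ) (hi : i + 1 ≤ n) :
      Move (two (cap (n := n) i (by omega)) (cross s (i + 1) (by omega)))
        (two (cap (i + 1) hi) (cross (!s) i (by omega)))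
  | slide_cup {n : ℕ} (s : Bool) (i : ℕ) (hi : i + 1 ≤ n) :
      Move (two (cross s (i + 1) (by omega)) (cup (n := n) i (by omega)))
        (two (cross (!s) i (by omega)) (cup (i + 1) hi))
  | reidemeister_two {n : ℕ} (s : Bool) (i : ℕ) (hi : i + 1 < n) :
      Move (two (cross (n := n) s i hi) (cross (!s) i hi)) nil
  | reidemeister_three {n : ℕ} (i : ℕ) (hi : i + 2 < n) :
      Move (three (cross (n := n) true i (by omega)) (cross true (i + 1) hi)
          (cross true i (by omega)))
        (three (cross true (i + 1) hi) (cross true i (by omega)) (cross true (i + 1) hi))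

/-- A local move inside a larger diagram. -/
inductive Step : {m n : ℕ} → Diagram m n → Diagram m n → Prop
  | mk {m k l n : ℕ} (A : Diagram m k) {x y : Diagram k l} (h : Move x y) (B : Diagram l n) :
      Step (A.comp (x.comp B)) (A.comp (y.comp B))

/-- `(m, n)`-tangles up to regular isotopy (the equivalence relation generated by `Step`). -/
def Tangle (m n : ℕ) : Type := Quot (Step (m := m) (n := n))

namespace Tangle

/-- The tangle represented by a diagram. -/
def mk {m n : ℕ} (A : Diagram m n) : Tangle m n := Quot.mk _ A

/-- `S.comp T` places `S` above `T`. -/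
def comp {m k n : ℕ} : Tangle m k → Tangle k n → Tangle m n :=
  Quot.map₂ Diagram.comp
    (by
      rintro A _ _ ⟨C, h, D⟩
      rw [← Diagram.comp_assoc, ← Diagram.comp_assoc A C]
      exact Step.mk _ h _)
    (by
      rintro _ _ B ⟨C, h, D⟩
      simp only [Diagram.comp_assoc]
      exact Step.mk _ h _)

theorem mk_comp {m k n : ℕ} (A : Diagram m k) (B : Diagram k n) :
    mk (A.comp B) = (mk A).comp (mk B) := rfl

theorem comp_assoc {m k l n : ℕ} (A : Tangle m k) (B : Tangle k l) (C : Tangle l n) :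
    (A.comp B).comp C = A.comp (B.comp C) := by
  induction A using Quot.ind
  induction B using Quot.ind
  induction C using Quot.ind
  exact congrArg (Quot.mk _) (Diagram.comp_assoc _ _ _)

/-- `(n, n)`-tangles form a monoid: `S * T` is `S` above `T`. -/
instance (n : ℕ) : Monoid (Tangle n n) where
  mul := comp
  one := mk Diagram.nil
  mul_assoc := comp_assoc
  one_mul A := by
    induction A using Quot.ind
    rfl
  mul_one A := by
    induction A using Quot.ind
    exact congrArg (Quot.mk _) (Diagram.comp_nil _)

/-- The tangle `G_i` (for `s = true`) or `G_i⁻¹` (for `s = false`): the strings `i`, `i + 1`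
cross once, all others are vertical. -/
def G {n : ℕ} (s : Bool) (i : Fin (n - 1)) : Tangle n n :=
  mk (Diagram.one (Layer.cross s i (by omega)))

/-- The tangle `E_i`: the points `i`, `i + 1` are joined at the top by a local minimum and at the
bottom by a local maximum, all other strings are vertical. -/
def E : {n : ℕ} → Fin (n - 1) → Tangle n n
  | 0, i => i.elim0
  | 1, i => i.elim0
  | _ + 2, i => mk (Diagram.two (Layer.cup i (by omega)) (Layer.cap i (by omega)))

/-- A vertical string `i` with one curl, whose loop lies to the right of the string. -/
def curlR {n : ℕ} (s : Bool) (i : Fin n) : Tangle n n :=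
  mk (Diagram.three (Layer.cap (i + 1) (by omega)) (Layer.cross s i (by omega))
    (Layer.cup (i + 1) (by omega)))

/-- A vertical string `i` with one curl, whose loop lies to the left of the string. -/
def curlL {n : ℕ} (s : Bool) (i : Fin n) : Tangle n n :=
  mk (Diagram.three (Layer.cap i (by omega)) (Layer.cross s (i + 1) (by omega))
    (Layer.cup i (by omega)))

/-- Vertical strings and one circle without crossings, to the right of the first `i` strings. -/
def circle {n : ℕ} (i : Fin (n + 1)) : Tangle n n :=
  mk (Diagram.two (Layer.cap i (by omega)) (Layer.cup i (by omega)))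

end Tangle

/-! ### The Kauffman tangle algebra -/

/-- The tangle `T` as an element of the free `Λ`-module on `(n, n)`-tangles. -/
noncomputable abbrev tg {n : ℕ} (T : Tangle n n) : MonoidAlgebra Lam (Tangle n n) :=
  MonoidAlgebra.of Lam (Tangle n n) T

/-- The relations of the Kauffman tangle algebra. The parts `A` (above) and `B` (below) of the
diagram outside of the place of the change are arbitrary. Which curl is called a left-hand and
which a right-hand one is fixed by the sign of its crossing: with the sign of `G_i` it
contributes `λ⁻¹`, with the opposite sign `λ`. -/
inductive MTRel (n : ℕ) :
    MonoidAlgebra Lam (Tangle n n) → MonoidAlgebra Lam (Tangle n n) → Prop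
  | skein {k : ℕ} (A : Tangle n k) (B : Tangle k n) (i : Fin (k - 1)) :
      MTRel n
        (tg ((A.comp (Tangle.G true i)).comp B) - tg ((A.comp (Tangle.G false i)).comp B))
        (z • (tg (A.comp B) - tg ((A.comp (Tangle.E i)).comp B)))
  | curlR_true {k : ℕ} (A : Tangle n k) (B : Tangle k n) (i : Fin k) :
      MTRel n (tg ((A.comp (Tangle.curlR true i)).comp B)) (lamInv • tg (A.comp B))
  | curlL_true {k : ℕ} (A : Tangle n k) (B : Tangle k n) (i : Fin k) :
      MTRel n (tg ((A.comp (Tangle.curlL true i)).comp B)) (lamInv • tg (A.comp B))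
  | curlR_false {k : ℕ} (A : Tangle n k) (B : Tangle k n) (i : Fin k) :
      MTRel n (tg ((A.comp (Tangle.curlR false i)).comp B)) (lam • tg (A.comp B))
  | curlL_false {k : ℕ} (A : Tangle n k) (B : Tangle k n) (i : Fin k) :
      MTRel n (tg ((A.comp (Tangle.curlL false i)).comp B)) (lam • tg (A.comp B))
  | circle {k : ℕ} (A : Tangle n k) (B : Tangle k n) (i : Fin (k + 1)) :
      MTRel n (tg ((A.comp (Tangle.circle i)).comp B)) (delta • tg (A.comp B))

/-- The Kauffman tangle algebra `MT_n` over `Λ`. (The relations are closed under multiplication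
by tangles on either side, so the ideal that they generate is their `Λ`-linear span.) -/
def MT (n : ℕ) : Type := RingQuot (MTRel n)

noncomputable instance (n : ℕ) : Ring (MT n) := inferInstanceAs (Ring (RingQuot (MTRel n)))

noncomputable instance (n : ℕ) : Algebra Lam (MT n) :=
  inferInstanceAs (Algebra Lam (RingQuot (MTRel n)))

/-- The quotient map from the free `Λ`-module on `(n, n)`-tangles. -/
noncomputable def MT.mk (n : ℕ) : MonoidAlgebra Lam (Tangle n n) →ₐ[Lam] MT n :=
  RingQuot.mkAlgHom Lam (MTRel n)

/-- The class of the tangle `T` in `MT_n`. -/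
noncomputable def MT.of {n : ℕ} (T : Tangle n n) : MT n := MT.mk n (tg T)

/-- `MT_n^{(r)}`: the span of the tangles of rank at most `r`, i.e. the composites of an
`(n, r)`-tangle and an `(r, n)`-tangle. -/
noncomputable def MT.filtration (n r : ℕ) : Submodule Lam (MT n) :=
  Submodule.span Lam {x | ∃ (A : Tangle n r) (B : Tangle r n), x = MT.of (A.comp B)}

/-! ### The homomorphism from the Birman-Wenzl algebra to the tangle algebra -/

namespace Tangle

/-- One layer, as a tangle. -/
def ly {m n : ℕ} (a : Layer m n) : Tangle m n := mk (Diagram.one a)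

theorem move_eq {m n : ℕ} {x y : Diagram m n} (h : Move x y) : mk x = mk y := by
  have := Quot.sound (Step.mk Diagram.nil h Diagram.nil)
  rwa [Diagram.nil_comp, Diagram.comp_nil, Diagram.nil_comp, Diagram.comp_nil] at this

theorem mk_two {m k n : ℕ} (a : Layer m k) (b : Layer k n) :
    mk (Diagram.two a b) = (ly a).comp (ly b) := rfl

theorem mk_three {m k l n : ℕ} (a : Layer m k) (b : Layer k l) (c : Layer l n) :
    mk (Diagram.three a b c) = (ly a).comp ((ly b).comp (ly c)) := rfl

theorem nil_comp {m n : ℕ} (T : Tangle m n) : (mk Diagram.nil).comp T = T := by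
  induction T using Quot.ind
  rfl

theorem comp_nil {m n : ℕ} (T : Tangle m n) : T.comp (mk Diagram.nil) = T := by
  induction T using Quot.ind
  exact congrArg (Quot.mk _) (Diagram.comp_nil _)

theorem mul_def {n : ℕ} (S T : Tangle n n) : S * T = S.comp T := rfl

theorem one_def (n : ℕ) : (1 : Tangle n n) = mk Diagram.nil := rfl

theorem one_comp {m n : ℕ} (T : Tangle m n) : (1 : Tangle m m).comp T = T := nil_comp T

theorem comp_one {m n : ℕ} (T : Tangle m n) : T.comp (1 : Tangle n n) = T := comp_nil T

theorem two_nil {m k : ℕ} {a : Layer m k} {b : Layer k m}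
    (h : Move (Diagram.two a b) Diagram.nil) {p : ℕ} (T : Tangle m p) :
    (ly a).comp ((ly b).comp T) = T := by
  rw [← comp_assoc, ← mk_two, move_eq h, nil_comp]

theorem two_two {m k l n : ℕ} {a : Layer m k} {b : Layer k n} {c : Layer m l} {d : Layer l n}
    (h : Move (Diagram.two a b) (Diagram.two c d)) {p : ℕ} (T : Tangle n p) :
    (ly a).comp ((ly b).comp T) = (ly c).comp ((ly d).comp T) := by
  rw [← comp_assoc, ← mk_two, move_eq h, mk_two, comp_assoc]

theorem G_def {n : ℕ} (s : Bool) (i : Fin (n - 1)) :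
    G s i = ly (Layer.cross s i (by omega)) := rfl

theorem E_def {n : ℕ} (i : Fin (n + 2 - 1)) :
    E i = (ly (Layer.cup i (by omega))).comp (ly (Layer.cap i (by omega))) := rfl

end Tangle

/-- The images of the generators. -/
noncomputable def phiGen (n : ℕ) : Gen n → MT n
  | .g i => MT.of (Tangle.G true i)
  | .gInv i => MT.of (Tangle.G false i)
  | .e i => MT.of (Tangle.E i)

namespace Tangle

theorem G_mul_G_not {n : ℕ} (s : Bool) (i : Fin (n - 1)) : G s i * G (!s) i = 1 :=
  move_eq (Move.reidemeister_two s i (by omega))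

theorem G_braid {n : ℕ} (i j : Fin (n - 1)) (h : Adj i j) :
    G true i * G true j * G true i = G true j * G true i * G true j := by
  rcases i with ⟨i, hi⟩
  rcases j with ⟨j, hj⟩
  rcases h with h | h <;> dsimp only at h <;> subst h
  · exact move_eq (Move.reidemeister_three i (by omega))
  · exact (move_eq (Move.reidemeister_three j (by omega))).symm

theorem G_comm_G {n : ℕ} (s t : Bool) (i j : Fin (n - 1)) (h : Far i j) :
    G s i * G t j = G t j * G s i := by
  rcases h with h | h
  · exact move_eq (Move.cross_cross s t i j (by omega) (by omega))
  · exact (move_eq (Move.cross_cross t s j i (by omega) (by omega))).symm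

theorem G_comm_E {n : ℕ} (s : Bool) (i j : Fin (n - 1)) (h : Far i j) :
    G s i * E j = E j * G s i := by
  rcases i with ⟨i, hi⟩
  rcases j with ⟨j, hj⟩
  obtain ⟨n, rfl⟩ : ∃ p, n = p + 2 := ⟨n - 2, by omega⟩
  simp only [mul_def, E_def, G_def, comp_assoc]
  rcases h with h | h <;> dsimp only at h
  · rw [← two_two (Move.cup_cross_left s j i (by omega) (by omega)), ← mk_two (Layer.cross s i _),
      move_eq (Move.cap_cross_left s j i (by omega) (by omega)), mk_two]
  · obtain ⟨i, rfl⟩ : ∃ p, i = p + 2 := ⟨i - 2, by omega⟩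
    rw [← two_two (Move.cup_cross_right s j i (by omega) (by omega)),
      ← mk_two (Layer.cross s i _),
      move_eq (Move.cap_cross_right s j i (by omega) (by omega)), mk_two]

theorem E_comm_E {n : ℕ} (i j : Fin (n - 1)) (h : Far i j) : E i * E j = E j * E i := by
  have key : ∀ (n i j : ℕ) (hi : i < n + 4 - 1) (hj : j + 2 < n + 4 - 1), i ≤ j →
      (E ⟨i, hi⟩ : Tangle (n + 4) (n + 4)) * E ⟨j + 2, hj⟩ = E ⟨j + 2, hj⟩ * E ⟨i, hi⟩ := by
    intro n i j hi hj h
    rw [mul_def, mul_def, E_def (n := n + 2), E_def (n := n + 2)]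
    simp only [comp_assoc]
    rw [← two_two (Move.cup_cap_left i j h (by omega)),
      two_two (Move.cup_cup i j h (by omega)), ← mk_two (Layer.cap i _),
      ← move_eq (Move.cap_cap i j h (by omega)), mk_two,
      two_two (Move.cup_cap_right i j h (by omega))]
  rcases i with ⟨i, hi⟩
  rcases j with ⟨j, hj⟩
  rcases h with h | h <;> dsimp only at h
  · obtain ⟨n, rfl⟩ : ∃ p, n = p + 4 := ⟨n - 4, by omega⟩
    obtain ⟨j, rfl⟩ : ∃ p, j = p + 2 := ⟨j - 2, by omega⟩
    exact key n i j hi hj (by omega)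
  · obtain ⟨n, rfl⟩ : ∃ p, n = p + 4 := ⟨n - 4, by omega⟩
    obtain ⟨i, rfl⟩ : ∃ p, i = p + 2 := ⟨i - 2, by omega⟩
    exact (key n j i hj hi (by omega)).symm

theorem E_E_E {n : ℕ} (i j : Fin (n - 1)) (h : Adj i j) : E i * E j * E i = E i := by
  rcases i with ⟨i, hi⟩
  rcases j with ⟨j, hj⟩
  obtain ⟨n, rfl⟩ : ∃ p, n = p + 2 := ⟨n - 2, by omega⟩
  simp only [mul_def, E_def, comp_assoc]
  rcases h with h | h <;> dsimp only at h <;> subst h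
  · rw [two_nil (Move.zigzag_right i (by omega)), two_nil (Move.zigzag_left i (by omega))]
  · rw [two_nil (Move.zigzag_left j (by omega)), two_nil (Move.zigzag_right j (by omega))]

theorem G_G_E {n : ℕ} (s : Bool) (i j : Fin (n - 1)) (h : Adj i j) :
    G s i * G s j * E i = E j * E i := by
  rcases i with ⟨i, hi⟩
  rcases j with ⟨j, hj⟩
  obtain ⟨n, rfl⟩ : ∃ p, n = p + 2 := ⟨n - 2, by omega⟩
  simp only [mul_def, E_def, G_def, comp_assoc]
  rcases h with h | h <;> dsimp only at h <;> subst h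
  · rw [two_two (Move.slide_cup s i (by omega)),
      two_nil (Move.reidemeister_two s i (by omega)), two_nil (Move.zigzag_left i (by omega))]
  · have := two_two (Move.slide_cup (!s) j (show j + 1 ≤ n by omega))
      (ly (Layer.cap (j + 1) (by omega)))
    rw [Bool.not_not] at this
    rw [← this, two_nil (Move.reidemeister_two s (j + 1) (by omega)),
      two_nil (Move.zigzag_right j (by omega))]

theorem E_G_G {n : ℕ} (s : Bool) (i j : Fin (n - 1)) (h : Adj i j) :
    E i * G s j * G s i = E i * E j := by
  rcases i with ⟨i, hi⟩
  rcases j with ⟨j, hj⟩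
  obtain ⟨n, rfl⟩ : ∃ p, n = p + 2 := ⟨n - 2, by omega⟩
  have key : ∀ (t : Bool) (i : ℕ) (hi : i + 1 < n + 2),
      (ly (Layer.cross (!t) i hi)).comp (ly (Layer.cross t i hi)) = mk Diagram.nil := by
    intro t i hi
    have := move_eq (Move.reidemeister_two (!t) i hi)
    rwa [Bool.not_not] at this
  simp only [mul_def, E_def, G_def, comp_assoc]
  rcases h with h | h <;> dsimp only at h <;> subst h
  · rw [two_two (Move.slide_cap s i (by omega)), key, comp_nil,
      two_nil (Move.zigzag_right i (by omega))]
  · have := two_two (Move.slide_cap (!s) j (show j + 1 ≤ n by omega))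
      (ly (Layer.cross s (j + 1) (by omega)))
    rw [Bool.not_not] at this
    rw [← this, key, comp_nil, two_nil (Move.zigzag_left j (by omega))]

theorem curl_E {n : ℕ} (s : Bool) (i : ℕ) (hi : i < n - 1) :
    (curlR s ⟨i + 1, by omega⟩).comp (E ⟨i, hi⟩) = G (!s) ⟨i, hi⟩ * E ⟨i, hi⟩ := by
  obtain ⟨n, rfl⟩ : ∃ p, n = p + 2 := ⟨n - 2, by omega⟩
  simp only [mul_def, E_def, G_def, curlR, mk_three, comp_assoc]
  rw [← two_two (Move.cup_cup i i le_rfl (by omega)), two_two (Move.slide_cup s i (by omega)),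
    ← two_two (Move.cap_cross_left (!s) (i + 2) i le_rfl (by omega)),
    two_nil (Move.zigzag_left (i + 1) (by omega))]

theorem E_curl {n : ℕ} (s : Bool) (i : ℕ) (hi : i < n - 1) :
    (E ⟨i, hi⟩).comp (curlR s ⟨i + 1, by omega⟩) = E ⟨i, hi⟩ * G (!s) ⟨i, hi⟩ := by
  obtain ⟨n, rfl⟩ : ∃ p, n = p + 2 := ⟨n - 2, by omega⟩
  simp only [mul_def, E_def, G_def, curlR, mk_three, comp_assoc]
  rw [← two_two (Move.cap_cap i i le_rfl (by omega)), two_two (Move.slide_cap s i (by omega)),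
    ← mk_two (Layer.cross (!s) i _), ← move_eq (Move.cup_cross_left (!s) (i + 2) i le_rfl
      (by omega)), mk_two, two_nil (Move.zigzag_right (i + 1) (by omega))]

end Tangle

namespace MT

theorem of_mul {n : ℕ} (S T : Tangle n n) : of (S * T) = of S * of T := by
  simp only [of, map_mul]

theorem of_one {n : ℕ} : of (1 : Tangle n n) = 1 := by
  simp only [of, map_one]

theorem rel {n : ℕ} {x y : MonoidAlgebra Lam (Tangle n n)} (h : MTRel n x y) :
    mk n x = mk n y :=
  RingQuot.mkAlgHom_rel Lam h

theorem skein {n : ℕ} (i : Fin (n - 1)) :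
    of (Tangle.G true i) - of (Tangle.G false i) = z • (1 - of (Tangle.E i)) := by
  have := rel (MTRel.skein (1 : Tangle n n) 1 i)
  simp only [Tangle.one_comp, Tangle.comp_one, map_sub, map_smul] at this
  rw [← of_one]
  exact this

theorem idem {n : ℕ} (i : Fin (n - 1)) :
    of (Tangle.E i) * of (Tangle.E i) = delta • of (Tangle.E i) := by
  rcases i with ⟨i, hi⟩
  obtain ⟨n, rfl⟩ : ∃ p, n = p + 2 := ⟨n - 2, by omega⟩
  have := rel (MTRel.circle (Tangle.ly (Layer.cup (n := n) i (by omega)))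
    (Tangle.ly (Layer.cap i (by omega))) ⟨i, by omega⟩)
  rw [← of_mul, Tangle.mul_def]
  simpa only [Tangle.E_def, of, Tangle.circle, Tangle.mk_two, Tangle.comp_assoc, map_smul]
    using this

theorem deloop_GE {n : ℕ} (i : Fin (n - 1)) :
    of (Tangle.G true i) * of (Tangle.E i) = lam • of (Tangle.E i) := by
  have := rel (MTRel.curlR_false (1 : Tangle n n) (Tangle.E i) ⟨i + 1, by omega⟩)
  rw [← of_mul]
  have h2 := Tangle.curl_E false i i.2
  simp only [Bool.not_false, Fin.eta] at h2
  rw [Tangle.one_comp, h2, Tangle.one_comp, map_smul] at this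
  exact this

theorem deloop_EG {n : ℕ} (i : Fin (n - 1)) :
    of (Tangle.E i) * of (Tangle.G true i) = lam • of (Tangle.E i) := by
  have := rel (MTRel.curlR_false (Tangle.E i) (1 : Tangle n n) ⟨i + 1, by omega⟩)
  rw [← of_mul]
  have h2 := Tangle.E_curl false i i.2
  simp only [Bool.not_false, Fin.eta] at h2
  rw [Tangle.comp_one, h2, Tangle.comp_one, map_smul] at this
  exact this

theorem deloop_EGE {n : ℕ} (i j : Fin (n - 1)) (h : Adj i j) :
    of (Tangle.E i) * of (Tangle.G true j) * of (Tangle.E i) = lamInv • of (Tangle.E i) := by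
  rcases i with ⟨i, hi⟩
  rcases j with ⟨j, hj⟩
  obtain ⟨n, rfl⟩ : ∃ p, n = p + 2 := ⟨n - 2, by omega⟩
  rw [← of_mul, ← of_mul, Tangle.mul_def, Tangle.mul_def]
  rcases h with h | h <;> dsimp only at h <;> subst h
  · have := rel (MTRel.curlL_true (Tangle.ly (Layer.cup (n := n) i (by omega)))
      (Tangle.ly (Layer.cap i (by omega))) ⟨i, by omega⟩)
    simpa only [Tangle.E_def, Tangle.G_def, of, Tangle.curlL, Tangle.mk_three,
      Tangle.comp_assoc, map_smul] using this
  · have := rel (MTRel.curlR_true (Tangle.ly (Layer.cup (n := n) (j + 1) (by omega)))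
      (Tangle.ly (Layer.cap (j + 1) (by omega))) ⟨j, by omega⟩)
    simpa only [Tangle.E_def, Tangle.G_def, of, Tangle.curlR, Tangle.mk_three,
      Tangle.comp_assoc, map_smul] using this

end MT

/-- The homomorphism `φ : BW_n → MT_n` with `g_i ↦ G_i`, `e_i ↦ E_i`. -/
noncomputable def phi (n : ℕ) : BW n →ₐ[Lam] MT n :=
  BW.lift (phiGen n) (by
    intro x y hxy
    cases hxy <;>
      simp only [map_mul, map_sub, map_one, map_smul, FreeAlgebra.lift_ι_apply, phiGen]
    case mul_inv i =>
      rw [← MT.of_mul, ← MT.of_one]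
      exact congrArg _ (Tangle.G_mul_G_not true i)
    case inv_mul i =>
      rw [← MT.of_mul, ← MT.of_one]
      exact congrArg _ (Tangle.G_mul_G_not false i)
    case skein i => exact MT.skein i
    case idem i => exact MT.idem i
    case braid i j h => simp only [← MT.of_mul, Tangle.G_braid i j h]
    case comm_gg i j h => simp only [← MT.of_mul, Tangle.G_comm_G true true i j h]
    case comm_ge i j h => simp only [← MT.of_mul, Tangle.G_comm_E true i j h]
    case comm_ee i j h => simp only [← MT.of_mul, Tangle.E_comm_E i j h]
    case tangle_eee i j h => simp only [← MT.of_mul, Tangle.E_E_E i j h]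
    case tangle_gge i j h => simp only [← MT.of_mul, Tangle.G_G_E true i j h]
    case tangle_egg i j h => simp only [← MT.of_mul, Tangle.E_G_G true i j h]
    case deloop_ge i => exact MT.deloop_GE i
    case deloop_eg i => exact MT.deloop_EG i
    case deloop_ege i j h => exact MT.deloop_EGE i j h)

theorem two_mul_le {n : ℕ} (k : Fin (n / 2 + 1)) : 2 * (k : ℕ) ≤ n := by omega

theorem le_two_mul (k : ℕ) : k ≤ 2 * k := by omega

end BMW

set_option linter.unusedSectionVars false

set_option linter.unusedSimpArgs false
set_option linter.style.longLine false

/-! The proof bounds `BW n` from above and from below by the same number `(2 * n - 1)‼` of elements.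

Lower bound. For every `N` there is an explicit solution of the tangle relations on a free module of
rank `2 * N`, a `q`-deformation of the vector representation of the orthogonal group, with `z = q -
q⁻¹` and `λ = q ^ (1 - 2 * N)`. It is built by adding one hyperbolic plane at a time
(`RData.IsTangle.ext`), and it makes `MT n` act on the `n`-th tensor power (`RData.IsTangle.rep`).
Over `ℚ⟦X⟧` with `q = 1 + X`, reduction modulo `X` gives the classical action of the Brauer algebra.
For large `N` suitable matrix entries of this action separate the words attached to the perfect
matchings of `2 * n` points (`RData.IsClassical.eval_word`). If a family indexed by the matchings
spans `BW n`, these words are combinations of it, so the matrix of the corresponding entries of the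
family has non-zero determinant. Coefficients of a linear relation between the images in `MT n` are
therefore killed by infinitely many specializations of `Λ`, and an element of `Λ` with this property
vanishes (`Lam.eq_zero_of_specializations`). Hence `phi` maps every spanning family with at most `(2
* n - 1)‼` elements to a linearly independent one (`linearIndependent_phi_of_card_le`).

Upper bound. `BW n` is filtered by the ideals of `e_0 e_2 ⋯ e_{2k-2}`. Modulo the next ideal, an
element of such an ideal is a combination of products `b_π w b_τ b_μ`: Lorenz braids collect the
ends of the arcs at the top and at the bottom, `w` runs over a spanning set of the ideal of `BW (2 *
k)` without through strings, and `b_τ` permutes the through strings (`ideal_le_span_famSet`). That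
ideal is spanned by the products `t f_k t'` with `t`, `t'` from `BW k`, because `f_k` consists of
nested arcs and a generator on their right half can be moved along the arcs to the left half
(`Sys.S_mul_V`, `BW.ideal_le_span`). By recursion `BW n` has a spanning family with at most `∑ k,
(n.choose (2 * k)) ^ 2 * ((2 * k - 1)‼) ^ 2 * (n - 2 * k)!` elements, and comparing coefficients in
`(1 + 2 X + X ^ 2) ^ n = (1 + X) ^ (2 * n)` shows that this is at most `(2 * n - 1)‼`
(`card_sum_le`).

Together the bounds make these families bases and `phi` injective. For surjectivity every tangle is
put into the form `c y d`, with maxima `c` and minima `d` to the right of all strings and `y` a word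
in the generators (`Tangle.isNormal`). Closing up the last two strings sends the image of `phi` into
the image of `phi`, so the maxima and minima can be removed in pairs (`closure_mem_range`). -/

namespace BMW

/-! ### R-matrices and their enlargement by a hyperbolic plane. -/

/-- Matrix entries of a crossing, a cup and a cap for a module with basis `I`. -/
structure RData (k I : Type) where
  r : I → I → I → I → k
  eta : I → I → k
  kap : I → I → k

namespace RData

variable {k I X Y : Type} [CommRing k] [Fintype I] [AddCommGroup X] [Module k X]
  [AddCommGroup Y] [Module k Y] (D : RData k I)

/-- The operator of a crossing. -/
def R : (I → I → X) →ₗ[k] (I → I → X) where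
  toFun f i j := ∑ a, ∑ b, D.r i j a b • f a b
  map_add' f g := by
    funext i j
    simp only [Pi.add_apply, smul_add, Finset.sum_add_distrib]
  map_smul' c f := by
    funext i j
    simp only [Pi.smul_apply, RingHom.id_apply, Finset.smul_sum, smul_comm c]

/-- The operator of a local maximum. -/
def cap : (I → I → X) →ₗ[k] X where
  toFun f := ∑ a, ∑ b, D.kap a b • f a b
  map_add' f g := by
    simp only [Pi.add_apply, smul_add, Finset.sum_add_distrib]
  map_smul' c f := by
    simp only [Pi.smul_apply, RingHom.id_apply, Finset.smul_sum, smul_comm c]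

/-- The operator of a local minimum. -/
def cup : X →ₗ[k] (I → I → X) where
  toFun x i j := D.eta i j • x
  map_add' f g := by
    funext i j
    simp only [Pi.add_apply, smul_add]
  map_smul' c f := by
    funext i j
    simp only [Pi.smul_apply, RingHom.id_apply, smul_comm c]

theorem R_def (f : I → I → X) (i j : I) : D.R f i j = ∑ a, ∑ b, D.r i j a b • f a b := rfl

theorem cap_def (f : I → I → X) : D.cap f = ∑ a, ∑ b, D.kap a b • f a b := rfl

theorem R_fun_apply {α : Type} (f : I → I → α → X) (i j : I) (a : α) :
    D.R f i j a = D.R (fun i j => f i j a) i j := by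
  simp only [R_def, Finset.sum_apply, Pi.smul_apply]

theorem cap_fun_apply {α : Type} (f : I → I → α → X) (a : α) :
    D.cap f a = D.cap (fun i j => f i j a) := by
  simp only [cap_def, Finset.sum_apply, Pi.smul_apply]

theorem R_map (h : X →ₗ[k] Y) (f : I → I → X) (i j : I) :
    D.R (fun i j => h (f i j)) i j = h (D.R f i j) := by
  simp only [R_def, map_sum, map_smul]

theorem cap_map (h : X →ₗ[k] Y) (f : I → I → X) :
    D.cap (fun i j => h (f i j)) = h (D.cap f) := by
  simp only [cap_def, map_sum, map_smul]

theorem R_add (f g : I → I → X) (i j : I) :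
    D.R (fun i j => f i j + g i j) i j = D.R f i j + D.R g i j := by
  simp only [R_def, smul_add, Finset.sum_add_distrib]

theorem R_sub (f g : I → I → X) (i j : I) :
    D.R (fun i j => f i j - g i j) i j = D.R f i j - D.R g i j := by
  simp only [R_def, smul_sub, Finset.sum_sub_distrib]

theorem R_zero (i j : I) : D.R (fun _ _ => (0 : X)) i j = 0 := by
  simp only [R_def, smul_zero, Finset.sum_const_zero]

theorem cap_zero : D.cap (fun _ _ => (0 : X)) = 0 := by
  simp only [cap_def, smul_zero, Finset.sum_const_zero]

theorem R_smul (c : k) (f : I → I → X) (i j : I) :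
    D.R (fun i j => c • f i j) i j = c • D.R f i j := by
  simp only [R_def, Finset.smul_sum, smul_comm c]

theorem cap_add (f g : I → I → X) :
    D.cap (fun i j => f i j + g i j) = D.cap f + D.cap g := by
  simp only [cap_def, smul_add, Finset.sum_add_distrib]

theorem cap_sub (f g : I → I → X) :
    D.cap (fun i j => f i j - g i j) = D.cap f - D.cap g := by
  simp only [cap_def, smul_sub, Finset.sum_sub_distrib]

theorem cap_smul (c : k) (f : I → I → X) :
    D.cap (fun i j => c • f i j) = c • D.cap f := by
  simp only [cap_def, Finset.smul_sum, smul_comm c]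

/-- The relations for the operators that make them a representation of the category of tangles
with the parameters `z`, `l` (for `λ`), `d` (for `δ`). -/
structure IsTangle (D : RData k I) (z l d : k) : Prop where
  quad : ∀ {X : Type} [AddCommGroup X] [Module k X] (f : I → I → X) (i j : I),
    D.R (fun i j => D.R f i j) i j = f i j + z • D.R f i j - (z * l) • D.eta i j • D.cap f
  R_cup : ∀ {X : Type} [AddCommGroup X] [Module k X] (x : X) (i j : I),
    D.R (fun i j => D.eta i j • x) i j = l • D.eta i j • x
  cap_R : ∀ {X : Type} [AddCommGroup X] [Module k X] (f : I → I → X),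
    D.cap (fun i j => D.R f i j) = l • D.cap f
  loop : ∀ {X : Type} [AddCommGroup X] [Module k X] (x : X),
    D.cap (fun i j => D.eta i j • x) = d • x
  zig : ∀ {X : Type} [AddCommGroup X] [Module k X] (f : I → X) (i : I),
    D.cap (fun j a => D.eta i j • f a) = f i
  zag : ∀ {X : Type} [AddCommGroup X] [Module k X] (f : I → X) (i : I),
    D.cap (fun a j => D.eta j i • f a) = f i
  slide : ∀ {X : Type} [AddCommGroup X] [Module k X] (f : I → I → I → X) (i : I),
    D.cap (fun a b => D.R (fun b c => f a b c) b i) =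
      D.cap (fun b c => D.R (fun a b => f a b c) i b) -
        z • (D.cap (f i) - D.cap (fun a b => f a b i))
  slide_eta : ∀ {X : Type} [AddCommGroup X] [Module k X] (g : I → X) (i j l : I),
    D.R (fun a b => D.eta i a • g b) j l =
      D.R (fun a b => D.eta b l • g a) i j - z • (D.eta j l • g i - D.eta i j • g l)
  ybe : ∀ {X : Type} [AddCommGroup X] [Module k X] (f : I → I → I → X) (i j l : I),
    D.R (fun i j => D.R (fun j l => D.R (fun i j => f i j l) i j) j l) i j =
      D.R (fun j l => D.R (fun i j => D.R (fun j l => f i j l) j l) i j) j l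

namespace IsTangle

variable {D} {z l d : k}

/-- The slide relation is applied to `R f` and the square of the crossing is removed by `quad`. This
and the next two identities evaluate composites that occur when the Yang-Baxter equation of `ext` is
expanded in components. -/
theorem slide_R (h : D.IsTangle z l d) (f : I → I → I → X) (i : I) :
    D.cap (fun b c => D.R (fun a b => D.R (fun b c => f a b c) b c) i b) =
      D.cap (fun a b => f a b i) := by
  have := h.slide (fun a b c => D.R (fun b c => f a b c) b c) i
  simp only [h.quad, h.cap_R, cap_add, cap_sub, cap_smul, h.zag] at this
  rw [eq_sub_iff_add_eq] at this
  rw [← this]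
  module

/-- This is the curl of value `λ⁻¹`, which is written `l + z * (d - 1)` because no inverse of `l`
belongs to the data. -/
theorem slide_cap_eta (h : D.IsTangle z l d) (g : I → X) (i : I) :
    D.cap (fun b c => D.R (fun a b => D.eta b c • g a) i b) =
      (l + z * (d - 1)) • g i := by
  have := h.slide (fun a b c => D.eta b c • g a) i
  simp only [h.R_cup, h.loop, cap_smul, h.zag] at this
  rw [eq_sub_iff_add_eq] at this
  rw [← this]
  module

theorem R_R_eta_right (h : D.IsTangle z l d) (g : I → X) (i j m : I) :
    D.R (fun j m => D.R (fun a b => D.eta b m • g a) i j) j m = D.eta i j • g m := by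
  have : ∀ i j m, D.R (fun a b => D.eta b m • g a) i j = D.R (fun a b => D.eta i a • g b) j m +
      z • (D.eta j m • g i - D.eta i j • g m) := fun i j m => by
    rw [h.slide_eta]; module
  simp only [this, h.quad, R_add, R_sub, R_smul, h.R_cup, h.zig, smul_sub]
  module

end IsTangle

/-- Enlarging the index set by two elements. -/
def ext [DecidableEq I] (q qi z mu mui : k) : RData k (Bool ⊕ I) where
  r
    | .inl true, .inl true, .inl true, .inl true => q
    | .inl false, .inl false, .inl false, .inl false => q
    | .inl true, .inr i, .inr j, .inl true => if i = j then 1 else 0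
    | .inl true, .inr i, .inl true, .inr j => if i = j then z else 0
    | .inr i, .inl true, .inl true, .inr j => if i = j then 1 else 0
    | .inr i, .inl false, .inl false, .inr j => if i = j then 1 else 0
    | .inr i, .inl false, .inr j, .inl false => if i = j then z else 0
    | .inl false, .inr i, .inr j, .inl false => if i = j then 1 else 0
    | .inl true, .inl false, .inl false, .inl true => qi
    | .inl true, .inl false, .inl true, .inl false => z * (1 - mu)
    | .inl true, .inl false, .inr i, .inr j => -z * D.kap i j
    | .inr i, .inr j, .inr a, .inr b => D.r i j a b
    | .inr i, .inr j, .inl true, .inl false => -z * mu * D.eta i j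
    | .inl false, .inl true, .inl true, .inl false => qi
    | _, _, _, _ => 0
  eta
    | .inl true, .inl false => 1
    | .inl false, .inl true => mui
    | .inr i, .inr j => D.eta i j
    | _, _ => 0
  kap
    | .inl true, .inl false => mu
    | .inl false, .inl true => 1
    | .inr i, .inr j => D.kap i j
    | _, _ => 0

section ext

variable [DecidableEq I] (q qi z mu mui : k) (f : Bool ⊕ I → Bool ⊕ I → X) (i j : I)

theorem ext_pp : (D.ext q qi z mu mui).R f (.inl true) (.inl true) =
    q • f (.inl true) (.inl true) := by
  simp [R_def, ext]

theorem ext_mm : (D.ext q qi z mu mui).R f (.inl false) (.inl false) =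
    q • f (.inl false) (.inl false) := by
  simp [R_def, ext]

theorem ext_pi : (D.ext q qi z mu mui).R f (.inl true) (.inr i) =
    f (.inr i) (.inl true) + z • f (.inl true) (.inr i) := by
  simp [R_def, ext, ite_smul, add_comm]

theorem ext_ip : (D.ext q qi z mu mui).R f (.inr i) (.inl true) = f (.inl true) (.inr i) := by
  simp [R_def, ext, ite_smul]

theorem ext_im : (D.ext q qi z mu mui).R f (.inr i) (.inl false) =
    f (.inl false) (.inr i) + z • f (.inr i) (.inl false) := by
  simp [R_def, ext, ite_smul]

theorem ext_mi : (D.ext q qi z mu mui).R f (.inl false) (.inr i) = f (.inr i) (.inl false) := by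
  simp [R_def, ext, ite_smul]

theorem ext_pm : (D.ext q qi z mu mui).R f (.inl true) (.inl false) =
    qi • f (.inl false) (.inl true) + (z * (1 - mu)) • f (.inl true) (.inl false) -
      z • D.cap (fun i j => f (.inr i) (.inr j)) := by
  simp [R_def, cap_def, ext, Finset.smul_sum, mul_smul]
  abel

theorem ext_mp : (D.ext q qi z mu mui).R f (.inl false) (.inl true) =
    qi • f (.inl true) (.inl false) := by
  simp [R_def, ext]

theorem ext_ij : (D.ext q qi z mu mui).R f (.inr i) (.inr j) =
    D.R (fun i j => f (.inr i) (.inr j)) i j - (z * mu) • D.eta i j • f (.inl true) (.inl false) := by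
  simp [R_def, ext, mul_smul]
  abel

theorem ext_cap : (D.ext q qi z mu mui).cap f =
    mu • f (.inl true) (.inl false) + f (.inl false) (.inl true) +
      D.cap (fun i j => f (.inr i) (.inr j)) := by
  simp [cap_def, ext]

theorem ext_eta_inl (a b : Bool) : (D.ext q qi z mu mui).eta (.inl a) (.inl b) =
    if a = b then 0 else if a then 1 else mui := by
  rcases a with _ | _ <;> rcases b with _ | _ <;> rfl

theorem ext_eta_inl_inr (a : Bool) : (D.ext q qi z mu mui).eta (.inl a) (.inr j) = 0 := by
  rcases a with _ | _ <;> rfl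

theorem ext_eta_inr_inl (a : Bool) : (D.ext q qi z mu mui).eta (.inr i) (.inl a) = 0 := by
  rcases a with _ | _ <;> rfl

theorem ext_eta_inr : (D.ext q qi z mu mui).eta (.inr i) (.inr j) = D.eta i j := rfl

end ext

end RData
end BMW

namespace BMW
namespace RData
variable {k I X : Type} [CommRing k] [Fintype I] [AddCommGroup X] [Module k X] (D : RData k I)

/-- Each of the three indices is one of the two new ones or an old one, which gives 27 components.
In each of them the relations of `D` turn both sides into combinations of the same terms, and the
identities between the coefficients follow from `hq`, `hz`, `hm`, `hd`. -/
theorem ext_ybe [DecidableEq I] {q qi z mu mui d : k} (hq : q * qi = 1)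
    (hz : z = q - qi) (hm : mu * mui = 1) (hd : z * d = mui * qi - mu * q + z)
    (h : D.IsTangle z (mu * q) d) {X : Type} [AddCommGroup X] [Module k X]
    (f : Bool ⊕ I → Bool ⊕ I → Bool ⊕ I → X) (i j l : Bool ⊕ I) :
    let D := D.ext q qi z mu mui
    D.R (fun i j => D.R (fun j l => D.R (fun i j => f i j l) i j) j l) i j =
      D.R (fun j l => D.R (fun i j => D.R (fun j l => f i j l) j l) i j) j l := by
  intro D'
  rcases i with (_ | _) | i <;> rcases j with (_ | _) | j <;> rcases l with (_ | _) | l <;>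
  simp only [D', ext_pp, ext_mm, ext_pi, ext_ip, ext_im, ext_mi, ext_pm, ext_mp, ext_ij,
    R_add, R_sub, R_smul, cap_add, cap_sub, cap_smul, h.quad, h.R_cup, h.cap_R, h.loop, h.zig,
    h.zag, h.slide_R, h.slide_cap_eta, h.R_R_eta_right, h.slide_eta, h.ybe, h.slide] <;>
  match_scalars <;> (subst hz; clear h; grind)

/-- `hd` is the relation `λ⁻¹ - λ = z (δ - 1)` for `λ = mu * q`. The enlargement divides `λ` by `q ^
2` and adds `mu + mu⁻¹` to `δ`, as in the passage from rank `2 * N` to rank `2 * N + 2` in the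
orthogonal series. All relations are checked component by component, where they reduce to those of
`D` and to scalar identities. -/
theorem IsTangle.ext [DecidableEq I] {q qi z mu mui d : k} (hq : q * qi = 1) (hz : z = q - qi)
    (hm : mu * mui = 1) (hd : z * d = mui * qi - mu * q + z) (h : D.IsTangle z (mu * q) d) :
    (D.ext q qi z mu mui).IsTangle z (mu * qi) (d + mu + mui) where
  quad f i j := by
    rcases i with (_ | _) | i <;> rcases j with (_ | _) | j <;>
    simp only [ext_pp, ext_mm, ext_pi, ext_ip, ext_im, ext_mi, ext_pm, ext_mp, ext_ij,
      ext_cap, ext_eta_inl, ext_eta_inl_inr, ext_eta_inr_inl, ext_eta_inr, reduceCtorEq, if_true, if_false,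
      zero_smul, smul_zero, one_smul,
      R_add, R_sub, R_smul, cap_add, cap_sub, cap_smul, h.quad, h.R_cup, h.cap_R, h.loop, h.zig, h.zag] <;>
    match_scalars <;> (subst hz; clear h; grind)
  R_cup x i j := by
    rcases i with (_ | _) | i <;> rcases j with (_ | _) | j <;>
    simp only [ext_pp, ext_mm, ext_pi, ext_ip, ext_im, ext_mi, ext_pm, ext_mp, ext_ij,
      ext_cap, ext_eta_inl, ext_eta_inl_inr, ext_eta_inr_inl, ext_eta_inr, reduceCtorEq, if_true, if_false,
      zero_smul, smul_zero, one_smul,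
      R_add, R_sub, R_smul, cap_add, cap_sub, cap_smul, h.quad, h.R_cup, h.cap_R, h.loop, h.zig, h.zag] <;>
    match_scalars <;> (subst hz; clear h; grind)
  cap_R f := by
    simp only [ext_pp, ext_mm, ext_pi, ext_ip, ext_im, ext_mi, ext_pm, ext_mp, ext_ij,
      ext_cap, ext_eta_inl, ext_eta_inl_inr, ext_eta_inr_inl, ext_eta_inr, reduceCtorEq, if_true, if_false,
      zero_smul, smul_zero, one_smul,
      R_add, R_sub, R_smul, cap_add, cap_sub, cap_smul, h.quad, h.R_cup, h.cap_R, h.loop, h.zig, h.zag]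
    match_scalars <;> (subst hz; clear h; grind)
  loop x := by
    simp only [ext_cap, ext_eta_inl, ext_eta_inl_inr, ext_eta_inr_inl, ext_eta_inr, reduceCtorEq, if_true, if_false,
      zero_smul, smul_zero, one_smul,
      h.loop]
    match_scalars <;> (subst hz; clear h; grind)
  zig f i := by
    rcases i with (_ | _) | i <;>
    simp only [ext_cap, ext_eta_inl, ext_eta_inl_inr, ext_eta_inr_inl, ext_eta_inr, reduceCtorEq, if_true, if_false,
      zero_smul, smul_zero, one_smul,
      cap_zero, h.zig] <;>
    match_scalars <;> (subst hz; clear h; grind)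
  zag f i := by
    rcases i with (_ | _) | i <;>
    simp only [ext_cap, ext_eta_inl, ext_eta_inl_inr, ext_eta_inr_inl, ext_eta_inr, reduceCtorEq, if_true, if_false,
      zero_smul, smul_zero, one_smul,
      cap_zero, h.zag] <;>
    match_scalars <;> (subst hz; clear h; grind)
  slide f i := by
    rcases i with (_ | _) | i <;>
    simp only [ext_pp, ext_mm, ext_pi, ext_ip, ext_im, ext_mi, ext_pm, ext_mp, ext_ij,
      ext_cap,
      R_add, R_sub, R_smul, cap_add, cap_sub, cap_smul, h.quad, h.R_cup, h.cap_R, h.loop, h.zig, h.zag, h.slide] <;>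
    match_scalars <;> (subst hz; clear h; grind)
  slide_eta g i j l := by
    rcases i with (_ | _) | i <;> rcases j with (_ | _) | j <;> rcases l with (_ | _) | l <;>
    simp only [ext_pp, ext_mm, ext_pi, ext_ip, ext_im, ext_mi, ext_pm, ext_mp, ext_ij,
      ext_cap, ext_eta_inl, ext_eta_inl_inr, ext_eta_inr_inl, ext_eta_inr, reduceCtorEq, if_true, if_false,
      zero_smul, smul_zero, one_smul,
      R_add, R_sub, R_smul, R_zero, cap_zero, cap_add, cap_sub, cap_smul, h.quad, h.R_cup, h.cap_R, h.loop, h.zig, h.zag, h.slide_eta] <;>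
    match_scalars <;> (subst hz; clear h; grind)
  ybe := ext_ybe D hq hz hm hd h

end RData
end BMW

/-! ### Tensor powers and invariance of the operators under the moves. -/

namespace BMW

/-- The `n`-th tensor power of the free module with basis `I`, as functions of `n` indices. -/
def W (k I : Type) : ℕ → Type
  | 0 => k
  | n + 1 => I → W k I n

section W

variable {k I : Type} [CommRing k]

instance W.instAddCommGroup : ∀ n, AddCommGroup (W k I n)
  | 0 => inferInstanceAs (AddCommGroup k)
  | n + 1 =>
    have := W.instAddCommGroup n
    inferInstanceAs (AddCommGroup (I → W k I n))

instance W.instModule : ∀ n, Module k (W k I n)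
  | 0 => inferInstanceAs (Module k k)
  | n + 1 =>
    have := W.instModule n
    inferInstanceAs (Module k (I → W k I n))

/-- The operator on the last tensor factors, with the first factor left alone. -/
def W.shift {m n : ℕ} (A : W k I m →ₗ[k] W k I n) : W k I (m + 1) →ₗ[k] W k I (n + 1) where
  toFun f i := A (f i)
  map_add' f g := by
    funext i
    exact map_add A (f i) (g i)
  map_smul' c f := by
    funext i
    exact map_smul A c (f i)

theorem W.shift_comp {l m n : ℕ} (A : W k I m →ₗ[k] W k I n) (B : W k I l →ₗ[k] W k I m) :
    W.shift (A ∘ₗ B) = W.shift A ∘ₗ W.shift B := rfl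

end W

namespace RData

variable {k I X Y : Type} [CommRing k] [Fintype I] [AddCommGroup X] [Module k X]
  [AddCommGroup Y] [Module k Y] (D : RData k I) (z : k)

/-- The operator of a crossing of either sign. -/
def cr (s : Bool) : (I → I → X) →ₗ[k] (I → I → X) :=
  if s then D.R else D.R - z • (LinearMap.id - D.cup ∘ₗ D.cap)

theorem cr_true : D.cr (X := X) z true = D.R := rfl

theorem cr_false_apply (f : I → I → X) (i j : I) :
    D.cr z false f i j = D.R f i j - z • (f i j - D.eta i j • D.cap f) := rfl

theorem cr_map (s : Bool) (h : X →ₗ[k] Y) (f : I → I → X) (i j : I) :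
    D.cr z s (fun i j => h (f i j)) i j = h (D.cr z s f i j) := by
  cases s
  · simp only [cr_false_apply, R_map, cap_map, map_sub, map_smul]
  · exact D.R_map h f i j

theorem cr_fun_apply {α : Type} (s : Bool) (f : I → I → α → X) (i j : I) (a : α) :
    D.cr z s f i j a = D.cr z s (fun i j => f i j a) i j := by
  cases s
  · simp only [cr_false_apply, Pi.sub_apply, Pi.smul_apply, R_fun_apply, cap_fun_apply]
  · exact D.R_fun_apply f i j a

/-- The operator of the crossing of the first two strings. -/
def crossOpZero (s : Bool) : ∀ n : ℕ, W k I n →ₗ[k] W k I n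
  | n + 2 => D.cr (X := W k I n) z s
  | 0 => 0
  | 1 => 0

/-- The operator of the crossing of the strings `i` and `i + 1`. -/
def crossOp (s : Bool) (n i : ℕ) : W k I n →ₗ[k] W k I n :=
  match i, n with
  | 0, n => D.crossOpZero z s n
  | i + 1, n + 1 => W.shift (crossOp s n i)
  | _ + 1, 0 => 0
termination_by structural i

/-- The operator of a local maximum between the strings `i` and `i + 1`. -/
def capOp (n i : ℕ) : W k I (n + 2) →ₗ[k] W k I n :=
  match i, n with
  | 0, n => D.cap (X := W k I n)
  | i + 1, n + 1 => W.shift (capOp n i)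
  | _ + 1, 0 => 0
termination_by structural i

/-- The operator of a local minimum between the strings `i` and `i + 1`. -/
def cupOp (n i : ℕ) : W k I n →ₗ[k] W k I (n + 2) :=
  match i, n with
  | 0, n => D.cup (X := W k I n)
  | i + 1, n + 1 => W.shift (cupOp n i)
  | _ + 1, 0 => 0
termination_by structural i

/-- The operator of a layer. -/
def layerOp : ∀ {m n : ℕ}, Layer m n → (W k I n →ₗ[k] W k I m)
  | _, _, .cross (n := n) s i _ => D.crossOp z s n i
  | _, _, .cap (n := n) i _ => D.capOp n i
  | _, _, .cup (n := n) i _ => D.cupOp n i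

/-- The operator of a diagram. -/
def diagOp : ∀ {m n : ℕ}, Diagram m n → (W k I n →ₗ[k] W k I m)
  | _, _, .nil => LinearMap.id
  | _, _, .cons a A => D.layerOp z a ∘ₗ diagOp A

theorem diagOp_comp {m n l : ℕ} (A : Diagram m n) (B : Diagram n l) :
    D.diagOp z (A.comp B) = D.diagOp z A ∘ₗ D.diagOp z B := by
  induction A with
  | nil => rfl
  | cons a A ih => simp only [Diagram.comp, diagOp, ih, LinearMap.comp_assoc]

/-- The recursion removes the first tensor factor by `W.shift` until the left layer is at position
`0`. There the right layer acts linearly on the values of the tensor, and the local operator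
commutes with it by naturality. All exchanges of distant layers are treated in this way. -/
theorem cross_cross_op (s t : Bool) : ∀ {n : ℕ} (i j : ℕ) (_ : i + 2 ≤ j) (_ : j + 1 < n),
    D.crossOp z s n i ∘ₗ D.crossOp z t n j = D.crossOp z t n j ∘ₗ D.crossOp z s n i
  | n + 2, 0, j + 2, _, _ => by
    ext f
    funext a b
    exact D.cr_map z s (D.crossOp z t n j) f a b
  | n + 1, i + 1, j + 1, h, h' =>
    congrArg W.shift (cross_cross_op s t (n := n) i j (by omega) (by omega))

theorem cap_cross_right_op (s : Bool) : ∀ {n : ℕ} (i j : ℕ) (_ : i ≤ j) (_ : j + 1 < n),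
    D.crossOp z s n j ∘ₗ D.capOp n i = D.capOp n i ∘ₗ D.crossOp z s (n + 2) (j + 2)
  | n, 0, j, _, _ => by
    ext f
    exact (D.cap_map (D.crossOp z s _ j) f).symm
  | n + 1, i + 1, j + 1, h, h' =>
    congrArg W.shift (cap_cross_right_op s (n := n) i j (by omega) (by omega))

theorem cap_cross_left_op (s : Bool) : ∀ {n : ℕ} (i j : ℕ) (_ : j + 2 ≤ i) (_ : i ≤ n),
    D.crossOp z s n j ∘ₗ D.capOp n i = D.capOp n i ∘ₗ D.crossOp z s (n + 2) j
  | n + 2, i + 2, 0, _, _ => by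
    ext f
    funext a b
    exact D.cr_map z s (D.capOp n i) f a b
  | n + 1, i + 1, j + 1, h, h' =>
    congrArg W.shift (cap_cross_left_op s (n := n) i j (by omega) (by omega))
  | 0, _, _, h, h' => by omega
  | 1, _ + 1, 0, h, h' => by omega
  | _ + 2, 1, 0, h, h' => by omega

theorem cup_cross_right_op (s : Bool) : ∀ {n : ℕ} (i j : ℕ) (_ : i ≤ j) (_ : j + 1 < n),
    D.cupOp n i ∘ₗ D.crossOp z s n j = D.crossOp z s (n + 2) (j + 2) ∘ₗ D.cupOp n i
  | n, 0, j, _, _ => by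
    ext f
    funext a b
    exact (map_smul (D.crossOp z s _ j) (D.eta a b) f).symm
  | n + 1, i + 1, j + 1, h, h' =>
    congrArg W.shift (cup_cross_right_op s (n := n) i j (by omega) (by omega))

theorem cup_cross_left_op (s : Bool) : ∀ {n : ℕ} (i j : ℕ) (_ : j + 2 ≤ i) (_ : i ≤ n),
    D.cupOp n i ∘ₗ D.crossOp z s n j = D.crossOp z s (n + 2) j ∘ₗ D.cupOp n i
  | n + 2, i + 2, 0, _, _ => by
    ext f
    funext a b
    exact (D.cr_map z s (D.cupOp n i) f a b).symm
  | n + 1, i + 1, j + 1, h, h' =>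
    congrArg W.shift (cup_cross_left_op s (n := n) i j (by omega) (by omega))
  | 0, _, _, h, h' => by omega
  | 1, _ + 1, 0, h, h' => by omega
  | _ + 2, 1, 0, h, h' => by omega

theorem cap_cap_op : ∀ {n : ℕ} (i j : ℕ) (_ : i ≤ j) (_ : j ≤ n),
    D.capOp n j ∘ₗ D.capOp (n + 2) i = D.capOp n i ∘ₗ D.capOp (n + 2) (j + 2)
  | n, 0, j, _, _ => by
    ext f
    exact (D.cap_map (D.capOp _ j) f).symm
  | n + 1, i + 1, j + 1, h, h' =>
    congrArg W.shift (cap_cap_op (n := n) i j (by omega) (by omega))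
  | 0, _ + 1, _, h, h' => by omega

theorem cup_cup_op : ∀ {n : ℕ} (i j : ℕ) (_ : i ≤ j) (_ : j ≤ n),
    D.cupOp (n + 2) i ∘ₗ D.cupOp n j = D.cupOp (n + 2) (j + 2) ∘ₗ D.cupOp n i
  | n, 0, j, _, _ => by
    ext f
    funext a b
    exact (map_smul (D.cupOp _ j) (D.eta a b) f).symm
  | n + 1, i + 1, j + 1, h, h' =>
    congrArg W.shift (cup_cup_op (n := n) i j (by omega) (by omega))
  | 0, _ + 1, _, h, h' => by omega

theorem cup_cap_left_op : ∀ {n : ℕ} (i j : ℕ) (_ : i ≤ j) (_ : j ≤ n),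
    D.cupOp n j ∘ₗ D.capOp n i = D.capOp (n + 2) i ∘ₗ D.cupOp (n + 2) (j + 2)
  | n, 0, j, _, _ => by
    ext f
    exact (D.cap_map (D.cupOp _ j) f).symm
  | n + 1, i + 1, j + 1, h, h' =>
    congrArg W.shift (cup_cap_left_op (n := n) i j (by omega) (by omega))
  | 0, _ + 1, _, h, h' => by omega

theorem cup_cap_right_op : ∀ {n : ℕ} (i j : ℕ) (_ : i ≤ j) (_ : j ≤ n),
    D.cupOp n i ∘ₗ D.capOp n j = D.capOp (n + 2) (j + 2) ∘ₗ D.cupOp (n + 2) i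
  | n, 0, j, _, _ => by
    ext f
    funext a b
    exact (map_smul (D.capOp _ j) (D.eta a b) f).symm
  | n + 1, i + 1, j + 1, h, h' =>
    congrArg W.shift (cup_cap_right_op (n := n) i j (by omega) (by omega))
  | 0, _ + 1, _, h, h' => by omega

namespace IsTangle

variable {D z} {l d : k}

/-- The negative crossing is defined by the skein relation. That it inverts the positive one is the
quadratic relation, combined with the values `cap_R` and `R_cup` of the curls. -/
theorem cr_cr (h : D.IsTangle z l d) (s : Bool) (f : I → I → X) (i j : I) :
    D.cr z s (fun i j => D.cr z (!s) f i j) i j = f i j := by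
  cases s
  · simp only [Bool.not_false, cr_true, cr_false_apply, h.quad, h.cap_R]
    module
  · simp only [Bool.not_true, cr_true, cr_false_apply, R_sub, R_smul, h.quad, h.R_cup]
    module

theorem cap_cr (h : D.IsTangle z l d) (s : Bool) (f : I → I → I → X) (i : I) :
    D.cap (fun a b => D.cr z s (fun b c => f a b c) b i) =
      D.cap (fun b c => D.cr z (!s) (fun a b => f a b c) i b) := by
  cases s
  · simp only [Bool.not_false, cr_true, cr_false_apply, cap_sub, cap_smul, h.slide, h.zag]
    have : ∀ a b : I, D.eta b i • D.cap (f a) = D.eta b i • D.cap (fun b c => f a b c) :=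
      fun _ _ => rfl
    module
  · simp only [Bool.not_true, cr_true, cr_false_apply, cap_sub, cap_smul, h.slide, h.zig]

theorem cr_eta (h : D.IsTangle z l d) (s : Bool) (g : I → X) (i j m : I) :
    D.cr z s (fun a b => D.eta i a • g b) j m =
      D.cr z (!s) (fun a b => D.eta b m • g a) i j := by
  cases s
  · simp only [Bool.not_false, cr_true, cr_false_apply, h.slide_eta, h.zig]
    module
  · simp only [Bool.not_true, cr_true, cr_false_apply, h.slide_eta, h.zag]

theorem zigzag_left_op (h : D.IsTangle z l d) : ∀ {n : ℕ} (i : ℕ) (_ : i + 1 ≤ n),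
    D.capOp n (i + 1) ∘ₗ D.cupOp n i = LinearMap.id
  | n + 1, 0, _ => by
    ext f
    funext a
    exact h.zig f a
  | n + 1, i + 1, h' => congrArg W.shift (h.zigzag_left_op (n := n) i (by omega))

theorem zigzag_right_op (h : D.IsTangle z l d) : ∀ {n : ℕ} (i : ℕ) (_ : i + 1 ≤ n),
    D.capOp n i ∘ₗ D.cupOp n (i + 1) = LinearMap.id
  | n + 1, 0, _ => by
    ext f
    funext a
    exact (D.cap_fun_apply _ a).trans (h.zag f a)
  | n + 1, i + 1, h' => congrArg W.shift (h.zigzag_right_op (n := n) i (by omega))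

theorem slide_cap_op (h : D.IsTangle z l d) (s : Bool) : ∀ {n : ℕ} (i : ℕ) (_ : i + 1 ≤ n),
    D.capOp n i ∘ₗ D.crossOp z s (n + 2) (i + 1) = D.capOp n (i + 1) ∘ₗ D.crossOp z (!s) (n + 2) i
  | n + 1, 0, _ => by
    ext f
    funext a
    refine (D.cap_fun_apply _ a).trans ((h.cap_cr s f a).trans ?_)
    exact congrArg D.cap (funext fun b => funext fun c => (D.cr_fun_apply z (!s) f a b c).symm)
  | n + 1, i + 1, h' => congrArg W.shift (h.slide_cap_op s (n := n) i (by omega))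

theorem slide_cup_op (h : D.IsTangle z l d) (s : Bool) : ∀ {n : ℕ} (i : ℕ) (_ : i + 1 ≤ n),
    D.crossOp z s (n + 2) (i + 1) ∘ₗ D.cupOp n i = D.crossOp z (!s) (n + 2) i ∘ₗ D.cupOp n (i + 1)
  | n + 1, 0, _ => by
    ext f
    funext a b c
    exact (h.cr_eta s f a b c).trans
      (D.cr_fun_apply z (!s) (fun a b c => D.eta b c • f a) a b c).symm
  | n + 1, i + 1, h' => congrArg W.shift (h.slide_cup_op s (n := n) i (by omega))

theorem reidemeister_two_op (h : D.IsTangle z l d) (s : Bool) :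
    ∀ {n : ℕ} (i : ℕ) (_ : i + 1 < n),
    D.crossOp z s n i ∘ₗ D.crossOp z (!s) n i = LinearMap.id
  | n + 2, 0, _ => by
    ext f
    funext a b
    exact h.cr_cr s f a b
  | n + 1, i + 1, h' => congrArg W.shift (h.reidemeister_two_op s (n := n) i (by omega))

theorem reidemeister_three_op (h : D.IsTangle z l d) : ∀ {n : ℕ} (i : ℕ) (_ : i + 2 < n),
    D.crossOp z true n i ∘ₗ D.crossOp z true n (i + 1) ∘ₗ D.crossOp z true n i =
      D.crossOp z true n (i + 1) ∘ₗ D.crossOp z true n i ∘ₗ D.crossOp z true n (i + 1)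
  | n + 3, 0, _ => by
    -- `R` acts pointwise in a spectator index, so the crossing of the first two factors can be
    -- evaluated with the third index fixed, which is the form used in `ybe`.
    have e : ∀ (f : I → I → I → W k I n) (a b c : I),
        D.R f a b c = D.R (fun i j => f i j c) a b := fun f a b c => D.R_fun_apply f a b c
    have key : ∀ (f : I → I → I → W k I n) (a b c : I),
        D.R (fun i => D.R (D.R f i)) a b c = D.R (D.R (fun i => D.R (f i)) a) b c := fun f a b c => by
      have := h.ybe f a b c
      simp only [← e] at this
      rw [e]
      simp only [← e] at this ⊢
      exact this
    ext f
    funext a b c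
    exact key f a b c
  | n + 1, i + 1, h' => congrArg W.shift (h.reidemeister_three_op (n := n) i (by omega))

theorem diagOp_move (h : D.IsTangle z l d) {m n : ℕ} {x y : Diagram m n} (hm : Move x y) :
    D.diagOp z x = D.diagOp z y := by
  cases hm
  case cross_cross s t i j hij hj => exact D.cross_cross_op z s t i j hij hj
  case cap_cross_right s i j hij hj => exact D.cap_cross_right_op z s i j hij hj
  case cap_cross_left s i j hij hi => exact D.cap_cross_left_op z s i j hij hi
  case cup_cross_right s i j hij hj => exact D.cup_cross_right_op z s i j hij hj
  case cup_cross_left s i j hij hi => exact D.cup_cross_left_op z s i j hij hi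
  case cap_cap i j hij hj => exact D.cap_cap_op i j hij hj
  case cup_cup i j hij hj => exact D.cup_cup_op i j hij hj
  case cup_cap_left i j hij hj => exact D.cup_cap_left_op i j hij hj
  case cup_cap_right i j hij hj => exact D.cup_cap_right_op i j hij hj
  case zigzag_left i hi => exact h.zigzag_left_op i hi
  case zigzag_right i hi => exact h.zigzag_right_op i hi
  case slide_cap s i hi => exact h.slide_cap_op s i hi
  case slide_cup s i hi => exact h.slide_cup_op s i hi
  case reidemeister_two s i hi => exact h.reidemeister_two_op s i hi
  case reidemeister_three i hi => exact h.reidemeister_three_op i hi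

/-- The operator of a tangle. -/
def op (h : D.IsTangle z l d) {m n : ℕ} : Tangle m n → (W k I n →ₗ[k] W k I m) :=
  Quot.lift (D.diagOp z) (by
    rintro _ _ ⟨A, hm, B⟩
    simp only [diagOp_comp, h.diagOp_move hm])

theorem op_comp (h : D.IsTangle z l d) {m n p : ℕ} (S : Tangle m n) (T : Tangle n p) :
    h.op (S.comp T) = h.op S ∘ₗ h.op T := by
  induction S using Quot.ind
  induction T using Quot.ind
  exact D.diagOp_comp z _ _

end IsTangle
end RData
end BMW

/-! ### The representation of the Kauffman tangle algebra. -/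

namespace BMW

theorem lamInv_sub_lam : lamInv - lam = z * (delta - 1) := by
  have : Lam.mk (LaurentPolynomial.T (-1) - LaurentPolynomial.T 1 -
      LaurentPolynomial.C (MvPolynomial.X 0) *
      (LaurentPolynomial.C (MvPolynomial.X 1) - 1)) = 0 :=
    Ideal.Quotient.eq_zero_iff_mem.mpr (Ideal.subset_span rfl)
  simp only [map_sub, map_mul, map_one] at this
  exact sub_eq_zero.mp this

theorem lamInv_eq : lamInv = lam + z * (delta - 1) := by
  rw [← lamInv_sub_lam]; ring

theorem lam_mul_lamInv : lam * lamInv = 1 := by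
  rw [lam, lamInv, ← map_mul, ← LaurentPolynomial.T_add]
  exact map_one _

theorem MT.mk_surjective (n : ℕ) : Function.Surjective (MT.mk n) :=
  RingQuot.mkAlgHom_surjective Lam (MTRel n)

namespace RData

variable {k I : Type} [CommRing k] [Fintype I] {D : RData k I} {chi : Lam →+* k}

namespace IsTangle

theorem crossOp_sub {z l d : k} (_ : D.IsTangle z l d) : ∀ {n : ℕ} (i : ℕ) (_ : i ≤ n),
    D.crossOp z true (n + 2) i - D.crossOp z false (n + 2) i =
      z • (LinearMap.id - D.cupOp n i ∘ₗ D.capOp n i)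
  | n, 0, _ => by
    ext f
    funext a b
    have key : ∀ (f : I → I → W k I n) (a b : I), D.R f a b - D.cr z false f a b =
        z • (f a b - D.eta a b • D.cap f) := fun f a b => by
      rw [cr_false_apply]
      module
    exact key f a b
  | n + 1, i + 1, h' => congrArg W.shift (crossOp_sub ‹_› (n := n) i (by omega))
  | 0, _ + 1, h' => by omega

theorem capOp_comp_cupOp {z l d : k} (h : D.IsTangle z l d) : ∀ {n : ℕ} (i : ℕ) (_ : i ≤ n),
    D.capOp n i ∘ₗ D.cupOp n i = d • LinearMap.id
  | n, 0, _ => by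
    ext f
    exact h.loop f
  | n + 1, i + 1, h' => congrArg W.shift (h.capOp_comp_cupOp (n := n) i (by omega))
  | 0, _ + 1, h' => by omega

theorem crossOp_comp_cupOp {z l d : k} (h : D.IsTangle z l d) (s : Bool) :
    ∀ {n : ℕ} (i : ℕ) (_ : i ≤ n), D.crossOp z s (n + 2) i ∘ₗ D.cupOp n i =
      (if s then l else l + z * (d - 1)) • D.cupOp n i
  | n, 0, _ => by
    have key : ∀ (x : W k I n) (a b : I), D.cr z s (fun i j => D.eta i j • x) a b =
        (if s then l else l + z * (d - 1)) • D.eta a b • x := fun x a b => by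
      cases s
      · rw [cr_false_apply, h.R_cup, h.loop]
        simp only [Bool.false_eq_true, if_false]
        module
      · exact h.R_cup x a b
    ext x
    funext a b
    exact key x a b
  | n + 1, i + 1, h' => congrArg W.shift (h.crossOp_comp_cupOp s (n := n) i (by omega))
  | 0, _ + 1, h' => by omega

theorem op_G {z l d : k} (h : D.IsTangle z l d) {n : ℕ} (s : Bool) (i : Fin (n - 1)) :
    h.op (Tangle.G s i) = D.crossOp z s n i := rfl

theorem op_E {z l d : k} (h : D.IsTangle z l d) {n : ℕ} (i : Fin (n + 2 - 1)) :
    h.op (Tangle.E i) = D.cupOp n i ∘ₗ D.capOp n i := rfl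

/-- Sliding the crossing across the maximum changes its sign and places it on the minimum, where
`crossOp_comp_cupOp` turns it into a scalar. What remains is a zigzag. -/
theorem op_curlR {z l d : k} (h : D.IsTangle z l d) {n : ℕ} (s : Bool) (i : Fin n) :
    h.op (Tangle.curlR s i) = (if s then l + z * (d - 1) else l) • LinearMap.id := by
  have : h.op (Tangle.curlR s i) =
    D.capOp n (i + 1) ∘ₗ D.crossOp z s (n + 2) i ∘ₗ D.cupOp n (i + 1) := rfl
  rw [this]
  have h1 := h.slide_cap_op (!s) (n := n) i (by omega)
  rw [Bool.not_not] at h1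
  rw [← LinearMap.comp_assoc, ← h1, LinearMap.comp_assoc,
    h.crossOp_comp_cupOp (!s) (i + 1) (by omega), LinearMap.comp_smul,
    h.zigzag_right_op i (by omega)]
  cases s <;> rfl

theorem op_curlL {z l d : k} (h : D.IsTangle z l d) {n : ℕ} (s : Bool) (i : Fin n) :
    h.op (Tangle.curlL s i) = (if s then l + z * (d - 1) else l) • LinearMap.id := by
  have : h.op (Tangle.curlL s i) =
    D.capOp n i ∘ₗ D.crossOp z s (n + 2) (i + 1) ∘ₗ D.cupOp n i := rfl
  rw [this, ← LinearMap.comp_assoc, h.slide_cap_op s (n := n) i (by omega), LinearMap.comp_assoc,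
    h.crossOp_comp_cupOp (!s) i (by omega), LinearMap.comp_smul,
    h.zigzag_left_op i (by omega)]
  cases s <;> rfl

/-- The representation of the tangle monoid. -/
def opHom {z l d : k} (h : D.IsTangle z l d) (n : ℕ) : Tangle n n →* Module.End k (W k I n) where
  toFun := h.op
  map_one' := rfl
  map_mul' S T := h.op_comp S T

/-- The representation of the monoid algebra of the tangle monoid. -/
noncomputable def preRep (h : D.IsTangle (chi z) (chi lam) (chi delta)) (n : ℕ) :
    MonoidAlgebra Lam (Tangle n n) →+* Module.End k (W k I n) :=
  MonoidAlgebra.liftNCRingHom ((algebraMap k (Module.End k (W k I n))).comp chi) (h.opHom n)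
    fun c _ => Algebra.commutes (chi c) _

theorem preRep_tg (h : D.IsTangle (chi z) (chi lam) (chi delta)) {n : ℕ} (T : Tangle n n) :
    h.preRep n (tg T) = h.op T := by
  have : h.preRep n (tg T) = _ := MonoidAlgebra.liftNC_single _ _ _ _
  rw [this]
  refine (congrArg (· * _) (map_one ((algebraMap k (Module.End k (W k I n))).comp chi))).trans ?_
  exact one_mul _

theorem preRep_smul (h : D.IsTangle (chi z) (chi lam) (chi delta)) {n : ℕ} (c : Lam)
    (x : MonoidAlgebra Lam (Tangle n n)) : h.preRep n (c • x) = chi c • h.preRep n x := by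
  have : c • x = MonoidAlgebra.single 1 c * x := by
    rw [← mul_one c, ← smul_eq_mul, ← MonoidAlgebra.smul_single, smul_mul_assoc]
    simp only [smul_eq_mul, mul_one]
    congr 1
    exact (one_mul x).symm
  have e : h.preRep n (MonoidAlgebra.single 1 c) =
      algebraMap k (Module.End k (W k I n)) (chi c) * h.opHom n 1 :=
    MonoidAlgebra.liftNC_single _ _ _ _
  rw [this, map_mul, e, map_one, mul_one, Algebra.smul_def]

/-- The representation of the Kauffman tangle algebra. -/
noncomputable def rep (h : D.IsTangle (chi z) (chi lam) (chi delta)) (n : ℕ) :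
    MT n →+* Module.End k (W k I n) :=
  RingQuot.lift ⟨h.preRep n, by
    intro x y hxy
    -- In `Λ` the element `λ⁻¹` is the factor `λ + z (δ - 1)` that `op_curlR` and `op_curlL`
    -- produce.
    have hl : chi lamInv = chi lam + chi z * (chi delta - 1) := by
      rw [lamInv_eq]; simp
    cases hxy
    case skein m A B i =>
      simp only [map_sub, preRep_smul, preRep_tg, op_comp]
      obtain ⟨m, rfl⟩ : ∃ p, m = p + 2 := ⟨m - 2, by have := i.2; omega⟩
      rw [op_E, op_G, op_G, ← LinearMap.sub_comp, ← LinearMap.comp_sub, h.crossOp_sub i (by omega),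
        LinearMap.comp_smul, LinearMap.smul_comp, LinearMap.comp_sub, LinearMap.sub_comp]
      rfl
    case curlR_true A B i =>
      simp only [preRep_smul, preRep_tg, op_comp, op_curlR, hl, if_true]
      rw [LinearMap.comp_smul, LinearMap.smul_comp]
      rfl
    case curlL_true A B i =>
      simp only [preRep_smul, preRep_tg, op_comp, op_curlL, hl, if_true]
      rw [LinearMap.comp_smul, LinearMap.smul_comp]
      rfl
    case curlR_false A B i =>
      simp only [preRep_smul, preRep_tg, op_comp, op_curlR, Bool.false_eq_true, if_false]
      rw [LinearMap.comp_smul, LinearMap.smul_comp]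
      rfl
    case curlL_false A B i =>
      simp only [preRep_smul, preRep_tg, op_comp, op_curlL, Bool.false_eq_true, if_false]
      rw [LinearMap.comp_smul, LinearMap.smul_comp]
      rfl
    case circle m A B i =>
      have : h.op (Tangle.circle i) = chi delta • LinearMap.id :=
        h.capOp_comp_cupOp (i : ℕ) (by omega)
      simp only [preRep_smul, preRep_tg, op_comp, this]
      rw [LinearMap.comp_smul, LinearMap.smul_comp]
      rfl⟩

theorem rep_mk (h : D.IsTangle (chi z) (chi lam) (chi delta)) {n : ℕ}
    (x : MonoidAlgebra Lam (Tangle n n)) : h.rep n (MT.mk n x) = h.preRep n x := by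
  have := RingQuot.mkAlgHom_coe Lam (MTRel n)
  have h2 : MT.mk n x = RingQuot.mkRingHom (MTRel n) x := DFunLike.congr_fun this x
  rw [h2]
  exact RingQuot.lift_mkRingHom_apply _ _ _

theorem rep_of (h : D.IsTangle (chi z) (chi lam) (chi delta)) {n : ℕ} (T : Tangle n n) :
    h.rep n (MT.of T) = h.op T := by
  rw [MT.of, rep_mk, preRep_tg]

theorem rep_smul (h : D.IsTangle (chi z) (chi lam) (chi delta)) {n : ℕ} (c : Lam) (x : MT n) :
    h.rep n (c • x) = chi c • h.rep n x := by
  obtain ⟨x, rfl⟩ := MT.mk_surjective n x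
  rw [← map_smul, rep_mk, rep_mk, preRep_smul]

end IsTangle
end RData
end BMW

/-! ### The ring `Λ`: regularity of `z` and elimination of `δ`. -/

namespace BMW

open LaurentPolynomial (T C)

theorem PreLam.induction {P : PreLam → Prop} (hc : ∀ c : ℤ, P (C (MvPolynomial.C c)))
    (hX : ∀ i, P (C (MvPolynomial.X i))) (hT : ∀ n, P (T n))
    (hadd : ∀ a b, P a → P b → P (a + b)) (hmul : ∀ a b, P a → P b → P (a * b)) (a : PreLam) :
    P a := by
  induction a using LaurentPolynomial.induction_on' with
  | add p q hp hq => exact hadd _ _ hp hq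
  | C_mul_T n a =>
    refine hmul _ _ ?_ (hT n)
    induction a using MvPolynomial.induction_on with
    | C c => exact hc c
    | add p q hp hq => rw [map_add]; exact hadd _ _ hp hq
    | mul_X p i hp => rw [map_mul]; exact hmul _ _ hp (hX i)

theorem Lam.mk_surjective : Function.Surjective Lam.mk := Ideal.Quotient.mk_surjective

/-- The homomorphism from `Λ` with given values of `λ`, `z`, `δ`. -/
noncomputable def Lam.lift {k : Type} [CommRing k] (l : kˣ) (x d : k)
    (h : (↑l⁻¹ : k) - l = x * (d - 1)) : Lam →+* k :=
  Ideal.Quotient.lift _ (LaurentPolynomial.eval₂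
    (MvPolynomial.eval₂Hom (Int.castRingHom k) ![x, d]) l) (by
      intro a ha
      rw [← RingHom.mem_ker]
      refine (Ideal.span_le.mpr ?_) ha
      rintro _ rfl
      simp [RingHom.mem_ker, LaurentPolynomial.eval₂_T, h])

section lift

variable {k : Type} [CommRing k] {l : kˣ} {x d : k} (h : (↑l⁻¹ : k) - l = x * (d - 1))

theorem Lam.lift_mk (a : PreLam) : Lam.lift l x d h (Lam.mk a) = LaurentPolynomial.eval₂
    (MvPolynomial.eval₂Hom (Int.castRingHom k) ![x, d]) l a := rfl

theorem Lam.lift_z : Lam.lift l x d h z = x := by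
  simp [z, Lam.lift_mk]

theorem Lam.lift_delta : Lam.lift l x d h delta = d := by
  simp [delta, Lam.lift_mk]

theorem Lam.lift_lam : Lam.lift l x d h lam = l := by
  simp [lam, Lam.lift_mk, LaurentPolynomial.eval₂_T]

end lift

/-- Setting `z` to `0`. -/
noncomputable def PreLam.killZ : PreLam →+* PreLam :=
  LaurentPolynomial.eval₂ (MvPolynomial.eval₂Hom (Int.castRingHom PreLam)
    ![0, C (MvPolynomial.X 1)]) ((LaurentPolynomial.isUnit_T 1).unit)

theorem PreLam.killZ_T (n : ℤ) : PreLam.killZ (T n) = T n := by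
  have hu : ∀ n : ℕ, ((((LaurentPolynomial.isUnit_T (R := MvPolynomial (Fin 2) ℤ) 1).unit) ^ n :
      PreLamˣ) : PreLam) = T n := by
    intro n
    rw [Units.val_pow_eq_pow_val, IsUnit.unit_spec, LaurentPolynomial.T_pow, mul_one]
  obtain ⟨n, rfl | rfl⟩ := n.eq_nat_or_neg
  · rw [PreLam.killZ, LaurentPolynomial.eval₂_T, zpow_natCast, hu]
  · rw [PreLam.killZ, LaurentPolynomial.eval₂_T, zpow_neg, zpow_natCast]
    rw [Units.inv_eq_of_mul_eq_one_right]
    rw [hu, ← LaurentPolynomial.T_add]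
    simp

theorem PreLam.exists_eq_killZ_add (a : PreLam) :
    ∃ b, a = PreLam.killZ a + C (MvPolynomial.X 0) * b := by
  induction a using PreLam.induction with
  | hc c => exact ⟨0, by simp [PreLam.killZ]⟩
  | hX i =>
    fin_cases i
    · exact ⟨1, by simp [PreLam.killZ]⟩
    · exact ⟨0, by simp [PreLam.killZ]⟩
  | hT n => exact ⟨0, by simp [PreLam.killZ_T]⟩
  | hadd a b ha hb =>
    obtain ⟨a', ha⟩ := ha
    obtain ⟨b', hb⟩ := hb
    refine ⟨a' + b', ?_⟩
    rw [map_add]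
    linear_combination ha + hb
  | hmul a b ha hb =>
    obtain ⟨a', ha⟩ := ha
    obtain ⟨b', hb⟩ := hb
    refine ⟨a' * b + PreLam.killZ a * b', ?_⟩
    rw [map_mul]
    linear_combination b * ha + PreLam.killZ a * hb

/-- Let `ρ` be the generator of the ideal and let `z x = g ρ` in the Laurent polynomials. Setting `z
= 0` gives `g(0) (λ⁻¹ - λ) = 0`, so `g(0) = 0` because the ring is a domain. Hence `g = z b`, and
cancelling `z` shows `x = b ρ`. -/
theorem eq_zero_of_z_mul_eq_zero {a : Lam} (h : z * a = 0) : a = 0 := by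
  obtain ⟨x, rfl⟩ := Lam.mk_surjective a
  rw [z, ← map_mul] at h
  obtain ⟨g, hg⟩ := Ideal.mem_span_singleton'.mp (Ideal.Quotient.eq_zero_iff_mem.mp h)
  have h1 := congrArg PreLam.killZ hg
  have hX : PreLam.killZ (C (MvPolynomial.X 0)) = 0 := by simp [PreLam.killZ]
  have hT : (T (-1) - T 1 : PreLam) ≠ 0 := by
    intro h0
    have := congrArg (fun p => p.coeff 1) h0
    simp at this
  rw [map_mul, map_mul, map_sub, map_mul, hX, zero_mul, zero_mul, sub_zero, map_sub,
    PreLam.killZ_T, PreLam.killZ_T] at h1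
  have h2 : PreLam.killZ g = 0 := (mul_eq_zero.mp h1).resolve_right hT
  obtain ⟨b, hb⟩ := PreLam.exists_eq_killZ_add g
  rw [h2, zero_add] at hb
  have h3 : (C (MvPolynomial.X 0) : PreLam) ≠ 0 := by
    intro h0
    have := congrArg (fun p => p.coeff 0) h0
    simp at this
  refine Ideal.Quotient.eq_zero_iff_mem.mpr (Ideal.mem_span_singleton'.mpr ⟨b, ?_⟩)
  apply mul_left_cancel₀ h3
  rw [← hg, hb]
  ring

theorem eq_zero_of_z_pow_mul_eq_zero {a : Lam} (m : ℕ) (h : z ^ m * a = 0) : a = 0 := by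
  induction m with
  | zero => simpa using h
  | succ m ih =>
    refine ih (eq_zero_of_z_mul_eq_zero ?_)
    rw [← h]; ring

/-- The homomorphism from Laurent polynomials in `λ` over `ℤ[z]`. -/
noncomputable def Lam.ofLaurent : LaurentPolynomial (Polynomial ℤ) →+* Lam :=
  LaurentPolynomial.eval₂ (Polynomial.eval₂RingHom (Int.castRingHom Lam) z)
    ⟨lam, lamInv, lam_mul_lamInv, (mul_comm _ _).trans lam_mul_lamInv⟩

theorem Lam.ofLaurent_T (n : ℤ) : Lam.ofLaurent (T n) = Lam.mk (T n) := by
  have hu : ∀ n : ℕ, (((⟨lam, lamInv, lam_mul_lamInv, (mul_comm _ _).trans lam_mul_lamInv⟩ :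
      Lamˣ) ^ n : Lamˣ) : Lam) = Lam.mk (T n) := by
    intro n
    rw [Units.val_pow_eq_pow_val]
    simp only [lam, ← map_pow, LaurentPolynomial.T_pow, mul_one]
  obtain ⟨n, rfl | rfl⟩ := n.eq_nat_or_neg
  · rw [Lam.ofLaurent, LaurentPolynomial.eval₂_T, zpow_natCast, hu]
  · rw [Lam.ofLaurent, LaurentPolynomial.eval₂_T, zpow_neg, zpow_natCast]
    rw [Units.inv_eq_of_mul_eq_one_right]
    rw [hu, ← map_mul, ← LaurentPolynomial.T_add]
    simp

/-- Since `z δ = λ⁻¹ - λ + z`, a power of `z` eliminates `δ`. As `z` is not a zero divisor,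
questions of vanishing in `Λ` are thereby reduced to Laurent polynomials in `λ` over `ℤ[z]`. -/
theorem Lam.exists_z_pow_mul_eq (a : Lam) : ∃ m p, z ^ m * a = Lam.ofLaurent p := by
  obtain ⟨a, rfl⟩ := Lam.mk_surjective a
  have hz : Lam.ofLaurent (C Polynomial.X) = z := by
    rw [Lam.ofLaurent, LaurentPolynomial.eval₂_C, Polynomial.coe_eval₂RingHom,
      Polynomial.eval₂_X]
  induction a using PreLam.induction with
  | hc c => exact ⟨0, C (Polynomial.C c), by simp [Lam.ofLaurent]⟩
  | hX i =>
    fin_cases i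
    · exact ⟨0, C Polynomial.X, by rw [hz, pow_zero, one_mul]; rfl⟩
    · refine ⟨1, T (-1) - T 1 + C Polynomial.X, ?_⟩
      rw [map_add, map_sub, hz, Lam.ofLaurent_T, Lam.ofLaurent_T]
      have h := lamInv_sub_lam
      rw [lamInv, lam] at h
      change z ^ 1 * delta = _
      rw [h]; ring
  | hT n => exact ⟨0, T n, by rw [Lam.ofLaurent_T, pow_zero, one_mul]⟩
  | hadd a b ha hb =>
    obtain ⟨m, p, ha⟩ := ha
    obtain ⟨m', p', hb⟩ := hb
    refine ⟨m + m', C Polynomial.X ^ m' * p + C Polynomial.X ^ m * p', ?_⟩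
    rw [map_add, map_add, map_mul, map_mul, map_pow, map_pow, hz, ← ha, ← hb]
    ring
  | hmul a b ha hb =>
    obtain ⟨m, p, ha⟩ := ha
    obtain ⟨m', p', hb⟩ := hb
    refine ⟨m + m', p * p', ?_⟩
    rw [map_mul, map_mul, ← ha, ← hb]
    ring

/-! ### Specialization to power series -/

/-- `q = 1 + X`. -/
noncomputable def qu : (PowerSeries ℚ)ˣ where
  val := 1 + PowerSeries.X
  inv := (1 + PowerSeries.X)⁻¹
  val_inv := PowerSeries.mul_inv_cancel _ (by simp)
  inv_val := PowerSeries.inv_mul_cancel _ (by simp)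

/-- `q - q⁻¹`. -/
noncomputable def qz : PowerSeries ℚ := qu - ↑qu⁻¹

theorem constantCoeff_qu : PowerSeries.constantCoeff (qu : PowerSeries ℚ) = 1 := by
  simp [qu]

theorem constantCoeff_qu_inv : PowerSeries.constantCoeff (↑qu⁻¹ : PowerSeries ℚ) = 1 := by
  have := congrArg PowerSeries.constantCoeff qu.mul_inv
  rwa [map_mul, constantCoeff_qu, one_mul, map_one] at this

theorem constantCoeff_qz : PowerSeries.constantCoeff qz = 0 := by
  rw [qz, map_sub, constantCoeff_qu, constantCoeff_qu_inv, sub_self]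

theorem qu_pow_ne_one {n : ℕ} (hn : n ≠ 0) : (qu : PowerSeries ℚ) ^ n ≠ 1 := by
  intro h
  have h1 : (((1 + Polynomial.X) ^ n : Polynomial ℚ) : PowerSeries ℚ) = 1 := by
    simpa [qu] using h
  have h2 := congrArg (PowerSeries.coeff 1) h1
  rw [Polynomial.coeff_coe, Polynomial.coeff_one_add_X_pow] at h2
  simp [PowerSeries.coeff_one, hn] at h2

theorem qu_zpow_injective : Function.Injective fun n : ℤ => qu ^ n := by
  have : ¬ IsOfFinOrder qu := by
    rw [isOfFinOrder_iff_pow_eq_one]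
    rintro ⟨n, hn, h⟩
    refine qu_pow_ne_one hn.ne' ?_
    rw [← Units.val_pow_eq_pow_val, h, Units.val_one]
  exact injective_zpow_iff_not_isOfFinOrder.mpr this

theorem qz_ne_zero : qz ≠ 0 := by
  intro h
  refine qu_pow_ne_one two_ne_zero ?_
  rw [qz, sub_eq_zero] at h
  rw [pow_two]
  nth_rewrite 2 [h]
  exact qu.mul_inv

/-- The series `qz` is non-zero with zero constant term. If `p` vanishes at `qz`, the constant
coefficients give `p.coeff 0 = 0`. Then `p = X * p.divX`, and `p.divX` vanishes at `qz` too, which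
allows an induction on the degree. -/
theorem eval₂_qz_injective :
    Function.Injective (Polynomial.eval₂RingHom (Int.castRingHom (PowerSeries ℚ)) qz) := by
  rw [injective_iff_map_eq_zero]
  intro p
  induction hn : p.natDegree using Nat.strong_induction_on generalizing p with
  | _ n ih =>
    intro hp
    have h0 : p.coeff 0 = 0 := by
      have := congrArg PowerSeries.constantCoeff hp
      rw [Polynomial.coe_eval₂RingHom, Polynomial.hom_eval₂, constantCoeff_qz,
        Polynomial.eval₂_at_zero] at this
      simpa using this
    have h1 : p = Polynomial.X * p.divX := by
      have := p.X_mul_divX_add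
      rw [h0] at this
      simpa using this.symm
    rcases Nat.eq_zero_or_pos n with rfl | hpos
    · rw [Polynomial.eq_C_of_natDegree_eq_zero hn, h0, map_zero]
    · rw [h1, map_mul] at hp
      have h2 : Polynomial.eval₂RingHom (Int.castRingHom (PowerSeries ℚ)) qz Polynomial.X ≠ 0 := by
        simpa using qz_ne_zero
      have h3 := (mul_eq_zero.mp hp).resolve_left h2
      have := ih _ (by rw [Polynomial.natDegree_divX_eq_natDegree_tsub_one]; omega) _ rfl h3
      rw [h1, this, mul_zero]

/-- After multiplication by powers of `z` and `λ` the element becomes a polynomial in `λ` over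
`ℤ[z]`. Its image over `ℚ⟦X⟧` has the infinitely many roots `q ^ m`, `m ∈ S`, hence is zero, and
`ℤ[z]` embeds into `ℚ⟦X⟧` by `z ↦ qz`. -/
theorem Lam.eq_zero_of_specializations {a : Lam} (S : Set ℤ) (hS : S.Infinite)
    (chi : ℤ → Lam →+* PowerSeries ℚ) (hz : ∀ m ∈ S, chi m z = qz)
    (hl : ∀ m ∈ S, chi m lam = ↑(qu ^ m)) (h : ∀ m ∈ S, chi m a = 0) : a = 0 := by
  obtain ⟨m, p, hp⟩ := Lam.exists_z_pow_mul_eq a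
  refine eq_zero_of_z_pow_mul_eq_zero m ?_
  rw [hp]
  obtain ⟨n, f, hf⟩ := p.exists_T_pow
  have hev : ∀ j ∈ S, Polynomial.eval (↑(qu ^ j) : PowerSeries ℚ)
      (f.map (Polynomial.eval₂RingHom (Int.castRingHom (PowerSeries ℚ)) qz)) = 0 := by
    intro j hj
    have h1 : chi j (Lam.ofLaurent (Polynomial.toLaurent f)) = 0 := by
      rw [hf, map_mul, ← hp, map_mul, map_mul, h j hj, mul_zero, zero_mul]
    rw [Lam.ofLaurent, LaurentPolynomial.eval₂_toLaurent, Polynomial.hom_eval₂] at h1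
    rw [Polynomial.eval_map, ← h1]
    congr 1
    · ext x
      · simp
      · simp [hz j hj]
    · exact (hl j hj).symm
  have hf0 : f.map (Polynomial.eval₂RingHom (Int.castRingHom (PowerSeries ℚ)) qz) = 0 := by
    refine Polynomial.eq_zero_of_infinite_isRoot _ ?_
    refine (hS.image (f := fun j : ℤ => (↑(qu ^ j) : PowerSeries ℚ)) ?_).mono ?_
    · intro x _ y _ hxy
      exact qu_zpow_injective (Units.ext hxy)
    · rintro _ ⟨j, hj, rfl⟩
      exact hev j hj
  have hf1 : f = 0 := Polynomial.map_injective _ eval₂_qz_injective (by rw [hf0, Polynomial.map_zero])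
  rw [hf1, map_zero] at hf
  have : p = 0 := by
    have := (LaurentPolynomial.isUnit_T (R := Polynomial ℤ) (n : ℤ)).mul_left_eq_zero.mp hf.symm
    exact this
  rw [this, map_zero]

end BMW

namespace BMW

/-! ### Specializations of the parameters and the corresponding representations -/

/-- The index set of the representation of dimension `2 * N`. -/
def Idx : ℕ → Type
  | 0 => Empty
  | N + 1 => Bool ⊕ Idx N

instance Idx.instDecidableEq : ∀ N, DecidableEq (Idx N)
  | 0 => inferInstanceAs (DecidableEq Empty)
  | N + 1 =>
    have := Idx.instDecidableEq N
    inferInstanceAs (DecidableEq (Bool ⊕ Idx N))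

instance Idx.instFintype : ∀ N, Fintype (Idx N)
  | 0 => inferInstanceAs (Fintype Empty)
  | N + 1 =>
    have := Idx.instFintype N
    inferInstanceAs (Fintype (Bool ⊕ Idx N))

/-- The involution of the index set. -/
def Idx.bar : ∀ {N : ℕ}, Idx N → Idx N
  | _ + 1, .inl b => Sum.inl (!b)
  | _ + 1, .inr i => Sum.inr i.bar

theorem Idx.bar_bar : ∀ {N : ℕ} (i : Idx N), i.bar.bar = i
  | _ + 1, .inl b => congrArg Sum.inl (Bool.not_not b)
  | _ + 1, .inr i => congrArg Sum.inr (bar_bar i)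

/-- Indices from distinct orbits of the involution. -/
def Idx.label : ∀ N : ℕ, ℕ → Idx (N + 1)
  | 0, _ => Sum.inl true
  | _ + 1, 0 => Sum.inl true
  | N + 1, m + 1 => Sum.inr (Idx.label N m)

theorem Idx.label_inj : ∀ {N m m' : ℕ}, m ≤ N → m' ≤ N → label N m = label N m' → m = m'
  | 0, m, m', h, h', _ => by omega
  | _ + 1, 0, 0, _, _, _ => rfl
  | _ + 1, 0, _ + 1, _, _, e => nomatch e
  | _ + 1, _ + 1, 0, _, _, e => nomatch e
  | N + 1, m + 1, m' + 1, h, h', e => congrArg (· + 1)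
    (label_inj (N := N) (by omega) (by omega) (Sum.inr_injective e))

theorem Idx.label_ne_bar : ∀ {N : ℕ} (m m' : ℕ), label N m ≠ (label N m').bar
  | 0, _, _, e => nomatch Sum.inl_injective e
  | _ + 1, 0, 0, e => nomatch Sum.inl_injective e
  | _ + 1, 0, _ + 1, e => nomatch e
  | _ + 1, _ + 1, 0, e => nomatch e
  | _ + 1, m + 1, m' + 1, e => label_ne_bar m m' (Sum.inr_injective e)

namespace RData

/-- Base change. -/
def map {k k' I : Type} [CommRing k] [CommRing k'] (ψ : k →+* k') (D : RData k I) :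
    RData k' I where
  r i j a b := ψ (D.r i j a b)
  eta i j := ψ (D.eta i j)
  kap i j := ψ (D.kap i j)

theorem map_ext {k k' I : Type} [CommRing k] [CommRing k'] [DecidableEq I] (ψ : k →+* k')
    (D : RData k I) (q qi z mu mui : k) :
    (D.ext q qi z mu mui).map ψ = (D.map ψ).ext (ψ q) (ψ qi) (ψ z) (ψ mu) (ψ mui) := by
  unfold map ext
  congr 1
  · funext i j a b
    rcases i with (_ | _) | i <;> rcases j with (_ | _) | j <;>
      rcases a with (_ | _) | a <;> rcases b with (_ | _) | b <;>
      simp [apply_ite ψ]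
  · funext i j
    rcases i with (_ | _) | i <;> rcases j with (_ | _) | j <;> simp
  · funext i j
    rcases i with (_ | _) | i <;> rcases j with (_ | _) | j <;> simp

/-- The representation with `λ = q ^ (1 - 2 * N)`. -/
def fam {k : Type} [CommRing k] (q : kˣ) : ∀ N : ℕ, RData k (Idx N)
  | 0 => ⟨fun i => (nomatch i), fun i => (nomatch i), fun i => (nomatch i)⟩
  | N + 1 => (fam q N).ext q ↑q⁻¹ (q - ↑q⁻¹) ↑(q ^ (-2 * N : ℤ)) ↑(q ^ (2 * N : ℤ))

/-- The value of `δ` in this representation. -/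
def famDelta {k : Type} [CommRing k] (q : kˣ) : ℕ → k
  | 0 => 0
  | N + 1 => famDelta q N + ↑(q ^ (-2 * N : ℤ)) + ↑(q ^ (2 * N : ℤ))

/-- This is `λ⁻¹ - λ = z (δ - 1)` for `λ = q ^ (1 - 2 * N)`. The summands of `famDelta` telescope
after multiplication by `q - q⁻¹`. -/
theorem famDelta_spec {k : Type} [CommRing k] (q : kˣ) (N : ℕ) :
    (q - ↑q⁻¹ : k) * famDelta q N = ↑(q ^ (2 * N - 1 : ℤ)) - ↑(q ^ (1 - 2 * N : ℤ)) +
      (q - ↑q⁻¹) := by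
  induction N with
  | zero => simp [famDelta]
  | succ N ih =>
    rw [famDelta, mul_add, mul_add, ih]
    have h1 : (↑(q ^ (2 * (N + 1 : ℕ) - 1 : ℤ)) : k) = q * ↑(q ^ (2 * N : ℤ)) := by
      rw [← Units.val_mul, ← zpow_one_add]; congr 2; push_cast; ring
    have h2 : (↑(q ^ (2 * N - 1 : ℤ)) : k) = ↑q⁻¹ * ↑(q ^ (2 * N : ℤ)) := by
      rw [← Units.val_mul, zpow_sub_one, mul_comm]
    have h3 : (↑(q ^ (1 - 2 * (N + 1 : ℕ) : ℤ)) : k) = ↑q⁻¹ * ↑(q ^ (-2 * N : ℤ)) := by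
      rw [← Units.val_mul, ← zpow_neg_one, ← zpow_add]; congr 2; push_cast; ring
    have h4 : (↑(q ^ (1 - 2 * N : ℤ)) : k) = q * ↑(q ^ (-2 * N : ℤ)) := by
      rw [← Units.val_mul, ← zpow_one_add]; congr 1
    rw [h1, h2, h3, h4]
    ring

/-- With `mu = q ^ (-2 * N)` the parameter `mu * q` is the `λ` of step `N`, and `mu * q⁻¹` is the
`λ` of step `N + 1`. The condition `hd` of `IsTangle.ext` is `famDelta_spec`. In rank `0` only
`loop` and `cap_R` have any content. -/
theorem fam_isTangle {k : Type} [CommRing k] (q : kˣ) (N : ℕ) :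
    (fam q N).IsTangle (q - ↑q⁻¹) ↑(q ^ (1 - 2 * N : ℤ)) (famDelta q N) := by
  induction N with
  | zero =>
    constructor
    case loop => intros; simp [cap_def, famDelta]; rfl
    case cap_R => intros; exact (smul_zero _).symm
    case slide => intro X _ _ f i; exact (nomatch i)
    case slide_eta => intro X _ _ f i; exact (nomatch i)
    case ybe => intro X _ _ f i; exact (nomatch i)
    case quad => intro X _ _ f i; exact (nomatch i)
    case R_cup => intro X _ _ f i; exact (nomatch i)
    case zig => intro X _ _ f i; exact (nomatch i)
    case zag => intro X _ _ f i; exact (nomatch i)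
  | succ N ih =>
    have h1 : (↑(q ^ (1 - 2 * N : ℤ)) : k) = ↑(q ^ (-2 * N : ℤ)) * q := by
      rw [← Units.val_mul, ← zpow_add_one]; congr 2; ring
    have h2 : (↑(q ^ (1 - 2 * (N + 1 : ℕ) : ℤ)) : k) = ↑(q ^ (-2 * N : ℤ)) * ↑q⁻¹ := by
      rw [← Units.val_mul, ← zpow_sub_one]; congr 2; push_cast; ring
    have h3 : (↑(q ^ (2 * N - 1 : ℤ)) : k) = ↑(q ^ (2 * N : ℤ)) * ↑q⁻¹ := by
      rw [← Units.val_mul, zpow_sub_one]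
    rw [h2]
    rw [h1] at ih
    refine IsTangle.ext (D := fam q N) q.mul_inv rfl ?_ ?_ ih
    · rw [← Units.val_mul, ← zpow_add]; simp
    · rw [famDelta_spec, h1, h3]

/-- All entries are built from `q` and its powers. The case of interest is the constant coefficient
`ℚ⟦X⟧ → ℚ`, which sends `q = 1 + X` to `1`. -/
theorem fam_map {k k' : Type} [CommRing k] [CommRing k'] (ψ : k →+* k') (q : kˣ) (N : ℕ) :
    (fam q N).map ψ = fam (Units.map ψ.toMonoidHom q) N := by
  induction N with
  | zero =>
    simp only [fam, map]
    congr 1 <;> funext i <;> exact nomatch i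
  | succ N ih =>
    have e : ∀ m : ℤ, ψ ↑(q ^ m) = ↑((Units.map ψ.toMonoidHom q) ^ m) := fun m => by
      rw [← map_zpow (Units.map ψ.toMonoidHom)]; rfl
    refine (map_ext ψ (fam q N) _ _ _ _ _).trans ?_
    rw [ih, e, e, map_sub]
    have h : ψ ↑q⁻¹ = ↑(Units.map ψ.toMonoidHom q)⁻¹ := by
      rw [← map_inv (Units.map ψ.toMonoidHom)]; rfl
    rw [h]
    rfl

/-- The operators are those of the Brauer algebra. -/
structure IsClassical {k I : Type} [CommRing k] [Fintype I] [DecidableEq I] (D : RData k I)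
    (bar : I → I) : Prop where
  R_eq : ∀ {X : Type} [AddCommGroup X] [Module k X] (f : I → I → X) (i j : I),
    D.R f i j = f j i
  cap_eq : ∀ {X : Type} [AddCommGroup X] [Module k X] (f : I → I → X),
    D.cap f = ∑ a, f a (bar a)
  eta_eq : ∀ i j : I, D.eta i j = if j = bar i then 1 else 0

theorem IsClassical.ext {k I : Type} [CommRing k] [Fintype I] [DecidableEq I] {D : RData k I}
    {bar : I → I} (h : D.IsClassical bar) :
    (D.ext 1 1 0 1 1).IsClassical (Sum.map not bar) where
  R_eq f i j := by
    rcases i with (_ | _) | i <;> rcases j with (_ | _) | j <;>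
    simp only [ext_pp, ext_mm, ext_pi, ext_ip, ext_im, ext_mi, ext_pm, ext_mp, ext_ij,
      h.R_eq, one_smul, zero_smul, zero_mul, add_zero, sub_zero]
  cap_eq f := by simp [ext_cap, h.cap_eq]
  eta_eq i j := by
    rcases i with (_ | _) | i <;> rcases j with (_ | _) | j <;>
    simp [ext_eta_inl, ext_eta_inl_inr, ext_eta_inr_inl, ext_eta_inr, h.eta_eq]

/-- For `q = 1` all corrections with the factor `z` disappear, the crossing becomes the flip of the
two factors, and maxima and minima become the pairing of each index with its partner under `bar`. -/
theorem fam_one {k : Type} [CommRing k] (N : ℕ) : (fam (1 : kˣ) N).IsClassical Idx.bar := by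
  induction N with
  | zero => exact ⟨fun _ i => (nomatch i), fun f => rfl, fun i => (nomatch i)⟩
  | succ N ih =>
    have h1 : fam (1 : kˣ) (N + 1) = (fam 1 N).ext 1 1 0 1 1 := by
      simp only [fam, one_zpow, inv_one, Units.val_one, sub_self]
      rfl
    have h2 : (Idx.bar : Idx (N + 1) → Idx (N + 1)) = Sum.map not Idx.bar := by
      funext i
      rcases i with _ | _ <;> rfl
    rw [h1, h2]
    exact ih.ext

end RData
end BMW

namespace BMW

/-! ### Matrix entries of words in the generators -/

section W

variable {k k' I : Type} [CommRing k] [CommRing k']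

/-- The value of a tensor at a list of indices. -/
def W.eval : ∀ n, W k I n → List I → k
  | 0, f, _ => f
  | n + 1, f, a :: l => W.eval n (f a) l
  | _ + 1, _, [] => 0

theorem W.eval_ext : ∀ {n : ℕ} {f g : W k I n},
    (∀ l : List I, l.length = n → W.eval n f l = W.eval n g l) → f = g
  | 0, _, _, h => h [] rfl
  | n + 1, f, g, h => by
    funext a
    exact W.eval_ext fun l hl => h (a :: l) (congrArg (· + 1) hl)

theorem W.eval_add : ∀ {n : ℕ} (f g : W k I n) (l : List I),
    W.eval n (f + g) l = W.eval n f l + W.eval n g l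
  | 0, _, _, _ => rfl
  | n + 1, f, g, a :: l => W.eval_add (f a) (g a) l
  | n + 1, f, g, [] => (add_zero (0 : k)).symm

theorem W.eval_smul : ∀ {n : ℕ} (c : k) (f : W k I n) (l : List I),
    W.eval n (c • f) l = c * W.eval n f l
  | 0, _, _, _ => rfl
  | n + 1, c, f, a :: l => W.eval_smul c (f a) l
  | n + 1, c, f, [] => (mul_zero c).symm

/-- Evaluation as a linear map. -/
def W.evalHom (n : ℕ) (l : List I) : W k I n →ₗ[k] k where
  toFun f := W.eval n f l
  map_add' f g := W.eval_add f g l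
  map_smul' c f := W.eval_smul c f l

theorem W.eval_sum {α : Type} (s : Finset α) {n : ℕ} (f : α → W k I n) (l : List I) :
    W.eval n (∑ a ∈ s, f a) l = ∑ a ∈ s, W.eval n (f a) l :=
  map_sum (W.evalHom n l) f s

theorem W.eval_zero {n : ℕ} (l : List I) : W.eval n (0 : W k I n) l = 0 :=
  map_zero (W.evalHom n l)

/-- The basis vectors. -/
def W.single [DecidableEq I] : ∀ n, List I → W k I n
  | 0, _ => (1 : k)
  | n + 1, b :: l => fun a => if a = b then W.single n l else 0
  | _ + 1, [] => 0

theorem W.eval_single [DecidableEq I] : ∀ {n : ℕ} (b l : List I), b.length = n → l.length = n →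
    W.eval n (W.single n b : W k I n) l = if l = b then 1 else 0
  | 0, [], [], _, _ => by simp; rfl
  | n + 1, b :: bs, l :: ls, hb, hl => by
    have : W.eval n (W.single n bs : W k I n) ls = _ := W.eval_single bs ls (Nat.succ.inj hb) (Nat.succ.inj hl)
    change W.eval n (if l = b then (W.single n bs : W k I n) else 0) ls = _
    by_cases h : l = b
    · simp [h, this]
    · simp [h, W.eval_zero]

/-- Base change. -/
def W.map (ψ : k →+* k') : ∀ n, W k I n →+ W k' I n
  | 0 => ψ.toAddMonoidHom
  | n + 1 =>
    { toFun := fun f a => W.map ψ n (f a)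
      map_zero' := funext fun _ => map_zero (W.map ψ n)
      map_add' := fun f g => funext fun a => map_add (W.map ψ n) (f a) (g a) }

theorem W.map_smul (ψ : k →+* k') : ∀ {n : ℕ} (c : k) (f : W k I n),
    W.map ψ n (c • f) = ψ c • W.map ψ n f
  | 0, c, f => map_mul ψ c f
  | _ + 1, c, f => funext fun a => W.map_smul ψ c (f a)

theorem W.eval_map (ψ : k →+* k') : ∀ {n : ℕ} (f : W k I n) (l : List I),
    W.eval n (W.map ψ n f) l = ψ (W.eval n f l)
  | 0, _, _ => rfl
  | _ + 1, f, a :: l => W.eval_map ψ (f a) l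
  | _ + 1, _, [] => (map_zero ψ).symm

theorem W.map_single [DecidableEq I] (ψ : k →+* k') : ∀ (n : ℕ) (b : List I),
    W.map ψ n (W.single n b) = W.single n b
  | 0, _ => map_one ψ
  | n + 1, b :: l => funext fun a => by
      change W.map ψ n (if a = b then W.single n l else 0) = if a = b then W.single n l else 0
      rw [apply_ite (W.map ψ n), W.map_single, map_zero]
  | n + 1, [] => map_zero (W.map ψ (n + 1))

end W

namespace RData

variable {k k' I : Type} [CommRing k] [CommRing k'] [Fintype I] (D : RData k I)

/-- The operator of a pair of a minimum above a maximum. -/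
def eOp : ∀ n, ℕ → (W k I n →ₗ[k] W k I n)
  | n + 2, i => D.cupOp n i ∘ₗ D.capOp n i
  | _, _ => 0

/-- The operator of a generator: `(true, i)` stands for `g_i`, and `(false, i)` for `e_i`. -/
def genOp (n : ℕ) : Bool × ℕ → (W k I n →ₗ[k] W k I n)
  | (true, i) => D.crossOp 0 true n i
  | (false, i) => D.eOp n i

/-- The operator of a word. -/
def wordOp (n : ℕ) : List (Bool × ℕ) → (W k I n →ₗ[k] W k I n)
  | [] => LinearMap.id
  | x :: w => D.genOp n x ∘ₗ wordOp n w

theorem wordOp_append (n : ℕ) (v w : List (Bool × ℕ)) :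
    D.wordOp n (v ++ w) = D.wordOp n v ∘ₗ D.wordOp n w := by
  induction v with
  | nil => rfl
  | cons x v ih => simp only [List.cons_append, wordOp, ih, LinearMap.comp_assoc]

theorem genOp_shift : ∀ (n : ℕ) (x : Bool × ℕ),
    D.genOp (n + 1) (x.1, x.2 + 1) = W.shift (D.genOp n x)
  | _, (true, _) => rfl
  | _ + 2, (false, _) => rfl
  | 1, (false, _) => rfl
  | 0, (false, _) => rfl

theorem wordOp_shift (n : ℕ) (w : List (Bool × ℕ)) :
    D.wordOp (n + 1) (w.map fun x => (x.1, x.2 + 1)) = W.shift (D.wordOp n w) := by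
  induction w with
  | nil => rfl
  | cons x v ih => simp only [List.map_cons, wordOp, ih, genOp_shift, W.shift_comp]

/-- Only the negative crossing depends on `z`. This is why `genOp`, which uses positive crossings
alone, can be written with the parameter `0`. -/
theorem crossOp_z (z z' : k) : ∀ (i n : ℕ), D.crossOp z true n i = D.crossOp z' true n i
  | 0, _ + 2 => rfl
  | 0, 0 => rfl
  | 0, 1 => rfl
  | i + 1, n + 1 => congrArg W.shift (crossOp_z z z' i n)
  | _ + 1, 0 => rfl

section map

variable (ψ : k →+* k')

theorem map_crossOp : ∀ (i n : ℕ) (f : W k I n),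
    W.map ψ n (D.crossOp 0 true n i f) = (D.map ψ).crossOp 0 true n i (W.map ψ n f)
  | 0, n + 2, f => by
    have key : ∀ (f : I → I → W k I n) (i j : I), W.map ψ n (D.R f i j) =
        (D.map ψ).R (fun i j => W.map ψ n (f i j)) i j := fun f i j => by
      simp only [R_def, map_sum, W.map_smul, RData.map]
    funext i j
    exact key f i j
  | 0, 0, f => map_zero (W.map ψ 0)
  | 0, 1, f => map_zero (W.map ψ 1)
  | i + 1, n + 1, f => funext fun a => map_crossOp i n (f a)
  | _ + 1, 0, f => map_zero (W.map ψ 0)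

theorem map_capOp : ∀ (i n : ℕ) (f : W k I (n + 2)),
    W.map ψ n (D.capOp n i f) = (D.map ψ).capOp n i (W.map ψ (n + 2) f)
  | 0, n, f => by
    have key : ∀ (f : I → I → W k I n), W.map ψ n (D.cap f) =
        (D.map ψ).cap (fun i j => W.map ψ n (f i j)) := fun f => by
      simp only [cap_def, map_sum, W.map_smul, RData.map]
    exact key f
  | i + 1, n + 1, f => funext fun a => map_capOp i n (f a)
  | _ + 1, 0, f => map_zero (W.map ψ 0)

theorem map_cupOp : ∀ (i n : ℕ) (f : W k I n),
    W.map ψ (n + 2) (D.cupOp n i f) = (D.map ψ).cupOp n i (W.map ψ n f)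
  | 0, n, f => funext fun a => funext fun b => W.map_smul ψ (D.eta a b) f
  | i + 1, n + 1, f => funext fun a => map_cupOp i n (f a)
  | _ + 1, 0, f => map_zero (W.map ψ 2)

theorem map_wordOp (n : ℕ) (w : List (Bool × ℕ)) (f : W k I n) :
    W.map ψ n (D.wordOp n w f) = (D.map ψ).wordOp n w (W.map ψ n f) := by
  induction w with
  | nil => rfl
  | cons x w ih =>
    simp only [wordOp, LinearMap.comp_apply, ← ih]
    rcases x with ⟨_ | _, i⟩
    · rcases n with _ | _ | n
      · exact map_zero (W.map ψ 0)
      · exact map_zero (W.map ψ 1)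
      · exact (D.map_cupOp ψ i n _).trans (congrArg _ (D.map_capOp ψ i n _))
    · exact D.map_crossOp ψ i n _

end map

end RData
end BMW

/-! ### Perfect matchings, their words and separating labels. -/

namespace BMW

/-- The list on the right contains `x` exactly once, namely at place `j`, so the place of insertion
can be recovered from it. -/
theorem List.insertIdx_eq_insertIdx_iff {α : Type} {x : α} : ∀ {l l' : List α} {i j : ℕ},
    x ∉ l' → l.length = l'.length → i ≤ l.length → j ≤ l'.length →
      (l.insertIdx i x = l'.insertIdx j x ↔ i = j ∧ l = l')
  | l, l', 0, 0, _, _, _, _ => by simp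
  | l, a :: l', 0, j + 1, h, _, _, _ => by
    simp only [List.insertIdx_zero, List.insertIdx_succ_cons]
    constructor
    · intro e
      rw [List.cons.injEq] at e
      exact (h (e.1 ▸ List.mem_cons_self)).elim
    · rintro ⟨e, -⟩
      omega
  | a :: l, l', i + 1, 0, h, h', _, _ => by
    rcases l' with _ | ⟨b, l'⟩
    · simp at h'
    · simp only [List.insertIdx_zero, List.insertIdx_succ_cons]
      constructor
      · intro e
        rw [List.cons.injEq] at e
        rcases l with _ | ⟨c, l⟩
        · rcases i with _ | i
          · simp at e h
            exact (h.1 e.2.1).elim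
          · simp_all
        · refine (h ?_).elim
          rw [← e.2]
          exact List.mem_insertIdx (by simp_all) |>.mpr (Or.inl rfl)
      · rintro ⟨e, -⟩
        omega
  | a :: l, b :: l', i + 1, j + 1, h, h', hi, hj => by
    simp only [List.insertIdx_succ_cons, List.cons.injEq]
    rw [List.insertIdx_eq_insertIdx_iff (l := l) (l' := l') (fun hx => h (List.mem_cons_of_mem _ hx))
      (by simpa using h') (by simpa using hi) (by simpa using hj)]
    constructor
    · rintro ⟨rfl, rfl, rfl⟩
      exact ⟨rfl, rfl, rfl⟩
    · rintro ⟨e, rfl, rfl⟩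
      exact ⟨rfl, by omega, rfl⟩
  | [], a :: _, _, _, _, h', _, _ => by simp at h'
  | _ :: _, [], _, _ + 1, _, h', _, _ => by simp at h'
  | [], [], _ + 1, _, _, _, h', _ => by simp at h'
  | [], [], _, _ + 1, _, _, _, h' => by simp at h'

theorem List.exists_insertIdx {α : Type} : ∀ {l : List α} {j : ℕ}, j < l.length →
    ∃ (x : α) (l' : List α), l = l'.insertIdx j x ∧ l.length = l'.length + 1 ∧ x ∈ l
  | a :: l, 0, _ => ⟨a, l, rfl, rfl, List.mem_cons_self⟩
  | a :: l, j + 1, h => by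
    obtain ⟨x, l', h1, h2, h3⟩ := List.exists_insertIdx (l := l) (j := j) (by simpa using h)
    exact ⟨x, a :: l', by rw [List.insertIdx_succ_cons, ← h1], by simp [h2],
      List.mem_cons_of_mem _ h3⟩

/-- The word `g_0 g_1 ⋯ g_{j-1}`. -/
def upWord (j : ℕ) : List (Bool × ℕ) := (List.range j).map fun i => (true, i)

/-- The word `g_{j-1} ⋯ g_1 g_0`. -/
def downWord (j : ℕ) : List (Bool × ℕ) := (List.range j).reverse.map fun i => (true, i)

/-- A word placed one string further to the right. -/
def shiftWord (w : List (Bool × ℕ)) : List (Bool × ℕ) := w.map fun x => (x.1, x.2 + 1)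

theorem upWord_succ (j : ℕ) : upWord (j + 1) = (true, 0) :: shiftWord (upWord j) := by
  simp [upWord, shiftWord, List.range_succ_eq_map]

theorem downWord_succ (j : ℕ) : downWord (j + 1) = shiftWord (downWord j) ++ [(true, 0)] := by
  simp [downWord, shiftWord, List.range_succ_eq_map]

/-- Indices for the perfect matchings of `2 * n` points. -/
def Mat : ℕ → Type
  | 0 => Unit
  | n + 1 => (Fin (n + 1) ⊕ Fin n) × Mat n

instance Mat.instDecidableEq : ∀ N, DecidableEq (Mat N)
  | 0 => inferInstanceAs (DecidableEq Unit)
  | N + 1 =>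
    have := Mat.instDecidableEq N
    inferInstanceAs (DecidableEq ((Fin (N + 1) ⊕ Fin N) × Mat N))

instance Mat.instFintype : ∀ N, Fintype (Mat N)
  | 0 => inferInstanceAs (Fintype Unit)
  | N + 1 =>
    have := Mat.instFintype N
    inferInstanceAs (Fintype ((Fin (N + 1) ⊕ Fin N) × Mat N))

/-- Among `2 * (n + 1)` points the first upper one has `2 * n + 1` possible partners: `n + 1` lower
points (`inl`) and `n` other upper points (`inr`). When the partner is an upper point, the first
lower point is regarded as the first upper point of the remaining matching, so that `n` upper and
`n` lower points are left in both cases. -/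
theorem Mat.card : ∀ n, Fintype.card (Mat n) = Nat.doubleFactorial (2 * n - 1)
  | 0 => rfl
  | n + 1 => by
    have h : Fintype.card (Mat (n + 1)) = Fintype.card ((Fin (n + 1) ⊕ Fin n) × Mat n) := rfl
    rw [h, Fintype.card_prod, Fintype.card_sum, Fintype.card_fin, Fintype.card_fin, Mat.card n]
    rcases n with _ | n
    · rfl
    · have e : 2 * (n + 1 + 1) - 1 = (2 * (n + 1) - 1) + 2 := by omega
      rw [e, Nat.doubleFactorial_add_two]
      congr 1
      omega

/-- A word for a tangle with a given matching of its end points. -/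
def Mat.word : ∀ {n : ℕ}, Mat n → List (Bool × ℕ)
  | 0, _ => []
  | _ + 1, (.inl j, c) => shiftWord (Mat.word c) ++ upWord j
  | _ + 1, (.inr j, c) => shiftWord (downWord j) ++ (false, 0) :: shiftWord (Mat.word c)

theorem Mat.word_valid : ∀ {n : ℕ} (c : Mat n), ∀ x ∈ c.word, x.2 + 1 < n
  | 0, _, x, hx => by simp [Mat.word] at hx
  | n + 1, (.inl j, c), x, hx => by
    simp only [Mat.word, List.mem_append, shiftWord, List.mem_map, upWord, List.mem_range] at hx
    rcases hx with ⟨y, hy, rfl⟩ | ⟨i, hi, rfl⟩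
    · have := Mat.word_valid c y hy
      simpa using this
    · have := j.2
      simp only
      omega
  | n + 1, (.inr j, c), x, hx => by
    simp only [Mat.word, List.mem_append, shiftWord, List.mem_map, downWord, List.mem_reverse,
      List.mem_range, List.mem_cons] at hx
    have := j.2
    rcases hx with ⟨y, ⟨i, hi, rfl⟩, rfl⟩ | rfl | ⟨y, hy, rfl⟩
    · simp only
      omega
    · simp only
      omega
    · have := Mat.word_valid c y hy
      simpa using this

section labels

variable {I : Type} (s : ℕ → I) (bar : I → I)

/-- Labels for the end points at the top, equal or opposite if the points are joined. -/
def Mat.top : ∀ {n : ℕ}, Mat n → List I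
  | 0, _ => []
  | n + 1, (.inl _, c) => s n :: Mat.top c
  | n + 1, (.inr j, c) => s n :: (Mat.top c).tail.insertIdx j (bar (s n))

/-- Labels for the end points at the bottom. -/
def Mat.bot : ∀ {n : ℕ}, Mat n → List I
  | 0, _ => []
  | n + 1, (.inl j, c) => (Mat.bot c).insertIdx j (s n)
  | _ + 1, (.inr _, c) => (Mat.top s bar c).head?.toList.map bar ++ Mat.bot c

theorem Mat.top_length : ∀ {n : ℕ} (c : Mat n), (c.top s bar).length = n
  | 0, _ => rfl
  | n + 1, (.inl _, c) => congrArg (· + 1) (Mat.top_length c)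
  | n + 1, (.inr j, c) => by
    have := Mat.top_length c
    have hj := j.2
    simp only [Mat.top, List.length_cons]
    rw [List.length_insertIdx_of_le_length (by rw [List.length_tail]; omega), List.length_tail]
    omega

theorem Mat.bot_length : ∀ {n : ℕ} (c : Mat n), (c.bot s bar).length = n
  | 0, _ => rfl
  | n + 1, (.inl j, c) => by
    have := Mat.bot_length c
    have hj := j.2
    simp only [Mat.bot]
    rw [List.length_insertIdx_of_le_length (by omega)]
    omega
  | n + 1, (.inr j, c) => by
    have := Mat.bot_length c
    have h2 := Mat.top_length s bar c
    have hj := j.2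
    simp only [Mat.bot]
    rcases h : c.top s bar with _ | ⟨a, l⟩
    · rw [h] at h2
      simp at h2
      omega
    · simp [this, add_comm]

theorem Mat.mem_top (hb : ∀ i, bar (bar i) = i) : ∀ {n : ℕ} (c : Mat n) (x : I),
    x ∈ c.top s bar → ∃ m < n, x = s m ∨ x = bar (s m)
  | 0, _, x, hx => by simp [Mat.top] at hx
  | n + 1, (.inl _, c), x, hx => by
    rcases List.mem_cons.mp hx with rfl | hx
    · exact ⟨n, by omega, Or.inl rfl⟩
    · obtain ⟨m, hm, h⟩ := Mat.mem_top hb c x hx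
      exact ⟨m, by omega, h⟩
  | n + 1, (.inr j, c), x, hx => by
    rcases List.mem_cons.mp hx with rfl | hx
    · exact ⟨n, by omega, Or.inl rfl⟩
    · rcases List.eq_or_mem_of_mem_insertIdx hx with rfl | hx
      · exact ⟨n, by omega, Or.inr rfl⟩
      · obtain ⟨m, hm, h⟩ := Mat.mem_top hb c x (List.mem_of_mem_tail hx)
        exact ⟨m, by omega, h⟩

theorem Mat.mem_bot (hb : ∀ i, bar (bar i) = i) : ∀ {n : ℕ} (c : Mat n) (x : I),
    x ∈ c.bot s bar → ∃ m < n, x = s m ∨ x = bar (s m)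
  | 0, _, x, hx => by simp [Mat.bot] at hx
  | n + 1, (.inl j, c), x, hx => by
    rcases List.eq_or_mem_of_mem_insertIdx hx with rfl | hx
    · exact ⟨n, by omega, Or.inl rfl⟩
    · obtain ⟨m, hm, h⟩ := Mat.mem_bot hb c x hx
      exact ⟨m, by omega, h⟩
  | n + 1, (.inr j, c), x, hx => by
    rcases List.mem_append.mp hx with hx | hx
    · simp only [List.mem_map, Option.mem_toList] at hx
      obtain ⟨y, hy, rfl⟩ := hx
      obtain ⟨m, hm, h | h⟩ := Mat.mem_top s bar hb c y (List.mem_of_mem_head? hy)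
      · exact ⟨m, by omega, Or.inr (by rw [h])⟩
      · exact ⟨m, by omega, Or.inl (by rw [h, hb])⟩
    · obtain ⟨m, hm, h⟩ := Mat.mem_bot hb c x hx
      exact ⟨m, by omega, h⟩

end labels

namespace RData
namespace IsClassical

variable {k I : Type} [CommRing k] [Fintype I] {D : RData k I} [DecidableEq I] {bar : I → I}

theorem eval_shiftWord (n : ℕ) (w : List (Bool × ℕ)) (f : W k I (n + 1)) (a : I) (l : List I) :
    W.eval (n + 1) (D.wordOp (n + 1) (shiftWord w) f) (a :: l) =
      W.eval n (D.wordOp n w (f a)) l := by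
  rw [shiftWord, wordOp_shift]
  rfl

variable (h : D.IsClassical bar)

include h

theorem eval_g (n : ℕ) (f : W k I (n + 2)) (a b : I) (l : List I) :
    W.eval (n + 2) (D.genOp (n + 2) (true, 0) f) (a :: b :: l) =
      W.eval (n + 2) f (b :: a :: l) := by
  have key : ∀ (f : I → I → W k I n), D.R f a b = f b a := fun f => h.R_eq f a b
  exact congrArg (W.eval n · l) (key f)

theorem eval_e (n : ℕ) (f : W k I (n + 2)) (a b : I) (l : List I) :
    W.eval (n + 2) (D.genOp (n + 2) (false, 0) f) (a :: b :: l) =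
      if b = bar a then ∑ c, W.eval (n + 2) f (c :: bar c :: l) else 0 := by
  have key : ∀ (f : I → I → W k I n), D.eta a b • D.cap f =
      if b = bar a then ∑ c, f c (bar c) else 0 := fun f => by
    rw [h.eta_eq, h.cap_eq, ite_smul, one_smul, zero_smul]
  refine (congrArg (W.eval n · l) (key f)).trans ?_
  split_ifs
  · exact W.eval_sum _ _ _
  · exact W.eval_zero _

theorem eval_upWord : ∀ (j n : ℕ) (f : W k I (n + 1)) (a : I) (l : List I), l.length = n → j ≤ n →
    W.eval (n + 1) (D.wordOp (n + 1) (upWord j) f) (a :: l) = W.eval (n + 1) f (l.insertIdx j a)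
  | 0, _, _, _, _, _, _ => rfl
  | j + 1, n + 1, f, a, b :: l, hl, hj => by
    rw [upWord_succ]
    refine (h.eval_g n _ a b l).trans ?_
    rw [eval_shiftWord, eval_upWord j n _ _ _ (Nat.succ.inj hl) (by omega),
      List.insertIdx_succ_cons]
    rfl

theorem eval_downWord : ∀ (j n : ℕ) (f : W k I (n + 1)) (a : I) (l : List I), l.length = n →
    j ≤ n →
    W.eval (n + 1) (D.wordOp (n + 1) (downWord j) f) (l.insertIdx j a) = W.eval (n + 1) f (a :: l)
  | 0, _, _, _, _, _, _ => rfl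
  | j + 1, n + 1, f, a, b :: l, hl, hj => by
    rw [downWord_succ, List.insertIdx_succ_cons, wordOp_append, LinearMap.comp_apply,
      eval_shiftWord, eval_downWord j n _ _ _ (Nat.succ.inj hl) (by omega)]
    exact h.eval_g n f b a l

theorem eval_inl {n : ℕ} (j : Fin (n + 1)) (c : Mat n) (f : W k I (n + 1)) (a : I) (l : List I) :
    W.eval (n + 1) (D.wordOp (n + 1) (Mat.word (n := n + 1) (.inl j, c)) f) (a :: l) =
      W.eval n (D.wordOp n c.word (D.wordOp (n + 1) (upWord j) f a)) l := by
  rw [Mat.word, wordOp_append, LinearMap.comp_apply, eval_shiftWord]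

/-- The braid brings the upper point `j + 1` next to the first one, and the minimum of `e_0`
requires opposite labels there. The left end of the maximum runs down to the first lower point, and
its right end becomes the first upper point of the rest. -/
theorem eval_inr {n : ℕ} (j : Fin (n + 1)) (c : Mat (n + 1)) (b : I) (bs : List I) (a x : I)
    (l : List I) (hl : l.length = n) :
    W.eval (n + 2) (D.wordOp (n + 2) (Mat.word (n := n + 2) (.inr j, c)) (W.single (n + 2) (b :: bs)))
      (a :: l.insertIdx j x) =
      if x = bar a then W.eval (n + 1) (D.wordOp (n + 1) c.word (W.single (n + 1) bs)) (bar b :: l)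
      else 0 := by
  rw [Mat.word, wordOp_append, LinearMap.comp_apply, eval_shiftWord,
    h.eval_downWord j n _ _ _ hl (by omega)]
  refine (h.eval_e n _ a x l).trans ?_
  congr 1
  simp only [eval_shiftWord]
  -- The left end of the maximum ends at the first lower point, whose label is `b`; this selects one
  -- term of the sum.
  rw [Finset.sum_eq_single b]
  · congr 2
    exact if_pos rfl
  · intro c' _ hc
    have : (W.single (n + 2) (b :: bs) : W k I (n + 2)) c' = 0 := if_neg hc
    rw [this, map_zero, W.eval_zero]
  · simp

/-- The entry is `1` if every arc of `c` joins points with compatible labels and `0` otherwise.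
Distinct arcs of `c'` carry labels from distinct orbits of `bar`, so compatibility forces `c = c'`.
The induction compares the partners of the first upper point. -/
theorem eval_word (hb : ∀ i, bar (bar i) = i) (s : ℕ → I) : ∀ {n : ℕ}
    (_ : ∀ m m', m < n → m' < n → s m = s m' → m = m') (_ : ∀ m m', s m ≠ bar (s m'))
    (c c' : Mat n),
    W.eval n (D.wordOp n c.word (W.single n (c'.bot s bar))) (c'.top s bar) =
      if c = c' then 1 else 0
  | 0, _, _, _, _ => rfl
  | n + 1, hs, hs', (.inl j, c), (.inl j', c') => by
    have ih := eval_word hb s (fun m m' h h' => hs m m' (by omega) (by omega)) hs' c c'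
    have hn : s n ∉ c'.bot s bar := by
      intro hm
      obtain ⟨m, hm, h1 | h1⟩ := Mat.mem_bot s bar hb c' _ hm
      · have := hs n m (by omega) (by omega) h1
        omega
      · exact hs' _ _ h1
    have hlen := c'.bot_length s bar
    rw [Mat.top, h.eval_inl, Mat.bot]
    have e : (D.wordOp (n + 1) (upWord j) (W.single (n + 1) ((c'.bot s bar).insertIdx j' (s n)))
        (s n) : W k I n) = if j = j' then W.single n (c'.bot s bar) else 0 := by
      refine W.eval_ext fun l hl => ?_
      refine (h.eval_upWord j n _ (s n) l hl (by omega)).trans ?_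
      rw [W.eval_single _ _ (by rw [List.length_insertIdx_of_le_length (by omega), hlen])
        (by rw [List.length_insertIdx_of_le_length (by omega), hl])]
      refine (if_congr (List.insertIdx_eq_insertIdx_iff hn (by omega) (by omega) (by omega))
        rfl rfl).trans ?_
      by_cases hj : j = j'
      · subst hj
        simp only [true_and, if_true]
        rw [W.eval_single _ _ hlen hl]
      · rw [if_neg hj, W.eval_zero, if_neg]
        exact fun hh => hj (Fin.ext hh.1)
    rw [e]
    by_cases hj : j = j'
    · subst hj
      rw [if_pos rfl, ih]
      by_cases hc : c = c'
      · subst hc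
        rw [if_pos rfl]
        exact (if_pos rfl).symm
      · rw [if_neg hc]
        exact (if_neg fun h => hc (Prod.mk.inj h).2).symm
    · rw [if_neg hj, map_zero, W.eval_zero, if_neg]
      exact fun h => hj (Sum.inl.inj (Prod.mk.inj h).1)
  | n + 1, hs, hs', (.inl j, c), (.inr j', c') => by
    -- In `c'` the label `s n` belongs to an arc with both ends at the top, whereas the word of `c`
    -- carries it to a lower point.
    have hn : s n ∉ Mat.bot (n := n + 1) s bar (.inr j', c') := by
      intro hm
      have : ∃ m < n, s n = s m ∨ s n = bar (s m) := by
        rcases List.mem_append.mp hm with hx | hx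
        · simp only [List.mem_map, Option.mem_toList] at hx
          obtain ⟨y, hy, he⟩ := hx
          obtain ⟨m, hm, h | h⟩ := Mat.mem_top s bar hb c' y (List.mem_of_mem_head? hy)
          · exact ⟨m, by omega, Or.inr (by rw [← he, h])⟩
          · exact ⟨m, by omega, Or.inl (by rw [← he, h, hb])⟩
        · exact Mat.mem_bot s bar hb c' _ hx
      obtain ⟨m, hm, h1 | h1⟩ := this
      · have := hs n m (by omega) (by omega) h1
        omega
      · exact hs' _ _ h1
    have hlen := Mat.bot_length (n := n + 1) s bar (.inr j', c')
    rw [Mat.top, h.eval_inl]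
    have e : (D.wordOp (n + 1) (upWord j) (W.single (n + 1)
        (Mat.bot (n := n + 1) s bar (.inr j', c'))) (s n) : W k I n) = 0 := by
      refine W.eval_ext fun l hl => ?_
      refine (h.eval_upWord j n _ (s n) l hl (by omega)).trans ?_
      rw [W.eval_single _ _ hlen (by rw [List.length_insertIdx_of_le_length (by omega), hl]),
        W.eval_zero, if_neg]
      intro he
      exact hn (he ▸ (List.mem_insertIdx (by omega)).mpr (Or.inl rfl))
    rw [e, map_zero, W.eval_zero, if_neg]
    exact fun h => nomatch (Prod.mk.inj h).1
  | n + 2, hs, hs', (.inr j, c), (.inl j', c') => by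
    have hlen := c'.top_length s bar
    -- The label `x` of the partner that `c` assigns to the first upper point would have to be `bar
    -- (s (n + 1))`, and this does not occur among the other upper labels of `c'`.
    obtain ⟨x, l, hl, hl2, hx⟩ := List.exists_insertIdx (l := c'.top s bar) (j := j) (by omega)
    have hlen2 := Mat.bot_length (n := n + 2) s bar (.inl j', c')
    rcases hbot : Mat.bot (n := n + 2) s bar (.inl j', c') with _ | ⟨b, bs⟩
    · rw [hbot] at hlen2; simp at hlen2
    rw [Mat.top, hl, h.eval_inr j c b bs _ _ _ (by omega), if_neg, if_neg]
    · exact fun h => nomatch (Prod.mk.inj h).1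
    · rintro rfl
      obtain ⟨m, hm, h1 | h1⟩ := Mat.mem_top s bar hb c' _ hx
      · exact hs' _ _ h1.symm
      · have := congrArg bar h1
        rw [hb, hb] at this
        have := hs _ _ (by omega) (by omega) this
        omega
  | n + 2, hs, hs', (.inr j, c), (.inr j', c') => by
    have ih := eval_word hb s (fun m m' h h' => hs m m' (by omega) (by omega)) hs' c c'
    have hlen := c'.top_length s bar
    rcases htop : c'.top s bar with _ | ⟨t, o⟩
    · rw [htop] at hlen; simp at hlen
    rw [htop] at ih hlen
    have ho : o.length = n := by simpa using hlen
    have hn : bar (s (n + 1)) ∉ o := by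
      intro hm
      obtain ⟨m, hm, h1 | h1⟩ := Mat.mem_top s bar hb c' _
        (htop ▸ List.mem_cons_of_mem t hm)
      · exact hs' _ _ h1.symm
      · have := congrArg bar h1
        rw [hb, hb] at this
        have := hs _ _ (by omega) (by omega) this
        omega
    rw [Mat.top, Mat.bot, htop]
    simp only [List.head?_cons, Option.toList_some, List.map_cons, List.map_nil,
      List.singleton_append, List.tail_cons]
    obtain ⟨x, l, hl, hl2, hx⟩ := List.exists_insertIdx
      (l := o.insertIdx j' (bar (s (n + 1)))) (j := j)
      (by rw [List.length_insertIdx_of_le_length (by omega)]; omega)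
    rw [List.length_insertIdx_of_le_length (by omega)] at hl2
    rw [hl, h.eval_inr j c _ _ _ _ _ (by omega)]
    by_cases hxb : x = bar (s (n + 1))
    · subst hxb
      have := (List.insertIdx_eq_insertIdx_iff hn (by omega) (by omega) (by omega)).mp hl.symm
      obtain ⟨hj, rfl⟩ := this
      have hj := Fin.ext hj
      subst hj
      rw [if_pos rfl, hb, ih]
      by_cases hc : c = c'
      · subst hc
        rw [if_pos rfl]
        exact (if_pos rfl).symm
      · rw [if_neg hc]
        exact (if_neg fun h => hc (Prod.mk.inj h).2).symm
    · rw [if_neg hxb, if_neg]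
      intro hh
      have hj := Sum.inr.inj (Prod.mk.inj hh).1
      subst hj
      have := congrArg (fun l => l[(j : ℕ)]?) hl
      simp only [List.getElem?_insertIdx_self] at this
      rw [if_pos (by omega), if_pos (by omega)] at this
      exact hxb (Option.some.inj this).symm
  | 1, _, _, (.inr j, _), _ => j.elim0

end IsClassical
end RData
end BMW

namespace BMW

/-! ### Independence of small spanning families -/

theorem BW.mk_surjective (n : ℕ) : Function.Surjective (BW.mk n) :=
  RingQuot.mkAlgHom_surjective Lam (BWRel n)

theorem phi_mk_fr {n : ℕ} (x : Gen n) : phi n (BW.mk n (fr x)) = phiGen n x := by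
  have : phi n (BW.mk n (fr x)) = FreeAlgebra.lift Lam (phiGen n) (fr x) :=
    RingQuot.liftAlgHom_mkAlgHom_apply _ _ _ _
  rw [this, FreeAlgebra.lift_ι_apply]

theorem phi_g {n i : ℕ} (h : i < n - 1) :
    phi n (BW.g n i) = MT.of (Tangle.G true ⟨i, h⟩) := by
  rw [BW.g, dif_pos h, phi_mk_fr, phiGen]

theorem phi_e {n i : ℕ} (h : i < n - 1) : phi n (BW.e n i) = MT.of (Tangle.E ⟨i, h⟩) := by
  rw [BW.e, dif_pos h, phi_mk_fr, phiGen]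

/-- The element of `BW n` given by a word. -/
noncomputable def BW.word (n : ℕ) (w : List (Bool × ℕ)) : BW n :=
  (w.map fun x => if x.1 then BW.g n x.2 else BW.e n x.2).prod

theorem RData.IsTangle.rep_word {k I : Type} [CommRing k] [Fintype I] {D : RData k I}
    {chi : Lam →+* k} (h : D.IsTangle (chi z) (chi lam) (chi delta)) {n : ℕ}
    (w : List (Bool × ℕ)) (hw : ∀ x ∈ w, x.2 + 1 < n) :
    h.rep n (phi n (BW.word n w)) = D.wordOp n w := by
  induction w with
  | nil =>
    simp only [BW.word, List.map_nil, List.prod_nil, map_one]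
    rfl
  | cons x w ih =>
    have hx := hw x List.mem_cons_self
    have e : BW.word n (x :: w) = (if x.1 then BW.g n x.2 else BW.e n x.2) * BW.word n w := by
      simp only [BW.word, List.map_cons, List.prod_cons]
    rw [e, map_mul, map_mul, ih fun y hy => hw y (List.mem_cons_of_mem _ hy), RData.wordOp]
    have e2 : h.rep n (phi n (if x.1 then BW.g n x.2 else BW.e n x.2)) = D.genOp n x := by
      rcases x with ⟨_ | _, i⟩
      · simp only [Bool.false_eq_true, if_false]
        rw [phi_e (by simp at hx; omega), h.rep_of]
        obtain ⟨m, rfl⟩ : ∃ m, n = m + 2 := ⟨n - 2, by simp at hx; omega⟩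
        rfl
      · simp only [if_true]
        rw [phi_g (by simp at hx; omega), h.rep_of]
        exact D.crossOp_z _ _ _ _
    rw [e2]
    rfl

/-- The specialization `λ = q ^ (-2 * N - 1)`. -/
noncomputable def specialization (N : ℕ) : Lam →+* PowerSeries ℚ :=
  Lam.lift (qu ^ (1 - 2 * (N + 1 : ℕ) : ℤ)) qz (RData.famDelta qu (N + 1)) (by
    have := RData.famDelta_spec qu (N + 1)
    have e : (-(1 - 2 * (N + 1 : ℕ)) : ℤ) = 2 * (N + 1 : ℕ) - 1 := by ring
    rw [mul_sub, mul_one, qz, this, ← zpow_neg, e]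
    ring)

theorem specialization_isTangle (N : ℕ) : (RData.fam qu (N + 1)).IsTangle (specialization N z)
    (specialization N lam) (specialization N delta) := by
  rw [specialization, Lam.lift_z, Lam.lift_delta, Lam.lift_lam]
  exact RData.fam_isTangle qu (N + 1)

/-- The entries of the words form the matrix `M' * V`, where `M'` expresses the words in the given
family and `V` contains the entries of the family itself. Modulo `X` the product is the identity, so
`V` has non-zero determinant over the domain `ℚ⟦X⟧`. The specialized coefficients of a relation form
a row vector annihilated by `V`, hence vanish for all `N ≥ n`. -/
theorem linearIndependent_phi_of_span_eq_top {n : ℕ} (x : Mat n → BW n)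
    (hx : Submodule.span Lam (Set.range x) = ⊤) : LinearIndependent Lam fun c => phi n (x c) := by
  rw [Fintype.linearIndependent_iff]
  intro a ha c
  have hM : ∀ c : Mat n, ∃ M : Mat n → Lam, ∑ p, M p • x p = BW.word n c.word := fun c => by
    have : BW.word n c.word ∈ Submodule.span Lam (Set.range x) := hx ▸ Submodule.mem_top
    exact (Submodule.mem_span_range_iff_exists_fun Lam).mp this
  choose M hM using hM
  have key : ∀ N : ℕ, n ≤ N → specialization N (a c) = 0 := by
    intro N hN
    let h := specialization_isTangle N
    let s := Idx.label N
    let V : Matrix (Mat n) (Mat n) (PowerSeries ℚ) := fun p c =>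
      W.eval n (h.rep n (phi n (x p)) (W.single n (c.bot s Idx.bar))) (c.top s Idx.bar)
    let M' : Matrix (Mat n) (Mat n) (PowerSeries ℚ) := fun c p => specialization N (M c p)
    have h1 : M' * V = fun c c' => W.eval n ((RData.fam qu (N + 1)).wordOp n c.word
        (W.single n (c'.bot s Idx.bar))) (c'.top s Idx.bar) := by
      funext c c'
      rw [Matrix.mul_apply, ← h.rep_word _ c.word_valid, ← hM c]
      simp only [map_sum, map_smul, h.rep_smul, LinearMap.sum_apply, W.eval_sum,
        LinearMap.smul_apply, W.eval_smul]
      rfl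
    -- Passing to constant coefficients sets `q = 1`, where `eval_word` applies. The bound `n ≤ N`
    -- provides enough labels from distinct orbits of `bar`.
    have h2 : (M' * V).map (PowerSeries.constantCoeff (R := ℚ)) = 1 := by
      funext c c'
      have hq : Units.map (PowerSeries.constantCoeff (R := ℚ)).toMonoidHom qu = 1 :=
        Units.ext constantCoeff_qu
      have := (RData.fam_one (k := ℚ) (N + 1)).eval_word Idx.bar_bar s (n := n)
        (fun m m' hm hm' => Idx.label_inj (by omega) (by omega)) Idx.label_ne_bar c c'
      rw [h1]
      refine (W.eval_map (PowerSeries.constantCoeff (R := ℚ)) _ _).symm.trans ?_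
      rw [RData.map_wordOp, RData.fam_map, hq, W.map_single,
        this, Matrix.one_apply]
    have h3 : (M' * V).det ≠ 0 := by
      intro h0
      have := congrArg (PowerSeries.constantCoeff (R := ℚ)) h0
      rw [RingHom.map_det, RingHom.mapMatrix_apply, h2, Matrix.det_one, map_zero] at this
      exact one_ne_zero this
    have h4 : V.det ≠ 0 := by
      intro h0
      rw [Matrix.det_mul, h0, mul_zero] at h3
      exact h3 rfl
    have h5 : Matrix.vecMul (fun p => specialization N (a p)) V = 0 := by
      funext c
      have h6 := congrArg (fun y => W.eval n (h.rep n y (W.single n (c.bot s Idx.bar)))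
        (c.top s Idx.bar)) ha
      simp only [map_sum, h.rep_smul, LinearMap.sum_apply, W.eval_sum,
        LinearMap.smul_apply, W.eval_smul, map_zero, LinearMap.zero_apply, W.eval_zero] at h6
      exact h6
    exact congrFun (Matrix.eq_zero_of_vecMul_eq_zero h4 h5) c
  -- The specializations are indexed by the exponent `m = 1 - 2 * (N + 1)` of `λ = q ^ m`, and `N`
  -- is recovered as `(1 - m) / 2 - 1`.
  refine Lam.eq_zero_of_specializations ((fun N : ℕ => (1 - 2 * (N + 1 : ℕ) : ℤ)) '' Set.Ici n)
    ((Set.Ici_infinite n).image (fun N _ N' _ hN => by simpa using hN))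
    (fun m => specialization ((1 - m) / 2 - 1).toNat) ?_ ?_ ?_
  · rintro _ ⟨N, hN, rfl⟩
    rw [specialization, Lam.lift_z]
  · rintro _ ⟨N, hN, rfl⟩
    have : ((1 - (1 - 2 * (N + 1 : ℕ) : ℤ)) / 2 - 1).toNat = N := by omega
    rw [this, specialization, Lam.lift_lam]
  · rintro _ ⟨N, hN, rfl⟩
    have : ((1 - (1 - 2 * (N + 1 : ℕ) : ℤ)) / 2 - 1).toNat = N := by omega
    rw [this]
    exact key N hN

instance : Nontrivial Lam := (specialization 0).domain_nontrivial

theorem linearIndependent_phi_extend {n : ℕ} {ι : Type} (x : ι → BW n)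
    (hx : Submodule.span Lam (Set.range x) = ⊤) (f : ι ↪ Mat n) :
    LinearIndependent Lam fun c => phi n (Function.extend f x 0 c) :=
  linearIndependent_phi_of_span_eq_top _ (by
    rw [eq_top_iff, ← hx]
    refine Submodule.span_mono ?_
    rintro _ ⟨i, rfl⟩
    exact ⟨f i, f.injective.extend_apply x 0 i⟩)

/-- The family is extended by zeros to the index set `Mat n`. The extended family still spans, so
even it is independent after `phi`. -/
theorem linearIndependent_phi_of_card_le {n : ℕ} {ι : Type} [Fintype ι] (x : ι → BW n)
    (hx : Submodule.span Lam (Set.range x) = ⊤)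
    (hc : Fintype.card ι ≤ Nat.doubleFactorial (2 * n - 1)) :
    LinearIndependent Lam fun c => phi n (x c) := by
  rw [← Mat.card] at hc
  obtain ⟨f⟩ := Function.Embedding.nonempty_of_card_le hc
  have h2 := (linearIndependent_phi_extend x hx f).comp f f.injective
  have h3 : ((fun c => phi n (Function.extend f x 0 c)) ∘ f) = fun c => phi n (x c) :=
    funext fun i => congrArg (phi n) (f.injective.extend_apply x 0 i)
  rwa [h3] at h2

/-- If the family were strictly smaller, its extension by zeros would contain the vector `0` and yet
be independent. -/
theorem card_eq_of_span_eq_top {n : ℕ} {ι : Type} [Fintype ι] (x : ι → BW n)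
    (hx : Submodule.span Lam (Set.range x) = ⊤)
    (hc : Fintype.card ι ≤ Nat.doubleFactorial (2 * n - 1)) :
    Fintype.card ι = Nat.doubleFactorial (2 * n - 1) := by
  rw [← Mat.card] at hc ⊢
  obtain ⟨f⟩ := Function.Embedding.nonempty_of_card_le hc
  refine Fintype.card_congr (Equiv.ofBijective f ⟨f.injective, fun c => ?_⟩)
  by_contra hcf
  refine (linearIndependent_phi_extend x hx f).ne_zero c ?_
  rw [Function.extend_apply' _ _ _ hcf, Pi.zero_apply, map_zero]

end BMW

namespace BMW

theorem mul_mul_mem_of_mem_span {A : Type} [Ring A] [Algebra Lam A] {X : Set A}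
    {T : Submodule Lam A} {u v : A} (h : ∀ x ∈ X, u * x * v ∈ T) {x : A}
    (hx : x ∈ Submodule.span Lam X) : u * x * v ∈ T := by
  have : Submodule.span Lam X ≤ T.comap (LinearMap.mulLeftRight Lam (u, v)) := by
    rw [Submodule.span_le]
    intro x hx
    simpa using h x hx
  simpa using this hx

theorem mul_mul_mul_comm_of_comm {A : Type} [Monoid A] {x y m m' : A} (p : A) (h : x * m = m * x)
    (h' : y * m' = m' * y) : m * (x * p * y) * m' = x * (m * p * m') * y := by
  calc m * (x * p * y) * m' = (m * x) * p * (y * m') := by simp only [mul_assoc]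
    _ = x * (m * p * m') * y := by rw [← h, h']; simp only [mul_assoc]

/-! ### Elements satisfying the Birman-Wenzl relations -/

/-- Elements `g_i`, `g_i⁻¹`, `e_i`, `i < N`, of an algebra that satisfy the relations of the
Birman-Wenzl algebra. -/
structure Sys (A : Type) [Ring A] [Algebra Lam A] (N : ℕ) where
  g : ℕ → A
  gi : ℕ → A
  e : ℕ → A
  mul_inv : ∀ {i}, i < N → g i * gi i = 1
  inv_mul : ∀ {i}, i < N → gi i * g i = 1
  skein : ∀ {i}, i < N → g i - gi i = z • (1 - e i)
  idem : ∀ {i}, i < N → e i * e i = delta • e i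
  braid : ∀ {i j}, i < N → j < N → (i + 1 = j ∨ j + 1 = i) → g i * g j * g i = g j * g i * g j
  gg : ∀ {i j}, i < N → j < N → (i + 1 < j ∨ j + 1 < i) → g i * g j = g j * g i
  ge : ∀ {i j}, i < N → j < N → (i + 1 < j ∨ j + 1 < i) → g i * e j = e j * g i
  ee : ∀ {i j}, i < N → j < N → (i + 1 < j ∨ j + 1 < i) → e i * e j = e j * e i
  eee : ∀ {i j}, i < N → j < N → (i + 1 = j ∨ j + 1 = i) → e i * e j * e i = e i
  gge : ∀ {i j}, i < N → j < N → (i + 1 = j ∨ j + 1 = i) → g i * g j * e i = e j * e i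
  egg : ∀ {i j}, i < N → j < N → (i + 1 = j ∨ j + 1 = i) → e i * g j * g i = e i * e j
  g_e : ∀ {i}, i < N → g i * e i = lam • e i
  e_g : ∀ {i}, i < N → e i * g i = lam • e i
  ege : ∀ {i j}, i < N → j < N → (i + 1 = j ∨ j + 1 = i) → e i * g j * e i = lamInv • e i

namespace Sys

variable {A : Type} [Ring A] [Algebra Lam A] {N : ℕ} (s : Sys A N)

open MulOpposite in
/-- The same elements of the opposite algebra. -/
def op : Sys Aᵐᵒᵖ N where
  g i := MulOpposite.op (s.g i)
  gi i := MulOpposite.op (s.gi i)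
  e i := MulOpposite.op (s.e i)
  mul_inv h := congrArg MulOpposite.op (s.inv_mul h)
  inv_mul h := congrArg MulOpposite.op (s.mul_inv h)
  skein h := congrArg MulOpposite.op (s.skein h)
  idem h := congrArg MulOpposite.op (s.idem h)
  braid hi hj h := by
    simpa only [op_mul, mul_assoc] using congrArg MulOpposite.op (s.braid hi hj h)
  gg hi hj h := congrArg MulOpposite.op (s.gg hj hi h.symm)
  ge hi hj h := congrArg MulOpposite.op (s.ge hi hj h).symm
  ee hi hj h := congrArg MulOpposite.op (s.ee hj hi h.symm)
  eee hi hj h := by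
    simpa only [op_mul, mul_assoc] using congrArg MulOpposite.op (s.eee hi hj h)
  gge hi hj h := by
    simpa only [op_mul, mul_assoc] using congrArg MulOpposite.op (s.egg hi hj h)
  egg hi hj h := by
    simpa only [op_mul, mul_assoc] using congrArg MulOpposite.op (s.gge hi hj h)
  g_e h := congrArg MulOpposite.op (s.e_g h)
  e_g h := congrArg MulOpposite.op (s.g_e h)
  ege hi hj h := by
    simpa only [op_mul, op_smul, mul_assoc] using congrArg MulOpposite.op (s.ege hi hj h)

/-- The same elements in the opposite order. -/
def rev : Sys A N where
  g i := s.g (N - 1 - i)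
  gi i := s.gi (N - 1 - i)
  e i := s.e (N - 1 - i)
  mul_inv h := s.mul_inv (by omega)
  inv_mul h := s.inv_mul (by omega)
  skein h := s.skein (by omega)
  idem h := s.idem (by omega)
  braid hi hj h := s.braid (by omega) (by omega) (by omega)
  gg hi hj h := s.gg (by omega) (by omega) (by omega)
  ge hi hj h := s.ge (by omega) (by omega) (by omega)
  ee hi hj h := s.ee (by omega) (by omega) (by omega)
  eee hi hj h := s.eee (by omega) (by omega) (by omega)
  gge hi hj h := s.gge (by omega) (by omega) (by omega)
  egg hi hj h := s.egg (by omega) (by omega) (by omega)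
  g_e h := s.g_e (by omega)
  e_g h := s.e_g (by omega)
  ege hi hj h := s.ege (by omega) (by omega) (by omega)

/-! #### Consequences of the relations -/

section rel

variable {i j : ℕ} (hi : i < N) (hj : j < N) (h : i + 1 = j ∨ j + 1 = i)

include hi

theorem gi_eq : s.gi i = s.g i - z • (1 - s.e i) := by
  rw [← s.skein hi]; abel

theorem g_sq : s.g i * s.g i = 1 + z • s.g i - (z * lam) • s.e i := by
  have h1 := congrArg (s.g i * ·) (s.skein hi)
  simp only [mul_sub, s.mul_inv hi, mul_smul_comm, mul_one, s.g_e hi] at h1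
  rw [sub_eq_iff_eq_add] at h1
  rw [h1, smul_sub, mul_smul]
  abel

theorem gi_mul_cancel (x : A) : s.gi i * (s.g i * x) = x := by
  rw [← mul_assoc, s.inv_mul hi, one_mul]

include hj h

theorem g_e_adj : s.g j * s.e i = s.gi i * s.e j * s.e i := by
  rw [mul_assoc, ← s.gge hi hj h, mul_assoc, s.gi_mul_cancel hi]

theorem g_e_e : s.g j * s.e i * s.e j = s.gi i * s.e j := by
  rw [s.g_e_adj hi hj h, mul_assoc, mul_assoc, ← mul_assoc (s.e j), s.eee hj hi h.symm]

theorem e_g_adj : s.e i * s.g j = s.e i * s.e j * s.gi i := by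
  rw [← s.egg hi hj h, mul_assoc, mul_assoc, s.mul_inv hi, mul_one]

theorem e_e_g : s.e j * s.e i * s.g j = s.e j * s.gi i := by
  rw [mul_assoc, s.e_g_adj hi hj h, ← mul_assoc, ← mul_assoc, s.eee hj hi h.symm]

end rel

/-! #### The subalgebras generated by consecutive generators -/

/-- The subalgebra generated by `g_i^{±1}`, `e_i` for `a ≤ i < b`. -/
noncomputable def S (a b : ℕ) : Subalgebra Lam A :=
  Algebra.adjoin Lam {x | ∃ i, a ≤ i ∧ i < b ∧ (x = s.g i ∨ x = s.e i)}

variable {s} {a b c d i : ℕ}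

theorem g_mem (h1 : a ≤ i) (h2 : i < b) : s.g i ∈ s.S a b :=
  Algebra.subset_adjoin ⟨i, h1, h2, Or.inl rfl⟩

theorem e_mem (h1 : a ≤ i) (h2 : i < b) : s.e i ∈ s.S a b :=
  Algebra.subset_adjoin ⟨i, h1, h2, Or.inr rfl⟩

theorem gi_mem (h1 : a ≤ i) (h2 : i < b) (hb : b ≤ N) : s.gi i ∈ s.S a b := by
  rw [s.gi_eq (by omega)]
  exact sub_mem (g_mem h1 h2) (Subalgebra.smul_mem _ (sub_mem (one_mem _) (e_mem h1 h2)) _)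

theorem S_mono (h1 : c ≤ a) (h2 : b ≤ d) : s.S a b ≤ s.S c d :=
  Algebra.adjoin_mono fun _ ⟨i, hi, hj, h⟩ => ⟨i, h1.trans hi, hj.trans_le h2, h⟩

theorem mem_S (h1 : c ≤ a) (h2 : b ≤ d) {x : A} (hx : x ∈ s.S a b) : x ∈ s.S c d :=
  S_mono h1 h2 hx

theorem S_commute (hb : b + 1 ≤ c) (hd : d ≤ N) {x y : A} (hx : x ∈ s.S a b) (hy : y ∈ s.S c d) :
    x * y = y * x := by
  refine Algebra.commute_of_mem_adjoin_of_forall_mem_commute (R := Lam) (a := x) hy ?_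
  rintro y ⟨j, hj1, hj2, hy⟩
  refine (Algebra.commute_of_mem_adjoin_of_forall_mem_commute (R := Lam) (a := y) hx ?_).symm
  rintro x ⟨i, hi1, hi2, hx⟩
  rcases hx with rfl | rfl <;> rcases hy with rfl | rfl
  · exact s.gg (by omega) (by omega) (by omega)
  · exact (s.ge (by omega) (by omega) (by omega)).symm
  · exact s.ge (by omega) (by omega) (by omega)
  · exact s.ee (by omega) (by omega) (by omega)

/-- A submodule is stable under `S a b` if it is stable under the generators. -/
theorem S_mul_mem {T : Submodule Lam A}
    (hT : ∀ i, a ≤ i → i < b → ∀ t ∈ T, s.g i * t ∈ T ∧ s.e i * t ∈ T) {x t : A}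
    (hx : x ∈ s.S a b) (ht : t ∈ T) : x * t ∈ T := by
  induction hx using Algebra.adjoin_induction generalizing t with
  | mem x hx =>
    obtain ⟨i, h1, h2, rfl | rfl⟩ := hx
    · exact (hT i h1 h2 t ht).1
    · exact (hT i h1 h2 t ht).2
  | algebraMap r => rw [← Algebra.smul_def]; exact T.smul_mem r ht
  | add x y _ _ hx hy => rw [add_mul]; exact T.add_mem (hx ht) (hy ht)
  | mul x y _ _ hx hy => rw [mul_assoc]; exact hx (hy ht)

theorem S_le_bot (h : b ≤ a) {x : A} (hx : x ∈ s.S a b) : ∃ r : Lam, x = algebraMap Lam A r := by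
  have : s.S a b ≤ ⊥ := by
    refine Algebra.adjoin_le ?_
    rintro x ⟨i, h1, h2, -⟩
    omega
  obtain ⟨r, hr⟩ := this hx
  exact ⟨r, hr.symm⟩

/-- The products `x * m * y` with `x, y ∈ S a b` and `m ∈ {1, g_b, e_b}`. -/
def STri (s : Sys A N) (a b : ℕ) : Set A :=
  {t | ∃ x ∈ s.S a b, ∃ m, (m = 1 ∨ m = s.g b ∨ m = s.e b) ∧ ∃ y ∈ s.S a b, t = x * m * y}

/-- For `a < b` the middle factor `x` is written with at most one letter of index `b - 1`. The
remaining factors commute with `m` and `m'` and can be moved outwards, so that a product of three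
letters with indices `b`, `b - 1`, `b` is left; each such product is rewritten with at most one
letter of index `b`. -/
theorem mul_mul_mem_STri_aux (hab : a ≤ b) (hb : b < N) (hS : a < b → ∀ x ∈ s.S a b,
    x ∈ Submodule.span Lam (STri s a (b - 1))) {x : A} (hx : x ∈ s.S a b) {m m' : A}
    (hm : m = s.g b ∨ m = s.e b) (hm' : m' = 1 ∨ m' = s.g b ∨ m' = s.e b) :
    m * x * m' ∈ Submodule.span Lam (STri s a b) := by
  have hmem : ∀ {x m y : A}, x ∈ s.S a b → (m = 1 ∨ m = s.g b ∨ m = s.e b) → y ∈ s.S a b →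
      x * m * y ∈ Submodule.span Lam (STri s a b) := fun hx hm hy =>
    Submodule.subset_span ⟨_, hx, _, hm, _, hy, rfl⟩
  have h1 : (1 : A) ∈ Submodule.span Lam (STri s a b) := by
    simpa using hmem (one_mem _) (Or.inl rfl) (one_mem _)
  have hg : s.g b ∈ Submodule.span Lam (STri s a b) := by
    simpa using hmem (one_mem _) (Or.inr (Or.inl rfl)) (one_mem _)
  have he : s.e b ∈ Submodule.span Lam (STri s a b) := by
    simpa using hmem (one_mem _) (Or.inr (Or.inr rfl)) (one_mem _)
  have hmm : m * m' ∈ Submodule.span Lam (STri s a b) := by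
    rcases hm with rfl | rfl <;> rcases hm' with rfl | rfl | rfl
    · rwa [mul_one]
    · rw [s.g_sq hb]
      exact sub_mem (add_mem h1 (Submodule.smul_mem _ _ hg)) (Submodule.smul_mem _ _ he)
    · rw [s.g_e hb]
      exact Submodule.smul_mem _ _ he
    · rwa [mul_one]
    · rw [s.e_g hb]
      exact Submodule.smul_mem _ _ he
    · rw [s.idem hb]
      exact Submodule.smul_mem _ _ he
  by_cases hm1 : m' = 1
  · subst hm1
    rw [mul_one]
    rcases hm with rfl | rfl
    · simpa using hmem (one_mem _) (Or.inr (Or.inl rfl)) hx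
    · simpa using hmem (one_mem _) (Or.inr (Or.inr rfl)) hx
  replace hm' := hm'.resolve_left hm1
  rcases hab.eq_or_lt with rfl | hab
  · obtain ⟨r, rfl⟩ := S_le_bot le_rfl hx
    rw [← Algebra.commutes, mul_assoc, ← Algebra.smul_def]
    exact Submodule.smul_mem _ _ hmm
  · have hadj : b - 1 + 1 = b ∨ b + 1 = b - 1 := by omega
    have hb1 : b - 1 < N := by omega
    have hg1 : s.g (b - 1) ∈ s.S a b := g_mem (by omega) (by omega)
    have he1 : s.e (b - 1) ∈ s.S a b := e_mem (by omega) (by omega)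
    have hi1 : s.gi (b - 1) ∈ s.S a b := gi_mem (by omega) (by omega) (by omega)
    have core : ∀ p, (p = 1 ∨ p = s.g (b - 1) ∨ p = s.e (b - 1)) →
        m * p * m' ∈ Submodule.span Lam (STri s a b) := by
      rintro p (rfl | rfl | rfl)
      · rwa [mul_one]
      · rcases hm with rfl | rfl <;> rcases hm' with rfl | rfl
        · rw [s.braid hb hb1 hadj.symm]
          exact hmem hg1 (by simp) hg1
        · rw [s.gge hb hb1 hadj.symm]
          simpa using hmem he1 (Or.inr (Or.inr rfl)) (one_mem _)
        · rw [s.egg hb hb1 hadj.symm]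
          simpa using hmem (one_mem _) (Or.inr (Or.inr rfl)) he1
        · rw [s.ege hb hb1 hadj.symm]
          exact Submodule.smul_mem _ _ he
      · rcases hm with rfl | rfl <;> rcases hm' with rfl | rfl
        · rw [mul_assoc, s.e_g_adj hb1 hb hadj, ← mul_assoc, ← mul_assoc, s.g_e_e hb1 hb hadj]
          exact hmem hi1 (by simp) hi1
        · rw [s.g_e_e hb1 hb hadj]
          simpa using hmem hi1 (Or.inr (Or.inr rfl)) (one_mem _)
        · rw [s.e_e_g hb1 hb hadj]
          simpa using hmem (one_mem _) (Or.inr (Or.inr rfl)) hi1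
        · rw [s.eee hb hb1 hadj.symm]
          exact he
    have hstab : ∀ {t u v : A}, t ∈ Submodule.span Lam (STri s a b) → u ∈ s.S a b → v ∈ s.S a b →
        u * t * v ∈ Submodule.span Lam (STri s a b) := by
      intro t u v ht hu hv
      refine mul_mul_mem_of_mem_span ?_ ht
      rintro t ⟨x, hx, m, hm, y, hy, rfl⟩
      have := hmem (mul_mem hu hx) hm (mul_mem hy hv)
      simpa only [mul_assoc] using this
    have hmS : ∀ {m}, (m = s.g b ∨ m = s.e b) → m ∈ s.S b (b + 1) := by
      rintro m (rfl | rfl)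
      · exact g_mem le_rfl (by omega)
      · exact e_mem le_rfl (by omega)
    refine mul_mul_mem_of_mem_span ?_ (hS hab x hx)
    rintro x ⟨x, hx, p, hp, y, hy, rfl⟩
    have e1 := S_commute (s := s) (by omega) (by omega) hx (hmS hm)
    have e2 : y * m' = m' * y :=
      S_commute (s := s) (c := b) (d := b + 1) (by omega) (by omega) hy (hmS hm')
    rw [mul_mul_mul_comm_of_comm p e1 e2]
    exact hstab (core p hp) (mem_S le_rfl (by omega) hx) (mem_S le_rfl (by omega) hy)

/-- The span of `STri s a b` contains `1` and is stable under left multiplication by the generators.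
For the last generator this is `mul_mul_mem_STri_aux`, whose hypothesis about the smaller algebra is
the induction hypothesis. -/
theorem S_succ_le (hab : a ≤ b) (hb : b < N) {x : A} (hx : x ∈ s.S a (b + 1)) :
    x ∈ Submodule.span Lam (STri s a b) := by
  induction b using Nat.strong_induction_on generalizing x with
  | _ b ih =>
    have h1 : (1 : A) ∈ Submodule.span Lam (STri s a b) :=
      Submodule.subset_span ⟨1, one_mem _, 1, Or.inl rfl, 1, one_mem _, by simp⟩
    have hstab : ∀ {t u v : A}, t ∈ Submodule.span Lam (STri s a b) → u ∈ s.S a b → v ∈ s.S a b →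
        u * t * v ∈ Submodule.span Lam (STri s a b) := by
      intro t u v ht hu hv
      refine mul_mul_mem_of_mem_span ?_ ht
      rintro t ⟨x, hx, m, hm, y, hy, rfl⟩
      refine Submodule.subset_span ⟨_, mul_mem hu hx, m, hm, _, mul_mem hy hv, ?_⟩
      simp only [mul_assoc]
    rw [← mul_one x]
    refine S_mul_mem ?_ hx h1
    intro i h1 h2 t ht
    have key : ∀ m, (m = s.g i ∨ m = s.e i) → m * t ∈ Submodule.span Lam (STri s a b) := by
      intro m hm
      rcases (Nat.lt_succ_iff.mp h2).eq_or_lt with rfl | h2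
      · rw [← mul_one (m * t)]
        refine mul_mul_mem_of_mem_span ?_ ht
        rintro t ⟨x, hx, m', hm', y, hy, rfl⟩
        have := hstab (mul_mul_mem_STri_aux hab hb (fun h x hx => ih (i - 1) (by omega) (by omega)
          (by omega) (by rwa [Nat.sub_add_cancel (by omega)])) hx hm hm') (one_mem _) hy
        simpa only [mul_assoc, one_mul, mul_one] using this
      · have hmS : m ∈ s.S a b := by
          rcases hm with rfl | rfl
          · exact g_mem h1 h2
          · exact e_mem h1 h2
        simpa using hstab ht hmS (one_mem _)
    exact ⟨key _ (Or.inl rfl), key _ (Or.inr rfl)⟩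

theorem S_succ_induction (hab : a ≤ b) (hb : b < N) {T : Submodule Lam A} {u v : A}
    (h : ∀ x ∈ s.S a b, ∀ m, (m = 1 ∨ m = s.g b ∨ m = s.e b) → ∀ y ∈ s.S a b,
      u * (x * m * y) * v ∈ T) {x : A} (hx : x ∈ s.S a (b + 1)) : u * x * v ∈ T := by
  refine mul_mul_mem_of_mem_span ?_ (S_succ_le hab hb hx)
  rintro t ⟨x, hx, m, hm, y, hy, rfl⟩
  exact h x hx m hm y hy

/-- The elements `x * t` with `x ∈ S a b`. -/
noncomputable def SMul (s : Sys A N) (a b : ℕ) (t : A) : Submodule Lam A :=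
  (Subalgebra.toSubmodule (s.S a b)).map (LinearMap.mulRight Lam t)

theorem mem_SMul {t x : A} : x ∈ s.SMul a b t ↔ ∃ y ∈ s.S a b, y * t = x := Iff.rfl

/-- By `S_succ_le` at most one letter of index `b` precedes `e_b`, and between them at most one
letter of index `b - 1` matters. The relations absorb the first of these letters into `e_b`, leaving
a factor from `S a b`. -/
theorem S_succ_mul_e (hab : a ≤ b) (hb : b < N) {x : A} (hx : x ∈ s.S a (b + 1)) :
    ∃ y ∈ s.S a b, x * s.e b = y * s.e b := by
  suffices h : 1 * x * s.e b ∈ s.SMul a b (s.e b) by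
    obtain ⟨y, hy, h⟩ := mem_SMul.mp h
    exact ⟨y, hy, by rw [h, one_mul]⟩
  refine S_succ_induction hab hb ?_ hx
  intro x hx m hm y hy
  suffices h : ∀ w ∈ s.S a b, m * w * s.e b ∈ s.SMul a b (s.e b) by
    obtain ⟨w, hw, h⟩ := mem_SMul.mp (h y hy)
    exact mem_SMul.mpr ⟨x * w, mul_mem hx hw, by
      rw [mul_assoc, h]; simp only [mul_assoc, one_mul]⟩
  intro w hw
  rcases hm with rfl | hm
  · exact mem_SMul.mpr ⟨w, hw, by rw [one_mul]⟩
  have hm1 : m * s.e b ∈ s.SMul a b (s.e b) := by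
    rcases hm with rfl | rfl
    · rw [s.g_e hb]
      exact Submodule.smul_mem _ _ (mem_SMul.mpr ⟨1, one_mem _, one_mul _⟩)
    · rw [s.idem hb]
      exact Submodule.smul_mem _ _ (mem_SMul.mpr ⟨1, one_mem _, one_mul _⟩)
  rcases hab.eq_or_lt with rfl | hab
  · obtain ⟨r, rfl⟩ := S_le_bot le_rfl hw
    rw [← Algebra.commutes, mul_assoc, ← Algebra.smul_def]
    exact Submodule.smul_mem _ _ hm1
  · have hadj : b - 1 + 1 = b ∨ b + 1 = b - 1 := by omega
    have hb1 : b - 1 < N := by omega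
    have he : ∀ {w}, w ∈ s.S a b → w * s.e b ∈ s.SMul a b (s.e b) := fun hw =>
      mem_SMul.mpr ⟨_, hw, rfl⟩
    have core : ∀ p, (p = 1 ∨ p = s.g (b - 1) ∨ p = s.e (b - 1)) →
        m * p * s.e b ∈ s.SMul a b (s.e b) := by
      rintro p (rfl | rfl | rfl)
      · rwa [mul_one]
      · rcases hm with rfl | rfl
        · rw [s.gge hb hb1 hadj.symm]
          exact he (e_mem (by omega) (by omega))
        · rw [s.ege hb hb1 hadj.symm]
          exact Submodule.smul_mem _ _ (mem_SMul.mpr ⟨1, one_mem _, one_mul _⟩)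
      · rcases hm with rfl | rfl
        · rw [s.g_e_e hb1 hb hadj]
          exact he (gi_mem (by omega) (by omega) (by omega))
        · rw [s.eee hb hb1 hadj.symm]
          exact mem_SMul.mpr ⟨1, one_mem _, one_mul _⟩
    have hmS : ∀ {m}, (m = s.g b ∨ m = s.e b) → m ∈ s.S b (b + 1) := by
      rintro m (rfl | rfl)
      · exact g_mem le_rfl (by omega)
      · exact e_mem le_rfl (by omega)
    obtain ⟨b, rfl⟩ : ∃ c, b = c + 1 := ⟨b - 1, by omega⟩
    refine S_succ_induction (by omega) (by omega) ?_ hw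
    intro x hx p hp y hy
    have e1 := S_commute (s := s) (by omega) (by omega) hx (hmS hm)
    have e2 := S_commute (s := s) (by omega) (by omega) hy (hmS (m := s.e (b + 1)) (Or.inr rfl))
    obtain ⟨w, hw, h⟩ := mem_SMul.mp (core p hp)
    refine mem_SMul.mpr ⟨x * w * y, mul_mem (mul_mem (mem_S le_rfl (by omega) hx) hw)
      (mem_S le_rfl (by omega) hy), ?_⟩
    rw [mul_assoc, e2, ← mul_assoc, mul_assoc x, h]
    simp only [mul_assoc, e2]
    rw [← mul_assoc m x, ← e1]
    simp only [mul_assoc]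

/-- `S_succ_mul_e` first replaces `x` by an element of `S a b`. Such an element contains at most one
essential letter of index `b - 1`, and `e_b p e_b` is a multiple of `e_b` for each possible `p`. -/
theorem e_mul_S_mul_e (hab : a ≤ b) (hb : b < N) {x : A} (hx : x ∈ s.S a (b + 1)) :
    ∃ y ∈ s.S a (b - 1), s.e b * x * s.e b = y * s.e b := by
  obtain ⟨w, hw, h⟩ := S_succ_mul_e hab hb hx
  rw [mul_assoc, h, ← mul_assoc]
  suffices h : s.e b * w * s.e b ∈ s.SMul a (b - 1) (s.e b) by
    obtain ⟨y, hy, h⟩ := mem_SMul.mp h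
    exact ⟨y, hy, by rw [h]⟩
  have h1 : s.e b ∈ s.SMul a (b - 1) (s.e b) := mem_SMul.mpr ⟨1, one_mem _, one_mul _⟩
  rcases hab.eq_or_lt with rfl | hab
  · obtain ⟨r, rfl⟩ := S_le_bot le_rfl hw
    rw [← Algebra.commutes, mul_assoc, ← Algebra.smul_def, s.idem hb]
    exact Submodule.smul_mem _ _ (Submodule.smul_mem _ _ h1)
  · obtain ⟨b, rfl⟩ : ∃ c, b = c + 1 := ⟨b - 1, by omega⟩
    have core : ∀ p, (p = 1 ∨ p = s.g b ∨ p = s.e b) →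
        ∃ r : Lam, s.e (b + 1) * p * s.e (b + 1) = r • s.e (b + 1) := by
      rintro p (rfl | rfl | rfl)
      · exact ⟨_, by rw [mul_one, s.idem hb]⟩
      · exact ⟨_, s.ege hb (by omega) (by omega)⟩
      · exact ⟨1, by rw [s.eee hb (by omega) (by omega), one_smul]⟩
    refine S_succ_induction (by omega) (by omega) ?_ hw
    intro x hx p hp y hy
    have he : s.e (b + 1) ∈ s.S (b + 1) (b + 2) := e_mem le_rfl (by omega)
    have e1 := S_commute (s := s) (by omega) (by omega) hx he
    have e2 := S_commute (s := s) (by omega) (by omega) hy he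
    obtain ⟨r, hr⟩ := core p hp
    refine mem_SMul.mpr ⟨x * (r • y), mul_mem hx (Subalgebra.smul_mem _ hy r), ?_⟩
    rw [mul_mul_mul_comm_of_comm p e1 e2, hr, mul_assoc, mul_assoc, smul_mul_assoc, smul_mul_assoc,
      e2]

end Sys
end BMW

namespace BMW
namespace Sys

variable {A : Type} [Ring A] [Algebra Lam A] {N : ℕ} {s : Sys A N} {a b c d i j k : ℕ}

theorem S_rev_le {x : A} (h : ∀ i, a ≤ i → i < b → c ≤ N - 1 - i ∧ N - 1 - i < d)
    (hx : x ∈ s.rev.S a b) : x ∈ s.S c d := by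
  refine (Algebra.adjoin_le ?_ : s.rev.S a b ≤ s.S c d) hx
  rintro x ⟨i, h1, h2, rfl | rfl⟩
  · exact g_mem (h i h1 h2).1 (h i h1 h2).2
  · exact e_mem (h i h1 h2).1 (h i h1 h2).2

theorem le_S_rev {x : A} (hb : b ≤ N) (h : ∀ i, a ≤ i → i < b → c ≤ N - 1 - i ∧ N - 1 - i < d)
    (hx : x ∈ s.S a b) : x ∈ s.rev.S c d := by
  refine (Algebra.adjoin_le ?_ : s.S a b ≤ s.rev.S c d) hx
  rintro x ⟨i, h1, h2, h3⟩
  have : N - 1 - (N - 1 - i) = i := by omega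
  refine Algebra.subset_adjoin ⟨N - 1 - i, (h i h1 h2).1, (h i h1 h2).2, ?_⟩
  simp only [rev, this]
  exact h3

/-- The mirror image of `e_mul_S_mul_e` under `rev`. -/
theorem e_mul_S_mul_e' (hab : a < b) (hb : b ≤ N) {x : A} (hx : x ∈ s.S a b) :
    ∃ y ∈ s.S (a + 2) b, s.e a * x * s.e a = y * s.e a := by
  have h1 : x ∈ s.rev.S (N - b) (N - 1 - a + 1) := le_S_rev hb (by omega) hx
  obtain ⟨y, hy, h⟩ := e_mul_S_mul_e (s := s.rev) (by omega) (by omega) h1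
  have : N - 1 - (N - 1 - a) = a := by omega
  simp only [rev, this] at h
  exact ⟨y, S_rev_le (by omega) hy, h⟩

/-! #### Words -/

/-- `g_{b-1} ⋯ g_{a+1} g_a`. -/
def D (s : Sys A N) (a : ℕ) : ℕ → A
  | 0 => 1
  | b + 1 => if a ≤ b then s.g b * s.D a b else 1

/-- `e_{b-1} ⋯ e_{a+1} e_a`. -/
def Ed (s : Sys A N) (a : ℕ) : ℕ → A
  | 0 => 1
  | b + 1 => if a ≤ b then s.e b * s.Ed a b else 1

/-- `e_a e_{a+2} ⋯ e_{a+2k-2}`. -/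
def eps (s : Sys A N) (a : ℕ) : ℕ → A
  | 0 => 1
  | k + 1 => s.eps a k * s.e (a + 2 * k)

theorem D_succ (h : a ≤ b) : s.D a (b + 1) = s.g b * s.D a b := if_pos h

theorem D_of_le (h : b ≤ a) : s.D a b = 1 := by
  rcases b with _ | b
  · rfl
  · exact if_neg (by omega)

theorem Ed_succ (h : a ≤ b) : s.Ed a (b + 1) = s.e b * s.Ed a b := if_pos h

theorem Ed_of_le (h : b ≤ a) : s.Ed a b = 1 := by
  rcases b with _ | b
  · rfl
  · exact if_neg (by omega)

theorem D_mul_D (h : a ≤ c) (h' : c ≤ b) : s.D c b * s.D a c = s.D a b := by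
  induction b, h' using Nat.le_induction with
  | base => rw [D_of_le le_rfl, one_mul]
  | succ b hb ih => rw [D_succ hb, D_succ (h.trans hb), mul_assoc, ih]

theorem Ed_mul_Ed (h : a ≤ c) (h' : c ≤ b) : s.Ed c b * s.Ed a c = s.Ed a b := by
  induction b, h' using Nat.le_induction with
  | base => rw [Ed_of_le le_rfl, one_mul]
  | succ b hb ih => rw [Ed_succ hb, Ed_succ (h.trans hb), mul_assoc, ih]

theorem D_one : s.D a (a + 1) = s.g a := by rw [D_succ le_rfl, D_of_le le_rfl, mul_one]

theorem Ed_one : s.Ed a (a + 1) = s.e a := by rw [Ed_succ le_rfl, Ed_of_le le_rfl, mul_one]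

theorem D_succ_left (h : a < b) : s.D a b = s.D (a + 1) b * s.g a := by
  rw [← D_mul_D (Nat.le_succ a) h, D_one]

theorem Ed_succ_left (h : a < b) : s.Ed a b = s.Ed (a + 1) b * s.e a := by
  rw [← Ed_mul_Ed (Nat.le_succ a) h, Ed_one]

theorem D_mem (hc : c ≤ a) (hd : b ≤ d) : s.D a b ∈ s.S c d := by
  induction b with
  | zero => exact one_mem _
  | succ b ih =>
    by_cases h : a ≤ b
    · rw [D_succ h]
      exact mul_mem (g_mem (by omega) (by omega)) (ih (by omega))
    · rw [D_of_le (by omega)]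
      exact one_mem _

theorem eps_zero : s.eps a 0 = 1 := rfl

theorem eps_succ : s.eps a (k + 1) = s.eps a k * s.e (a + 2 * k) := rfl

theorem eps_mem (hc : c ≤ a) (hd : a + 2 * k ≤ d + 1) : s.eps a k ∈ s.S c d := by
  induction k with
  | zero => exact one_mem _
  | succ k ih =>
    rw [eps_succ]
    exact mul_mem (ih (by omega)) (e_mem (by omega) (by omega))

theorem eps_comm (hc : a + 2 * k ≤ c) (hd : d ≤ N) {x : A} (hx : x ∈ s.S c d) :
    s.eps a k * x = x * s.eps a k := by
  rcases k with _ | k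
  · rw [eps_zero, one_mul, mul_one]
  · exact S_commute (s := s) (a := a) (b := a + 2 * k + 1) (by omega) hd
      (eps_mem le_rfl (by omega)) hx

theorem comm_eps (hb : b < a) (hd : a + 2 * k ≤ N + 1) {x : A} (hx : x ∈ s.S c b) :
    x * s.eps a k = s.eps a k * x :=
  S_commute (s := s) (c := a) (d := N) (by omega) le_rfl hx (eps_mem le_rfl hd)

theorem eps_succ' (h : a + 2 * k < N) : s.eps a (k + 1) = s.e a * s.eps (a + 2) k := by
  induction k with
  | zero => simp [eps]
  | succ k ih =>
    rw [eps_succ, ih (by omega), eps_succ, mul_assoc]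
    congr 3
    omega

/-- Only the two letters of the word next to `i` matter. They satisfy `g_{i+1} g_i g_{i+1} = g_i
g_{i+1} g_i` and `g_{i+1} g_i e_{i+1} = e_i e_{i+1} = e_i g_{i+1} g_i`. -/
theorem D_mul_gen (h1 : a < i) (h2 : i < b) (hb : b ≤ N) :
    s.D a b * s.g i = s.g (i - 1) * s.D a b ∧ s.D a b * s.e i = s.e (i - 1) * s.D a b := by
  obtain ⟨i, rfl⟩ : ∃ p, i = p + 1 := ⟨i - 1, by omega⟩
  have hD : s.D a b = s.D (i + 2) b * (s.g (i + 1) * s.g i) * s.D a i := by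
    rw [← D_mul_D (c := i + 2) (by omega) (by omega), D_succ (by omega), D_succ (by omega)]
    simp only [mul_assoc]
  have key : ∀ x y, x ∈ s.S (i + 1) (i + 2) → y ∈ s.S i (i + 1) →
      s.g (i + 1) * s.g i * x = y * (s.g (i + 1) * s.g i) → s.D a b * x = y * s.D a b := by
    intro x y hx hy hxy
    have e1 : s.D a i * x = x * s.D a i :=
      S_commute (s := s) (by omega) (by omega) (D_mem le_rfl le_rfl) hx
    have e2 : y * s.D (i + 2) b = s.D (i + 2) b * y :=
      S_commute (s := s) (by omega) (by omega) hy (D_mem le_rfl le_rfl)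
    rw [hD, mul_assoc, e1, ← mul_assoc, mul_assoc _ _ x, hxy, ← mul_assoc, ← e2]
    simp only [mul_assoc]
  simp only [Nat.add_sub_cancel]
  constructor
  · refine key _ _ (g_mem (by omega) (by omega)) (g_mem (by omega) (by omega)) ?_
    rw [s.braid (by omega) (by omega) (by omega), mul_assoc]
  · refine key _ _ (e_mem (by omega) (by omega)) (e_mem (by omega) (by omega)) ?_
    rw [s.gge (by omega) (by omega) (by omega), ← mul_assoc,
      s.egg (by omega) (by omega) (by omega)]

theorem D_mul_S (hac : a ≤ c) (hd : d ≤ b) (hb : b ≤ N) {x : A} (hx : x ∈ s.S (c + 1) d) :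
    ∃ y ∈ s.S c (d - 1), s.D a b * x = y * s.D a b := by
  induction hx using Algebra.adjoin_induction with
  | mem x hx =>
    obtain ⟨i, h1, h2, rfl | rfl⟩ := hx
    · exact ⟨_, g_mem (by omega) (by omega), (D_mul_gen (by omega) (by omega) hb).1⟩
    · exact ⟨_, e_mem (by omega) (by omega), (D_mul_gen (by omega) (by omega) hb).2⟩
  | algebraMap r => exact ⟨_, Subalgebra.algebraMap_mem _ r, (Algebra.commutes _ _).symm⟩
  | add x y _ _ hx hy =>
    obtain ⟨x', hx, hx'⟩ := hx
    obtain ⟨y', hy, hy'⟩ := hy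
    exact ⟨_, add_mem hx hy, by rw [mul_add, hx', hy', add_mul]⟩
  | mul x y _ _ hx hy =>
    obtain ⟨x', hx, hx'⟩ := hx
    obtain ⟨y', hy, hy'⟩ := hy
    exact ⟨_, mul_mem hx hy, by rw [← mul_assoc, hx', mul_assoc, hy', mul_assoc]⟩

theorem S_mul_D (hac : a ≤ c) (hd : d < b) (hb : b ≤ N) {x : A} (hx : x ∈ s.S c d) :
    ∃ y ∈ s.S (c + 1) (d + 1), x * s.D a b = s.D a b * y := by
  induction hx using Algebra.adjoin_induction with
  | mem x hx =>
    obtain ⟨i, h1, h2, rfl | rfl⟩ := hx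
    · exact ⟨s.g (i + 1), g_mem (by omega) (by omega),
        (D_mul_gen (i := i + 1) (by omega) (by omega) hb).1.symm⟩
    · exact ⟨s.e (i + 1), e_mem (by omega) (by omega),
        (D_mul_gen (i := i + 1) (by omega) (by omega) hb).2.symm⟩
  | algebraMap r => exact ⟨_, Subalgebra.algebraMap_mem _ r, Algebra.commutes _ _⟩
  | add x y _ _ hx hy =>
    obtain ⟨x', hx, hx'⟩ := hx
    obtain ⟨y', hy, hy'⟩ := hy
    exact ⟨_, add_mem hx hy, by rw [add_mul, hx', hy', mul_add]⟩
  | mul x y _ _ hx hy =>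
    obtain ⟨x', hx, hx'⟩ := hx
    obtain ⟨y', hy, hy'⟩ := hy
    exact ⟨_, mul_mem hx hy, by rw [mul_assoc, hy', ← mul_assoc, hx', mul_assoc]⟩

theorem D_mul_D_shift (hac : a < c) (hd : d ≤ b) (hb : b ≤ N) :
    s.D a b * s.D c d = s.D (c - 1) (d - 1) * s.D a b := by
  induction d with
  | zero => simp [D]
  | succ d ih =>
    by_cases h : c ≤ d
    · obtain ⟨d, rfl⟩ : ∃ p, d = p + 1 := ⟨d - 1, by omega⟩
      rw [D_succ h, ← mul_assoc, (D_mul_gen (by omega) (by omega) hb).1, mul_assoc, ih (by omega),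
        ← mul_assoc, Nat.add_sub_cancel, Nat.add_sub_cancel, D_succ (by omega)]
    · rw [D_of_le (a := c) (by omega), D_of_le (a := c - 1) (by omega), one_mul, mul_one]

/-- Each letter passed creates a further factor through `e_{b+1} g_b = e_{b+1} e_b g_{b+1}⁻¹`, and
the inverse commutes with the rest of the word. -/
theorem e_mul_D (hab : a ≤ b) (hb : b < N) :
    ∃ y ∈ s.S (a + 1) (b + 1), s.e b * s.D a b = s.Ed a (b + 1) * y := by
  induction b, hab using Nat.le_induction with
  | base => exact ⟨1, one_mem _, by rw [D_of_le le_rfl, Ed_one]⟩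
  | succ b hab ih =>
    obtain ⟨y, hy, h⟩ := ih (by omega)
    refine ⟨y * s.gi (b + 1), mul_mem (mem_S le_rfl (by omega) hy)
      (gi_mem (by omega) (by omega) (by omega)), ?_⟩
    have e1 : s.D a b * s.gi (b + 1) = s.gi (b + 1) * s.D a b :=
      S_commute (s := s) (c := b + 1) (d := b + 2) (by omega) (by omega) (D_mem le_rfl le_rfl)
        (gi_mem (by omega) (by omega) (by omega))
    rw [D_succ hab, ← mul_assoc, s.e_g_adj (by omega) (by omega) (by omega), mul_assoc, ← e1,
      ← mul_assoc, mul_assoc (s.e (b + 1)), h, Ed_succ (by omega : a ≤ b + 1)]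
    simp only [mul_assoc]

/-- The two words move a pair of strings that are joined by the minimum of `e_a`. The pair slides
across the other strings, and the letters `g` turn into letters `e` one by one through `gge`. -/
theorem D_mul_D_mul_e (hab : a ≤ b) (hb : b < N) :
    s.D a b * s.D (a + 1) (b + 1) * s.e a = s.Ed a (b + 1) := by
  induction b, hab using Nat.le_induction with
  | base => rw [D_of_le le_rfl, D_of_le le_rfl, Ed_one, one_mul, one_mul]
  | succ b hab ih =>
    have e1 : s.D a b * s.g (b + 1) = s.g (b + 1) * s.D a b :=
      S_commute (s := s) (c := b + 1) (d := b + 2) (by omega) (by omega) (D_mem le_rfl le_rfl)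
        (g_mem (by omega) (by omega))
    rw [D_succ hab, D_succ (by omega : a + 1 ≤ b + 1), mul_assoc (s.g b), ← mul_assoc (s.D a b), e1,
      mul_assoc, mul_assoc, mul_assoc, ← mul_assoc (s.D a b), ih (by omega), Ed_succ hab,
      ← mul_assoc, ← mul_assoc, s.gge (by omega) (by omega) (by omega), mul_assoc, ← Ed_succ hab,
      ← Ed_succ (by omega)]

theorem e_mul_D_mul_D (hab : a ≤ b) (hb : b < N) :
    s.e b * s.D a b * s.D (a + 1) (b + 1) = s.Ed a (b + 1) := by
  induction hd : b - a generalizing a with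
  | zero =>
    obtain rfl : a = b := by omega
    rw [D_of_le le_rfl, D_of_le le_rfl, Ed_one, mul_one, mul_one]
  | succ d ih =>
    have e1 : s.g a * s.D (a + 2) (b + 1) = s.D (a + 2) (b + 1) * s.g a :=
      S_commute (s := s) (a := a) (b := a + 1) (by omega) (by omega) (g_mem (by omega) (by omega))
        (D_mem le_rfl le_rfl)
    rw [D_succ_left (by omega : a < b), D_succ_left (by omega : a + 1 < b + 1), ← mul_assoc,
      ← mul_assoc, mul_assoc _ (s.g a), e1, ← mul_assoc, ih (by omega) (by omega),
      Ed_succ_left (by omega : a + 1 < b + 1), Ed_succ_left (by omega : a < b + 1),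
      Ed_succ_left (by omega : a + 1 < b + 1), mul_assoc, mul_assoc, ← mul_assoc (s.e (a + 1)),
      s.egg (by omega) (by omega) (by omega)]
    simp only [mul_assoc]

/-! #### Decomposition with respect to the first string -/

/-- Since `e_{i+1} = e_{i+1} e_i e_{i+1}`, all `e_i` of the range generate the same ideal. -/
theorem exists_e_eq (hai : a ≤ i) (hib : i < b) (hb : b ≤ N) :
    ∃ u ∈ s.S a b, ∃ v ∈ s.S a b, s.e i = u * s.e a * v := by
  induction i, hai using Nat.le_induction with
  | base => exact ⟨1, one_mem _, 1, one_mem _, by simp⟩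
  | succ i hai ih =>
    obtain ⟨u, hu, v, hv, h⟩ := ih (by omega)
    have he : s.e (i + 1) ∈ s.S a b := e_mem (by omega) hib
    refine ⟨_, mul_mem he hu, _, mul_mem hv he, ?_⟩
    have h3 := (s.eee (i := i + 1) (j := i) (by omega) (by omega) (by omega)).symm
    rw [h] at h3
    exact h3.trans (by simp only [mul_assoc])

/-- The products `D a j * y` with `y ∈ S (a + 1) b` and the elements of the ideal of `e_a`. -/
def HSet (s : Sys A N) (a b : ℕ) : Set A :=
  {t | (∃ j, a ≤ j ∧ j ≤ b ∧ ∃ y ∈ s.S (a + 1) b, t = s.D a j * y) ∨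
    ∃ u ∈ s.S a b, ∃ v ∈ s.S a b, t = u * s.e a * v}

/-- Modulo the ideal of `e_a` the relations are those of a Hecke algebra, where the words `D a j`
represent the cosets of the subgroup fixing the first point. Stability of the span under the
generators is checked by comparing `i` with `j`; only the quadratic relation produces a term in the
ideal of `e_a`. -/
theorem S_le_HSet (hab : a ≤ b) (hb : b ≤ N) {x : A} (hx : x ∈ s.S a b) :
    x ∈ Submodule.span Lam (s.HSet a b) := by
  have hD : ∀ {j y}, a ≤ j → j ≤ b → y ∈ s.S (a + 1) b →
      s.D a j * y ∈ Submodule.span Lam (s.HSet a b) := fun h1 h2 h3 =>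
    Submodule.subset_span (Or.inl ⟨_, h1, h2, _, h3, rfl⟩)
  have hE : ∀ {u v}, u ∈ s.S a b → v ∈ s.S a b →
      u * s.e a * v ∈ Submodule.span Lam (s.HSet a b) := fun h1 h2 =>
    Submodule.subset_span (Or.inr ⟨_, h1, _, h2, rfl⟩)
  rw [← mul_one x]
  refine S_mul_mem ?_ hx (by simpa [D_of_le] using hD le_rfl hab (one_mem _))
  intro i h1 h2 t ht
  have he : ∀ {y}, y ∈ s.S a b → s.e i * y ∈ Submodule.span Lam (s.HSet a b) := by
    intro y hy
    obtain ⟨u, hu, v, hv, h⟩ := exists_e_eq (s := s) h1 h2 hb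
    rw [h, mul_assoc]
    exact hE hu (mul_mem hv hy)
  rw [← mul_one (s.g i * t), ← mul_one (s.e i * t)]
  constructor
  · refine mul_mul_mem_of_mem_span ?_ ht
    rintro t (⟨j, hj1, hj2, y, hy, rfl⟩ | ⟨u, hu, v, hv, rfl⟩)
    · rw [mul_one]
      rcases lt_trichotomy i j with hij | rfl | hij
      · rcases (Nat.succ_le_of_lt hij).eq_or_lt with rfl | hij'
        · rw [Nat.succ_eq_add_one, D_succ h1, ← mul_assoc, ← mul_assoc, s.g_sq (by omega), sub_mul,
            sub_mul, add_mul, add_mul, one_mul, smul_mul_assoc, smul_mul_assoc, smul_mul_assoc,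
            smul_mul_assoc, ← D_succ h1, mul_assoc (s.e i)]
          exact sub_mem (add_mem (hD h1 (by omega) hy) (Submodule.smul_mem _ _ (hD hj1 hj2 hy)))
            (Submodule.smul_mem _ _ (he (mul_mem (D_mem le_rfl (by omega))
              (mem_S (by omega) le_rfl hy))))
        · have := (D_mul_gen (s := s) (a := a) (b := j) (i := i + 1) (by omega) (by omega)
            (by omega)).1
          rw [← mul_assoc, ← Nat.add_sub_cancel (n := i) (m := 1), ← this, mul_assoc]
          exact hD hj1 hj2 (mul_mem (g_mem (by omega) (by omega)) hy)
      · rw [← mul_assoc, ← D_succ h1]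
        exact hD (by omega) (by omega) hy
      · rcases hj1.eq_or_lt with rfl | hj1
        · rw [D_of_le le_rfl, one_mul]
          have := hD (j := a) le_rfl hj2 (mul_mem (g_mem (i := i) (by omega) h2) hy)
          rwa [D_of_le le_rfl, one_mul] at this
        · have e1 : s.D a j * s.g i = s.g i * s.D a j :=
            S_commute (s := s) (c := i) (d := b) (by omega) hb (D_mem le_rfl le_rfl)
              (g_mem le_rfl h2)
          rw [← mul_assoc, ← e1, mul_assoc]
          exact hD hj1.le hj2 (mul_mem (g_mem (by omega) h2) hy)
    · have := hE (mul_mem (g_mem h1 h2) hu) hv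
      simpa only [mul_assoc, mul_one] using this
  · refine mul_mul_mem_of_mem_span ?_ ht
    rintro t (⟨j, hj1, hj2, y, hy, rfl⟩ | ⟨u, hu, v, hv, rfl⟩)
    · rw [mul_one]
      exact he (mul_mem (D_mem le_rfl hj2) (mem_S (by omega) le_rfl hy))
    · have := hE (mul_mem (e_mem h1 h2) hu) hv
      simpa only [mul_assoc, mul_one] using this

end Sys
end BMW

/-! ### The left ideal generated by the arcs, with the last string separated. -/

namespace BMW
namespace Sys

variable {A : Type} [Ring A] [Algebra Lam A] {N : ℕ} {s : Sys A N} {a b c d i j k l m : ℕ}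

theorem mul_mem_span {X : Set A} {T : Submodule Lam A} {u : A} (h : ∀ x ∈ X, u * x ∈ T) {x : A}
    (hx : x ∈ Submodule.span Lam X) : u * x ∈ T := by
  have := mul_mul_mem_of_mem_span (u := u) (v := 1) (T := T)
    (fun x hx => by rw [mul_one]; exact h x hx) hx
  rwa [mul_one] at this

theorem span_mul_mem {X : Set A} {T : Submodule Lam A} {v : A} (h : ∀ x ∈ X, x * v ∈ T) {x : A}
    (hx : x ∈ Submodule.span Lam X) : x * v ∈ T := by
  have := mul_mul_mem_of_mem_span (u := 1) (v := v) (T := T)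
    (fun x hx => by rw [one_mul]; exact h x hx) hx
  rwa [one_mul] at this

/-- Products arising from `S a b * D (a + 1) (b + 1) * e_a`. -/
def BSet (s : Sys A N) (a b : ℕ) : Set A :=
  {t | (∃ j, a ≤ j ∧ j ≤ b ∧ ∃ v ∈ s.S (a + 2) (b + 1),
      t = s.D a j * s.D (a + 1) (b + 1) * s.e a * v) ∨
    ∃ w ∈ s.S a b, ∃ v ∈ s.S (a + 2) (b + 1), t = w * s.e a * v}

/-- The factor `u` is expanded by `S_le_HSet`. A factor `y` that avoids the first string passes
through `D` with shifted indices and then through `e_a`. In the ideal of `e_a` two letters `e_a`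
enclose an element of the algebra, which `e_mul_S_mul_e'` reduces. -/
theorem mul_D_mul_e_mem (hab : a < b) (hb : b < N) {u : A} (hu : u ∈ s.S a b) :
    u * (s.D (a + 1) (b + 1) * s.e a) ∈ Submodule.span Lam (s.BSet a b) := by
  have hcomm : ∀ {v}, v ∈ s.S (a + 2) (b + 1) → s.e a * v = v * s.e a := fun hv =>
    S_commute (s := s) (a := a) (b := a + 1) (by omega) (by omega) (e_mem le_rfl (by omega)) hv
  refine span_mul_mem ?_ (S_le_HSet hab.le (by omega) hu)
  rintro t (⟨j, h1, h2, y, hy, rfl⟩ | ⟨u, hu, v, hv, rfl⟩)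
  · obtain ⟨y', hy', h⟩ := S_mul_D (s := s) (a := a + 1) (b := b + 1) le_rfl (by omega) (by omega) hy
    refine Submodule.subset_span (Or.inl ⟨j, h1, h2, y', hy', ?_⟩)
    rw [mul_assoc, ← mul_assoc y, h, mul_assoc, ← hcomm hy']
    simp only [mul_assoc]
  · obtain ⟨y, hy, h⟩ := e_mul_S_mul_e' (s := s) (a := a) (b := b + 1) (by omega) (by omega)
      (mul_mem (mem_S le_rfl (by omega) hv) (D_mem (s := s) (a := a + 1) (by omega) le_rfl))
    refine Submodule.subset_span (Or.inr ⟨u, hu, y, hy, ?_⟩)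
    rw [mul_assoc u (s.e a) y, hcomm hy, ← h]
    simp only [mul_assoc]

/-- Products that span `S 0 b * eps 0 k`, with the last string separated. -/
def QSet (s : Sys A N) (k b : ℕ) : Set A :=
  {t | ∃ x ∈ s.S 0 (b - 1), ∃ u ∈ s.S (2 * k) b, t = x * s.eps 0 k * u ∨
    (1 ≤ k ∧ t = x * s.D (2 * k - 1) b * s.eps 0 k * u)}

section step

variable (hk : 2 * k + 1 ≤ b) (hb : b < N)

local notation "T" => Submodule.span Lam (QSet s (k + 1) (b + 1))

theorem QSet_mul {t u : A} (ht : t ∈ T) (hu : u ∈ s.S (2 * (k + 1)) (b + 1)) : t * u ∈ T := by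
  refine span_mul_mem ?_ ht
  rintro t ⟨x, hx, v, hv, rfl | ⟨h, rfl⟩⟩
  · exact Submodule.subset_span ⟨x, hx, v * u, mul_mem hv hu, Or.inl (mul_assoc _ _ _)⟩
  · exact Submodule.subset_span ⟨x, hx, v * u, mul_mem hv hu, Or.inr ⟨h, mul_assoc _ _ _⟩⟩

theorem mul_QSet {t x : A} (ht : t ∈ T) (hx : x ∈ s.S 0 b) : x * t ∈ T := by
  refine mul_mem_span ?_ ht
  rintro t ⟨y, hy, v, hv, rfl | ⟨h, rfl⟩⟩
  · exact Submodule.subset_span ⟨x * y, mul_mem hx hy, v, hv, Or.inl (by simp only [mul_assoc])⟩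
  · exact Submodule.subset_span
      ⟨x * y, mul_mem hx hy, v, hv, Or.inr ⟨h, by simp only [mul_assoc]⟩⟩

theorem eps_mem_QSet : s.eps 0 (k + 1) ∈ T :=
  Submodule.subset_span ⟨1, one_mem _, 1, one_mem _, Or.inl (by simp)⟩

theorem D_eps_mem_QSet : s.D (2 * k + 1) (b + 1) * s.eps 0 (k + 1) ∈ T :=
  Submodule.subset_span ⟨1, one_mem _, 1, one_mem _, Or.inr ⟨by omega, by simp; rfl⟩⟩

include hk hb

theorem eps_succ_comm : s.eps 0 (k + 1) = s.e (2 * k) * s.eps 0 k := by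
  rw [eps_succ, zero_add]
  exact eps_comm (s := s) (c := 2 * k) (d := N) (by omega) le_rfl (e_mem le_rfl (by omega))

theorem Ed_mul_eps : s.Ed (2 * k + 1) (b + 1) * s.eps 0 (k + 1) =
    s.D (2 * k) b * (s.D (2 * k + 1) (b + 1) * s.eps 0 (k + 1)) := by
  rw [eps_succ_comm hk hb, ← mul_assoc, ← Ed_succ_left (by omega),
    ← D_mul_D_mul_e (by omega) hb]
  simp only [mul_assoc]

theorem Ed_mul_eps_mem : s.Ed (2 * k + 1) (b + 1) * s.eps 0 (k + 1) ∈ T := by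
  rw [Ed_mul_eps hk hb]
  exact mul_QSet D_eps_mem_QSet (D_mem (by omega) le_rfl)

/-- If there is a string beyond the arcs and position `b`, the induction hypothesis separates it,
and `m` commutes with the remaining left factor. Otherwise `b = 2 * k + 1`, and `S_succ_mul_e`
replaces `x` by an element that commutes with `m`. -/
theorem gen_mul_mul_eps_mem (ih : 2 * (k + 1) ≤ b → ∀ x ∈ s.S 0 b, x * s.eps 0 (k + 1) ∈
    Submodule.span Lam (QSet s (k + 1) b)) {m x : A} (hm : m = s.g b ∨ m = s.e b)
    (hx : x ∈ s.S 0 b) : m * (x * s.eps 0 (k + 1)) ∈ T := by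
  have hmS : m ∈ s.S b (b + 1) := by
    rcases hm with rfl | rfl
    · exact g_mem le_rfl (by omega)
    · exact e_mem le_rfl (by omega)
  rcases hk.eq_or_lt with rfl | hk'
  · obtain ⟨y, hy, h⟩ := S_succ_mul_e (s := s) (b := 2 * k) (by omega) (by omega) hx
    rw [eps_succ_comm hk hb, ← mul_assoc x, h, mul_assoc, ← eps_succ_comm hk hb, ← mul_assoc,
      ← S_commute (s := s) (by omega) (by omega) hy hmS, mul_assoc]
    refine mul_QSet ?_ (mem_S le_rfl (by omega) hy)
    rcases hm with rfl | rfl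
    · rw [← D_one]
      exact D_eps_mem_QSet
    · rw [← Ed_one]
      exact Ed_mul_eps_mem hk hb
  · refine mul_mem_span ?_ (ih (by omega) x hx)
    rintro t ⟨y, hy, u, hu, rfl | ⟨-, rfl⟩⟩
    · have h1 := S_commute (s := s) (by omega) (by omega) hy hmS
      have h2 := eps_comm (s := s) (a := 0) (k := k + 1) (by omega) (by omega) hmS
      have : m * (y * s.eps 0 (k + 1) * u) = y * (s.eps 0 (k + 1) * (m * u)) := by
        rw [← mul_assoc, ← mul_assoc, ← h1, mul_assoc y, ← h2]
        simp only [mul_assoc]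
      rw [this]
      exact mul_QSet (QSet_mul eps_mem_QSet (mul_mem (mem_S (by omega) le_rfl hmS)
        (mem_S le_rfl (by omega) hu))) (mem_S le_rfl (by omega) hy)
    · have h1 := S_commute (s := s) (by omega) (by omega) hy hmS
      have : m * (y * s.D (2 * (k + 1) - 1) b * s.eps 0 (k + 1) * u) =
          y * ((m * s.D (2 * k + 1) b) * s.eps 0 (k + 1) * u) := by
        rw [← mul_assoc, ← mul_assoc, ← mul_assoc, ← h1]
        simp only [mul_assoc]
        rfl
      rw [this]
      refine mul_QSet (QSet_mul ?_ (mem_S le_rfl (by omega) hu)) (mem_S le_rfl (by omega) hy)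
      rcases hm with rfl | rfl
      · rw [← D_succ (by omega)]
        exact D_eps_mem_QSet
      · obtain ⟨v, hv, h⟩ := e_mul_D (s := s) hk hb
        rw [h, mul_assoc, ← eps_comm (by omega) (by omega) hv, ← mul_assoc]
        exact QSet_mul (Ed_mul_eps_mem hk hb) hv

/-- The last two upper points belong to two different arcs. A crossing at these points is undone by
exchanging the roles of the two arcs, and `e_b` joins the arcs into one with a scalar factor `λ⁻¹`.
-/
theorem gen_mul_D_mul_D_mem {m : A} (hm : m = s.g b ∨ m = s.e b) (hk1 : 1 ≤ k) :
    m * (s.D (2 * k - 1) b * (s.D (2 * k + 1) (b + 1) * s.eps 0 (k + 1))) ∈ T := by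
  have hadj : 2 * k - 1 + 1 = 2 * k ∨ 2 * k + 1 = 2 * k - 1 := by omega
  rcases hm with rfl | rfl
  · rw [← mul_assoc, ← D_succ (by omega), ← mul_assoc,
      D_mul_D_shift (by omega) le_rfl (by omega), mul_assoc,
      ← D_mul_D (a := 2 * k - 1) (c := 2 * k + 1) (by omega) (by omega),
      D_succ (by omega : 2 * k - 1 ≤ 2 * k)]
    have h1 : s.D (2 * k - 1) (2 * k) = s.g (2 * k - 1) := by
      have := D_one (s := s) (a := 2 * k - 1)
      rwa [Nat.sub_add_cancel (by omega)] at this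
    have h2 : s.D (2 * k + 1) (b + 1) * s.e (2 * k - 1) =
        s.e (2 * k - 1) * s.D (2 * k + 1) (b + 1) :=
      (S_commute (s := s) (a := 2 * k - 1) (b := 2 * k) (by omega) (by omega)
        (e_mem (by omega) (by omega)) (D_mem le_rfl le_rfl)).symm
    rw [h1, eps_succ_comm hk hb, mul_assoc (s.D (2 * k + 1) (b + 1)), ← mul_assoc _ (s.e (2 * k)),
      s.gge (by omega) (by omega) (by omega), mul_assoc (s.e (2 * k - 1)), ← eps_succ_comm hk hb,
      ← mul_assoc (s.D (2 * k + 1) (b + 1)), h2, mul_assoc, ← mul_assoc]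
    exact mul_QSet D_eps_mem_QSet (mul_mem (D_mem (by omega) (by omega))
      (e_mem (by omega) (by omega)))
  · have h2 : s.g (2 * k - 1) * s.D (2 * k + 1) (b + 1) =
        s.D (2 * k + 1) (b + 1) * s.g (2 * k - 1) :=
      S_commute (s := s) (a := 2 * k - 1) (b := 2 * k) (by omega) (by omega)
        (g_mem (by omega) (by omega)) (D_mem le_rfl le_rfl)
    rw [D_succ_left (by omega : 2 * k - 1 < b), Nat.sub_add_cancel (by omega), mul_assoc,
      ← mul_assoc (s.g _), h2, mul_assoc, ← mul_assoc, ← mul_assoc,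
      e_mul_D_mul_D (by omega) hb, eps_succ_comm hk hb, Ed_succ_left (by omega), mul_assoc,
      ← mul_assoc (s.g _), ← mul_assoc (s.e _), ← mul_assoc (s.e _),
      s.ege (by omega) (by omega) (by omega), smul_mul_assoc, mul_smul_comm,
      ← eps_succ_comm hk hb]
    exact Submodule.smul_mem _ _ (Ed_mul_eps_mem hk hb)

/-- A single arc ends at the point `b + 1` and at the point `j`. For `j = b` it is a small arc under
`m`, which acts by a scalar. For `j < b` the letter `m` meets the first letter `g_b` of the long
word, and `g_sq` or `e_g` applies. -/
theorem gen_mul_D_mul_D_mem' (ih : 2 * (k + 1) ≤ b → ∀ x ∈ s.S 0 b, x * s.eps 0 (k + 1) ∈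
    Submodule.span Lam (QSet s (k + 1) b)) {m : A} (hm : m = s.g b ∨ m = s.e b)
    (hj : 2 * k ≤ j) (hjb : j ≤ b) :
    m * (s.D (2 * k) j * (s.D (2 * k + 1) (b + 1) * s.eps 0 (k + 1))) ∈ T := by
  rcases hjb.eq_or_lt with rfl | hjb
  · rw [← Ed_mul_eps hk hb, Ed_succ (by omega), mul_assoc, ← mul_assoc]
    have h := Ed_mul_eps_mem (s := s) hk hb
    rw [Ed_succ (by omega), mul_assoc] at h
    rcases hm with rfl | rfl
    · rw [s.g_e hb, smul_mul_assoc]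
      exact Submodule.smul_mem _ _ h
    · rw [s.idem hb, smul_mul_assoc]
      exact Submodule.smul_mem _ _ h
  · have hmS : m ∈ s.S b (b + 1) := by
      rcases hm with rfl | rfl
      · exact g_mem le_rfl (by omega)
      · exact e_mem le_rfl (by omega)
    rw [← mul_assoc, ← S_commute (s := s) (by omega) (by omega)
      (D_mem (s := s) (a := 2 * k) (b := j) le_rfl le_rfl) hmS, mul_assoc]
    refine mul_QSet ?_ (D_mem (by omega) (by omega))
    have he := gen_mul_mul_eps_mem hk hb ih (m := s.e b) (Or.inr rfl)
      (D_mem (s := s) (a := 2 * k + 1) (b := b) (by omega) le_rfl)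
    rw [D_succ hk, mul_assoc, ← mul_assoc]
    rcases hm with rfl | rfl
    · rw [s.g_sq hb, sub_mul, add_mul, one_mul, smul_mul_assoc, smul_mul_assoc]
      refine sub_mem (add_mem ?_ (Submodule.smul_mem _ _ ?_)) (Submodule.smul_mem _ _ he)
      · exact mul_QSet eps_mem_QSet (D_mem (by omega) le_rfl)
      · rw [← mul_assoc, ← D_succ hk]
        exact D_eps_mem_QSet
    · rw [s.e_g hb, smul_mul_assoc]
      exact Submodule.smul_mem _ _ he

/-- The two kinds of elements of `QSet` correspond to the last upper point lying on a through string
or on an arc, which may then be taken to be the last arc. Generators with index below `b` are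
absorbed by the left factor. For the index `b` the left factor is itself expanded by the induction
hypothesis, so that the last two upper points become explicit. -/
theorem mul_eps_mem_QSet_succ (ih : ∀ k, 2 * k ≤ b → ∀ x ∈ s.S 0 b, x * s.eps 0 k ∈
    Submodule.span Lam (QSet s k b)) {x : A} (hx : x ∈ s.S 0 (b + 1)) :
    x * s.eps 0 (k + 1) ∈ T := by
  have hA : ∀ {m x : A}, (m = s.g b ∨ m = s.e b) → x ∈ s.S 0 b →
      m * (x * s.eps 0 (k + 1)) ∈ T := fun hm hx =>
    gen_mul_mul_eps_mem hk hb (ih (k + 1)) hm hx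
  have hmS : ∀ {m}, (m = s.g b ∨ m = s.e b) → m ∈ s.S b (b + 1) := by
    rintro m (rfl | rfl)
    · exact g_mem le_rfl (by omega)
    · exact e_mem le_rfl (by omega)
  -- After the expansion of `u`, the terms with a word `D (2 * k) j` are those of `hPj`, and the
  -- terms in the ideal of `e_{2k}` reduce to `hA`.
  have hP : ∀ {P m u : A}, (m = s.g b ∨ m = s.e b) → P ∈ s.S 0 b → u ∈ s.S (2 * k) b →
      (∀ j, 2 * k ≤ j → j ≤ b →
        m * (P * (s.D (2 * k) j * (s.D (2 * k + 1) (b + 1) * s.eps 0 (k + 1)))) ∈ T) →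
      m * (P * s.eps 0 k * (u * (s.D (2 * k + 1) (b + 1) * s.e (2 * k)))) ∈ T := by
    intro P m u hm hPS hu hPj
    rw [← mul_assoc]
    refine mul_mem_span ?_ (mul_D_mul_e_mem (by omega) hb hu)
    rintro t (⟨j, hj1, hj2, v, hv, rfl⟩ | ⟨w, hw, v, hv, rfl⟩)
    · have h1 : s.eps 0 k * (s.D (2 * k) j * s.D (2 * k + 1) (b + 1)) =
          s.D (2 * k) j * s.D (2 * k + 1) (b + 1) * s.eps 0 k :=
        eps_comm (s := s) (c := 2 * k) (d := b + 1) (by omega) (by omega)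
          (mul_mem (D_mem le_rfl (by omega)) (D_mem (by omega) le_rfl))
      have h2 := QSet_mul (hPj j hj1 hj2) hv
      rw [eps_succ, zero_add] at h2
      have : m * (P * s.eps 0 k) *
          (s.D (2 * k) j * s.D (2 * k + 1) (b + 1) * s.e (2 * k) * v) =
          m * (P * ((s.eps 0 k * (s.D (2 * k) j * s.D (2 * k + 1) (b + 1))) * s.e (2 * k) * v)) := by
        simp only [mul_assoc]
      rw [this, h1]
      simpa only [mul_assoc] using h2
    · have h1 : s.eps 0 k * w = w * s.eps 0 k := eps_comm (by omega) (by omega) hw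
      have h2 := QSet_mul (hA hm (mul_mem hPS (mem_S (by omega) le_rfl hw))) hv
      rw [eps_succ, zero_add] at h2
      have : m * (P * s.eps 0 k) * (w * s.e (2 * k) * v) =
          m * (P * ((s.eps 0 k * w) * s.e (2 * k) * v)) := by
        simp only [mul_assoc]
      rw [this, h1]
      simpa only [mul_assoc] using h2
  -- The induction hypothesis is used for `eps 0 k` and not for `eps 0 (k + 1)`: the word `D (2 * k
  -- + 1) (b + 1)` commutes with the first `k` arcs but not with `e_{2k}`.
  have hB : ∀ {m x : A}, (m = s.g b ∨ m = s.e b) → x ∈ s.S 0 b →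
      m * (x * (s.D (2 * k + 1) (b + 1) * s.eps 0 (k + 1))) ∈ T := by
    intro m x hm hx
    have h1 : s.D (2 * k + 1) (b + 1) * s.eps 0 (k + 1) =
        s.eps 0 k * (s.D (2 * k + 1) (b + 1) * s.e (2 * k)) := by
      rw [eps_succ, zero_add, ← mul_assoc, ← mul_assoc,
        eps_comm (c := 2 * k) (d := b + 1) (by omega) (by omega) (D_mem (by omega) le_rfl)]
    rw [h1, ← mul_assoc x, ← mul_assoc m]
    refine mul_mul_mem_of_mem_span ?_ (ih k (by omega) x hx)
    rintro t ⟨y, hy, u, hu, ht⟩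
    have h2 := S_commute (s := s) (by omega) (by omega) hy (hmS hm)
    rcases ht with rfl | ⟨hk1, rfl⟩
    · have : m * (y * s.eps 0 k * u) * (s.D (2 * k + 1) (b + 1) * s.e (2 * k)) =
          (m * y) * (1 * s.eps 0 k * (u * (s.D (2 * k + 1) (b + 1) * s.e (2 * k)))) := by
        simp only [mul_assoc, one_mul]
      rw [this, ← h2, mul_assoc]
      refine mul_QSet (hP hm (one_mem _) hu fun j hj1 hj2 => ?_) (mem_S le_rfl (by omega) hy)
      rw [one_mul]
      exact gen_mul_D_mul_D_mem' hk hb (ih (k + 1)) hm hj1 hj2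
    · have : m * (y * s.D (2 * k - 1) b * s.eps 0 k * u) *
          (s.D (2 * k + 1) (b + 1) * s.e (2 * k)) = (m * y) *
          (s.D (2 * k - 1) b * s.eps 0 k * (u * (s.D (2 * k + 1) (b + 1) * s.e (2 * k)))) := by
        simp only [mul_assoc]
      rw [this, ← h2, mul_assoc]
      refine mul_QSet (hP hm (D_mem (by omega) le_rfl) hu fun j hj1 hj2 => ?_)
        (mem_S le_rfl (by omega) hy)
      obtain ⟨w, hw, h⟩ := D_mul_S (s := s) (a := 2 * k - 1) (b := b) (c := 2 * k - 1) (d := b)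
        le_rfl le_rfl (by omega) (D_mem (s := s) (a := 2 * k) (b := j) (by omega) hj2)
      rw [← mul_assoc (s.D _ _), h, mul_assoc, ← mul_assoc m,
        ← S_commute (s := s) (by omega) (by omega) hw (hmS hm), mul_assoc]
      exact mul_QSet (gen_mul_D_mul_D_mem hk hb hm hk1) (mem_S (by omega) (by omega) hw)
  refine S_mul_mem ?_ hx eps_mem_QSet
  intro i hi1 hi2 t ht
  rcases (Nat.lt_succ_iff.mp hi2).eq_or_lt with hib | hi3
  · have key : ∀ m, (m = s.g b ∨ m = s.e b) → m * t ∈ T := by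
      intro m hm
      refine mul_mem_span ?_ ht
      rintro t ⟨y, hy, u, hu, rfl | ⟨-, rfl⟩⟩
      · rw [← mul_assoc]
        exact QSet_mul (hA hm hy) hu
      · rw [← mul_assoc]
        refine QSet_mul ?_ hu
        rw [mul_assoc y]
        exact hB hm hy
    rw [hib]
    exact ⟨key _ (Or.inl rfl), key _ (Or.inr rfl)⟩
  · exact ⟨mul_QSet ht (g_mem hi1 hi3), mul_QSet ht (e_mem hi1 hi3)⟩

end step

theorem mul_eps_mem_QSet (hk : 2 * k ≤ b) (hb : b ≤ N) {x : A} (hx : x ∈ s.S 0 b) :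
    x * s.eps 0 k ∈ Submodule.span Lam (QSet s k b) := by
  induction b generalizing k x with
  | zero =>
    obtain rfl : k = 0 := by omega
    exact Submodule.subset_span ⟨1, one_mem _, x, hx, Or.inl (by simp [eps])⟩
  | succ b ih =>
    rcases k with _ | k
    · exact Submodule.subset_span ⟨1, one_mem _, x, hx, Or.inl (by simp [eps])⟩
    · exact mul_eps_mem_QSet_succ (by omega) (by omega) (fun k hk x hx => ih hk (by omega) hx) hx

end Sys
end BMW

/-! ### Lorenz braids and the left ideal generated by the arcs. -/

namespace BMW
namespace Sys

variable {A : Type} [Ring A] [Algebra Lam A] {N : ℕ} {s : Sys A N} {a b c d i j k l m : ℕ}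

/-- Positive braids that take the first `l` of `m` points at the bottom, in order, to points at
the top, and the remaining points in order to the remaining points. -/
inductive Lz (s : Sys A N) : ℕ → ℕ → A → Prop
  | zero (m : ℕ) : Lz s m 0 1
  | skip {m l : ℕ} {x : A} : Lz s m (l + 1) x → Lz s (m + 1) (l + 1) x
  | take {m l : ℕ} {x : A} : Lz s m l x → Lz s (m + 1) (l + 1) (x * s.D l m)

theorem Lz.le {x : A} (h : Lz s m l x) : l ≤ m := by
  induction h <;> omega

theorem Lz.mem {x : A} (h : Lz s m l x) : x ∈ s.S 0 (m - 1) := by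
  induction h with
  | zero => exact one_mem _
  | skip _ ih => exact mem_S le_rfl (by omega) ih
  | take _ ih => exact mul_mem (mem_S le_rfl (by omega) ih) (D_mem (by omega) (by omega))

theorem Lz.self (l : ℕ) : Lz s l l 1 := by
  induction l with
  | zero => exact Lz.zero 0
  | succ l ih => simpa [D_of_le] using ih.take

/-- A further point is chosen at place `j`. If it does not lie beyond the points chosen before, the
strings have to be sorted, which costs the factor `y` on the first `l + 1` strings. The induction
moves the new word across the last word of `x` by `D_mul_D_shift`. -/
theorem Lz.mul_D {x : A} (h : Lz s m l x) (hm : m ≤ N + 1) (hlj : l ≤ j) (hjm : j < m) :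
    ∃ x', Lz s m (l + 1) x' ∧ ∃ y ∈ s.S 0 l, x * s.D l j = x' * y := by
  induction m generalizing l j x with
  | zero => omega
  | succ m ih =>
    rcases (Nat.lt_succ_iff.mp hjm).eq_or_lt with rfl | hj
    · cases h with
      | zero =>
        exact ⟨_, (Lz.zero j).take, 1, one_mem _, by simp⟩
      | skip h => exact ⟨_, h.take, 1, one_mem _, by simp⟩
      | @take _ l x h =>
        obtain ⟨x', hx', y, hy, e⟩ := ih (j := j - 1) h (by omega) (by omega) (by omega)
        refine ⟨_, hx'.take, y * s.g l, mul_mem (mem_S le_rfl (by omega) hy)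
          (g_mem (by omega) (by omega)), ?_⟩
        have h1 := D_mul_D_shift (s := s) (a := l) (c := l + 1) (d := j) (b := j) (by omega) le_rfl
          (by omega)
        have h2 : y * s.D (l + 1) j = s.D (l + 1) j * y :=
          S_commute (s := s) (by omega) (by omega) hy (D_mem le_rfl le_rfl)
        rw [mul_assoc, h1, ← mul_assoc, Nat.add_sub_cancel, e, D_succ_left (by omega), ← mul_assoc,
          mul_assoc x', h2]
        simp only [mul_assoc]
    · cases h with
      | zero =>
        obtain ⟨x', hx', y, hy, e⟩ := ih (j := j) (Lz.zero m) (by omega) (by omega) hj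
        exact ⟨_, hx'.skip, y, hy, e⟩
      | skip h =>
        obtain ⟨x', hx', y, hy, e⟩ := ih (j := j) h (by omega) (by omega) hj
        exact ⟨_, hx'.skip, y, hy, e⟩
      | @take _ l x h =>
        obtain ⟨x', hx', y, hy, e⟩ := ih (j := j - 1) h (by omega) (by omega) (by omega)
        refine ⟨_, hx'.take, y * s.g l, mul_mem (mem_S le_rfl (by omega) hy)
          (g_mem (by omega) (by omega)), ?_⟩
        have h1 := D_mul_D_shift (s := s) (a := l) (c := l + 1) (d := j) (b := m) (by omega) hj.le
          (by omega)
        have h2 : y * s.D (l + 1) m = s.D (l + 1) m * y :=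
          S_commute (s := s) (by omega) (by omega) hy (D_mem le_rfl le_rfl)
        rw [mul_assoc, h1, ← mul_assoc, Nat.add_sub_cancel, e, D_succ_left (by omega), ← mul_assoc,
          mul_assoc x', h2]
        simp only [mul_assoc]

/-- The products `x * y * eps 0 k * u` with `x` a positive braid as above, `y` in the subalgebra
of the first `2 * k` strings and `u` in that of the others. -/
def LSet (s : Sys A N) (m k : ℕ) : Set A :=
  {t | ∃ x, Lz s m (2 * k) x ∧ ∃ y ∈ s.S 0 (2 * k - 1), ∃ u ∈ s.S (2 * k) (m - 1),
    t = x * y * s.eps 0 k * u}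

theorem LSet_mul {t u : A} (ht : t ∈ Submodule.span Lam (LSet s m k)) (hu : u ∈ s.S (2 * k) (m - 1)) :
    t * u ∈ Submodule.span Lam (LSet s m k) := by
  refine span_mul_mem ?_ ht
  rintro t ⟨x, hx, y, hy, v, hv, rfl⟩
  exact Submodule.subset_span ⟨x, hx, y, hy, v * u, mul_mem hv hu, by simp only [mul_assoc]⟩

/-- The case `k = 0` is separate: `2 * k - 1` is then `0`, the two index ranges may be adjacent, but
the first algebra consists of scalars. -/
theorem comm_of_mem_S (hd : d ≤ N) {x y : A} (hx : x ∈ s.S 0 (2 * k - 1))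
    (hy : y ∈ s.S (2 * k) d) : x * y = y * x := by
  rcases k with _ | k
  · obtain ⟨r, rfl⟩ := S_le_bot (by omega) hx
    exact Algebra.commutes _ _
  · exact S_commute (by omega) hd hx hy

/-- Induction on the number of strings through `QSet`. If the last point lies on a through string,
it is skipped by the Lorenz braid. If it lies on the last arc, the other end of that arc is found by
`mul_D_mul_e_mem` and inserted by `Lz.mul_D`, and the last point itself is taken. -/
theorem mul_eps_mem_LSet (hk : 2 * k ≤ m) (hm : m ≤ N + 1) {x : A} (hx : x ∈ s.S 0 (m - 1)) :
    x * s.eps 0 k ∈ Submodule.span Lam (LSet s m k) := by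
  induction m generalizing k x with
  | zero =>
    obtain rfl : k = 0 := by omega
    exact Submodule.subset_span ⟨1, Lz.zero _, 1, one_mem _, x, hx, by simp [eps]⟩
  | succ m ih =>
    rcases k with _ | k
    · exact Submodule.subset_span ⟨1, Lz.zero _, 1, one_mem _, x, hx, by simp [eps]⟩
    rcases hk.eq_or_lt with hk | hk
    · rw [← hk] at hx ⊢
      exact Submodule.subset_span ⟨1, Lz.self _, x, hx, 1, one_mem _, by simp⟩
    obtain ⟨b, rfl⟩ : ∃ b, m = b + 1 := ⟨m - 1, by omega⟩
    simp only [Nat.add_sub_cancel] at hx ih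
    have hfirst : ∀ {x}, x ∈ s.S 0 b →
        x * s.eps 0 (k + 1) ∈ Submodule.span Lam (LSet s (b + 1 + 1) (k + 1)) := by
      intro x hx
      refine Submodule.span_mono ?_ (ih (k := k + 1) (by omega) (by omega) hx)
      rintro t ⟨x, hx, y, hy, u, hu, rfl⟩
      exact ⟨x, Lz.skip (l := 2 * k + 1) hx, y, hy, u, mem_S le_rfl (by omega) hu, rfl⟩
    rw [← mul_one (x * _)]
    refine span_mul_mem ?_ (mul_eps_mem_QSet (by omega) (by omega) hx)
    rintro t ⟨x, hx, u, hu, rfl | ⟨-, rfl⟩⟩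
    · rw [mul_one]
      exact LSet_mul (hfirst hx) hu
    · rw [mul_one]
      refine LSet_mul ?_ hu
      have h1 : s.D (2 * k + 1) (b + 1) * s.eps 0 (k + 1) =
          s.eps 0 k * (s.D (2 * k + 1) (b + 1) * s.e (2 * k)) := by
        rw [eps_succ, zero_add, ← mul_assoc, ← mul_assoc,
          eps_comm (c := 2 * k) (d := b + 1) (by omega) (by omega) (D_mem (by omega) le_rfl)]
      have h2 : 2 * (k + 1) - 1 = 2 * k + 1 := by omega
      rw [h2, mul_assoc, h1, ← mul_assoc]
      refine span_mul_mem ?_ (ih (k := k) (by omega) (by omega) hx)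
      rintro t ⟨x, hx, y, hy, u, hu, rfl⟩
      rw [mul_assoc]
      simp only [Nat.add_sub_cancel] at hu
      refine mul_mem_span ?_ (mul_D_mul_e_mem (by omega) (by omega) hu)
      rintro t (⟨j, hj1, hj2, v, hv, rfl⟩ | ⟨w, hw, v, hv, rfl⟩)
      · obtain ⟨x', hx', y', hy', e⟩ := hx.mul_D (by omega) hj1 (by omega)
        have e1 : s.eps 0 k * (s.D (2 * k) j * s.D (2 * k + 1) (b + 1)) =
            s.D (2 * k) j * s.D (2 * k + 1) (b + 1) * s.eps 0 k :=
          eps_comm (s := s) (c := 2 * k) (d := b + 1) (by omega) (by omega)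
            (mul_mem (D_mem le_rfl (by omega)) (D_mem (by omega) le_rfl))
        have e2 : y * (s.D (2 * k) j * s.D (2 * k + 1) (b + 1)) =
            s.D (2 * k) j * s.D (2 * k + 1) (b + 1) * y :=
          comm_of_mem_S (k := k) (d := b + 1) (by omega) hy
            (mul_mem (D_mem le_rfl (by omega)) (D_mem (by omega) le_rfl))
        have e3 : y' * s.D (2 * k + 1) (b + 1) = s.D (2 * k + 1) (b + 1) * y' :=
          S_commute (s := s) (by omega) (by omega) hy' (D_mem le_rfl le_rfl)
        refine Submodule.subset_span ⟨_, hx'.take, y' * y, mul_mem (mem_S le_rfl (by omega) hy')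
          (mem_S le_rfl (by omega) hy), v, hv, ?_⟩
        calc x * y * s.eps 0 k * (s.D (2 * k) j * s.D (2 * k + 1) (b + 1) * s.e (2 * k) * v)
            = x * y * (s.eps 0 k * (s.D (2 * k) j * s.D (2 * k + 1) (b + 1))) * s.e (2 * k) * v := by
              simp only [mul_assoc]
          _ = x * (y * (s.D (2 * k) j * s.D (2 * k + 1) (b + 1))) * s.eps 0 k * s.e (2 * k) * v := by
              rw [e1]; simp only [mul_assoc]
          _ = (x * s.D (2 * k) j) * s.D (2 * k + 1) (b + 1) * y * s.eps 0 k * s.e (2 * k) * v := by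
              rw [e2]; simp only [mul_assoc]
          _ = x' * (y' * s.D (2 * k + 1) (b + 1)) * y * s.eps 0 k * s.e (2 * k) * v := by
              rw [e]; simp only [mul_assoc]
          _ = _ := by
              rw [e3, eps_succ, zero_add]; simp only [mul_assoc]
      · have e1 : s.eps 0 k * w = w * s.eps 0 k := eps_comm (by omega) (by omega) hw
        have : x * y * s.eps 0 k * (w * s.e (2 * k) * v) =
            x * y * w * s.eps 0 (k + 1) * v := by
          rw [eps_succ, zero_add, mul_assoc w, ← mul_assoc, mul_assoc (x * y), e1]
          simp only [mul_assoc]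
        rw [this]
        exact LSet_mul (hfirst (mul_mem (mul_mem (mem_S le_rfl (by omega) hx.mem)
          (mem_S le_rfl (by omega) hy)) (mem_S (by omega) le_rfl hw))) hv

end Sys
end BMW

/-! ### The generators of `BW n` as such a system, and products of braid words. -/

namespace BMW

/-- The generators of the Birman-Wenzl algebra. -/
noncomputable def BW.sys (n : ℕ) : Sys (BW n) (n - 1) where
  g := BW.g n
  gi i := if h : i < n - 1 then BW.mk n (fr (Gen.gInv ⟨i, h⟩)) else 1
  e := BW.e n
  mul_inv {i} hi := by
    have := RingQuot.mkAlgHom_rel Lam (BWRel.mul_inv (n := n) ⟨i, hi⟩)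
    simp only [BW.g, dif_pos hi]
    exact (map_mul _ _ _).symm.trans (this.trans (map_one _))
  inv_mul {i} hi := by
    have := RingQuot.mkAlgHom_rel Lam (BWRel.inv_mul (n := n) ⟨i, hi⟩)
    simp only [BW.g, dif_pos hi]
    exact (map_mul _ _ _).symm.trans (this.trans (map_one _))
  skein {i} hi := by
    have : BW.mk n _ = BW.mk n _ := RingQuot.mkAlgHom_rel Lam (BWRel.skein (n := n) ⟨i, hi⟩)
    simpa only [map_sub, map_smul, map_one, BW.g, BW.e, dif_pos hi] using this
  idem {i} hi := by
    have : BW.mk n _ = BW.mk n _ := RingQuot.mkAlgHom_rel Lam (BWRel.idem (n := n) ⟨i, hi⟩)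
    simpa only [map_mul, map_smul, map_one, BW.g, BW.e, dif_pos hi] using this
  braid {i j} hi hj h := by
    have : BW.mk n _ = BW.mk n _ :=
      RingQuot.mkAlgHom_rel Lam (BWRel.braid (n := n) ⟨i, hi⟩ ⟨j, hj⟩ h)
    simpa only [map_mul, BW.g, dif_pos hi, dif_pos hj] using this
  gg {i j} hi hj h := by
    have : BW.mk n _ = BW.mk n _ :=
      RingQuot.mkAlgHom_rel Lam (BWRel.comm_gg (n := n) ⟨i, hi⟩ ⟨j, hj⟩ h)
    simpa only [map_mul, BW.g, dif_pos hi, dif_pos hj] using this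
  ge {i j} hi hj h := by
    have : BW.mk n _ = BW.mk n _ :=
      RingQuot.mkAlgHom_rel Lam (BWRel.comm_ge (n := n) ⟨i, hi⟩ ⟨j, hj⟩ h)
    simpa only [map_mul, BW.g, BW.e, dif_pos hi, dif_pos hj] using this
  ee {i j} hi hj h := by
    have : BW.mk n _ = BW.mk n _ :=
      RingQuot.mkAlgHom_rel Lam (BWRel.comm_ee (n := n) ⟨i, hi⟩ ⟨j, hj⟩ h)
    simpa only [map_mul, BW.g, BW.e, dif_pos hi, dif_pos hj] using this
  eee {i j} hi hj h := by
    have : BW.mk n _ = BW.mk n _ :=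
      RingQuot.mkAlgHom_rel Lam (BWRel.tangle_eee (n := n) ⟨i, hi⟩ ⟨j, hj⟩ h)
    simpa only [map_mul, BW.g, BW.e, dif_pos hi, dif_pos hj] using this
  gge {i j} hi hj h := by
    have : BW.mk n _ = BW.mk n _ :=
      RingQuot.mkAlgHom_rel Lam (BWRel.tangle_gge (n := n) ⟨i, hi⟩ ⟨j, hj⟩ h)
    simpa only [map_mul, BW.g, BW.e, dif_pos hi, dif_pos hj] using this
  egg {i j} hi hj h := by
    have : BW.mk n _ = BW.mk n _ :=
      RingQuot.mkAlgHom_rel Lam (BWRel.tangle_egg (n := n) ⟨i, hi⟩ ⟨j, hj⟩ h)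
    simpa only [map_mul, BW.g, BW.e, dif_pos hi, dif_pos hj] using this
  g_e {i} hi := by
    have : BW.mk n _ = BW.mk n _ := RingQuot.mkAlgHom_rel Lam (BWRel.deloop_ge (n := n) ⟨i, hi⟩)
    simpa only [map_mul, map_smul, BW.g, BW.e, dif_pos hi] using this
  e_g {i} hi := by
    have : BW.mk n _ = BW.mk n _ := RingQuot.mkAlgHom_rel Lam (BWRel.deloop_eg (n := n) ⟨i, hi⟩)
    simpa only [map_mul, map_smul, BW.g, BW.e, dif_pos hi] using this
  ege {i j} hi hj h := by
    have : BW.mk n _ = BW.mk n _ :=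
      RingQuot.mkAlgHom_rel Lam (BWRel.deloop_ege (n := n) ⟨i, hi⟩ ⟨j, hj⟩ h)
    simpa only [map_mul, map_smul, BW.g, BW.e, dif_pos hi, dif_pos hj] using this

namespace Sys

variable {A : Type} [Ring A] [Algebra Lam A] {N : ℕ} {s : Sys A N} {a b c d i j k l m : ℕ}

theorem prod_range_eq_D (h : c ≤ j) :
    ((List.range c).map fun t => s.g (j - 1 - t)).prod = s.D (j - c) j := by
  induction c with
  | zero => simp [D_of_le]
  | succ c ih =>
    rw [List.prod_range_succ, ih (by omega), D_succ_left (by omega : j - (c + 1) < j)]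
    rw [show j - (c + 1) + 1 = j - c by omega, show j - 1 - c = j - (c + 1) by omega]

/-- The product of words that move the string `j` to the left across `c j` strings,
for `j < m`. -/
def braidProd (s : Sys A N) (c : ℕ → ℕ) (m : ℕ) : A :=
  ((List.range m).map fun j => s.D (j - c j) j).prod

theorem braidProd_succ (f : ℕ → ℕ) :
    s.braidProd f (m + 1) = s.braidProd f m * s.D (m - f m) m :=
  List.prod_range_succ _ _

theorem braidProd_mem (f : ℕ → ℕ) : s.braidProd f m ∈ s.S 0 (m - 1) := by
  induction m with
  | zero => exact one_mem _
  | succ m ih =>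
    rw [braidProd_succ]
    exact mul_mem (mem_S le_rfl (by omega) ih) (D_mem (by omega) (by omega))

theorem braidProd_congr {f f' : ℕ → ℕ} (h : ∀ j < m, f j = f' j) :
    s.braidProd f m = s.braidProd f' m := by
  induction m with
  | zero => rfl
  | succ m ih => rw [braidProd_succ, braidProd_succ, h m (by omega), ih fun j hj => h j (by omega)]

/-- Only the factors of the strings `i` and `i + 1` change. The letter `g_i` lengthens the word of
the string `i`, and `D_mul_D_shift` exchanges it with the word of the other string. -/
theorem g_mul_braidProd {f f' : ℕ → ℕ} (hf : f i ≤ i) (h : f (i + 1) ≤ f i) (h1 : f' i = f (i + 1))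
    (h2 : f' (i + 1) = f i + 1) (h3 : ∀ j, j ≠ i → j ≠ i + 1 → f' j = f j) (hm : i + 2 ≤ m)
    (hmN : m ≤ N + 1) : s.g i * s.braidProd f m = s.braidProd f' m := by
  induction m, hm using Nat.le_induction with
  | base =>
    have e1 : s.g i * s.braidProd f i = s.braidProd f i * s.g i := by
      rcases i with _ | i
      · simp [braidProd]
      · exact (S_commute (s := s) (c := i + 1) (d := i + 2) (by omega) (by omega)
          (braidProd_mem f) (g_mem le_rfl (by omega))).symm
    have e2 := D_mul_D_shift (s := s) (a := i - f i) (c := i + 1 - f (i + 1)) (d := i + 1)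
      (b := i + 1) (by omega) le_rfl (by omega)
    have e3 : i + 1 - f (i + 1) - 1 = i - f (i + 1) := by omega
    have e4 : i + 1 - (f i + 1) = i - f i := by omega
    rw [braidProd_succ, braidProd_succ, braidProd_succ, braidProd_succ, h1, h2, e4,
      braidProd_congr (f := f') (f' := f) fun j hj => h3 j (by omega) (by omega)]
    calc s.g i * (s.braidProd f i * s.D (i - f i) i * s.D (i + 1 - f (i + 1)) (i + 1))
        = s.g i * s.braidProd f i * s.D (i - f i) i * s.D (i + 1 - f (i + 1)) (i + 1) := by
          simp only [mul_assoc]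
      _ = s.braidProd f i * (s.g i * s.D (i - f i) i * s.D (i + 1 - f (i + 1)) (i + 1)) := by
          rw [e1]
          simp only [mul_assoc]
      _ = _ := by
          rw [← D_succ (by omega), e2, e3, Nat.add_sub_cancel, mul_assoc]
  | succ m hm ih =>
    rw [braidProd_succ, braidProd_succ, ← mul_assoc, ih (by omega), h3 m (by omega) (by omega)]

end Sys

/-! ### Positive permutation braids -/

section perm

variable {n : ℕ} {i l : ℕ}

/-- The transposition of `i` and `i + 1`. -/
def adjSwap {n : ℕ} (i : ℕ) (h : i + 1 < n) : Equiv.Perm (Fin n) :=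
  Equiv.swap ⟨i, by omega⟩ ⟨i + 1, h⟩

theorem adjSwap_val (h : i + 1 < n) (p : Fin n) :
    (adjSwap i h p : ℕ) = if (p : ℕ) = i then i + 1 else if (p : ℕ) = i + 1 then i else p := by
  rw [adjSwap, Equiv.swap_apply_def]
  simp only [Fin.ext_iff]
  split_ifs <;> rfl

theorem adjSwap_mul_self (h : i + 1 < n) : adjSwap i h * adjSwap i h = 1 := Equiv.swap_mul_self _ _

theorem adjSwap_inv (h : i + 1 < n) : (adjSwap i h)⁻¹ = adjSwap i h := Equiv.swap_inv _ _

theorem adjSwap_left (h : i + 1 < n) : adjSwap i h ⟨i, by omega⟩ = ⟨i + 1, h⟩ :=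
  Equiv.swap_apply_left _ _

theorem adjSwap_right (h : i + 1 < n) : adjSwap i h ⟨i + 1, h⟩ = ⟨i, by omega⟩ :=
  Equiv.swap_apply_right _ _

theorem adjSwap_of_ne (h : i + 1 < n) {p : Fin n} (h1 : (p : ℕ) ≠ i) (h2 : (p : ℕ) ≠ i + 1) :
    adjSwap i h p = p := by
  ext
  rw [adjSwap_val, if_neg h1, if_neg h2]

theorem adjSwap_lt (h : i + 1 < n) {p q : Fin n} (hpq : p < q)
    (hne : ¬ ((p : ℕ) = i ∧ (q : ℕ) = i + 1)) : adjSwap i h p < adjSwap i h q := by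
  rw [Fin.lt_def] at hpq ⊢
  rw [adjSwap_val, adjSwap_val]
  split_ifs <;> omega

theorem crossings_le (π : Equiv.Perm (Fin n)) (j : Fin n) : crossings π j ≤ j := by
  have : (Finset.univ.filter fun i : Fin n => i < j ∧ π j < π i) ⊆ Finset.Iio j := by
    intro i hi
    simp only [Finset.mem_filter] at hi
    exact Finset.mem_Iio.mpr hi.2.1
  simpa [crossings] using Finset.card_le_card this

theorem crossings_mul_adjSwap_of_ne (π : Equiv.Perm (Fin n)) (h : i + 1 < n) {j : Fin n}
    (h1 : (j : ℕ) ≠ i) (h2 : (j : ℕ) ≠ i + 1) : crossings (π * adjSwap i h) j = crossings π j := by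
  refine Finset.card_equiv (adjSwap i h) fun a => ?_
  have : a < j ↔ adjSwap i h a < j := by
    rw [Fin.lt_def, Fin.lt_def, adjSwap_val]
    split_ifs <;> omega
  simp only [Finset.mem_filter, Finset.mem_univ, true_and, Equiv.Perm.mul_apply,
    adjSwap_of_ne h h1 h2, this]

section lt

variable {π : Equiv.Perm (Fin n)} (h : i + 1 < n) (hπ : π ⟨i, by omega⟩ < π ⟨i + 1, h⟩)

include hπ

theorem crossings_mul_adjSwap_left :
    crossings (π * adjSwap i h) ⟨i, by omega⟩ = crossings π ⟨i + 1, h⟩ := by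
  unfold crossings
  congr 1
  ext a
  simp only [Finset.mem_filter, Finset.mem_univ, true_and, Equiv.Perm.mul_apply, adjSwap_left]
  rcases lt_trichotomy (a : ℕ) i with ha | ha | ha
  · rw [adjSwap_of_ne h (by omega) (by omega)]
    simp only [Fin.lt_def (a := a)]
    constructor <;> rintro ⟨-, h'⟩ <;> exact ⟨by omega, h'⟩
  · have ha' : a = ⟨i, by omega⟩ := Fin.ext ha
    rw [ha']
    simp only [lt_self_iff_false, false_and, false_iff, not_and, not_lt]
    exact fun _ => hπ.le
  · simp only [Fin.lt_def (a := a)]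
    constructor <;> rintro ⟨h', -⟩ <;> omega

theorem crossings_mul_adjSwap_right :
    crossings (π * adjSwap i h) ⟨i + 1, h⟩ = crossings π ⟨i, by omega⟩ + 1 := by
  unfold crossings
  rw [← Finset.card_insert_of_notMem (a := (⟨i, by omega⟩ : Fin n))]
  · congr 1
    ext a
    simp only [Finset.mem_filter, Finset.mem_univ, true_and, Equiv.Perm.mul_apply, adjSwap_right,
      Finset.mem_insert]
    rcases lt_trichotomy (a : ℕ) i with ha | ha | ha
    · rw [adjSwap_of_ne h (by omega) (by omega)]
      simp only [Fin.lt_def (a := a), Fin.ext_iff (a := a)]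
      constructor
      · rintro ⟨-, h'⟩
        exact Or.inr ⟨ha, h'⟩
      · rintro (h' | ⟨-, h'⟩)
        · omega
        · exact ⟨by omega, h'⟩
    · have ha' : a = ⟨i, by omega⟩ := Fin.ext ha
      rw [ha']
      simp only [adjSwap_left, true_or, iff_true]
      exact ⟨by simp [Fin.lt_def], hπ⟩
    · simp only [Fin.lt_def (a := a), Fin.ext_iff (a := a)]
      constructor
      · rintro ⟨h', -⟩
        omega
      · rintro (h' | ⟨h', -⟩) <;> omega
  · simp

theorem crossings_succ_le : crossings π ⟨i + 1, h⟩ ≤ crossings π ⟨i, by omega⟩ := by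
  refine Finset.card_le_card fun a ha => ?_
  simp only [Finset.mem_filter, Finset.mem_univ, true_and] at ha ⊢
  rcases lt_trichotomy (a : ℕ) i with h' | h' | h'
  · exact ⟨h', hπ.trans ha.2⟩
  · have ha' : a = ⟨i, by omega⟩ := Fin.ext h'
    rw [ha'] at ha
    exact (hπ.not_gt ha.2).elim
  · have := Fin.lt_def.mp ha.1
    simp only at this
    omega

end lt

/-- The numbers of crossings, for natural numbers as indices. -/
def natCrossings (π : Equiv.Perm (Fin n)) (j : ℕ) : ℕ :=
  if h : j < n then crossings π ⟨j, h⟩ else 0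

theorem posBraid_eq (π : Equiv.Perm (Fin n)) :
    BW.posBraid π = (BW.sys n).braidProd (natCrossings π) n := by
  unfold BW.posBraid Sys.braidProd
  rw [← List.map_coe_finRange_eq_range, List.map_map]
  congr 1
  refine List.map_congr_left fun j _ => ?_
  simp only [Function.comp_apply, natCrossings, dif_pos j.2, Fin.eta]
  exact Sys.prod_range_eq_D (s := BW.sys n) (crossings_le π j)

theorem g_mul_posBraid {π : Equiv.Perm (Fin n)} (h : i + 1 < n)
    (hπ : π ⟨i, by omega⟩ < π ⟨i + 1, h⟩) :
    BW.g n i * BW.posBraid π = BW.posBraid (π * adjSwap i h) := by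
  rw [posBraid_eq, posBraid_eq]
  have hi : i < n := by omega
  refine Sys.g_mul_braidProd (s := BW.sys n) (i := i) ?_ ?_ ?_ ?_ ?_ (by omega) (by omega)
  · simp only [natCrossings, dif_pos hi]
    exact crossings_le π ⟨i, hi⟩
  · simp only [natCrossings, dif_pos hi, dif_pos h]
    exact crossings_succ_le h hπ
  · simp only [natCrossings, dif_pos hi, dif_pos h]
    exact crossings_mul_adjSwap_left h hπ
  · simp only [natCrossings, dif_pos hi, dif_pos h]
    exact crossings_mul_adjSwap_right h hπ
  · intro j h1 h2
    simp only [natCrossings]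
    split_ifs
    · exact crossings_mul_adjSwap_of_ne π h h1 h2
    · rfl

theorem posBraid_one : BW.posBraid (1 : Equiv.Perm (Fin n)) = 1 := by
  have h : ∀ j, crossings (1 : Equiv.Perm (Fin n)) j = 0 := by
    intro j
    refine Finset.card_eq_zero.mpr (Finset.filter_eq_empty_iff.mpr ?_)
    rintro i - ⟨h1, h2⟩
    exact h1.not_gt h2
  simp [BW.posBraid, h]

theorem sum_crossings_mul_adjSwap {π : Equiv.Perm (Fin n)} (h : i + 1 < n)
    (hπ : π ⟨i, by omega⟩ < π ⟨i + 1, h⟩) :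
    ∑ j, crossings (π * adjSwap i h) j = ∑ j, crossings π j + 1 := by
  have e : ∀ j, crossings (π * adjSwap i h) j =
      crossings π (adjSwap i h j) + if j = ⟨i + 1, h⟩ then 1 else 0 := by
    intro j
    by_cases h1 : (j : ℕ) = i
    · have hj : j = ⟨i, by omega⟩ := Fin.ext h1
      rw [hj, crossings_mul_adjSwap_left h hπ, adjSwap_left, if_neg (by simp), add_zero]
    · by_cases h2 : (j : ℕ) = i + 1
      · have hj : j = ⟨i + 1, h⟩ := Fin.ext h2
        rw [hj, crossings_mul_adjSwap_right h hπ, adjSwap_right, if_pos rfl]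
      · rw [crossings_mul_adjSwap_of_ne π h h1 h2, adjSwap_of_ne h h1 h2, if_neg, add_zero]
        exact fun h' => h2 (Fin.ext_iff.mp h')
  simp only [e, Finset.sum_add_distrib, Finset.sum_ite_eq', Finset.mem_univ, if_true]
  rw [Equiv.sum_comp (adjSwap i h) (crossings π)]

theorem eq_one_of_forall_lt {π : Equiv.Perm (Fin n)}
    (hπ : ∀ i, ∀ h : i + 1 < n, π ⟨i, by omega⟩ < π ⟨i + 1, h⟩) : π = 1 := by
  rcases n with _ | n
  · exact Subsingleton.elim _ _
  have h1 : StrictMono π := Fin.strictMono_iff_lt_succ.mpr fun i => hπ i (by omega)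
  have h2 : (h1.orderIsoOfSurjective π π.surjective) = OrderIso.refl _ := Subsingleton.elim _ _
  ext p
  exact congrArg (fun f : Fin (n + 1) ≃o Fin (n + 1) => (f p : ℕ)) h2

/-- The word of a permutation braid is adapted to multiplication from the left. Induction on the
number of crossings: a descent `i` of `π` splits off a letter, `b_π = g_i b_ρ`, and the induction
hypothesis applies to `ρ`. Without descents `π = 1`. -/
theorem posBraid_mul_g {π : Equiv.Perm (Fin n)} {j : ℕ} (h : j + 1 < n)
    (hπ : π⁻¹ ⟨j, by omega⟩ < π⁻¹ ⟨j + 1, h⟩) :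
    BW.posBraid π * BW.g n j = BW.posBraid (adjSwap j h * π) := by
  induction hM : ∑ p, crossings π p using Nat.strong_induction_on generalizing π with
  | _ M ih =>
    by_cases hd : ∀ i, ∀ h : i + 1 < n, π ⟨i, by omega⟩ < π ⟨i + 1, h⟩
    · obtain rfl := eq_one_of_forall_lt hd
      rw [posBraid_one, one_mul, mul_one, ← one_mul (adjSwap j h),
        ← g_mul_posBraid h (by simp), posBraid_one, mul_one]
    · push Not at hd
      obtain ⟨i, hi, hd⟩ := hd
      let ρ := π * adjSwap i hi
      have hρ : ρ ⟨i, by omega⟩ < ρ ⟨i + 1, hi⟩ := by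
        simp only [ρ, Equiv.Perm.mul_apply, adjSwap_left, adjSwap_right]
        refine lt_of_le_of_ne hd fun h' => ?_
        have := Fin.ext_iff.mp (π.injective h')
        simp at this
      have hπρ : π = ρ * adjSwap i hi := by
        rw [mul_assoc, adjSwap_mul_self, mul_one]
      have h1 := sum_crossings_mul_adjSwap hi hρ
      rw [← hπρ] at h1
      have hn : ¬ ((π⁻¹ ⟨j, by omega⟩ : ℕ) = i ∧ (π⁻¹ ⟨j + 1, h⟩ : ℕ) = i + 1) := by
        rintro ⟨h2, h3⟩
        have h2' : π⁻¹ ⟨j, by omega⟩ = ⟨i, by omega⟩ := Fin.ext h2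
        have h3' : π⁻¹ ⟨j + 1, h⟩ = ⟨i + 1, hi⟩ := Fin.ext h3
        rw [Equiv.Perm.inv_eq_iff_eq] at h2' h3'
        rw [← h2', ← h3'] at hd
        simp [Fin.le_def] at hd
      have h2 : ρ⁻¹ ⟨j, by omega⟩ < ρ⁻¹ ⟨j + 1, h⟩ := by
        have := adjSwap_lt hi hπ hn
        simpa only [ρ, mul_inv_rev, adjSwap_inv, Equiv.Perm.mul_apply] using this
      have h3 := ih _ (by omega) h2 rfl
      have h4 : (adjSwap j h * ρ) ⟨i, by omega⟩ < (adjSwap j h * ρ) ⟨i + 1, hi⟩ := by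
        refine adjSwap_lt h hρ ?_
        rintro ⟨h5, h6⟩
        have h5' : ρ ⟨i, by omega⟩ = ⟨j, by omega⟩ := Fin.ext h5
        have h6' : ρ ⟨i + 1, hi⟩ = ⟨j + 1, h⟩ := Fin.ext h6
        have h7 : π⁻¹ ⟨j, by omega⟩ = ⟨i + 1, hi⟩ := by
          rw [Equiv.Perm.inv_eq_iff_eq, ← h5', ← adjSwap_right hi, ← Equiv.Perm.mul_apply, ← hπρ]
        have h8 : π⁻¹ ⟨j + 1, h⟩ = ⟨i, by omega⟩ := by
          rw [Equiv.Perm.inv_eq_iff_eq, ← h6', ← adjSwap_left hi, ← Equiv.Perm.mul_apply, ← hπρ]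
        rw [h7, h8, Fin.lt_def] at hπ
        simp only at hπ
        omega
      have h5 := g_mul_posBraid hi h4
      have h6 := g_mul_posBraid hi hρ
      rw [← hπρ] at h6
      rw [← h6, mul_assoc, h3, h5, mul_assoc, ← hπρ]

end perm
end BMW

namespace BMW

/-! ### Spanning sets of the Birman-Wenzl algebra -/

namespace BW

variable {m n i k l : ℕ}

theorem incl_mk_fr (h : m ≤ n) (x : Gen m) : incl h (mk m (fr x)) = mk n (fr (x.cast h)) := by
  have : incl h (mk m (fr x)) = FreeAlgebra.lift Lam (fun x : Gen m => mk n (fr (x.cast h))) (fr x) :=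
    RingQuot.liftAlgHom_mkAlgHom_apply _ _ _ _
  rw [this, FreeAlgebra.lift_ι_apply]

theorem incl_g (h : m ≤ n) (hi : i < m - 1) : incl h (g m i) = g n i := by
  rw [g, g, dif_pos hi, dif_pos (by omega), incl_mk_fr]
  rfl

theorem incl_e (h : m ≤ n) (hi : i < m - 1) : incl h (e m i) = e n i := by
  rw [e, e, dif_pos hi, dif_pos (by omega), incl_mk_fr]
  rfl

theorem mem_S_top (x : BW n) : x ∈ (sys n).S 0 (n - 1) := by
  obtain ⟨y, rfl⟩ := mk_surjective n x
  induction y using FreeAlgebra.induction with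
  | grade0 r => rw [AlgHom.commutes]; exact Subalgebra.algebraMap_mem _ r
  | grade1 y =>
    rcases y with i | i | i
    · have : mk n (fr (Gen.g i)) = (sys n).g i := by simp only [sys, g, dif_pos i.2]
      exact this ▸ Sys.g_mem (Nat.zero_le _) i.2
    · have : mk n (fr (Gen.gInv i)) = (sys n).gi i := by simp only [sys, dif_pos i.2]
      exact this ▸ Sys.gi_mem (Nat.zero_le _) i.2 le_rfl
    · have : mk n (fr (Gen.e i)) = (sys n).e i := by simp only [sys, e, dif_pos i.2]
      exact this ▸ Sys.e_mem (Nat.zero_le _) i.2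
  | mul x y hx hy => rw [map_mul]; exact mul_mem hx hy
  | add x y hx hy => rw [map_add]; exact add_mem hx hy

theorem exists_incl_eq (h : m ≤ n) {x : BW n} (hx : x ∈ (sys n).S 0 (m - 1)) :
    ∃ y, incl h y = x := by
  have : (sys n).S 0 (m - 1) ≤ (incl h).range := by
    refine Algebra.adjoin_le ?_
    rintro x ⟨i, -, hi, rfl | rfl⟩
    · exact ⟨_, incl_g h hi⟩
    · exact ⟨_, incl_e h hi⟩
  exact this hx

theorem prod_e_eq_eps (n k : ℕ) :
    ((List.range k).map fun j => e n (2 * j)).prod = (sys n).eps 0 k := by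
  induction k with
  | zero => rfl
  | succ k ih => rw [List.prod_range_succ, ih, Sys.eps_succ, zero_add]; rfl

theorem incl_eps (h : m ≤ n) (hk : 2 * k ≤ m) : incl h ((sys m).eps 0 k) = (sys n).eps 0 k := by
  induction k with
  | zero => exact map_one _
  | succ k ih =>
    rw [Sys.eps_succ, Sys.eps_succ, map_mul, ih (by omega), zero_add]
    congr 1
    exact incl_e h (by omega)

theorem ideal_eq (n k : ℕ) :
    ideal n k = Submodule.span Lam {x | ∃ a b : BW n, x = a * (sys n).eps 0 k * b} := by
  rw [ideal, prod_e_eq_eps]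

theorem mul_eps_mul_mem_ideal (a b : BW n) : a * (sys n).eps 0 k * b ∈ ideal n k := by
  rw [ideal_eq]
  exact Submodule.subset_span ⟨a, b, rfl⟩

end BW

/-! #### Lorenz permutations -/

section lorenz

variable {A : Type} [Ring A] [Algebra Lam A] {n m l d : ℕ} {s : Sys A (n - 1)}
  {F : Equiv.Perm (Fin n) → A}

/-- Multiplication by `D (m - d) m` lets the point `m - d` go to `m` and shifts the points after it
by one place. Every letter on the way is a genuine new crossing because `σ` maps the points below
`m` to points below `m`. -/
theorem exists_perm_mul_D (hF : ∀ (σ : Equiv.Perm (Fin n)) (i : ℕ) (h : i + 1 < n),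
    σ ⟨i, by omega⟩ < σ ⟨i + 1, h⟩ → F σ * s.g i = F (σ * adjSwap i h))
    (hm : m < n) {σ : Equiv.Perm (Fin n)} (hσ : ∀ p : Fin n, m ≤ p → σ p = p) (hd : d ≤ m) :
    ∃ ρ : Equiv.Perm (Fin n), F ρ = F σ * s.D (m - d) m ∧
      (∀ p : Fin n, (p : ℕ) < m - d → ρ p = σ p) ∧
      (∀ p : Fin n, (p : ℕ) = m - d → (ρ p : ℕ) = m) ∧
      (∀ p q : Fin n, (q : ℕ) + 1 = p → m - d < p → (p : ℕ) ≤ m → ρ p = σ q) ∧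
      ∀ p : Fin n, m < p → ρ p = p := by
  have hlt : ∀ p : Fin n, (p : ℕ) < m → (σ p : ℕ) < m := fun p hp => by
    by_contra h
    have := σ.injective (hσ (σ p) (by omega))
    rw [this] at h
    exact h hp
  induction d with
  | zero =>
    refine ⟨σ, by rw [Sys.D_of_le (by omega), mul_one], fun _ _ => rfl, fun p hp => ?_, ?_, ?_⟩
    · rw [hσ p (by omega)]; omega
    · intro p q h1 h2 h3; omega
    · exact fun p hp => hσ p hp.le
  | succ d ih =>
    obtain ⟨ρ, h1, h2, h3, h4, h5⟩ := ih (by omega)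
    have hj : m - (d + 1) + 1 = m - d := by omega
    have hjn : m - (d + 1) + 1 < n := by omega
    refine ⟨ρ * adjSwap (m - (d + 1)) hjn, ?_, ?_, ?_, ?_, ?_⟩
    · rw [← hF, h1, Sys.D_succ_left (by omega : m - (d + 1) < m), hj, mul_assoc]
      rw [Fin.lt_def, h3 ⟨m - (d + 1) + 1, hjn⟩ hj, h2 ⟨m - (d + 1), _⟩ (by simp only; omega)]
      exact hlt _ (by simp only; omega)
    · intro p hp
      rw [Equiv.Perm.mul_apply, adjSwap_of_ne _ (by omega) (by omega), h2 p (by omega)]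
    · intro p hp
      rw [Equiv.Perm.mul_apply, h3]
      rw [adjSwap_val, if_pos hp, hj]
    · intro p q hq hp hpm
      rw [Equiv.Perm.mul_apply]
      by_cases hp' : (p : ℕ) = m - d
      · have : adjSwap (m - (d + 1)) hjn p = q := by
          ext
          rw [adjSwap_val, if_neg (by omega), if_pos (by omega)]
          omega
        rw [this, h2 q (by omega)]
      · rw [adjSwap_of_ne _ (by omega) (by omega), h4 p q hq (by omega) hpm]
    · intro p hp
      rw [Equiv.Perm.mul_apply, adjSwap_of_ne _ (by omega) (by omega), h5 p hp]

/-- `F` stands for `σ ↦ b_{σ⁻¹}` and, in the opposite algebra, for `σ ↦ b_σ`; this treats the upper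
and the lower braids at once. In the step `take` the new image `m` of the point `l` exceeds all
images of the points before it, and the order of the other points is kept. -/
theorem Sys.Lz.exists_perm (hF1 : F 1 = 1)
    (hF : ∀ (σ : Equiv.Perm (Fin n)) (i : ℕ) (h : i + 1 < n),
      σ ⟨i, by omega⟩ < σ ⟨i + 1, h⟩ → F σ * s.g i = F (σ * adjSwap i h))
    {x : A} (hx : s.Lz m l x) (hm : m ≤ n) :
    ∃ σ : Equiv.Perm (Fin n), F σ = x ∧ IsLorenz l σ ∧ ∀ p : Fin n, m ≤ p → σ p = p := by
  induction hx with
  | zero m => exact ⟨1, hF1, fun i j h _ => h, fun p _ => rfl⟩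
  | skip _ ih =>
    obtain ⟨σ, h1, h2, h3⟩ := ih (by omega)
    exact ⟨σ, h1, h2, fun p hp => h3 p (by omega)⟩
  | @take m l x hx ih =>
    have hlm := hx.le
    obtain ⟨σ, h1, h2, h3⟩ := ih (by omega)
    obtain ⟨ρ, h4, h5, h6, h7, h8⟩ := exists_perm_mul_D hF (by omega) h3 (d := m - l) (by omega)
    have hl : m - (m - l) = l := by omega
    rw [hl] at h4 h5 h6 h7
    refine ⟨ρ, by rw [h4, h1], ?_, fun p hp => h8 p (by omega)⟩
    have hlt : ∀ p : Fin n, (p : ℕ) < m → (σ p : ℕ) < m := fun p hp => by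
      by_contra h
      have := σ.injective (h3 (σ p) (by omega))
      rw [this] at h
      exact h hp
    rintro i j hij (hj | hi)
    · rw [h5 i (by omega)]
      by_cases hj' : (j : ℕ) = l
      · rw [Fin.lt_def, h6 j hj']
        exact hlt i (by omega)
      · rw [h5 j (by omega)]
        exact h2 i j hij (Or.inl (by omega))
    · by_cases hjm : (j : ℕ) ≤ m
      · rw [h7 i ⟨i - 1, by omega⟩ (by simp only; omega) (by omega) (by omega),
          h7 j ⟨j - 1, by omega⟩ (by simp only; omega) (by omega) hjm]
        exact h2 _ _ (by rw [Fin.lt_def]; simp only; omega) (Or.inr (by simp only; omega))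
      · rw [h8 j (by omega)]
        by_cases him : (i : ℕ) ≤ m
        · rw [h7 i ⟨i - 1, by omega⟩ (by simp only; omega) (by omega) (by omega), Fin.lt_def]
          have := hlt ⟨i - 1, by omega⟩ (by simp only; omega)
          omega
        · rw [h8 i (by omega)]
          exact hij

end lorenz

section

variable {n m l k : ℕ}

theorem exists_posBraid_left {x : BW n} (hx : (BW.sys n).Lz m l x) (hm : m ≤ n) :
    ∃ π : Equiv.Perm (Fin n), BW.posBraid π = x ∧ IsLorenz l π⁻¹ := by
  obtain ⟨σ, h1, h2, -⟩ := hx.exists_perm (F := fun σ => BW.posBraid σ⁻¹)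
    (by rw [inv_one, posBraid_one])
    (fun σ i h hσ => by
      rw [mul_inv_rev, adjSwap_inv]
      exact posBraid_mul_g h (by rwa [inv_inv])) hm
  exact ⟨σ⁻¹, h1, by rwa [inv_inv]⟩

theorem exists_posBraid_right {x : (BW n)ᵐᵒᵖ} (hx : (BW.sys n).op.Lz m l x) (hm : m ≤ n) :
    ∃ μ : Equiv.Perm (Fin n), BW.posBraid μ = x.unop ∧ IsLorenz l μ := by
  obtain ⟨σ, h1, h2, -⟩ := hx.exists_perm (F := fun σ => MulOpposite.op (BW.posBraid σ))
    (by rw [posBraid_one, MulOpposite.op_one])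
    (fun σ i h hσ => by
      refine (MulOpposite.op_mul _ _).symm.trans (congrArg MulOpposite.op ?_)
      exact g_mul_posBraid h hσ) hm
  exact ⟨σ, by rw [← h1, MulOpposite.unop_op], h2⟩

/-! #### Permutations of the last points -/

/-- The permutation braids of the strings from `l` on, and the ideal of `e_l`. -/
def tauSet (n l : ℕ) : Set (BW n) :=
  {x | (∃ τ : Equiv.Perm (Fin n), FixesFirst l τ ∧ x = BW.posBraid τ) ∨
    (l < n - 1 ∧ ∃ u ∈ (BW.sys n).S l (n - 1), ∃ v, x = u * (BW.sys n).e l * v)}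

/-- Modulo the ideal of `e_l` the algebra on the last strings is a Hecke algebra, spanned by
permutation braids. -/
theorem mem_span_tauSet {x : BW n} (hx : x ∈ (BW.sys n).S l (n - 1)) :
    x ∈ Submodule.span Lam (tauSet n l) := by
  have he : ∀ i, l ≤ i → i < n - 1 → ∀ u ∈ (BW.sys n).S l (n - 1), ∀ v,
      u * ((BW.sys n).e i * v) ∈ Submodule.span Lam (tauSet n l) := by
    intro i h1 h2 u hu v
    obtain ⟨u', hu', v', hv', e⟩ := Sys.exists_e_eq (s := BW.sys n) h1 h2 le_rfl
    refine Submodule.subset_span (Or.inr ⟨by omega, u * u', mul_mem hu hu', v' * v, ?_⟩)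
    rw [e]
    simp only [mul_assoc]
  have hg : ∀ i, l ≤ i → ∀ h : i + 1 < n, ∀ τ : Equiv.Perm (Fin n), FixesFirst l τ →
      FixesFirst l (τ * adjSwap i h) := by
    intro i hi h τ hτ p hp
    rw [Equiv.Perm.mul_apply, adjSwap_of_ne _ (by omega) (by omega), hτ p hp]
  rw [← mul_one x]
  refine Sys.S_mul_mem ?_ hx (Submodule.subset_span
    (Or.inl ⟨1, fun _ _ => rfl, posBraid_one.symm⟩))
  intro i h1 h2 t ht
  refine ⟨Sys.mul_mem_span ?_ ht, by simpa using he i h1 h2 1 (one_mem _) t⟩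
  rintro t (⟨τ, hτ, rfl⟩ | ⟨-, u, hu, v, rfl⟩)
  · have h : i + 1 < n := by omega
    by_cases hi : τ ⟨i, by omega⟩ < τ ⟨i + 1, h⟩
    · exact Submodule.subset_span (Or.inl ⟨_, hg i h1 h τ hτ, g_mul_posBraid h hi⟩)
    -- If `g_i b_τ` is not a permutation braid, then `b_τ` begins with `g_i`, and the square of
    -- `g_i` is expanded.
    · have e1 := g_mul_posBraid (π := τ * adjSwap i h) h (by
        rw [Equiv.Perm.mul_apply, Equiv.Perm.mul_apply, adjSwap_left, adjSwap_right]
        refine lt_of_le_of_ne (not_lt.mp hi) fun h' => ?_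
        have := Fin.ext_iff.mp (τ.injective h')
        simp at this)
      rw [mul_assoc, adjSwap_mul_self, mul_one] at e1
      have e2 : (BW.sys n).g i * BW.posBraid τ = BW.posBraid (τ * adjSwap i h) +
          z • BW.posBraid τ - (z * lam) • ((BW.sys n).e i * BW.posBraid (τ * adjSwap i h)) := by
        rw [← e1]
        change (BW.sys n).g i * ((BW.sys n).g i * _) = _ + z • ((BW.sys n).g i * _) - _
        rw [← mul_assoc, Sys.g_sq _ h2, sub_mul, add_mul, one_mul, smul_mul_assoc, smul_mul_assoc]
      rw [e2]
      refine Submodule.sub_mem _ (Submodule.add_mem _ ?_ (Submodule.smul_mem _ _ ?_))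
        (Submodule.smul_mem _ _ ?_)
      · exact Submodule.subset_span (Or.inl ⟨_, hg i h1 h τ hτ, rfl⟩)
      · exact Submodule.subset_span (Or.inl ⟨_, hτ, rfl⟩)
      · simpa using he i h1 h2 1 (one_mem _) (BW.posBraid (τ * adjSwap i h))
  · have := he l le_rfl (by omega) ((BW.sys n).g i * u) (mul_mem (Sys.g_mem h1 h2) hu) v
    simpa only [mul_assoc] using this

/-! #### The spanning set -/

/-- The elements `b_π w b_τ b_μ` for `w` in `W`. -/
def famSet (h : 2 * k ≤ n) (W : Set (BW (2 * k))) : Set (BW n) :=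
  {x | ∃ π : Equiv.Perm (Fin n), IsLorenz (2 * k) π⁻¹ ∧ ∃ w ∈ W,
    ∃ τ : Equiv.Perm (Fin n), FixesFirst (2 * k) τ ∧ ∃ μ : Equiv.Perm (Fin n), IsLorenz (2 * k) μ ∧
      x = BW.posBraid π * BW.incl h w * BW.posBraid τ * BW.posBraid μ}

end

end BMW

/-! ### Reflection of the spanning sets and the filtration of `BW n`. -/

namespace BMW

namespace Sys

variable {A : Type} [Ring A] [Algebra Lam A] {N : ℕ} {s : Sys A N} {a b k m : ℕ}

theorem op_S_le {x : Aᵐᵒᵖ} (hx : x ∈ s.op.S a b) : x.unop ∈ s.S a b := by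
  have : s.op.S a b ≤ (s.S a b).op := by
    refine Algebra.adjoin_le ?_
    rintro x ⟨i, h1, h2, rfl | rfl⟩
    · exact g_mem h1 h2
    · exact e_mem h1 h2
  exact this hx

theorem le_op_S {x : A} (hx : x ∈ s.S a b) : MulOpposite.op x ∈ s.op.S a b := by
  have : s.S a b ≤ (s.op.S a b).unop := by
    refine Algebra.adjoin_le ?_
    rintro x ⟨i, h1, h2, rfl | rfl⟩
    · exact g_mem (s := s.op) h1 h2
    · exact e_mem (s := s.op) h1 h2
  exact this hx

theorem op_eps (h : a + 2 * k ≤ N + 1) : s.op.eps a k = MulOpposite.op (s.eps a k) := by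
  induction k with
  | zero => rfl
  | succ k ih =>
    rw [eps_succ, ih (by omega), eps_succ, eps_comm (c := a + 2 * k) (d := a + 2 * k + 1) le_rfl
      (by omega) (e_mem le_rfl (by omega))]
    rfl

/-- The reflection of `LSet`. -/
def RSet (s : Sys A N) (m k : ℕ) : Set A :=
  {t | ∃ x, Lz s.op m (2 * k) x ∧ ∃ y ∈ s.S 0 (2 * k - 1), ∃ u ∈ s.S (2 * k) (m - 1),
    t = u * s.eps 0 k * y * x.unop}

/-- `mul_eps_mem_LSet` in the opposite algebra, transported back; the factors `e_0, e_2, …` of `eps`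
commute, so `eps` is its own reflection. -/
theorem eps_mul_mem_RSet (hk : 2 * k ≤ m) (hm : m ≤ N + 1) {x : A} (hx : x ∈ s.S 0 (m - 1)) :
    s.eps 0 k * x ∈ Submodule.span Lam (RSet s m k) := by
  have h := mul_eps_mem_LSet (s := s.op) hk hm (le_op_S hx)
  rw [op_eps (by omega)] at h
  have h1 := Submodule.mem_map_of_mem (f := (MulOpposite.opLinearEquiv Lam (M := A)).symm.toLinearMap) h
  rw [Submodule.map_span] at h1
  refine Submodule.span_mono ?_ h1
  rintro _ ⟨t, ⟨x, hx, y, hy, u, hu, rfl⟩, rfl⟩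
  refine ⟨x, hx, y.unop, op_S_le hy, u.unop, op_S_le hu, ?_⟩
  rw [op_eps (by omega)]
  simp [mul_assoc]

end Sys

section

variable {n k : ℕ}

/-- The left and the right factor are expanded by `LSet` and `RSet`, which leaves two Lorenz braids
around an element of `BW (2 * k)` and an element on the through strings. The latter is a combination
of permutation braids modulo the ideal of `e_{2k}`, and one more `e_{2k}` leads into the next ideal.
The supremum over a proposition makes that ideal disappear when `2 * (k + 1)` exceeds `n`. -/
theorem ideal_le_span_famSet (h : 2 * k ≤ n) {W : Set (BW (2 * k))}
    (hW : BW.ideal (2 * k) k ≤ Submodule.span Lam W) :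
    BW.ideal n k ≤ Submodule.span Lam (famSet h W) ⊔ ⨆ _ : 2 * (k + 1) ≤ n, BW.ideal n (k + 1) := by
  set T := Submodule.span Lam (famSet h W) ⊔ ⨆ _ : 2 * (k + 1) ≤ n, BW.ideal n (k + 1)
  let s := BW.sys n
  rw [BW.ideal_eq, Submodule.span_le]
  rintro _ ⟨a, b, rfl⟩
  refine Sys.span_mul_mem ?_ (Sys.mul_eps_mem_LSet (s := s) h (by omega) (BW.mem_S_top a))
  rintro _ ⟨x, hx, y, hy, u, hu, rfl⟩
  rw [mul_assoc _ u, mul_assoc _ (s.eps 0 k)]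
  refine Sys.mul_mem_span ?_ (Sys.eps_mul_mem_RSet (s := s) h (by omega) (BW.mem_S_top (u * b)))
  rintro _ ⟨x', hx', y', hy', u', hu', rfl⟩
  obtain ⟨π, rfl, hπ⟩ := exists_posBraid_left hx le_rfl
  obtain ⟨μ, hμ', hμ⟩ := exists_posBraid_right hx' le_rfl
  obtain ⟨w, hw⟩ := BW.exists_incl_eq h hy
  obtain ⟨w', hw'⟩ := BW.exists_incl_eq h hy'
  have e1 : y' * u' = u' * y' := Sys.comm_of_mem_S (k := k) (d := n - 1) le_rfl hy' hu'
  have e2 : s.eps 0 k * u' = u' * s.eps 0 k :=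
    Sys.eps_comm (s := s) (c := 2 * k) (d := n - 1) (by omega) le_rfl hu'
  have e : BW.posBraid π * y * (u' * s.eps 0 k * y' * x'.unop) =
      BW.posBraid π * BW.incl h (w * (BW.sys (2 * k)).eps 0 k * w') * u' * BW.posBraid μ := by
    rw [map_mul, map_mul, hw, hw', BW.incl_eps h le_rfl, hμ', ← e2]
    simp only [mul_assoc]
    rw [← mul_assoc u' y', ← e1]
    simp only [mul_assoc]
    rfl
  rw [e]
  refine mul_mul_mem_of_mem_span ?_ (mem_span_tauSet hu')
  rintro _ (⟨τ, hτ, rfl⟩ | ⟨hlt, c, hc, d, rfl⟩)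
  · refine Submodule.mem_sup_left ?_
    rw [mul_assoc _ (BW.posBraid τ)]
    have h1 := Submodule.mem_map_of_mem (f := (BW.incl h).toLinearMap)
      (hW (BW.mul_eps_mul_mem_ideal w w'))
    rw [Submodule.map_span] at h1
    refine mul_mul_mem_of_mem_span ?_ h1
    rintro _ ⟨v, hv, rfl⟩
    exact Submodule.subset_span ⟨π, hπ, v, hv, τ, hτ, μ, hμ, by simp only [mul_assoc]; rfl⟩
  · have hk : 2 * (k + 1) ≤ n := by omega
    refine Submodule.mem_sup_right (Submodule.mem_iSup_of_mem hk ?_)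
    have e3 : y' * (c * s.e (2 * k)) = c * s.e (2 * k) * y' :=
      Sys.comm_of_mem_S (k := k) (d := n - 1) le_rfl hy'
        (mul_mem hc (Sys.e_mem le_rfl (by omega)))
    have e4 : s.eps 0 k * c = c * s.eps 0 k :=
      Sys.eps_comm (s := s) (c := 2 * k) (d := n - 1) (by omega) le_rfl hc
    have e5 : BW.posBraid π * BW.incl h (w * (BW.sys (2 * k)).eps 0 k * w') *
        (c * s.e (2 * k) * d) * BW.posBraid μ =
        (BW.posBraid π * y * c) * s.eps 0 (k + 1) * (y' * d * BW.posBraid μ) := by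
      rw [map_mul, map_mul, hw, hw', BW.incl_eps h le_rfl, Sys.eps_succ, zero_add]
      calc BW.posBraid π * (y * s.eps 0 k * y') * (c * s.e (2 * k) * d) * BW.posBraid μ
          = BW.posBraid π * y * s.eps 0 k * (y' * (c * s.e (2 * k))) * d * BW.posBraid μ := by
            simp only [mul_assoc]
        _ = BW.posBraid π * y * (s.eps 0 k * c) * s.e (2 * k) * y' * d * BW.posBraid μ := by
            rw [e3]; simp only [mul_assoc]
        _ = _ := by rw [e4]; simp only [mul_assoc]
    rw [e5]
    exact BW.mul_eps_mul_mem_ideal _ _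

/-- Descending induction along the filtration, measured by a bound `d` for `n - 2 * k`. -/
theorem span_famSet_eq_top {W : ∀ k, Set (BW (2 * k))}
    (hW : ∀ k, 2 * k ≤ n → BW.ideal (2 * k) k ≤ Submodule.span Lam (W k)) :
    Submodule.span Lam (⋃ (k) (h : 2 * k ≤ n), famSet h (W k)) = ⊤ := by
  have key : ∀ d k, 2 * k ≤ n → n ≤ 2 * k + d →
      BW.ideal n k ≤ Submodule.span Lam (⋃ (k) (h : 2 * k ≤ n), famSet h (W k)) := by
    intro d
    induction d with
    | zero =>
      intro k h hd
      refine (ideal_le_span_famSet h (hW k h)).trans (sup_le (Submodule.span_mono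
        (Set.subset_iUnion₂ (s := fun k h => famSet h (W k)) k h)) (iSup_le fun hk => ?_))
      omega
    | succ d ih =>
      intro k h hd
      exact (ideal_le_span_famSet h (hW k h)).trans (sup_le (Submodule.span_mono
        (Set.subset_iUnion₂ (s := fun k h => famSet h (W k)) k h)) (iSup_le fun hk =>
        ih (k + 1) hk (by omega)))
  rw [eq_top_iff]
  intro x _
  -- The empty product of letters `e` is `1`, so the ideal for `k = 0` is the whole algebra.
  refine key n 0 (by omega) (by omega) ?_
  simpa [Sys.eps_zero] using BW.mul_eps_mul_mem_ideal (k := 0) x 1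

end

end BMW

namespace BMW
namespace Sys

variable {A : Type} [Ring A] [Algebra Lam A] {N : ℕ} {s : Sys A N} {a b c d i j k l m p : ℕ}

/-! #### Nested arcs -/

theorem e_gi_adj (hi : i < N) (hj : j < N) (h : i + 1 = j ∨ j + 1 = i) :
    s.e i * s.gi j = s.e i * s.e j * s.g i := by
  have h1 : s.e i * s.e j * s.g i * s.g j = s.e i := by
    rw [mul_assoc (s.e i), mul_assoc (s.e i), s.egg hj hi h.symm, ← mul_assoc, s.eee hi hj h]
  conv_lhs => rw [← h1]
  rw [mul_assoc _ (s.g j), s.mul_inv hj, mul_one]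

theorem gi_e_adj (hi : i < N) (hj : j < N) (h : i + 1 = j ∨ j + 1 = i) :
    s.gi j * s.e i = s.g i * s.e j * s.e i := by
  have h1 : s.g j * (s.g i * s.e j * s.e i) = s.e i := by
    rw [← mul_assoc, ← mul_assoc, s.gge hj hi h.symm, s.eee hi hj h]
  conv_lhs => rw [← h1]
  rw [s.gi_mul_cancel hj]

/-- The hypothesis `hloc` of the following lemmas for `y = gi`: an inverse crossing on one side of a
short chain of arcs is moved to the other side. For `y = 1`, which serves the letters `e`, it
follows from `eee`. -/
theorem e_gi_e_e (hb : b + 2 < N) : s.e (b + 1) * s.gi b * (s.e (b + 2) * s.e (b + 1)) =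
    s.e (b + 1) * s.e b * (s.gi (b + 2) * s.e (b + 1)) := by
  rw [e_gi_adj (by omega) (by omega) (by omega), gi_e_adj (by omega) (by omega) (by omega)]
  simp only [mul_assoc]

/-- The two rows of arcs form a chain along which the letter `y` travels from one end to the other,
two places at a time by `hloc`. The induction takes the first link off the chain. -/
theorem eps_mul_eps_mul_eps {y : ℕ → A} (hy : ∀ i < N, y i ∈ s.S i (i + 1))
    (hloc : ∀ b, b + 2 < N → s.e (b + 1) * y b * (s.e (b + 2) * s.e (b + 1)) =
      s.e (b + 1) * s.e b * (y (b + 2) * s.e (b + 1))) (hb : b + 2 * p < N) :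
    s.eps (b + 1) p * y b * (s.eps (b + 2) p * s.eps (b + 1) p) =
      s.eps (b + 1) p * s.eps b p * (y (b + 2 * p) * s.eps (b + 1) p) := by
  induction p generalizing b with
  | zero => simp [eps_zero]
  | succ p ih =>
    have ih' := ih (b := b + 2) (by omega)
    have c1 : s.eps (b + 3) p * y b = y b * s.eps (b + 3) p :=
      (comm_eps (by omega) (by omega) (hy b (by omega))).symm
    have c2 : s.e (b + 1) * s.eps (b + 4) p = s.eps (b + 4) p * s.e (b + 1) :=
      comm_eps (by omega) (by omega) (e_mem le_rfl (Nat.lt_succ_self _))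
    have c3 : s.e (b + 1) * s.eps (b + 3) p = s.eps (b + 3) p * s.e (b + 1) :=
      comm_eps (by omega) (by omega) (e_mem le_rfl (Nat.lt_succ_self _))
    have c4 : s.e b * s.eps (b + 3) p = s.eps (b + 3) p * s.e b :=
      comm_eps (by omega) (by omega) (e_mem le_rfl (Nat.lt_succ_self _))
    have e1 : b + 2 * (p + 1) = b + 2 + 2 * p := by ring
    rw [eps_succ' (by omega), eps_succ' (by omega : b + 2 + 2 * p < N),
      eps_succ' (by omega : b + 2 * p < N), e1]
    simp only [add_assoc, Nat.reduceAdd] at ih' ⊢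
    calc s.e (b + 1) * s.eps (b + 3) p * y b *
          (s.e (b + 2) * s.eps (b + 4) p * (s.e (b + 1) * s.eps (b + 3) p))
        = s.e (b + 1) * (s.eps (b + 3) p * y b) *
          (s.e (b + 2) * (s.eps (b + 4) p * s.e (b + 1)) * s.eps (b + 3) p) := by
          simp only [mul_assoc]
      _ = (s.e (b + 1) * y b) * s.eps (b + 3) p *
          (s.e (b + 2) * s.e (b + 1) * (s.eps (b + 4) p * s.eps (b + 3) p)) := by
          rw [c1, ← c2]; simp only [mul_assoc]
      _ = s.eps (b + 3) p * (s.e (b + 1) * y b * (s.e (b + 2) * s.e (b + 1))) *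
          (s.eps (b + 4) p * s.eps (b + 3) p) := by
          rw [mul_assoc (s.e (b + 1)), ← c1, ← mul_assoc (s.e (b + 1)), c3]; simp only [mul_assoc]
      _ = s.eps (b + 3) p * s.e (b + 1) * s.e b * y (b + 2) *
          (s.e (b + 1) * s.eps (b + 4) p * s.eps (b + 3) p) := by
          rw [hloc b (by omega)]; simp only [mul_assoc]
      _ = s.e (b + 1) * (s.eps (b + 3) p * s.e b) * y (b + 2) *
          (s.eps (b + 4) p * s.eps (b + 3) p) * s.e (b + 1) := by
          rw [c2, mul_assoc (s.eps (b + 4) p), c3, ← c3]; simp only [mul_assoc]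
          rw [c3]
      _ = s.e (b + 1) * s.e b * (s.eps (b + 3) p * y (b + 2) *
          (s.eps (b + 4) p * s.eps (b + 3) p)) * s.e (b + 1) := by
          rw [← c4]; simp only [mul_assoc]
      _ = s.e (b + 1) * (s.e b * s.eps (b + 3) p) * s.eps (b + 2) p * y (b + (2 + 2 * p)) *
          (s.eps (b + 3) p * s.e (b + 1)) := by
          rw [ih']; simp only [mul_assoc]
      _ = _ := by rw [c4, ← c3]; simp only [mul_assoc]

/-- A word for `k` nested arcs at the top, and arcs between neighbours at the bottom. -/
def V (s : Sys A N) : ℕ → ℕ → A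
  | 0, _ => 1
  | k + 1, a => s.V k (a + 1) * s.eps a (k + 1)

theorem V_mem (hc : c ≤ a) (hd : a + 2 * k ≤ d + 1) : s.V k a ∈ s.S c d := by
  induction k generalizing a with
  | zero => exact one_mem _
  | succ k ih => exact mul_mem (ih (by omega) (by omega)) (eps_mem hc hd)

theorem V_succ_eq (k a : ℕ) : ∃ v, s.V (k + 1) a = s.e (a + k) * v := by
  induction k generalizing a with
  | zero => exact ⟨1, by simp [V, eps_succ, eps_zero]⟩
  | succ k ih =>
    obtain ⟨v, hv⟩ := ih (a + 1)
    exact ⟨v * s.eps a (k + 2), by rw [V, hv, mul_assoc, add_right_comm, add_assoc]⟩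

section flip

variable {x y : ℕ → A} (hx : ∀ i < N, x i ∈ s.S i (i + 1)) (hy : ∀ i < N, y i ∈ s.S i (i + 1))
  (hloc : ∀ b, b + 2 < N → s.e (b + 1) * y b * (s.e (b + 2) * s.e (b + 1)) =
      s.e (b + 1) * s.e b * (y (b + 2) * s.e (b + 1)))
  (hxy : ∀ i < N, ∀ j < N, (i + 1 = j ∨ j + 1 = i) → x j * s.e i * s.e j = y i * s.e j)

include hx hy hloc hxy

/-- The first and the last letter are next to the ends of the chain of arcs. By `hxy` each of them
turns into a letter `y` at the corresponding end of a shorter chain, and `eps_mul_eps_mul_eps`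
identifies the two results. -/
theorem eps_flip (h : a + 2 * p + 2 < N) :
    s.eps (a + 2) p * (x a * (s.eps (a + 1) (p + 1) * s.eps a (p + 2))) =
      s.eps (a + 2) p * (x (a + 2 * p + 2) * (s.eps (a + 1) (p + 1) * s.eps a (p + 2))) := by
  have key := eps_mul_eps_mul_eps (b := a + 1) (p := p) hy hloc (by omega)
  have e1 : s.eps a (p + 2) = s.e a * s.eps (a + 2) p * s.e (a + 2 * p + 2) := by
    rw [eps_succ, eps_succ' (by omega)]
    rfl
  have c1 : s.e a * s.eps (a + 3) p = s.eps (a + 3) p * s.e a :=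
    comm_eps (by omega) (by omega) (e_mem le_rfl (Nat.lt_succ_self _))
  have c2 : s.e a * s.eps (a + 2) p = s.eps (a + 2) p * s.e a :=
    comm_eps (by omega) (by omega) (e_mem le_rfl (Nat.lt_succ_self _))
  have c3 : s.eps (a + 1) p * x (a + 2 * p + 2) = x (a + 2 * p + 2) * s.eps (a + 1) p :=
    eps_comm (by omega) (by omega) (hx _ (by omega))
  have c4 : s.eps (a + 2) p * s.e (a + 2 * p + 2) = s.e (a + 2 * p + 2) * s.eps (a + 2) p :=
    eps_comm (d := a + 2 * p + 3) (c := a + 2 * p + 2) (by omega) (by omega)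
      (e_mem le_rfl (Nat.lt_succ_self _))
  have c5 : s.e a * s.e (a + 2 * p + 2) = s.e (a + 2 * p + 2) * s.e a :=
    s.ee (by omega) (by omega) (by omega)
  have h1 : x a * (s.eps (a + 1) (p + 1) * s.eps a (p + 2)) =
      y (a + 1) * (s.eps (a + 3) p * s.eps (a + 2) p) * (s.e a * s.e (a + 2 * p + 2)) := by
    rw [e1, eps_succ' (by omega)]
    calc x a * (s.e (a + 1) * s.eps (a + 3) p * (s.e a * s.eps (a + 2) p * s.e (a + 2 * p + 2)))
        = x a * s.e (a + 1) * (s.eps (a + 3) p * s.e a) * s.eps (a + 2) p * s.e (a + 2 * p + 2) := by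
          simp only [mul_assoc]
      _ = (x a * s.e (a + 1) * s.e a) * s.eps (a + 3) p * s.eps (a + 2) p * s.e (a + 2 * p + 2) := by
          rw [← c1]; simp only [mul_assoc]
      _ = y (a + 1) * (s.e a * s.eps (a + 3) p) * s.eps (a + 2) p * s.e (a + 2 * p + 2) := by
          rw [hxy (a + 1) (by omega) a (by omega) (by omega)]; simp only [mul_assoc]
      _ = y (a + 1) * s.eps (a + 3) p * (s.e a * s.eps (a + 2) p) * s.e (a + 2 * p + 2) := by
          rw [c1]; simp only [mul_assoc]
      _ = _ := by rw [c2]; simp only [mul_assoc]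
  have h2 : x (a + 2 * p + 2) * (s.eps (a + 1) (p + 1) * s.eps a (p + 2)) =
      s.eps (a + 1) p * (y (a + 1 + 2 * p) * s.eps (a + 2) p) * (s.e a * s.e (a + 2 * p + 2)) := by
    have e2 : a + 1 + 2 * p = a + 2 * p + 1 := by ring
    rw [e1, eps_succ, c2, mul_assoc _ (s.e a), c5, ← mul_assoc _ _ (s.e a), c4, e2]
    calc x (a + 2 * p + 2) * (s.eps (a + 1) p * s.e (a + 2 * p + 1) *
          (s.e (a + 2 * p + 2) * s.eps (a + 2) p * s.e a))
        = (x (a + 2 * p + 2) * s.eps (a + 1) p) * s.e (a + 2 * p + 1) *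
          s.e (a + 2 * p + 2) * s.eps (a + 2) p * s.e a := by simp only [mul_assoc]
      _ = s.eps (a + 1) p * (x (a + 2 * p + 2) * s.e (a + 2 * p + 1) * s.e (a + 2 * p + 2)) *
          s.eps (a + 2) p * s.e a := by rw [← c3]; simp only [mul_assoc]
      _ = s.eps (a + 1) p * y (a + 2 * p + 1) * (s.e (a + 2 * p + 2) * s.eps (a + 2) p) * s.e a := by
          rw [hxy (a + 2 * p + 1) (by omega) (a + 2 * p + 2) (by omega) (by omega)]
          simp only [mul_assoc]
      _ = _ := by rw [← c4]; simp only [mul_assoc]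
  rw [h1, h2, ← mul_assoc, ← mul_assoc, ← mul_assoc, ← mul_assoc (s.eps (a + 2) p)]
  simp only [add_assoc, Nat.reduceAdd] at key ⊢
  rw [key]
  simp only [mul_assoc]

/-- On `k` nested arcs a letter can be moved along two neighbouring arcs to the mirror position.
Letters inside are treated by induction on the arcs of `V k (a + 1)`, and the outermost pair by
`eps_flip`. -/
theorem V_flip (hj : j + 1 < k) (h : a + 2 * k ≤ N + 1) :
    x (a + k + j) * s.V k a = x (a + k - 2 - j) * s.V k a := by
  induction k generalizing a with
  | zero => omega
  | succ k ih =>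
    by_cases hjk : j + 1 < k
    · have := ih (a := a + 1) hjk (by omega)
      rw [V, ← mul_assoc, ← mul_assoc, show a + (k + 1) + j = a + 1 + k + j by omega, this,
        show a + (k + 1) - 2 - j = a + 1 + k - 2 - j by omega]
    · obtain ⟨p, rfl⟩ : ∃ p, k = p + 1 := ⟨k - 1, by omega⟩
      obtain rfl : j = p := by omega
      rw [show a + (j + 1 + 1) + j = a + 2 * j + 2 by omega, show a + (j + 1 + 1) - 2 - j = a by omega]
      have hV : s.V (j + 1) (a + 1) = s.V j (a + 2) * s.eps (a + 1) (j + 1) := rfl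
      have key := eps_flip hx hy hloc hxy (a := a) (p := j) (by omega)
      have c1 : s.V j (a + 2) * x (a + 2 * j + 2) = x (a + 2 * j + 2) * s.V j (a + 2) := by
        rcases j with _ | j
        · simp [V]
        · exact S_commute (a := a + 2) (b := a + 2 * j + 3) (c := a + 2 * (j + 1) + 2)
            (d := a + 2 * (j + 1) + 3) (by omega) (by omega) (V_mem le_rfl (by omega))
            (hx _ (by omega))
      have c2 : x a * s.V j (a + 2) = s.V j (a + 2) * x a := by
        rcases j with _ | j
        · simp [V]
        · exact S_commute (a := a) (b := a + 1) (c := a + 2) (d := a + 2 * j + 3) (by omega)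
            (by omega) (hx _ (by omega)) (V_mem le_rfl (by omega))
      rw [V, hV, mul_assoc, ← mul_assoc, ← c1, ← mul_assoc (x a), c2, mul_assoc, mul_assoc]
      rcases j with _ | j
      · simpa [V, eps_zero] using key.symm
      · have hV2 : s.V (j + 1) (a + 2) = s.V j (a + 3) * s.eps (a + 2) (j + 1) := rfl
        rw [hV2, mul_assoc, mul_assoc, key]

end flip

end Sys
end BMW

namespace BMW
namespace Sys

variable {A : Type} [Ring A] [Algebra Lam A] {N : ℕ} {s : Sys A N} {a b c d i j k l m p : ℕ}

theorem g_mul_V (hj : j + 1 < k) (h : 2 * k ≤ N + 1) :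
    s.g (k + j) * s.V k 0 = s.g (k - 2 - j) * s.V k 0 := by
  have := V_flip (s := s) (x := s.g) (y := s.gi) (a := 0) (fun i _ => g_mem le_rfl (by omega))
    (fun i hi => gi_mem le_rfl (by omega) (by omega)) (fun b hb => e_gi_e_e hb)
    (fun i hi j hj hij => s.g_e_e hi hj hij) hj (by omega)
  simpa only [zero_add] using this

theorem e_mul_V (hj : j + 1 < k) (h : 2 * k ≤ N + 1) :
    s.e (k + j) * s.V k 0 = s.e (k - 2 - j) * s.V k 0 := by
  have := V_flip (s := s) (x := s.e) (y := fun _ => 1) (a := 0) (fun i _ => e_mem le_rfl (by omega))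
    (fun i hi => one_mem _)
    (fun b hb => by
      rw [mul_one, one_mul, ← mul_assoc, s.eee (by omega) (by omega) (by omega),
        s.eee (by omega) (by omega) (by omega)])
    (fun i hi j hj hij => by rw [one_mul, s.eee hj hi hij.symm]) hj (by omega)
  simpa only [zero_add] using this

/-- A letter to the right of the middle is replaced by its mirror image, after commuting with the
factor already obtained on the left. The letter in the middle is absorbed by `S_succ_mul_e`, because
`V` begins with the `e` of this index. -/
theorem S_mul_V (hk : 2 * k ≤ N + 1) {x : A} (hx : x ∈ s.S 0 (2 * k - 1)) :
    ∃ y ∈ s.S 0 (k - 1), x * s.V k 0 = y * s.V k 0 := by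
  rcases k with _ | k
  · exact ⟨x, hx, rfl⟩
  suffices h : x * s.V (k + 1) 0 ∈ s.SMul 0 (k + 1 - 1) (s.V (k + 1) 0) by
    obtain ⟨y, hy, e⟩ := mem_SMul.mp h
    exact ⟨y, hy, e.symm⟩
  refine S_mul_mem ?_ hx (mem_SMul.mpr ⟨1, one_mem _, one_mul _⟩)
  intro i _ hi t ht
  obtain ⟨y, hy, rfl⟩ := mem_SMul.mp ht
  rw [Nat.add_sub_cancel] at hy ⊢
  rcases lt_trichotomy i k with h | rfl | h
  · exact ⟨mem_SMul.mpr ⟨_, mul_mem (g_mem (Nat.zero_le _) h) hy, mul_assoc _ _ _⟩,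
      mem_SMul.mpr ⟨_, mul_mem (e_mem (Nat.zero_le _) h) hy, mul_assoc _ _ _⟩⟩
  · obtain ⟨v, hv⟩ := V_succ_eq (s := s) i 0
    rw [zero_add] at hv
    have key : ∀ x ∈ s.S 0 (i + 1),
        x * (y * s.V (i + 1) 0) ∈ s.SMul 0 i (s.V (i + 1) 0) := by
      intro x hx
      obtain ⟨y', hy', e⟩ := S_succ_mul_e (s := s) (Nat.zero_le i) (by omega)
        (mul_mem hx (mem_S le_rfl (Nat.le_succ i) hy))
      refine mem_SMul.mpr ⟨y', hy', ?_⟩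
      rw [hv, ← mul_assoc y', ← e]
      simp only [mul_assoc]
    exact ⟨key _ (g_mem (Nat.zero_le _) (Nat.lt_succ_self _)),
      key _ (e_mem (Nat.zero_le _) (Nat.lt_succ_self _))⟩
  · obtain ⟨j, rfl⟩ : ∃ j, i = k + 1 + j := ⟨i - (k + 1), by omega⟩
    have e1 : y * s.g (k + 1 + j) = s.g (k + 1 + j) * y :=
      S_commute (c := k + 1 + j) (d := k + 1 + j + 1) (by omega) (by omega) hy
        (g_mem le_rfl (Nat.lt_succ_self _))
    have e2 : y * s.e (k + 1 + j) = s.e (k + 1 + j) * y :=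
      S_commute (c := k + 1 + j) (d := k + 1 + j + 1) (by omega) (by omega) hy
        (e_mem le_rfl (Nat.lt_succ_self _))
    rw [← mul_assoc, ← mul_assoc, ← e1, ← e2, mul_assoc, mul_assoc, g_mul_V (by omega) hk,
      e_mul_V (by omega) hk]
    exact ⟨mem_SMul.mpr ⟨_, mul_mem hy (g_mem (Nat.zero_le _) (by omega)), mul_assoc _ _ _⟩,
      mem_SMul.mpr ⟨_, mul_mem hy (e_mem (Nat.zero_le _) (by omega)), mul_assoc _ _ _⟩⟩

/-! #### The elements `f_k` -/

/-- The word `g_0 ⋯ g_{b-1}`. -/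
def U (s : Sys A N) : ℕ → A
  | 0 => 1
  | b + 1 => s.U b * s.g b

theorem U_mem (h : b ≤ d) : s.U b ∈ s.S 0 d := by
  induction b with
  | zero => exact one_mem _
  | succ b ih => exact mul_mem (ih (by omega)) (g_mem (Nat.zero_le _) (by omega))

theorem prod_g_eq_U : ((List.range b).map s.g).prod = s.U b := by
  induction b with
  | zero => rfl
  | succ b ih => rw [List.prod_range_succ, ih]; rfl

theorem prod_reverse_g_eq_U : ((List.range b).reverse.map s.g).prod = (s.op.U b).unop := by
  induction b with
  | zero => rfl
  | succ b ih =>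
    rw [List.range_succ, List.reverse_append, List.map_append, List.prod_append, ih]
    simp [U, op]

theorem U_mul_gen (h : i + 1 < b) (hb : b ≤ N) :
    s.U b * s.g i = s.g (i + 1) * s.U b ∧ s.U b * s.e i = s.e (i + 1) * s.U b := by
  induction b with
  | zero => omega
  | succ b ih =>
    by_cases hi : i + 1 < b
    · obtain ⟨h1, h2⟩ := ih hi (by omega)
      constructor
      · rw [U, mul_assoc, s.gg (by omega) (by omega) (by omega), ← mul_assoc, h1, mul_assoc]
      · rw [U, mul_assoc, s.ge (by omega) (by omega) (by omega), ← mul_assoc, h2, mul_assoc]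
    · obtain rfl : b = i + 1 := by omega
      have c1 : s.U i * s.g (i + 1) = s.g (i + 1) * s.U i := by
        rcases i with _ | i
        · simp [U]
        · exact S_commute (c := i + 2) (d := i + 3) (by omega) (by omega) (U_mem le_rfl)
            (g_mem le_rfl (Nat.lt_succ_self _))
      have c2 : s.U i * s.e (i + 1) = s.e (i + 1) * s.U i := by
        rcases i with _ | i
        · simp [U]
        · exact S_commute (c := i + 2) (d := i + 3) (by omega) (by omega) (U_mem le_rfl)
            (e_mem le_rfl (Nat.lt_succ_self _))
      constructor
      · rw [U, U, mul_assoc, mul_assoc, ← mul_assoc (s.g i), s.braid (by omega) (by omega) (by omega),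
          mul_assoc, ← mul_assoc, c1, mul_assoc, mul_assoc]
      · rw [U, U, mul_assoc, mul_assoc, ← mul_assoc (s.g i), s.gge (by omega) (by omega) (by omega),
          ← s.egg (i := i + 1) (j := i) (by omega) (by omega) (by omega),
          mul_assoc, ← mul_assoc, c2, mul_assoc, mul_assoc]

theorem U_mul_eps (h : k = 0 ∨ a + 2 * k ≤ b) (hb : b ≤ N) :
    s.U b * s.eps a k = s.eps (a + 1) k * s.U b := by
  induction k with
  | zero => simp [eps_zero]
  | succ k ih =>
    rw [eps_succ, ← mul_assoc, ih (by omega), mul_assoc, (U_mul_gen (by omega) hb).2, ← mul_assoc,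
      eps_succ, show a + 1 + 2 * k = a + 2 * k + 1 by ring]

theorem U_mul_V (h : k = 0 ∨ a + 2 * k ≤ b) (hb : b ≤ N) :
    s.U b * s.V k a = s.V k (a + 1) * s.U b := by
  induction k generalizing a with
  | zero => simp [V]
  | succ k ih =>
    rw [V, ← mul_assoc, ih (by omega), mul_assoc, U_mul_eps (by omega) hb, ← mul_assoc, ← V]

/-- Each factor `e_{2k+1}` of `eps 1 k` absorbs two letters of `U` by `egg`, which turns the braid
word into further arcs. -/
theorem eps_mul_U_mul_e (hk : 2 * k < N) :
    s.eps 1 k * (s.U (2 * k) * s.e (2 * k)) = s.eps 1 k * s.eps 0 (k + 1) := by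
  induction k with
  | zero => simp [eps, U]
  | succ k ih =>
    have c1 : s.e (2 * k + 1) * s.U (2 * k) = s.U (2 * k) * s.e (2 * k + 1) := by
      rcases k with _ | k
      · simp [U]
      · exact (S_commute (c := 2 * (k + 1) + 1) (d := 2 * (k + 1) + 2) (by omega) (by omega)
          (U_mem (s := s) le_rfl) (e_mem le_rfl (Nat.lt_succ_self _))).symm
    have c2 : s.eps 1 k * s.e (2 * k + 1) = s.e (2 * k + 1) * s.eps 1 k :=
      eps_comm (d := 2 * k + 2) (by omega) (by omega) (e_mem le_rfl (Nat.lt_succ_self _))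
    have e1 : s.U (2 * (k + 1)) = s.U (2 * k) * s.g (2 * k) * s.g (2 * k + 1) := rfl
    have e2 : s.eps 0 (k + 1 + 1) = s.eps 0 (k + 1) * s.e (2 * (k + 1)) := by
      rw [eps_succ, zero_add]
    have e3 : s.eps 1 (k + 1) = s.eps 1 k * s.e (2 * k + 1) := by
      rw [eps_succ, add_comm 1]
    rw [e1, e2, e3]
    calc s.eps 1 k * s.e (2 * k + 1) *
          (s.U (2 * k) * s.g (2 * k) * s.g (2 * k + 1) * s.e (2 * (k + 1)))
        = s.eps 1 k * (s.e (2 * k + 1) * s.U (2 * k)) * s.g (2 * k) * s.g (2 * k + 1) *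
          s.e (2 * (k + 1)) := by simp only [mul_assoc]
      _ = s.eps 1 k * s.U (2 * k) * (s.e (2 * k + 1) * s.g (2 * k) * s.g (2 * k + 1)) *
          s.e (2 * (k + 1)) := by rw [c1]; simp only [mul_assoc]
      _ = s.eps 1 k * (s.U (2 * k) * s.e (2 * k + 1)) * s.e (2 * k) * s.e (2 * (k + 1)) := by
          rw [s.egg (by omega) (by omega) (by omega)]; simp only [mul_assoc]
      _ = (s.eps 1 k * s.e (2 * k + 1)) * s.U (2 * k) * s.e (2 * k) * s.e (2 * (k + 1)) := by
          rw [← c1]; simp only [mul_assoc]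
      _ = s.e (2 * k + 1) * (s.eps 1 k * (s.U (2 * k) * s.e (2 * k))) * s.e (2 * (k + 1)) := by
          rw [c2]; simp only [mul_assoc]
      _ = s.e (2 * k + 1) * s.eps 1 k * s.eps 0 (k + 1) * s.e (2 * (k + 1)) := by
          rw [ih (by omega)]; simp only [mul_assoc]
      _ = _ := by rw [c2]; simp only [mul_assoc]

/-- The braid that turns `eps 0 k` into nested arcs. -/
def Ub (s : Sys A N) : ℕ → A
  | 0 => 1
  | k + 1 => s.U (2 * k) * s.Ub k

theorem Ub_mem (h : 2 * k ≤ d + 2) : s.Ub k ∈ s.S 0 d := by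
  induction k with
  | zero => exact one_mem _
  | succ k ih => exact mul_mem (U_mem (by omega)) (ih (by omega))

/-- The braid `U (2 * k)` shifts the `k` nested arcs already formed by one place to the right, and
the factor `e_{2k}` is bent into an arc around them. -/
theorem Ub_mul_eps (hk : 2 * k ≤ N + 1) : s.Ub k * s.eps 0 k = s.V k 0 := by
  induction k with
  | zero => simp [Ub, eps, V]
  | succ k ih =>
    rw [Ub, eps_succ, zero_add, mul_assoc, ← mul_assoc (s.Ub k), ih (by omega), ← mul_assoc,
      U_mul_V (by omega) (by omega), V, zero_add, mul_assoc]
    rcases k with _ | k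
    · simp [V, eps, U]
    · have := eps_mul_U_mul_e (s := s) (k := k + 1) (by omega)
      rw [V, mul_assoc, this, mul_assoc]

theorem exists_mul_U_eq_one (hb : b ≤ N) : ∃ x, x * s.U b = 1 := by
  induction b with
  | zero => exact ⟨1, one_mul _⟩
  | succ b ih =>
    obtain ⟨x, hx⟩ := ih (by omega)
    exact ⟨s.gi b * x, by rw [U, ← mul_assoc, mul_assoc (s.gi b), hx, mul_one, s.inv_mul (by omega)]⟩

theorem exists_mul_Ub_eq_one (hk : 2 * k ≤ N + 2) : ∃ x, x * s.Ub k = 1 := by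
  induction k with
  | zero => exact ⟨1, one_mul _⟩
  | succ k ih =>
    obtain ⟨x, hx⟩ := ih (by omega)
    obtain ⟨y, hy⟩ := exists_mul_U_eq_one (s := s) (b := 2 * k) (by omega)
    exact ⟨x * y, by rw [Ub, mul_assoc, ← mul_assoc y, hy, one_mul, hx]⟩

theorem op_op_U : s.op.op.U b = MulOpposite.op (MulOpposite.op (s.U b)) := by
  induction b with
  | zero => rfl
  | succ b ih => rw [U, ih]; rfl

theorem op_op_Ub : s.op.op.Ub k = MulOpposite.op (MulOpposite.op (s.Ub k)) := by
  induction k with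
  | zero => rfl
  | succ k ih => rw [Ub, ih, op_op_U]; rfl

/-- The elements `f_k`. -/
noncomputable def f (s : Sys A N) (k : ℕ) : A := s.Ub k * s.eps 0 k * (s.op.Ub k).unop

theorem f_succ (hk : 2 * k < N) :
    s.f (k + 1) = s.U (2 * k) * s.f k * s.e (2 * k) * (s.op.U (2 * k)).unop := by
  have c : (s.op.Ub k).unop * s.e (2 * k) = s.e (2 * k) * (s.op.Ub k).unop := by
    rcases k with _ | k
    · simp [Ub]
    · exact S_commute (b := 2 * k) (c := 2 * (k + 1)) (d := 2 * (k + 1) + 1) (by omega) (by omega)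
        (op_S_le (Ub_mem (by omega))) (e_mem le_rfl (Nat.lt_succ_self _))
  simp only [f, Ub, eps_succ, zero_add, MulOpposite.unop_mul, mul_assoc]
  rw [← mul_assoc (s.op.Ub k).unop, c]
  simp only [mul_assoc]

theorem op_f (hk : 2 * k ≤ N + 1) : s.op.f k = MulOpposite.op (s.f k) := by
  rw [f, f, op_eps (by omega), MulOpposite.op_mul, MulOpposite.op_mul, MulOpposite.op_unop, mul_assoc,
    op_op_Ub]
  rfl

theorem S_mul_f (hk : 2 * k ≤ N + 1) {x : A} (hx : x ∈ s.S 0 (2 * k - 1)) :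
    ∃ y ∈ s.S 0 (k - 1), x * s.f k = y * s.f k := by
  obtain ⟨y, hy, h⟩ := S_mul_V hk hx
  exact ⟨y, hy, by rw [f, Ub_mul_eps hk, ← mul_assoc, h, mul_assoc]⟩

theorem f_mul_S (hk : 2 * k ≤ N + 1) {x : A} (hx : x ∈ s.S 0 (2 * k - 1)) :
    ∃ y ∈ s.S 0 (k - 1), s.f k * x = s.f k * y := by
  obtain ⟨y, hy, h⟩ := S_mul_f (s := s.op) hk (le_op_S hx)
  refine ⟨y.unop, op_S_le hy, ?_⟩
  rw [op_f hk] at h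
  exact congrArg MulOpposite.unop h

/-- The braids on both sides of `eps` in `f` are invertible, so `f` and `eps` generate the same
ideal. -/
theorem exists_eps_eq (hk : 2 * k ≤ N + 1) : ∃ x y, s.eps 0 k = x * s.f k * y := by
  obtain ⟨x, hx⟩ := exists_mul_Ub_eq_one (s := s) (k := k) (by omega)
  obtain ⟨y, hy⟩ := exists_mul_Ub_eq_one (s := s.op) (k := k) (by omega)
  have hy' : (s.op.Ub k).unop * y.unop = 1 := congrArg MulOpposite.unop hy
  refine ⟨x, y.unop, ?_⟩
  rw [f, ← mul_assoc, ← mul_assoc, hx, one_mul, mul_assoc, hy', mul_one]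

end Sys

theorem BW.f_eq {n k : ℕ} (hk : 2 * k ≤ n) : BW.f n k = (BW.sys n).f k := by
  induction k with
  | zero => simp [BW.f, Sys.f, Sys.Ub, Sys.eps]
  | succ k ih =>
    rw [Sys.f_succ (by omega), BW.f, ih (by omega), ← Sys.prod_g_eq_U, ← Sys.prod_reverse_g_eq_U]
    rfl

/-- The products `t f_k t'` span the ideal with no through strings. -/
theorem BW.ideal_le_span {k : ℕ} {X : Set (BW k)} (hX : Submodule.span Lam X = ⊤) :
    BW.ideal (2 * k) k ≤ Submodule.span Lam {x | ∃ t ∈ X, ∃ t' ∈ X,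
      x = BW.incl (le_two_mul k) t * BW.f (2 * k) k * BW.incl (le_two_mul k) t'} := by
  rw [BW.ideal_eq, Submodule.span_le]
  rintro _ ⟨a, b, rfl⟩
  let s := BW.sys (2 * k)
  obtain ⟨x, y, h⟩ := Sys.exists_eps_eq (s := s) (k := k) (by omega)
  obtain ⟨x', hx', h1⟩ := Sys.S_mul_f (s := s) (k := k) (by omega) (BW.mem_S_top (a * x))
  obtain ⟨y', hy', h2⟩ := Sys.f_mul_S (s := s) (k := k) (by omega) (BW.mem_S_top (y * b))
  obtain ⟨t, rfl⟩ := BW.exists_incl_eq (le_two_mul k) hx'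
  obtain ⟨t', rfl⟩ := BW.exists_incl_eq (le_two_mul k) hy'
  have e : a * s.eps 0 k * b =
      BW.incl (le_two_mul k) t * BW.f (2 * k) k * BW.incl (le_two_mul k) t' := by
    rw [BW.f_eq le_rfl]
    change _ = _ * s.f k * _
    rw [mul_assoc _ (s.f k), ← h2, ← mul_assoc, ← h1, h]
    simp only [mul_assoc]
  have key : ∀ t, BW.incl (le_two_mul k) t ∈
      Submodule.span Lam (BW.incl (le_two_mul k) '' X) := by
    intro t
    have := Submodule.mem_map_of_mem (f := (BW.incl (le_two_mul k)).toLinearMap)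
      (hX ▸ Submodule.mem_top : t ∈ Submodule.span Lam X)
    rwa [Submodule.map_span] at this
  refine e ▸ Sys.mul_mem_span ?_ (key t')
  rintro _ ⟨t', ht', rfl⟩
  rw [mul_assoc]
  refine Sys.span_mul_mem ?_ (key t)
  rintro _ ⟨t, ht, rfl⟩
  exact Submodule.subset_span ⟨t, ht, t', ht', (mul_assoc _ _ _).symm⟩

theorem BW.mul_f_mul_mem_ideal {k : ℕ} (a b : BW (2 * k)) : a * BW.f (2 * k) k * b ∈
    BW.ideal (2 * k) k := by
  rw [BW.f_eq le_rfl, Sys.f]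
  have := BW.mul_eps_mul_mem_ideal (k := k) (a * (BW.sys (2 * k)).Ub k)
    (((BW.sys (2 * k)).op.Ub k).unop * b)
  simpa only [mul_assoc] using this

end BMW

namespace BMW

/-! ### Partial closure of tangles -/

/-- An additive map that respects all multiples of the relations descends to the quotient. -/
theorem eq_of_mkAlgHom_eq {A M : Type} [Ring A] [Algebra Lam A] [AddCommGroup M]
    {r : A → A → Prop} (f : A →+ M) (hf : ∀ x y, r x y → ∀ u v, f (u * x * v) = f (u * y * v))
    {x y : A} (h : RingQuot.mkAlgHom Lam r x = RingQuot.mkAlgHom Lam r y) : f x = f y := by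
  -- The congruence identifies elements whose two-sided multiples have the same values under `f`. It
  -- contains the relations by `hf`, hence the quotient map factors through it.
  let c : RingCon A :=
    { r := fun x y => ∀ u v, f (u * x * v) = f (u * y * v)
      iseqv := ⟨fun _ _ _ => rfl, fun h u v => (h u v).symm,
        fun h h' u v => (h u v).trans (h' u v)⟩
      mul' := fun {a b c d} h h' u v => by
        have h1 := h u (c * v)
        have h2 := h' (u * b) v
        simp only [mul_assoc] at h1 h2 ⊢
        rw [h1, h2]
      add' := fun {a b c d} h h' u v => by
        simp only [mul_add, add_mul, map_add]
        rw [h u v, h' u v] }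
  let l : RingQuot r →+* c.Quotient :=
    RingQuot.lift ⟨c.mk', fun x y hxy => (RingCon.eq c).mpr (hf x y hxy)⟩
  have hl : ∀ x, l (RingQuot.mkAlgHom Lam r x) = c.mk' x := by
    intro x
    have : RingQuot.mkAlgHom Lam r x = RingQuot.mkRingHom r x :=
      congrArg (fun g : A →+* RingQuot r => g x) (RingQuot.mkAlgHom_coe Lam r)
    rw [this]
    exact RingQuot.lift_mkRingHom_apply _ _ _
  have h1 : c.mk' x = c.mk' y := by rw [← hl, ← hl, h]
  have h2 := (RingCon.eq c).mp h1 1 1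
  simpa only [one_mul, mul_one] using h2

namespace MT

variable {n : ℕ}

theorem mk_tg (T : Tangle n n) : mk n (tg T) = of T := rfl

/-- The linear extension of the map that puts the tangles `A` and `B` above and below. -/
noncomputable def preSandwich {m : ℕ} (A : Tangle m n) (B : Tangle n m) :
    MonoidAlgebra Lam (Tangle n n) →ₗ[Lam] MT m :=
  (MonoidAlgebra.basis (Tangle n n) Lam).constr Lam fun T => of ((A.comp T).comp B)

theorem preSandwich_tg {m : ℕ} (A : Tangle m n) (B : Tangle n m) (T : Tangle n n) :
    preSandwich A B (tg T) = of ((A.comp T).comp B) := by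
  have : tg T = MonoidAlgebra.basis (Tangle n n) Lam T := by
    simp [tg]
  rw [preSandwich, this, Module.Basis.constr_basis]

/-- The relations of the tangle algebra are local: each is stated for arbitrary tangles above and
below the place of the change. Enclosing it in further tangles gives an instance of the same
relation in `MT m`. -/
theorem preSandwich_rel {m : ℕ} (A : Tangle m n) (B : Tangle n m)
    {x y : MonoidAlgebra Lam (Tangle n n)} (h : MTRel n x y) (u v : MonoidAlgebra Lam (Tangle n n)) :
    preSandwich A B (u * x * v) = preSandwich A B (u * y * v) := by
  induction u using MonoidAlgebra.induction_on with
  | add u u' hu hu' => rw [add_mul, add_mul, map_add, hu, hu', ← map_add, ← add_mul, ← add_mul]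
  | smul c u hu => rw [smul_mul_assoc, smul_mul_assoc, smul_mul_assoc, smul_mul_assoc,
      map_smul, map_smul, hu]
  | of U =>
    induction v using MonoidAlgebra.induction_on with
    | add v v' hv hv' => rw [mul_add, mul_add, map_add, hv, hv', ← map_add]
    | smul c v hv => rw [mul_smul_comm, mul_smul_comm, map_smul, map_smul, hv]
    | of V =>
      have e : ∀ T : Tangle n n, preSandwich A B (tg U * tg T * tg V) =
          of (((A.comp U).comp T).comp (V.comp B)) := by
        intro T
        rw [tg, tg, tg, ← map_mul, ← map_mul, ← tg, preSandwich_tg]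
        simp only [Tangle.mul_def, Tangle.comp_assoc]
      have e' : ∀ {k : ℕ} (C : Tangle n k) (D : Tangle k k) (C' : Tangle k n),
          preSandwich A B (tg U * tg ((C.comp D).comp C') * tg V) =
            mk m (tg ((((A.comp U).comp C).comp D).comp (C'.comp (V.comp B)))) := by
        intro k C D C'
        rw [e, ← mk_tg]
        simp only [Tangle.comp_assoc]
      have e'' : ∀ {k : ℕ} (C : Tangle n k) (C' : Tangle k n),
          preSandwich A B (tg U * tg (C.comp C') * tg V) =
            mk m (tg (((A.comp U).comp C).comp (C'.comp (V.comp B)))) := by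
        intro k C C'
        rw [e, ← mk_tg]
        simp only [Tangle.comp_assoc]
      cases h with
      | skein C C' i =>
        simp only [mul_sub, sub_mul, mul_smul_comm, smul_mul_assoc, map_sub, map_smul, e', e'']
        simpa only [map_sub, map_smul] using rel (MTRel.skein ((A.comp U).comp C) (C'.comp (V.comp B)) i)
      | curlR_true C C' i =>
        simp only [mul_smul_comm, smul_mul_assoc, map_smul, e', e'']
        simpa only [map_smul] using rel (MTRel.curlR_true ((A.comp U).comp C) (C'.comp (V.comp B)) i)
      | curlL_true C C' i =>
        simp only [mul_smul_comm, smul_mul_assoc, map_smul, e', e'']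
        simpa only [map_smul] using rel (MTRel.curlL_true ((A.comp U).comp C) (C'.comp (V.comp B)) i)
      | curlR_false C C' i =>
        simp only [mul_smul_comm, smul_mul_assoc, map_smul, e', e'']
        simpa only [map_smul] using rel (MTRel.curlR_false ((A.comp U).comp C) (C'.comp (V.comp B)) i)
      | curlL_false C C' i =>
        simp only [mul_smul_comm, smul_mul_assoc, map_smul, e', e'']
        simpa only [map_smul] using rel (MTRel.curlL_false ((A.comp U).comp C) (C'.comp (V.comp B)) i)
      | circle C C' i =>
        simp only [mul_smul_comm, smul_mul_assoc, map_smul, e', e'']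
        simpa only [map_smul] using rel (MTRel.circle ((A.comp U).comp C) (C'.comp (V.comp B)) i)

/-- The linear map `MT n → MT m` that puts the tangles `A` and `B` above and below. -/
theorem exists_sandwich {m : ℕ} (A : Tangle m n) (B : Tangle n m) :
    ∃ f : MT n →ₗ[Lam] MT m, ∀ T, f (of T) = of ((A.comp T).comp B) := by
  have hker : LinearMap.ker (mk n).toLinearMap ≤ LinearMap.ker (preSandwich A B) := by
    intro x hx
    have h := eq_of_mkAlgHom_eq (r := MTRel n) (preSandwich A B).toAddMonoidHom
      (fun _ _ h => preSandwich_rel A B h) (x := x) (y := 0) (by rw [map_zero]; exact hx)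
    exact h.trans (map_zero _)
  refine ⟨(LinearMap.ker (mk n).toLinearMap).liftQ (preSandwich A B) hker ∘ₗ
    (LinearMap.quotKerEquivOfSurjective _ (mk_surjective n)).symm.toLinearMap, fun T => ?_⟩
  have : (LinearMap.quotKerEquivOfSurjective (mk n).toLinearMap (mk_surjective n)).symm (of T) =
      Submodule.Quotient.mk (tg T) := by
    rw [LinearEquiv.symm_apply_eq]
    rfl
  rw [LinearMap.comp_apply, LinearEquiv.coe_coe, this]
  exact preSandwich_tg A B T

end MT
end BMW

namespace BMW

/-! ### Normal forms of tangles -/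

namespace Tangle

open Layer

variable {n m w M i : ℕ}

/-- The monoid generated by the tangles `G_i^{±1}` and `E_i`. -/
def gens (n : ℕ) : Submonoid (Tangle n n) :=
  Submonoid.closure {T | (∃ s i, T = G s i) ∨ ∃ i, T = E i}

theorem G_mem_gens (s : Bool) (i : Fin (n - 1)) : G s i ∈ gens n :=
  Submonoid.subset_closure (Or.inl ⟨s, i, rfl⟩)

theorem E_mem_gens (i : Fin (n - 1)) : E i ∈ gens n :=
  Submonoid.subset_closure (Or.inr ⟨i, rfl⟩)

/-- Tangles of `n` vertical strings with maxima to the right of all strings. -/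
inductive Caps (n : ℕ) : ∀ M, Tangle n M → Prop
  | one : Caps n n 1
  | cap {M : ℕ} {c : Tangle n M} : Caps n M c → Caps n (M + 2) (c.comp (ly (cap M le_rfl)))

/-- Tangles of `w` vertical strings with minima to the right of all strings. -/
inductive Cups (w : ℕ) : ∀ M, Tangle M w → Prop
  | one : Cups w w 1
  | cup {M : ℕ} {d : Tangle M w} : Cups w M d → Cups w (M + 2) ((ly (cup M le_rfl)).comp d)

theorem Cups.le {d : Tangle M w} (h : Cups w M d) : w ≤ M := by
  induction h <;> omega

theorem Cups.exists_comp_cup {d : Tangle M w} (h : Cups w M d) :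
    ∃ d', Cups (w + 2) (M + 2) d' ∧ (ly (Layer.cup M le_rfl)).comp d = d'.comp (ly (Layer.cup w le_rfl)) := by
  induction h with
  | one => exact ⟨1, Cups.one, by rw [comp_one, one_comp]⟩
  | @cup M d _ ih =>
    obtain ⟨d', h1, h2⟩ := ih
    exact ⟨_, h1.cup, by rw [h2, comp_assoc]⟩

theorem G_comp_cup (s : Bool) (i : Fin (n - 1)) : (ly (cup n le_rfl)).comp (G s i) =
    (G s ⟨i, by omega⟩ : Tangle (n + 2) (n + 2)).comp (ly (cup n le_rfl)) := by
  exact move_eq (Move.cup_cross_left s n i (by omega) le_rfl)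

theorem cap_comp_G (s : Bool) (i : Fin (n - 1)) : (G s i).comp (ly (cap n le_rfl)) =
    (ly (cap n le_rfl)).comp (G s ⟨i, by omega⟩ : Tangle (n + 2) (n + 2)) := by
  exact move_eq (Move.cap_cross_left s n i (by omega) le_rfl)

theorem E_comp_cup (i : Fin (n - 1)) : (ly (cup n le_rfl)).comp (E i) =
    (E ⟨i, by omega⟩ : Tangle (n + 2) (n + 2)).comp (ly (cup n le_rfl)) := by
  obtain ⟨n, rfl⟩ : ∃ p, n = p + 2 := ⟨n - 2, by have := i.2; omega⟩
  rw [E_def, E_def (n := n + 2), comp_assoc,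
    ← mk_two (cap _ _), ← move_eq (Move.cup_cap_left i n (Nat.le_of_lt_succ i.2) le_rfl), mk_two, ← comp_assoc,
    ← mk_two, ← move_eq (Move.cup_cup i n (Nat.le_of_lt_succ i.2) le_rfl), mk_two, comp_assoc]

theorem cap_comp_E (i : Fin (n - 1)) : (E i).comp (ly (cap n le_rfl)) =
    (ly (cap n le_rfl)).comp (E ⟨i, by omega⟩ : Tangle (n + 2) (n + 2)) := by
  obtain ⟨n, rfl⟩ : ∃ p, n = p + 2 := ⟨n - 2, by have := i.2; omega⟩
  rw [E_def, E_def (n := n + 2), comp_assoc,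
    ← mk_two (cap _ _), ← move_eq (Move.cap_cap i n (Nat.le_of_lt_succ i.2) le_rfl), mk_two, ← comp_assoc,
    ← mk_two, move_eq (Move.cup_cap_right i n (Nat.le_of_lt_succ i.2) le_rfl), mk_two, comp_assoc]

theorem exists_gens_comp_cap {y : Tangle n n} (hy : y ∈ gens n) :
    ∃ y' ∈ gens (n + 2), y.comp (ly (cap n le_rfl)) = (ly (cap n le_rfl)).comp y' := by
  induction hy using Submonoid.closure_induction with
  | mem y hy =>
    rcases hy with ⟨s, i, rfl⟩ | ⟨i, rfl⟩
    · exact ⟨_, G_mem_gens _ _, cap_comp_G s i⟩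
    · exact ⟨_, E_mem_gens _, cap_comp_E i⟩
  | one => exact ⟨1, one_mem _, by rw [comp_one, one_comp]⟩
  | mul x y _ _ hx hy =>
    obtain ⟨x', hx', h1⟩ := hx
    obtain ⟨y', hy', h2⟩ := hy
    exact ⟨x' * y', mul_mem hx' hy', by
      rw [mul_def, comp_assoc, h2, ← comp_assoc, h1, comp_assoc, mul_def]⟩

theorem Cups.comp_G {d : Tangle M w} (h : Cups w M d) (s : Bool) (i : Fin (w - 1)) :
    ∃ y ∈ gens M, d.comp (G s i) = y.comp d := by
  suffices ∀ hi : (i : ℕ) < M - 1, d.comp (G s i) = (G s ⟨i, hi⟩ : Tangle M M).comp d from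
    have hle := h.le
    ⟨_, G_mem_gens _ _, this (by omega)⟩
  induction h with
  | one => intro _; rw [comp_one, one_comp]
  | cup h ih =>
    have := h.le
    intro _
    rw [comp_assoc, ih (by omega), ← comp_assoc, G_comp_cup, comp_assoc]

theorem Cups.comp_E {d : Tangle M w} (h : Cups w M d) (i : Fin (w - 1)) :
    ∃ y ∈ gens M, d.comp (E i) = y.comp d := by
  suffices ∀ hi : (i : ℕ) < M - 1, d.comp (E i) = (E ⟨i, hi⟩ : Tangle M M).comp d from
    have hle := h.le
    ⟨_, E_mem_gens _, this (by omega)⟩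
  induction h with
  | one => intro _; rw [comp_one, one_comp]
  | cup h ih =>
    have := h.le
    intro _
    rw [comp_assoc, ih (by omega), ← comp_assoc, E_comp_cup, comp_assoc]

theorem Cups.comp_gens {d : Tangle M w} (h : Cups w M d) {y : Tangle w w} (hy : y ∈ gens w) :
    ∃ y' ∈ gens M, d.comp y = y'.comp d := by
  induction hy using Submonoid.closure_induction with
  | mem y hy =>
    rcases hy with ⟨s, i, rfl⟩ | ⟨i, rfl⟩
    · exact h.comp_G s i
    · exact h.comp_E i
  | one => exact ⟨1, one_mem _, by rw [comp_one, one_comp]⟩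
  | mul x y _ _ hx hy =>
    obtain ⟨x', hx', h1⟩ := hx
    obtain ⟨y', hy', h2⟩ := hy
    exact ⟨x' * y', mul_mem hx' hy', by
      rw [mul_def, ← comp_assoc, h1, comp_assoc, h2, ← comp_assoc, mul_def]⟩

/-- A maximum is moved one place to the left by an `E`: `cap (i + 1)` followed by `cup i` is a
zigzag, so the `cap i` in `E_i` remains. -/
theorem exists_cap_eq (hi : i ≤ w) :
    ∃ y ∈ gens (w + 2), ly (cap i hi) = (ly (cap w le_rfl)).comp y := by
  induction hi using Nat.decreasingInduction with
  | self => exact ⟨1, one_mem _, by rw [comp_one]⟩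
  | of_succ i hi ih =>
    obtain ⟨y, hy, h⟩ := ih
    refine ⟨y * E ⟨i, by omega⟩, mul_mem hy (E_mem_gens _), ?_⟩
    rw [mul_def, ← comp_assoc, ← h, E_def, two_nil (Move.zigzag_left i hi)]

theorem exists_cup_eq (hi : i ≤ w) :
    ∃ y ∈ gens (w + 2), ly (cup i hi) = y.comp (ly (cup w le_rfl)) := by
  induction hi using Nat.decreasingInduction with
  | self => exact ⟨1, one_mem _, by rw [one_comp]⟩
  | of_succ i hi ih =>
    obtain ⟨y, hy, h⟩ := ih
    refine ⟨E ⟨i, by omega⟩ * y, mul_mem (E_mem_gens _) hy, ?_⟩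
    rw [mul_def, comp_assoc, ← h, E_def, comp_assoc, ← mk_two (cap i _),
      move_eq (Move.zigzag_right i hi), comp_nil]

/-- Tangles `c y d` where `c` consists of maxima, `d` of minima, and `y` is a word in the
generators. -/
def IsNormal (A : Tangle n w) : Prop :=
  ∃ (M : ℕ) (c : Tangle n M) (y : Tangle M M) (d : Tangle M w),
    Caps n M c ∧ y ∈ gens M ∧ Cups w M d ∧ A = c.comp (y.comp d)

theorem IsNormal.comp_gens {A : Tangle n w} (h : IsNormal A) {y : Tangle w w} (hy : y ∈ gens w) :
    IsNormal (A.comp y) := by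
  obtain ⟨M, c, x, d, hc, hx, hd, rfl⟩ := h
  obtain ⟨y', hy', e⟩ := hd.comp_gens hy
  exact ⟨M, c, x * y', d, hc, mul_mem hx hy', hd, by
    rw [comp_assoc, comp_assoc, e, mul_def, comp_assoc]⟩

/-- If `d` is trivial, the new maximum is pulled up through `y` and joins `c`. Otherwise a minimum
of `d` can be paired with the new maximum into an `E`, which is pulled up through the remaining
minima into `y`. -/
theorem IsNormal.comp_cap_self {A : Tangle n w} (h : IsNormal A) :
    IsNormal (A.comp (ly (cap w le_rfl))) := by
  obtain ⟨M, c, x, d, hc, hx, hd, rfl⟩ := h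
  cases hd with
  | one =>
    obtain ⟨x', hx', e⟩ := exists_gens_comp_cap hx
    exact ⟨w + 2, _, x', 1, hc.cap, hx', Cups.one, by rw [comp_one, comp_one, comp_assoc, e,
      comp_assoc]⟩
  | @cup M d hd =>
    obtain ⟨d', hd', e⟩ := hd.exists_comp_cup
    obtain ⟨y, hy, e'⟩ := hd'.comp_gens (E_mem_gens ⟨w, by omega⟩)
    refine ⟨M + 2, c, x * y, d', hc, mul_mem hx hy, hd', ?_⟩
    rw [mul_def, comp_assoc c, comp_assoc x, e, comp_assoc d', ← E_def ⟨w, by omega⟩, e', comp_assoc]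

theorem IsNormal.comp_cup_self {A : Tangle n (w + 2)} (h : IsNormal A) :
    IsNormal (A.comp (ly (cup w le_rfl))) := by
  obtain ⟨M, c, x, d, hc, hx, hd, rfl⟩ := h
  have : ∀ {M : ℕ} {d : Tangle M (w + 2)}, Cups (w + 2) M d → Cups w M (d.comp (ly (cup w le_rfl))) := by
    intro M d hd
    induction hd with
    | one => exact Cups.one.cup
    | cup hd ih => rw [comp_assoc]; exact ih.cup
  exact ⟨M, c, x, _, hc, hx, this hd, by rw [comp_assoc, comp_assoc]⟩

/-- The class of normal tangles is stable under adding one layer at the bottom. Maxima and minima at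
other places are first moved to the far right by generators. -/
theorem isNormal (T : Tangle n m) : IsNormal T := by
  have key : ∀ {w m : ℕ} (D : Diagram w m) (A : Tangle n w), IsNormal A →
      IsNormal (A.comp (mk D)) := by
    intro w m D
    induction D with
    | nil => intro A hA; rwa [comp_nil]
    | cons a D ih =>
      intro A hA
      have e : mk (Diagram.cons a D) = (ly a).comp (mk D) := rfl
      rw [e, ← comp_assoc]
      refine ih _ ?_
      cases a with
      | cross s i h => exact hA.comp_gens (G_mem_gens s ⟨i, by omega⟩)
      | cap i h =>
        obtain ⟨y, hy, e⟩ := exists_cap_eq h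
        rw [e, ← comp_assoc]
        exact hA.comp_cap_self.comp_gens hy
      | cup i h =>
        obtain ⟨y, hy, e⟩ := exists_cup_eq h
        rw [e, ← comp_assoc]
        exact (hA.comp_gens hy).comp_cup_self
  induction T using Quot.ind with
  | mk D =>
    have := key D 1 ⟨n, 1, 1, 1, Caps.one, one_mem _, Cups.one, by rw [comp_one, comp_one]⟩
    rwa [one_comp] at this

end Tangle

end BMW

namespace BMW

/-! ### Surjectivity of `φ` -/

open Tangle Layer

variable {n m : ℕ}

theorem MT.span_of (n : ℕ) : Submodule.span Lam (Set.range (MT.of (n := n))) = ⊤ := by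
  rw [eq_top_iff]
  rintro x -
  obtain ⟨y, rfl⟩ := MT.mk_surjective n x
  induction y using MonoidAlgebra.induction_on with
  | of T => exact Submodule.subset_span ⟨T, rfl⟩
  | add x y hx hy => rw [map_add]; exact add_mem hx hy
  | smul c x hx => rw [map_smul]; exact Submodule.smul_mem _ _ hx

theorem MT.curlR (s : Bool) (i : Fin n) :
    MT.of (Tangle.curlR s i) = algebraMap Lam (MT n) (if s then lamInv else lam) := by
  cases s
  · have := MT.rel (MTRel.curlR_false (1 : Tangle n n) 1 i)
    rwa [one_comp, comp_one, map_smul, one_comp, MT.mk_tg, MT.mk_tg, MT.of_one,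
      ← Algebra.algebraMap_eq_smul_one] at this
  · have := MT.rel (MTRel.curlR_true (1 : Tangle n n) 1 i)
    rwa [one_comp, comp_one, map_smul, one_comp, MT.mk_tg, MT.mk_tg, MT.of_one,
      ← Algebra.algebraMap_eq_smul_one] at this

theorem MT.circle (i : Fin (n + 1)) :
    MT.of (Tangle.circle i) = algebraMap Lam (MT n) delta := by
  have := MT.rel (MTRel.circle (1 : Tangle n n) 1 i)
  rwa [one_comp, comp_one, map_smul, one_comp, MT.mk_tg, MT.mk_tg, MT.of_one,
    ← Algebra.algebraMap_eq_smul_one] at this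

theorem phiGen_mem_range (x : Gen n) : phiGen n x ∈ (phi n).range := ⟨_, phi_mk_fr x⟩

theorem of_mem_range {T : Tangle n n} (hT : T ∈ gens n) : MT.of T ∈ (phi n).range := by
  induction hT using Submonoid.closure_induction with
  | mem T hT =>
    rcases hT with ⟨s, i, rfl⟩ | ⟨i, rfl⟩
    · cases s
      · exact phiGen_mem_range (Gen.gInv i)
      · exact phiGen_mem_range (Gen.g i)
    · exact phiGen_mem_range (Gen.e i)
  | one => rw [MT.of_one]; exact one_mem _
  | mul S T _ _ hS hT => rw [MT.of_mul]; exact mul_mem hS hT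

/-- A tangle `S` that slides through the upper part `A` can be taken out of the sandwich. Partial
closure is thus a map of bimodules over the strings that it does not close. -/
theorem mul_of_eq {f : MT n →ₗ[Lam] MT m} {A : Tangle m n} {B : Tangle n m}
    (hf : ∀ T, f (MT.of T) = MT.of ((A.comp T).comp B)) {S : Tangle n n} {S' : Tangle m m}
    (h : A.comp S = S'.comp A) (t : MT n) : f (MT.of S * t) = MT.of S' * f t := by
  have ht : t ∈ Submodule.span Lam (Set.range (MT.of (n := n))) := MT.span_of n ▸ Submodule.mem_top
  induction ht using Submodule.span_induction with
  | mem t ht =>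
    obtain ⟨T, rfl⟩ := ht
    rw [← MT.of_mul, hf, hf, ← MT.of_mul, mul_def, mul_def, ← comp_assoc, h]
    simp only [comp_assoc]
  | zero => simp
  | add x y _ _ hx hy => rw [mul_add, map_add, hx, hy, map_add, mul_add]
  | smul c x _ hx => rw [mul_smul_comm, map_smul, hx, map_smul, mul_smul_comm]

theorem of_mul_eq {f : MT n →ₗ[Lam] MT m} {A : Tangle m n} {B : Tangle n m}
    (hf : ∀ T, f (MT.of T) = MT.of ((A.comp T).comp B)) {S : Tangle n n} {S' : Tangle m m}
    (h : S.comp B = B.comp S') (t : MT n) : f (t * MT.of S) = f t * MT.of S' := by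
  have ht : t ∈ Submodule.span Lam (Set.range (MT.of (n := n))) := MT.span_of n ▸ Submodule.mem_top
  induction ht using Submodule.span_induction with
  | mem t ht =>
    obtain ⟨T, rfl⟩ := ht
    rw [← MT.of_mul, hf, hf, ← MT.of_mul, mul_def, mul_def, comp_assoc, comp_assoc, h]
    simp only [comp_assoc]
  | zero => simp
  | add x y _ _ hx hy => rw [add_mul, map_add, hx, hy, map_add, add_mul]
  | smul c x _ hx => rw [smul_mul_assoc, map_smul, hx, map_smul, smul_mul_assoc]

section closure

variable {f : MT (m + 2) →ₗ[Lam] MT m}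
  (hf : ∀ T, f (MT.of T) = MT.of (((ly (cap m le_rfl)).comp T).comp (ly (cup m le_rfl))))

include hf

theorem closure_phi_incl_mul (y : BW m) (t : MT (m + 2)) :
    f (phi (m + 2) (BW.incl (by omega) y) * t) = phi m y * f t := by
  obtain ⟨y, rfl⟩ := BW.mk_surjective m y
  induction y using FreeAlgebra.induction generalizing t with
  | grade0 r =>
    rw [AlgHom.commutes, AlgHom.commutes, AlgHom.commutes, AlgHom.commutes,
      ← Algebra.smul_def, ← Algebra.smul_def, map_smul]
  | grade1 x =>
    have e : BW.incl (n := m + 2) (by omega) (BW.mk m (FreeAlgebra.ι Lam x)) = _ :=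
      BW.incl_mk_fr _ x
    have e' : phi m (BW.mk m (FreeAlgebra.ι Lam x)) = _ := phi_mk_fr x
    rw [e, e', phi_mk_fr]
    cases x with
    | g i => exact mul_of_eq hf (cap_comp_G true i).symm t
    | gInv i => exact mul_of_eq hf (cap_comp_G false i).symm t
    | e i => exact mul_of_eq hf (cap_comp_E i).symm t
  | mul x y hx hy => rw [map_mul (BW.mk m), map_mul (BW.incl _), map_mul (phi (m + 2)), map_mul (phi m), mul_assoc, hx, hy, mul_assoc]
  | add x y hx hy => simp only [map_add, add_mul, hx, hy]

theorem closure_mul_phi_incl (y : BW m) (t : MT (m + 2)) :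
    f (t * phi (m + 2) (BW.incl (by omega) y)) = f t * phi m y := by
  obtain ⟨y, rfl⟩ := BW.mk_surjective m y
  induction y using FreeAlgebra.induction generalizing t with
  | grade0 r =>
    rw [AlgHom.commutes, AlgHom.commutes, AlgHom.commutes, AlgHom.commutes,
      ← Algebra.commutes, ← Algebra.commutes, ← Algebra.smul_def, ← Algebra.smul_def, map_smul]
  | grade1 x =>
    have e : BW.incl (n := m + 2) (by omega) (BW.mk m (FreeAlgebra.ι Lam x)) = _ :=
      BW.incl_mk_fr _ x
    have e' : phi m (BW.mk m (FreeAlgebra.ι Lam x)) = _ := phi_mk_fr x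
    rw [e, e', phi_mk_fr]
    cases x with
    | g i => exact of_mul_eq hf (G_comp_cup true i).symm t
    | gInv i => exact of_mul_eq hf (G_comp_cup false i).symm t
    | e i => exact of_mul_eq hf (E_comp_cup i).symm t
  | mul x y hx hy => rw [map_mul (BW.mk m), map_mul (BW.incl _), map_mul (phi (m + 2)), map_mul (phi m), ← mul_assoc, hy, hx, mul_assoc]
  | add x y hx hy => simp only [map_add, mul_add, hx, hy]

theorem closure_one : f 1 ∈ (phi m).range := by
  have : f 1 = algebraMap Lam (MT m) delta := by
    rw [← MT.of_one, hf, comp_one, ← MT.circle ⟨m, by omega⟩]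
    rfl
  rw [this]
  exact Subalgebra.algebraMap_mem _ _

end closure

theorem curlR_comp_cup (s : Bool) {i : ℕ} (hi : i ≤ n) :
    (Tangle.curlR s ⟨i + 1, by omega⟩).comp (ly (cup i hi)) =
      (G (!s) (⟨i, by omega⟩ : Fin (n + 2 - 1))).comp (ly (cup i hi)) := by
  rw [← comp_nil (ly (cup i hi))]
  simp only [G_def, Tangle.curlR, mk_three, comp_assoc]
  rw [← two_two (Move.cup_cup i i le_rfl (by omega)), two_two (Move.slide_cup s i (by omega)),
    ← two_two (Move.cap_cross_left (!s) (i + 2) i le_rfl (by omega)),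
    two_nil (Move.zigzag_left (i + 1) (by omega))]

/-- There is no string to the left, so the zigzag used in `closure_succ` is not available. `BW 2` is
spanned by `1`, `g_0`, `e_0`, whose closures are a circle, a curled circle and two circles. -/
theorem closure_zero {f : MT 2 →ₗ[Lam] MT 0}
    (hf : ∀ T, f (MT.of T) = MT.of (((ly (cap 0 le_rfl)).comp T).comp (ly (cup 0 le_rfl))))
    (x : BW 2) : f (phi 2 x) ∈ (phi 0).range := by
  have key : ∀ x ∈ Submodule.span Lam ((BW.sys 2).STri 0 0), f (phi 2 x) ∈ (phi 0).range := by
    intro x hx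
    induction hx using Submodule.span_induction with
    | mem x hx =>
      obtain ⟨u, hu, t, ht, v, hv, rfl⟩ := hx
      obtain ⟨r, rfl⟩ := Sys.S_le_bot le_rfl hu
      obtain ⟨r', rfl⟩ := Sys.S_le_bot le_rfl hv
      rw [← Algebra.commutes, ← Algebra.smul_def, ← Algebra.smul_def, map_smul, map_smul, map_smul,
        map_smul]
      refine Subalgebra.smul_mem _ (Subalgebra.smul_mem _ ?_ _) _
      rcases ht with rfl | rfl | rfl
      · rw [map_one]; exact closure_one hf
      · have e : phi 2 ((BW.sys 2).g 0) = MT.of (G true (⟨0, by omega⟩ : Fin (2 - 1))) :=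
          phi_g (n := 2) (i := 0) (by omega)
        -- The crossing on the minimum is a curl on its right leg, so the closure of `g_0` is a
        -- multiple of a circle.
        obtain ⟨h, hh⟩ := MT.exists_sandwich (ly (cap 0 (le_refl 0))) (ly (cup 0 (le_refl 0)))
        have e1 : f (MT.of (G true (⟨0, by omega⟩ : Fin (2 - 1)))) = h (MT.of (Tangle.curlR false (1 : Fin 2))) := by
          rw [hf, hh, comp_assoc, comp_assoc]
          exact congrArg (fun T => MT.of ((ly (cap 0 (le_refl 0))).comp T))
            (curlR_comp_cup false (le_refl 0)).symm
        rw [e, e1, MT.curlR, Algebra.algebraMap_eq_smul_one, map_smul]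
        exact Subalgebra.smul_mem _ (closure_one hh) _
      · have e : phi 2 ((BW.sys 2).e 0) = MT.of (E (⟨0, by omega⟩ : Fin (2 - 1))) :=
          phi_e (n := 2) (i := 0) (by omega)
        have e1 : f (MT.of (E (⟨0, by omega⟩ : Fin (2 - 1)))) =
            MT.of (Tangle.circle (0 : Fin (0 + 1))) * MT.of (Tangle.circle (0 : Fin (0 + 1))) := by
          rw [hf, ← MT.of_mul]
          rfl
        rw [e, e1, MT.circle]
        exact mul_mem (Subalgebra.algebraMap_mem _ _) (Subalgebra.algebraMap_mem _ _)
    | zero => rw [map_zero, map_zero]; exact zero_mem _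
    | add x y _ _ hx hy => rw [map_add, map_add]; exact add_mem hx hy
    | smul c x _ hx => rw [map_smul, map_smul]; exact Subalgebra.smul_mem _ hx _
  exact key x (Sys.S_succ_le le_rfl (by omega) (BW.mem_S_top x))

/-- The closure of `x` depends only on `x e_{m+1}`, so by `S_succ_mul_e` the last string may be
assumed free. Then `x` is a combination of products `u t v` with `t ∈ {1, g_m, e_m}`, and `u`, `v`
can be taken out of the closure. The closures of `1`, `g_m`, `e_m` are `δ`, `λ⁻¹` and `1`. -/
theorem closure_succ {f : MT (m + 1 + 2) →ₗ[Lam] MT (m + 1)}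
    (hf : ∀ T, f (MT.of T) = MT.of (((ly (cap (m + 1) le_rfl)).comp T).comp (ly (cup (m + 1) le_rfl))))
    (x : BW (m + 1 + 2)) : f (phi _ x) ∈ (phi (m + 1)).range := by
  have key : ∀ x ∈ Submodule.span Lam ((BW.sys (m + 1 + 2)).STri 0 m),
      f (phi _ x) ∈ (phi (m + 1)).range := by
    intro x hx
    induction hx using Submodule.span_induction with
    | mem x hx =>
      obtain ⟨u, hu, t, ht, v, hv, rfl⟩ := hx
      obtain ⟨u, rfl⟩ := BW.exists_incl_eq (m := m + 1) (by omega) hu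
      obtain ⟨v, rfl⟩ := BW.exists_incl_eq (m := m + 1) (by omega) hv
      rw [map_mul (phi _), map_mul (phi _), closure_mul_phi_incl hf, closure_phi_incl_mul hf]
      refine mul_mem (mul_mem ⟨u, rfl⟩ ?_) ⟨v, rfl⟩
      rcases ht with rfl | rfl | rfl
      · rw [map_one]; exact closure_one hf
      · have e : phi (m + 1 + 2) ((BW.sys (m + 1 + 2)).g m) = MT.of (G true ⟨m, by omega⟩) :=
          phi_g (by omega)
        have e1 : f (MT.of (G true ⟨m, by omega⟩)) =
            MT.of (Tangle.curlR true (⟨m, by omega⟩ : Fin (m + 1))) := by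
          rw [hf, Tangle.curlR, mk_three, ← comp_assoc]
          rfl
        rw [e, e1, MT.curlR]
        exact Subalgebra.algebraMap_mem _ _
      · have e : phi (m + 1 + 2) ((BW.sys (m + 1 + 2)).e m) = MT.of (E ⟨m, by omega⟩) :=
          phi_e (by omega)
        have e1 : f (MT.of (E ⟨m, by omega⟩)) = 1 := by
          rw [hf, E_def, comp_assoc, comp_assoc, two_nil (Move.zigzag_left m le_rfl), ← mk_two,
            move_eq (Move.zigzag_right m le_rfl), ← one_def, MT.of_one]
        rw [e, e1]
        exact one_mem _
    | zero => rw [map_zero, map_zero]; exact zero_mem _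
    | add x y _ _ hx hy => rw [map_add, map_add]; exact add_mem hx hy
    | smul c x _ hx => rw [map_smul, map_smul]; exact Subalgebra.smul_mem _ hx _
  obtain ⟨x', hx', e⟩ := Sys.S_succ_mul_e (s := BW.sys (m + 1 + 2)) (b := m + 1) (Nat.zero_le _)
    (by omega) (BW.mem_S_top x)
  obtain ⟨h, hh⟩ := MT.exists_sandwich (ly (cap (m + 1) (le_refl (m + 1))))
    (ly (cup m (Nat.le_succ m)))
  -- The maximum of `e_{m+1}` followed by `cup m` is a zigzag, so the minimum of `e_{m+1}` takes the
  -- place of the closing minimum.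
  have hfh : ∀ t, f t = h (t * phi _ ((BW.sys (m + 1 + 2)).e (m + 1))) := by
    have e : phi (m + 1 + 2) ((BW.sys (m + 1 + 2)).e (m + 1)) = MT.of (E ⟨m + 1, by omega⟩) :=
      phi_e (by omega)
    intro t
    rw [e]
    have ht : t ∈ Submodule.span Lam (Set.range (MT.of (n := m + 1 + 2))) :=
      MT.span_of _ ▸ Submodule.mem_top
    induction ht using Submodule.span_induction with
    | mem t ht =>
      obtain ⟨T, rfl⟩ := ht
      rw [hf, ← MT.of_mul, hh, mul_def, E_def, comp_assoc, comp_assoc, comp_assoc, comp_assoc,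
        ← mk_two (cap _ _), move_eq (Move.zigzag_left m le_rfl), comp_nil]
    | zero => simp
    | add x y _ _ hx hy => rw [add_mul, map_add, hx, hy, map_add]
    | smul c x _ hx => rw [smul_mul_assoc, map_smul, hx, map_smul]
  have : f (phi _ x) = f (phi _ x') := by
    rw [hfh, hfh, ← map_mul, ← map_mul, e]
  rw [this]
  exact key x' (Sys.S_succ_le (Nat.zero_le _) (by omega) hx')

theorem closure_mem_range {T : Tangle (m + 2) (m + 2)} (hT : MT.of T ∈ (phi (m + 2)).range) :
    MT.of (((ly (cap m le_rfl)).comp T).comp (ly (cup m le_rfl))) ∈ (phi m).range := by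
  obtain ⟨x, hx⟩ := hT
  obtain ⟨f, hf⟩ := MT.exists_sandwich (ly (cap m (le_refl m))) (ly (cup m (le_refl m)))
  rw [← hf, ← hx]
  rcases m with _ | m
  · exact closure_zero hf x
  · exact closure_succ hf x

theorem Tangle.Cups.exists_eq {M : ℕ} {d : Tangle (M + 2) n} (h : Cups n (M + 2) d) (hle : n ≤ M) :
    ∃ d', Cups n M d' ∧ d = (ly (Layer.cup M le_rfl)).comp d' := by
  cases h with
  | one => omega
  | cup h => exact ⟨_, h, rfl⟩

/-- The last maximum of `c` and the first minimum of `d` close the two rightmost strings of `T`.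
Removing this pair replaces `T` by its partial closure on two strings fewer. -/
theorem Tangle.Caps.closure_mem_range {M : ℕ} {c : Tangle n M} {d : Tangle M n} {T : Tangle M M}
    (hc : Caps n M c) (hd : Cups n M d) (hT : MT.of T ∈ (phi M).range) :
    MT.of (c.comp (T.comp d)) ∈ (phi n).range := by
  have hle : ∀ {M : ℕ} {c : Tangle n M}, Caps n M c → n ≤ M := by
    intro M c hc
    induction hc <;> omega
  induction hc with
  | one =>
    cases hd with
    | one => rwa [one_comp, comp_one]
    | cup hd => exact absurd hd.le (by omega)
  | @cap M c hc ih =>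
    obtain ⟨d, hd', rfl⟩ := hd.exists_eq (hle hc)
    have := ih hd' (BMW.closure_mem_range hT)
    simpa only [comp_assoc] using this

theorem phi_surjective (n : ℕ) : Function.Surjective (phi n) := by
  intro t
  have h : Submodule.span Lam (Set.range (MT.of (n := n))) ≤
      Subalgebra.toSubmodule (phi n).range := by
    rw [Submodule.span_le]
    rintro _ ⟨T, rfl⟩
    obtain ⟨M, c, y, d, hc, hy, hd, rfl⟩ := isNormal T
    exact hc.closure_mem_range hd (of_mem_range hy)
  exact h (MT.span_of n ▸ Submodule.mem_top : t ∈ _)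

end BMW

namespace BMW

/-! ### The filtration of the tangle algebra -/

open Tangle Layer

variable {n r k a i : ℕ}

namespace Tangle

/-- The product `E_a E_{a+2} ⋯` of `k` factors. -/
def epsE (n : ℕ) : ℕ → ℕ → Tangle n n
  | _, 0 => 1
  | a, k + 1 => (if h : a < n - 1 then E ⟨a, h⟩ else 1) * epsE n (a + 2) k

theorem cap_zero_comp_E (hi : i < n - 1) :
    (ly (cap 0 (Nat.zero_le n))).comp (E ⟨i + 2, by omega⟩ : Tangle (n + 2) (n + 2)) =
      (E ⟨i, hi⟩).comp (ly (cap 0 (Nat.zero_le n))) := by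
  obtain ⟨n, rfl⟩ : ∃ p, n = p + 2 := ⟨n - 2, by omega⟩
  rw [E_def (n := n + 2), E_def (n := n), comp_assoc,
    ← two_two (Move.cup_cap_left 0 i (Nat.zero_le i) (by omega)), ← mk_two (cap _ _),
    ← move_eq (Move.cap_cap 0 i (Nat.zero_le i) (by omega)), mk_two]

theorem cap_zero_comp_epsE (h : a + 2 * k ≤ n) :
    (ly (cap 0 (Nat.zero_le n))).comp (epsE (n + 2) (a + 2) k) =
      (epsE n a k).comp (ly (cap 0 (Nat.zero_le n))) := by
  induction k generalizing a with
  | zero => rw [epsE, epsE, comp_one, one_comp]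
  | succ k ih =>
    rw [epsE, epsE, dif_pos (by omega), dif_pos (by omega), mul_def, mul_def, ← comp_assoc,
      cap_zero_comp_E (by omega), comp_assoc, ih (by omega), comp_assoc]

/-- The maximum of the first factor is moved down past the other factors, which thereby act on two
strings fewer. This shows that the product factors through `r` strings. -/
theorem exists_epsE_eq (r k : ℕ) :
    ∃ (A : Tangle (r + 2 * k) r) (B : Tangle r (r + 2 * k)), epsE (r + 2 * k) 0 k = A.comp B := by
  induction k with
  | zero => exact ⟨1, 1, rfl⟩
  | succ k ih =>
    obtain ⟨A, B, h⟩ := ih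
    refine ⟨(ly (cup 0 (Nat.zero_le (r + 2 * k)))).comp A,
      B.comp (ly (cap 0 (Nat.zero_le (r + 2 * k)))), ?_⟩
    change epsE (r + 2 * k + 2) 0 (k + 1) = _
    rw [epsE, dif_pos (by omega), mul_def, E_def, comp_assoc, cap_zero_comp_epsE (by omega), h]
    simp only [comp_assoc]

end Tangle

theorem phi_eps (h : a + 2 * k ≤ n) : phi n ((BW.sys n).eps a k) = MT.of (epsE n a k) := by
  induction k generalizing a with
  | zero => rw [Sys.eps_zero, map_one, epsE, MT.of_one]
  | succ k ih =>
    rw [Sys.eps_succ' (by omega), map_mul, ih (by omega), epsE, dif_pos (by omega), MT.of_mul]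
    congr 1
    exact phi_e (by omega)

theorem MT.filtration_mul_mem {x : MT n} (hx : x ∈ MT.filtration n r) (a b : MT n) :
    a * x * b ∈ MT.filtration n r := by
  have ha : a ∈ Submodule.span Lam (Set.range (MT.of (n := n))) := MT.span_of n ▸ Submodule.mem_top
  have hb : b ∈ Submodule.span Lam (Set.range (MT.of (n := n))) := MT.span_of n ▸ Submodule.mem_top
  refine mul_mul_mem_of_mem_span ?_ hx
  rintro _ ⟨A, B, rfl⟩
  refine Sys.mul_mem_span ?_ hb
  rintro _ ⟨S, rfl⟩
  rw [mul_assoc]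
  refine Sys.span_mul_mem ?_ ha
  rintro _ ⟨T, rfl⟩
  refine Submodule.subset_span ⟨T.comp A, B.comp S, ?_⟩
  rw [← MT.of_mul, ← MT.of_mul, mul_def, mul_def]
  simp only [comp_assoc]

theorem mapsTo_filtration (h : n = r + 2 * k) :
    Set.MapsTo (phi n) (BW.ideal n k) (MT.filtration n r) := by
  subst h
  have : BW.ideal (r + 2 * k) k ≤ (MT.filtration (r + 2 * k) r).comap (phi _).toLinearMap := by
    rw [BW.ideal_eq, Submodule.span_le]
    rintro _ ⟨a, b, rfl⟩
    obtain ⟨A, B, h⟩ := exists_epsE_eq r k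
    have e : phi _ (a * (BW.sys (r + 2 * k)).eps 0 k * b) = phi _ a * MT.of (A.comp B) * phi _ b := by
      rw [map_mul, map_mul, phi_eps (by omega), h]
    exact Submodule.mem_comap.mpr (e ▸ MT.filtration_mul_mem (Submodule.subset_span ⟨A, B, rfl⟩) _ _)
  exact fun x hx => this hx

end BMW

namespace BMW

/-! ### Counting -/

/-- The coefficient of `X ^ n` in `((1 + X ^ 2) + 2 X) ^ n = (1 + X) ^ (2 * n)` is computed in two
ways. In the binomial expansion with `m` factors `1 + X ^ 2` only even `m = 2 * k` contribute, which
gives the summands on the left. -/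
theorem sum_choose_mul_centralBinom_le (n : ℕ) :
    ∑ k ∈ Finset.range (n / 2 + 1), n.choose (2 * k) * (2 * k).choose k * 2 ^ (n - 2 * k) ≤
      (2 * n).choose n := by
  open Polynomial in
  have h1 : ((1 + X ^ 2) + C 2 * X : ℕ[X]) ^ n = (1 + X) ^ (2 * n) := by
    rw [pow_mul]
    congr 1
    simp only [map_ofNat]
    ring
  have h2 := congrArg (fun p => Polynomial.coeff p n) h1
  simp only [Polynomial.coeff_one_add_X_pow] at h2
  rw [add_pow, Polynomial.finsetSum_coeff] at h2
  have h3 : ∀ m ∈ Finset.range (n + 1),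
      ((1 + Polynomial.X ^ 2 : Polynomial ℕ) ^ m * (Polynomial.C 2 * Polynomial.X) ^ (n - m) *
        (n.choose m : Polynomial ℕ)).coeff n =
      n.choose m * (if 2 ∣ m then m.choose (m / 2) else 0) * 2 ^ (n - m) := by
    intro m hm
    have hm' : m ≤ n := Nat.lt_succ_iff.mp (Finset.mem_range.mp hm)
    have e : (1 + Polynomial.X ^ 2 : Polynomial ℕ) ^ m =
        Polynomial.expand ℕ 2 ((1 + Polynomial.X) ^ m) := by simp
    have e2 : ((1 + Polynomial.X ^ 2 : Polynomial ℕ) ^ m * (Polynomial.C 2 * Polynomial.X) ^ (n - m) *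
        (n.choose m : Polynomial ℕ)) = Polynomial.C (n.choose m * 2 ^ (n - m)) *
        ((1 + Polynomial.X ^ 2 : Polynomial ℕ) ^ m * Polynomial.X ^ (n - m)) := by
      have ec : (n.choose m : Polynomial ℕ) = Polynomial.C (n.choose m) := by simp
      simp only [mul_pow, map_mul, map_pow, ec]
      ring
    rw [e2, Polynomial.coeff_C_mul, Polynomial.coeff_mul_X_pow', if_pos (Nat.sub_le _ _),
      Nat.sub_sub_self hm', e, Polynomial.coeff_expand (by norm_num)]
    simp only [Polynomial.coeff_one_add_X_pow, Nat.cast_id]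
    ring
  rw [Finset.sum_congr rfl h3] at h2
  simp only [Nat.cast_id] at h2
  rw [← h2]
  have h4 : ∀ k ∈ Finset.range (n / 2 + 1),
      n.choose (2 * k) * (2 * k).choose k * 2 ^ (n - 2 * k) =
      (fun m => n.choose m * (if 2 ∣ m then m.choose (m / 2) else 0) * 2 ^ (n - m)) (2 * k) := by
    intro k _
    simp
  rw [Finset.sum_congr rfl h4, ← Finset.sum_image (f := fun m => n.choose m *
    (if 2 ∣ m then m.choose (m / 2) else 0) * 2 ^ (n - m)) (g := fun k => 2 * k)
    (fun a _ b _ h => by simpa using h)]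
  refine Finset.sum_le_sum_of_subset fun m hm => ?_
  obtain ⟨k, hk, rfl⟩ := Finset.mem_image.mp hm
  have := Finset.mem_range.mp hk
  exact Finset.mem_range.mpr (by omega)

theorem doubleFactorial_mul_two_pow (n : ℕ) :
    Nat.doubleFactorial (2 * n - 1) * (2 ^ n * n.factorial) = (2 * n).factorial := by
  rcases n with _ | n
  · rfl
  · rw [← Nat.doubleFactorial_two_mul, mul_comm]
    exact (Nat.factorial_eq_mul_doubleFactorial (2 * n + 1)).symm

/-- Multiplication by `2 ^ n` and `(2 * k - 1)‼ * 2 ^ k * k! = (2 * k)!` turn each summand into `n!`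
times a summand of `sum_choose_mul_centralBinom_le`, and the bound into `n!` times the central
binomial coefficient. -/
theorem card_sum_le (n : ℕ) :
    ∑ k ∈ Finset.range (n / 2 + 1), n.choose (2 * k) ^ 2 * Nat.doubleFactorial (2 * k - 1) ^ 2 *
      (n - 2 * k).factorial ≤ Nat.doubleFactorial (2 * n - 1) := by
  have h1 : Nat.doubleFactorial (2 * n - 1) * 2 ^ n = (2 * n).choose n * n.factorial := by
    have h := Nat.choose_mul_factorial_mul_factorial (n := 2 * n) (k := n) (by omega)
    rw [← doubleFactorial_mul_two_pow, show 2 * n - n = n by omega, ← mul_assoc] at h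
    exact (Nat.eq_of_mul_eq_mul_right (Nat.factorial_pos n) h).symm
  have h2 : ∀ k ∈ Finset.range (n / 2 + 1), n.choose (2 * k) ^ 2 *
      Nat.doubleFactorial (2 * k - 1) ^ 2 * (n - 2 * k).factorial * 2 ^ n =
      n.choose (2 * k) * (2 * k).choose k * 2 ^ (n - 2 * k) * n.factorial := by
    intro k hk
    have hk' : 2 * k ≤ n := by
      have := Finset.mem_range.mp hk
      omega
    have e1 := Nat.choose_mul_factorial_mul_factorial hk'
    have e2 := Nat.choose_mul_factorial_mul_factorial (n := 2 * k) (k := k) (by omega)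
    have e3 := doubleFactorial_mul_two_pow k
    have e4 : 2 ^ n = 2 ^ (n - 2 * k) * 2 ^ (2 * k) := by rw [← pow_add, Nat.sub_add_cancel hk']
    rw [show 2 * k - k = k by omega] at e2
    refine Nat.eq_of_mul_eq_mul_right (Nat.mul_pos (Nat.factorial_pos k) (Nat.factorial_pos k)) ?_
    calc n.choose (2 * k) ^ 2 * Nat.doubleFactorial (2 * k - 1) ^ 2 * (n - 2 * k).factorial * 2 ^ n *
          (k.factorial * k.factorial)
        = n.choose (2 * k) ^ 2 * (n - 2 * k).factorial * 2 ^ (n - 2 * k) *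
          (Nat.doubleFactorial (2 * k - 1) * (2 ^ k * k.factorial)) ^ 2 := by
          rw [e4]; ring
      _ = n.choose (2 * k) * (2 * k).factorial * 2 ^ (n - 2 * k) *
          (n.choose (2 * k) * (2 * k).factorial * (n - 2 * k).factorial) := by rw [e3]; ring
      _ = n.choose (2 * k) * ((2 * k).choose k * k.factorial * k.factorial) * 2 ^ (n - 2 * k) *
          n.factorial := by rw [e1, e2]
      _ = _ := by ring
  refine Nat.le_of_mul_le_mul_right ?_ (Nat.two_pow_pos n)
  rw [h1, Finset.sum_mul, Finset.sum_congr rfl h2, ← Finset.sum_mul]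
  exact Nat.mul_le_mul_right _ (sum_choose_mul_centralBinom_le n)

variable {n l : ℕ}

/-- A Lorenz permutation is determined by the images of the first points. -/
theorem card_isLorenz_le (hl : l ≤ n) :
    Nat.card {μ : Equiv.Perm (Fin n) // IsLorenz l μ} ≤ n.choose l := by
  classical
  let F : Finset (Fin n) := Finset.univ.map (Fin.castLEEmb hl)
  have hF : F.card = l := by simp [F]
  let f : {μ : Equiv.Perm (Fin n) // IsLorenz l μ} → {s : Finset (Fin n) // s.card = l} :=
    fun μ => ⟨F.map μ.1.toEmbedding, by rw [Finset.card_map, hF]⟩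
  have hf : Function.Injective f := by
    rintro ⟨μ, hμ⟩ ⟨ν, hν⟩ h
    have hs : F.map μ.toEmbedding = F.map ν.toEmbedding := Subtype.ext_iff.mp h
    set s := F.map ν.toEmbedding with hs'
    have hsc : s.card = l := by rw [hs', Finset.card_map, hF]
    have hsc' : sᶜ.card = n - l := by rw [Finset.card_compl, hsc, Fintype.card_fin]
    have key : ∀ σ : Equiv.Perm (Fin n), IsLorenz l σ → F.map σ.toEmbedding = s →
        (fun i : Fin l => σ (Fin.castLE hl i)) = s.orderEmbOfFin hsc ∧
        (fun i : Fin (n - l) => σ ⟨l + i, by omega⟩) = sᶜ.orderEmbOfFin hsc' := by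
      intro σ hσ e
      refine ⟨Finset.orderEmbOfFin_unique hsc (fun i => ?_) (fun i j hij => ?_),
        Finset.orderEmbOfFin_unique hsc' (fun i => ?_) (fun i j hij => ?_)⟩
      · rw [← e]
        exact Finset.mem_map.mpr ⟨_, Finset.mem_map.mpr ⟨i, Finset.mem_univ _, rfl⟩, rfl⟩
      · exact hσ _ _ (by rw [Fin.lt_def]; exact hij) (Or.inl j.2)
      · rw [Finset.mem_compl, ← e]
        intro h
        obtain ⟨p, hp, h⟩ := Finset.mem_map.mp h
        obtain ⟨q, -, rfl⟩ := Finset.mem_map.mp hp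
        have := Fin.ext_iff.mp (σ.injective h)
        simp at this
        omega
      · exact hσ _ _ (by rw [Fin.lt_def] at hij ⊢; simp only; omega) (Or.inr (by simp))
    obtain ⟨a1, a2⟩ := key μ hμ hs
    obtain ⟨b1, b2⟩ := key ν hν rfl
    refine Subtype.ext (Equiv.ext fun p => ?_)
    by_cases hp : (p : ℕ) < l
    · exact congrFun (a1.trans b1.symm) ⟨p, hp⟩
    · have := congrFun (a2.trans b2.symm) ⟨p - l, by omega⟩
      have e : (⟨l + (p - l), by omega⟩ : Fin n) = p := Fin.ext (by simp only; omega)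
      simpa only [e] using this
  have := Nat.card_le_card_of_injective f hf
  refine this.trans (le_of_eq ?_)
  rw [Nat.card_eq_fintype_card, Fintype.card_finset_len, Fintype.card_fin]

theorem card_isLorenz_inv_le (hl : l ≤ n) :
    Nat.card {π : Equiv.Perm (Fin n) // IsLorenz l π⁻¹} ≤ n.choose l := by
  refine (Nat.card_congr ?_).trans_le (card_isLorenz_le hl)
  exact (Equiv.inv (Equiv.Perm (Fin n))).subtypeEquiv fun π => Iff.rfl

theorem card_fixesFirst (hl : l ≤ n) :
    Nat.card {τ : Equiv.Perm (Fin n) // FixesFirst l τ} = (n - l).factorial := by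
  classical
  have e := Equiv.Perm.subtypeEquivSubtypePerm (fun p : Fin n => l ≤ (p : ℕ))
  have h : Nat.card {τ : Equiv.Perm (Fin n) // FixesFirst l τ} =
      Nat.card (Equiv.Perm {p : Fin n // l ≤ (p : ℕ)}) :=
    Nat.card_congr ((Equiv.subtypeEquivRight fun τ => by
      simp only [FixesFirst, not_le]).trans e.symm)
  have h2 : Fintype.card {p : Fin n // l ≤ (p : ℕ)} = n - l := by
    rw [← Fintype.card_fin (n - l)]
    refine Fintype.card_congr ⟨fun p => ⟨p.1 - l, by have := p.1.2; have := p.2; omega⟩,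
      fun q => ⟨⟨l + q, by omega⟩, by simp⟩, fun p => ?_, fun q => ?_⟩
    · have := p.2
      exact Subtype.ext (Fin.ext (by simp only; omega))
    · exact Fin.ext (by simp)
  rw [h, Nat.card_eq_fintype_card, Fintype.card_perm, h2]

end BMW

namespace BMW

/-! ### Bases -/

variable {n : ℕ}

/-- The indices of the family of the elements `b_π w b_τ b_μ`. -/
abbrev FamIdx (n : ℕ) (ι : ℕ → Type) : Type :=
  Σ k : Fin (n / 2 + 1),
    {π : Equiv.Perm (Fin n) // IsLorenz (2 * k) π⁻¹} × ι k ×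
    {τ : Equiv.Perm (Fin n) // FixesFirst (2 * k) τ} ×
    {μ : Equiv.Perm (Fin n) // IsLorenz (2 * k) μ}

/-- The elements `b_π w b_τ b_μ`. -/
noncomputable def fam {ι : ℕ → Type} (w : ∀ k, ι k → BW (2 * k)) (c : FamIdx n ι) : BW n :=
  BW.posBraid c.2.1.1 * BW.incl (two_mul_le c.1) (w c.1 c.2.2.1) *
    BW.posBraid c.2.2.2.1.1 * BW.posBraid c.2.2.2.2.1

theorem span_fam {ι : ℕ → Type} {w : ∀ k, ι k → BW (2 * k)}
    (hw : ∀ k, 2 * k ≤ n → BW.ideal (2 * k) k ≤ Submodule.span Lam (Set.range (w k))) :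
    Submodule.span Lam (Set.range (fam (n := n) w)) = ⊤ := by
  rw [eq_top_iff, ← span_famSet_eq_top hw]
  refine Submodule.span_mono (Set.iUnion₂_subset fun k h => ?_)
  rintro _ ⟨π, hπ, _, ⟨x, rfl⟩, τ, hτ, μ, hμ, rfl⟩
  exact ⟨⟨⟨k, by omega⟩, ⟨π, hπ⟩, x, ⟨τ, hτ⟩, ⟨μ, hμ⟩⟩, rfl⟩

theorem card_famIdx_le {ι : ℕ → Type} [∀ k, Finite (ι k)]
    (hι : ∀ k, Nat.card (ι k) = Nat.doubleFactorial (2 * k - 1) ^ 2) :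
    Nat.card (FamIdx n ι) ≤ Nat.doubleFactorial (2 * n - 1) := by
  refine le_trans ?_ (card_sum_le n)
  rw [Nat.card_sigma, ← Fin.sum_univ_eq_sum_range (fun k => n.choose (2 * k) ^ 2 *
    Nat.doubleFactorial (2 * k - 1) ^ 2 * (n - 2 * k).factorial)]
  refine Finset.sum_le_sum fun k _ => ?_
  have hk := two_mul_le k
  rw [Nat.card_prod, Nat.card_prod, Nat.card_prod, hι, card_fixesFirst hk]
  calc Nat.card {π : Equiv.Perm (Fin n) // IsLorenz (2 * k) π⁻¹} *
        (Nat.doubleFactorial (2 * k - 1) ^ 2 * ((n - 2 * k).factorial *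
          Nat.card {μ : Equiv.Perm (Fin n) // IsLorenz (2 * k) μ}))
      ≤ n.choose (2 * k) * (Nat.doubleFactorial (2 * k - 1) ^ 2 * ((n - 2 * k).factorial *
          n.choose (2 * k))) := by
        gcongr
        · exact card_isLorenz_inv_le hk
        · exact card_isLorenz_le hk
    _ = _ := by ring

theorem linearIndependent_phi_fam {ι : ℕ → Type} [∀ k, Finite (ι k)] {w : ∀ k, ι k → BW (2 * k)}
    (hι : ∀ k, Nat.card (ι k) = Nat.doubleFactorial (2 * k - 1) ^ 2)
    (hw : ∀ k, 2 * k ≤ n → BW.ideal (2 * k) k ≤ Submodule.span Lam (Set.range (w k))) :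
    LinearIndependent Lam fun c => phi n (fam (n := n) w c) := by
  have : Fintype (FamIdx n ι) := Fintype.ofFinite _
  refine linearIndependent_phi_of_card_le _ (span_fam hw) ?_
  rw [← Nat.card_eq_fintype_card]
  exact card_famIdx_le hι

/-- The products `t_c f_k t_d`. -/
noncomputable def idealFam {ι : Type} (k : ℕ) (t : ι → BW k) (c : ι × ι) : BW (2 * k) :=
  BW.incl (le_two_mul k) (t c.1) * BW.f (2 * k) k * BW.incl (le_two_mul k) (t c.2)

theorem span_idealFam {ι : Type} {k : ℕ} {t : ι → BW k}
    (ht : Submodule.span Lam (Set.range t) = ⊤) :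
    Submodule.span Lam (Set.range (idealFam k t)) = BW.ideal (2 * k) k := by
  refine le_antisymm ?_ ((BW.ideal_le_span ht).trans (Submodule.span_mono ?_))
  · rw [Submodule.span_le]
    rintro _ ⟨c, rfl⟩
    exact BW.mul_f_mul_mem_ideal _ _
  · rintro _ ⟨_, ⟨c, rfl⟩, _, ⟨d, rfl⟩, rfl⟩
    exact ⟨(c, d), rfl⟩

theorem card_mat_prod (k : ℕ) :
    Nat.card (Mat k × Mat k) = Nat.doubleFactorial (2 * k - 1) ^ 2 := by
  rw [Nat.card_prod, Nat.card_eq_fintype_card, Mat.card, sq]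

/-- Recursion on `n`: spanning families of smaller algebras give spanning families `t_c f_k t_d` of
the ideals and from these the family `fam`. Its size is at most `(2 * n - 1)‼` by counting and
therefore exactly this by `card_eq_of_span_eq_top`, so it can be indexed by `Mat n` again. -/
theorem exists_span_eq_top (n : ℕ) :
    ∃ t : Mat n → BW n, Submodule.span Lam (Set.range t) = ⊤ := by
  induction n using Nat.strong_induction_on with
  | _ n ih =>
    rcases n with _ | n
    · have c : Mat 0 := Classical.choice (Fintype.card_pos_iff.mp (by rw [Mat.card]; decide))
      refine ⟨fun _ => 1, ?_⟩
      rw [eq_top_iff]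
      intro x _
      obtain ⟨r, rfl⟩ := Sys.S_le_bot le_rfl (BW.mem_S_top x)
      rw [Algebra.algebraMap_eq_smul_one]
      exact Submodule.smul_mem _ _ (Submodule.subset_span ⟨c, rfl⟩)
    · choose! t ht using ih
      have : Fintype (FamIdx (n + 1) fun k => Mat k × Mat k) := Fintype.ofFinite _
      -- Here `2 * k ≤ n + 1` implies `k < n + 1`, so only families already constructed enter. For
      -- the zero algebra index this fails at `k = 0`, which is why it was treated before.
      have h1 := span_fam (n := n + 1) (w := fun k => idealFam k (t k)) fun k hk =>
        (span_idealFam (ht k (by omega))).ge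
      have h2 := card_famIdx_le (n := n + 1) card_mat_prod
      rw [Nat.card_eq_fintype_card] at h2
      have h3 := card_eq_of_span_eq_top _ h1 h2
      rw [← Mat.card] at h3
      refine ⟨fam (fun k => idealFam k (t k)) ∘ (Fintype.equivOfCardEq h3).symm, ?_⟩
      rwa [(Fintype.equivOfCardEq h3).symm.surjective.range_comp]

theorem BW.incl_self (h : n ≤ n) (x : BW n) : BW.incl h x = x := by
  obtain ⟨y, rfl⟩ := BW.mk_surjective _ x
  have : (BW.incl h).comp (BW.mk n) = BW.mk n := by
    refine FreeAlgebra.hom_ext (funext fun x => ?_)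
    refine (BW.incl_mk_fr h x).trans ?_
    cases x <;> rfl
  exact congrArg (fun f : FreeAlgebra Lam (Gen n) →ₐ[Lam] BW n => f y) this

/-- The products form the part of the family `fam` of `BW (2 * k)` with index `k` and trivial
permutations, and a subfamily of an independent family is independent. -/
theorem linearIndependent_idealFam {ι : Type} {k : ℕ} (e : ι ≃ Mat k) {t : ι → BW k}
    (ht : Submodule.span Lam (Set.range t) = ⊤) : LinearIndependent Lam (idealFam k t) := by
  choose t₀ ht₀ using exists_span_eq_top
  -- The given family is used at the index `k` and arbitrary spanning families at all others.
  let t₁ : ∀ j, Mat j → BW j := Function.update t₀ k (t ∘ e.symm)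
  have ht₁ : ∀ j, Submodule.span Lam (Set.range (t₁ j)) = ⊤ := by
    intro j
    by_cases hj : j = k
    · subst hj
      have e1 : t₁ j = t ∘ e.symm := Function.update_self _ _ _
      rw [e1, e.symm.surjective.range_comp, ht]
    · have e1 : t₁ j = t₀ j := Function.update_of_ne hj _ _
      rw [e1, ht₀]
  have h := linearIndependent_phi_fam (n := 2 * k) (w := fun j => idealFam j (t₁ j)) card_mat_prod
    fun j _ => (span_idealFam (ht₁ j)).ge
  have hF : FixesFirst (2 * k) (1 : Equiv.Perm (Fin (2 * k))) := fun _ _ => rfl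
  have hL : IsLorenz (2 * k) (1 : Equiv.Perm (Fin (2 * k))) := fun _ _ h _ => h
  let g : ι × ι → FamIdx (2 * k) fun j => Mat j × Mat j := fun c =>
    ⟨⟨k, by omega⟩, ⟨1, by rwa [inv_one]⟩, (e c.1, e c.2), ⟨1, hF⟩, ⟨1, hL⟩⟩
  have hg : Function.Injective g := by
    intro c d hcd
    have h1 := congrArg (fun x => x.1) (eq_of_heq (Sigma.mk.inj hcd).2)
    have h2 := congrArg (fun x => x.2.1) (eq_of_heq (Sigma.mk.inj hcd).2)
    have h3 := Prod.mk.inj h2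
    exact Prod.ext (e.injective h3.1) (e.injective h3.2)
  have h' := (h.comp g hg)
  refine LinearIndependent.of_comp (phi (2 * k)).toLinearMap ?_
  convert h' using 1
  funext c
  have e1 : t₁ k = t ∘ e.symm := Function.update_self _ _ _
  have e2 : fam (n := 2 * k) (fun j => idealFam j (t₁ j)) (g c) = idealFam k t c := by
    simp only [fam, g, posBraid_one, one_mul, mul_one, BW.incl_self]
    rw [e1]
    simp only [idealFam, Function.comp_apply, Equiv.symm_apply_apply]
  exact congrArg (phi (2 * k)) e2.symm

/-- A basis of the algebra. -/
theorem exists_basis (n : ℕ) : Nonempty (Module.Basis (Mat n) Lam (BW n)) := by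
  obtain ⟨t, ht⟩ := exists_span_eq_top n
  have h := linearIndependent_phi_of_card_le t ht (by rw [Mat.card])
  exact ⟨Module.Basis.mk (LinearIndependent.of_comp (phi n).toLinearMap h) ht.ge⟩

/-- A spanning family with independent image: an element of the kernel is a combination of it whose
coefficients vanish. -/
theorem phi_injective (n : ℕ) : Function.Injective (phi n) := by
  obtain ⟨t, ht⟩ := exists_span_eq_top n
  have h := Fintype.linearIndependent_iff.mp
    (linearIndependent_phi_of_card_le t ht (by rw [Mat.card]))
  rw [injective_iff_map_eq_zero]
  intro x hx
  have hx' : x ∈ Submodule.span Lam (Set.range t) := ht ▸ Submodule.mem_top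
  obtain ⟨c, rfl⟩ := (Submodule.mem_span_range_iff_exists_fun Lam).mp hx'
  rw [map_sum] at hx
  simp only [map_smul] at hx
  simp [h c hx]

theorem exists_ideal_basis {ι : Type} {k : ℕ} (t : Module.Basis ι Lam (BW k)) :
    ∃ w : Module.Basis (ι × ι) Lam (BW.ideal (2 * k) k),
      ∀ c, (w c : BW (2 * k)) = idealFam k t c := by
  obtain ⟨b⟩ := exists_basis k
  have h := linearIndependent_idealFam (t.indexEquiv b) t.span_eq
  refine ⟨(Module.Basis.span h).map (LinearEquiv.ofEq _ _ (span_idealFam t.span_eq)), fun c => ?_⟩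
  rw [Module.Basis.map_apply, LinearEquiv.coe_ofEq_apply, Module.Basis.span_apply]

/-- Any two bases of the ideal in `BW (2 * k)` have index sets of the same size, so the counting
that was done for the products `t_c f_k t_d` applies to arbitrary bases `w k`. -/
theorem exists_fam_basis {ι : ℕ → Type}
    (w : ∀ k : ℕ, Module.Basis (ι k) Lam (BW.ideal (2 * k) k)) :
    ∃ b : Module.Basis (FamIdx n ι) Lam (BW n),
      ∀ c, b c = fam (fun k x => (w k x : BW (2 * k))) c := by
  have e : ∀ k, Nonempty (ι k ≃ Mat k × Mat k) := fun k => by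
    obtain ⟨b⟩ := exists_basis k
    obtain ⟨w', -⟩ := exists_ideal_basis b
    exact ⟨(w k).indexEquiv w'⟩
  have : ∀ k, Finite (ι k) := fun k => Finite.of_equiv _ (e k).some.symm
  have hw : ∀ k, BW.ideal (2 * k) k ≤
      Submodule.span Lam (Set.range fun x => (w k x : BW (2 * k))) := by
    intro k
    have h := congrArg (Submodule.map (BW.ideal (2 * k) k).subtype) (w k).span_eq
    rw [Submodule.map_span, Submodule.map_top, Submodule.range_subtype, ← Set.range_comp] at h
    exact h.ge
  have h := linearIndependent_phi_fam (n := n) (w := fun k x => (w k x : BW (2 * k)))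
    (fun k => (Nat.card_congr (e k).some).trans (card_mat_prod k)) fun k _ => hw k
  exact ⟨Module.Basis.mk (LinearIndependent.of_comp (phi n).toLinearMap h)
    (span_fam fun k _ => hw k).ge, fun c => Module.Basis.mk_apply _ _ _⟩

end BMW

/-! ### Assembly of the theorem. -/

theorem theorem4p5 (n : ℕ) :
    -- injectivity on every term of the filtration
    (∀ r k : ℕ, n = r + 2 * k →
      Set.MapsTo (BMW.phi n) (BMW.BW.ideal n k) (BMW.MT.filtration n r) ∧
      Set.InjOn (BMW.phi n) (BMW.BW.ideal n k)) ∧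
    -- isomorphism
    Function.Bijective (BMW.phi n) ∧
    -- freeness and rank
    Module.Free BMW.Lam (BMW.BW n) ∧
    Module.rank BMW.Lam (BMW.BW n) = (Nat.doubleFactorial (2 * n - 1) : Cardinal) ∧
    -- bases of the ideals with no through strings
    (∀ (k : ℕ) (ι : Type) (t : Module.Basis ι BMW.Lam (BMW.BW k)),
      ∃ w : Module.Basis (ι × ι) BMW.Lam (BMW.BW.ideal (2 * k) k), ∀ c d : ι,
        (w (c, d) : BMW.BW (2 * k)) =
          BMW.BW.incl (BMW.le_two_mul k) (t c) * BMW.BW.f (2 * k) k *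
            BMW.BW.incl (BMW.le_two_mul k) (t d)) ∧
    -- bases of the whole algebra
    (∀ (ι : ℕ → Type)
      (w : ∀ k : ℕ, Module.Basis (ι k) BMW.Lam (BMW.BW.ideal (2 * k) k)),
      ∃ b : Module.Basis
          (Σ k : Fin (n / 2 + 1),
            {π : Equiv.Perm (Fin n) // BMW.IsLorenz (2 * k) π⁻¹} × ι k ×
            {τ : Equiv.Perm (Fin n) // BMW.FixesFirst (2 * k) τ} ×
            {μ : Equiv.Perm (Fin n) // BMW.IsLorenz (2 * k) μ})
          BMW.Lam (BMW.BW n),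
        ∀ (k : Fin (n / 2 + 1))
          (π : {π : Equiv.Perm (Fin n) // BMW.IsLorenz (2 * k) π⁻¹}) (x : ι k)
          (τ : {τ : Equiv.Perm (Fin n) // BMW.FixesFirst (2 * k) τ})
          (μ : {μ : Equiv.Perm (Fin n) // BMW.IsLorenz (2 * k) μ}),
          b ⟨k, π, x, τ, μ⟩ =
            BMW.BW.posBraid π.1 *
              BMW.BW.incl (BMW.two_mul_le k) (w k x : BMW.BW (2 * k)) *
              BMW.BW.posBraid τ.1 * BMW.BW.posBraid μ.1) := by
  refine ⟨fun r k h => ⟨BMW.mapsTo_filtration h, (BMW.phi_injective n).injOn⟩,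
    ⟨BMW.phi_injective n, BMW.phi_surjective n⟩, ?_, ?_, ?_, ?_⟩
  · obtain ⟨b⟩ := BMW.exists_basis n
    exact Module.Free.of_basis b
  · obtain ⟨b⟩ := BMW.exists_basis n
    rw [rank_eq_card_basis b, BMW.Mat.card]
  · intro k ι t
    obtain ⟨w, hw⟩ := BMW.exists_ideal_basis t
    exact ⟨w, fun c d => hw (c, d)⟩
  · intro ι w
    obtain ⟨b, hb⟩ := BMW.exists_fam_basis (n := n) w
    exact ⟨b, fun k π x τ μ => hb ⟨k, π, x, τ, μ⟩⟩
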